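/- **Setting.** Let $\Omega\subset\mathbb R^3$ be a bounded domain with smooth boundary, $Y=(0,1)^3$, and let $\mathcal H$ be an open set with smooth boundary, $\overline{\mathcal H}\subset Y$, such that $Y^*=Y\setminus\overline{\mathcal H}$ is connected. For $\epsilon>0$ put $$\overline{\mathcal H}^\epsilon=\bigcup_{k\in\mathbb Z^3,\ \epsilon(k+Y)\subset\Omega}\epsilon(k+\overline{\mathcal H}),\qquad \Omega^\epsilon=\Omega\setminus\overline{\mathcal H}^\epsilon,\qquad D^\epsilon=\mathbb R^3\setminus\overline{\mathcal H}^\epsilon .$$ Let $\mathbf A,\mathbf K\in L^\infty(\Omega;C_\sharp(Y))$ and $\boldsymbol\mu\in L^\infty(\mathbb R^3;C_\sharp(Y))$ be fields of symmetric, uniformly coercive $3\times3$ matrices ($C_\sharp(Y)$: continuous $Y$-periodic functions), and let $\mathbf A^\epsilon(x)=\mathbf A(x,x/\epsilon)$, and so on. Let $\gamma,\theta_c,c_1,c_2,k_0,k_1,T>0$ and $F(s)=c_1\ln s+c_2s$. Let $W_{bp}(D^\epsilon)$ be the space of functions $\omega$ on $D^\epsilon$ with $\nabla\omega\in L^2(D^\epsilon)$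 and $\omega/\sqrt{1+|x|^2}\in L^2(D^\epsilon)$. **Initial data.** $\mathbf m_0^\epsilon\in H^1(\Omega^\epsilon;\mathbb R^3)$; $\theta_0^\epsilon\in L^2(\Omega^\epsilon)$ with $\theta_0^\epsilon>0$ a.e. and $F(\theta_0^\epsilon)\in L^2(\Omega^\epsilon)$; and $\varphi_0^\epsilon\in W_{bp}(D^\epsilon)$ with $$\int_{D^\epsilon}\boldsymbol\mu^\epsilon\nabla\varphi_0^\epsilon\cdot\nabla\psi\,dx+\int_{\Omega^\epsilon}\mathbf m_0^\epsilon\cdot\nabla\psi\,dx=0\quad\text{for all }\psi\in W_{bp}(D^\epsilon).$$ **Weak solutions.** A weak solution on $(0,T)$ is a triple $(\mathbf m^\epsilon,\theta^\epsilon,\varphi^\epsilon)$ with $\mathbf m^\epsilon\in L^2(0,T;H^1(\Omega^\epsilon))\cap L^\infty(0,T;L^4(\Omega^\epsilon))\cap H^1(0,T;L^2(\Omega^\epsilon))$, $\mathbf m^\epsilon(0)=\mathbf m^\epsilon_0$; $\theta^\epsilon>0$ a.e. and $\theta^\epsilon,\ln\theta^\epsilon\in L^2(0,T;H^1(\Omega^\epsilon))$;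 $\varphi^\epsilon(t)\in W_{bp}(D^\epsilon)$ for a.e. $t$ and $\nabla\varphi^\epsilon\in L^\infty(0,T;L^2(D^\epsilon))$; such that for a.e. $t\in(0,T)$, for all $\mathbf p\in H^1(\Omega^\epsilon;\mathbb R^3)$, $r\in H^1(\Omega^\epsilon)$ and $\psi\in W_{bp}(D^\epsilon)$, $$\int_{\Omega^\epsilon}\Bigl(\gamma\,\partial_t\mathbf m^\epsilon\cdot\mathbf p+\mathbf A^\epsilon\nabla\mathbf m^\epsilon\cdot\nabla\mathbf p+\theta_c(|\mathbf m^\epsilon|^2-1)\mathbf m^\epsilon\cdot\mathbf p+\theta^\epsilon\mathbf m^\epsilon\cdot\mathbf p-\nabla\varphi^\epsilon\cdot\mathbf p\Bigr)dx=0,$$ $$\int_{\Omega^\epsilon}F(\theta^\epsilon(t))\,r\,dx=\int_{\Omega^\epsilon}F(\theta_0^\epsilon)\,r\,dx+\int_0^t\!\int_{\Omega^\epsilon}\Bigl((\mathbf m^\epsilon\cdot\partial_t\mathbf m^\epsilon)\,r-\mathbf K^\epsilon\nabla(k_0\ln\theta^\epsilon+k_1\theta^\epsilon)\cdot\nabla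 r\Bigr)dx\,ds,$$ $$\int_{D^\epsilon}\boldsymbol\mu^\epsilon\nabla\varphi^\epsilon\cdot\nabla\psi\,dx+\int_{\Omega^\epsilon}\mathbf m^\epsilon\cdot\nabla\psi\,dx=0 .$$ **Energy.** For $t\in(0,T)$ let $$\mathcal E^\epsilon(t)=\frac12\Bigl[\int_{\Omega^\epsilon}\mathbf A^\epsilon\nabla\mathbf m^\epsilon\cdot\nabla\mathbf m^\epsilon\,dx+\frac{\theta_c}{2}\|\mathbf m^\epsilon\|^4_{L^4(\Omega^\epsilon)}+c_2\|\theta^\epsilon\|^2_{L^2(\Omega^\epsilon)}+\int_{D^\epsilon}\boldsymbol\mu^\epsilon\nabla\varphi^\epsilon\cdot\nabla\varphi^\epsilon\,dx+2c_1\int_{\Omega^\epsilon}\theta^\epsilon\,dx\Bigr](t),$$ and let $\mathcal E^\epsilon(0)$ be the same expression in $(\mathbf m_0^\epsilon,\theta_0^\epsilon,\varphi_0^\epsilon)$. **Lemma.** There are real numbers $\eta_1,\eta_2\ge0$, independent of $\epsilon$ (and of the initial data and the solution), such that for every $\epsilon>0$, all initial data as above and every weak solution, $$\mathcal E^\epsilon(t)+\int_0^t\Bigl(\frac\gamma2\|\partial_t\mathbf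 m^\epsilon\|^2_{L^2(\Omega^\epsilon)}+\int_{\Omega^\epsilon}\mathbf K^\epsilon\nabla(k_0\ln\theta^\epsilon+k_1\theta^\epsilon)\cdot\nabla\theta^\epsilon\,dx\Bigr)ds\le\eta_1\mathcal E^\epsilon(0)+\eta_2$$ for almost every $t\in(0,T)$, namely at every $t\in(0,T)$ at which $\mathbf m^\epsilon(t)\in H^1(\Omega^\epsilon)\cap L^4(\Omega^\epsilon)$ is the value at $t$ of the representative of $\mathbf m^\epsilon$ that is continuous into $L^2(\Omega^\epsilon)$, $0<\theta^\epsilon(t)\in L^2(\Omega^\epsilon)$, $F(\theta^\epsilon(t))\in L^2(\Omega^\epsilon)$, $\varphi^\epsilon(t)\in W_{bp}(D^\epsilon)$, and the last two identities hold (so for all $t\in(0,T)$ for the time-continuous representative of the solution). In particular, for every $R$ there is a constant $C$ independent of $\epsilon$ such that, whenever $\|\mathbf m_0^\epsilon\|_{H^1(\Omega^\epsilon)}\le R$ and $\|\theta_0^\epsilon\|_{L^2(\Omega^\epsilon)}\le R$, $$\|\mathbf m^\epsilon\|_{L^\infty(0,T;L^4(\Omega^\epsilon))}\le C .$$ -/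

import Mathlib

open MeasureTheory Set Filter Topology

noncomputable section

namespace PhaseTransition

/-- `ℝ³` with the Euclidean norm. -/
abbrev E3 := EuclideanSpace ℝ (Fin 3)

/-! ### Geometry -/

/-- The boundary of `U` is smooth: near each boundary point, `U` is a strict sublevel set of a smooth
function whose differential does not vanish at that point. -/
def HasSmoothBoundary (U : Set E3) : Prop :=
  ∀ x ∈ frontier U, ∃ V ∈ 𝓝 x, ∃ ρ : E3 → ℝ,
    ContDiff ℝ (⊤ : ℕ∞) ρ ∧ fderiv ℝ ρ x ≠ 0 ∧ U ∩ V = {z | ρ z < 0} ∩ V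

/-- The reference cell `Y = (0,1)³`. -/
def unitCell : Set E3 := {y | ∀ i, 0 < y i ∧ y i < 1}

/-- The vector of `ℤ³ ⊆ ℝ³` with coordinates `k`. -/
def intVec (k : Fin 3 → ℤ) : E3 := WithLp.toLp 2 (fun i => (k i : ℝ))

/-- The scaled and translated set `ε (k + S)`. -/
def scaled (ε : ℝ) (k : Fin 3 → ℤ) (S : Set E3) : Set E3 := (fun y => ε • (intVec k + y)) '' S

/-- The closed holes: the union of `ε (k + closure H)` over the `k ∈ ℤ³` with `ε (k + Y) ⊆ Ω`. -/
def closedHoles (Ω H : Set E3) (ε : ℝ) : Set E3 :=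
  ⋃ k ∈ {k : Fin 3 → ℤ | scaled ε k unitCell ⊆ Ω}, scaled ε k (closure H)

/-- The perforated domain `Ω^ε`. -/
def perforated (Ω H : Set E3) (ε : ℝ) : Set E3 := Ω \ closedHoles Ω H ε

/-! ### Weak derivatives -/

/-- `g` is the weak gradient of `u` on the open set `U`. -/
def HasWeakGrad (U : Set E3) (u : E3 → ℝ) (g : E3 → E3) : Prop :=
  ∀ ψ : E3 → ℝ, ContDiff ℝ (⊤ : ℕ∞) ψ → HasCompactSupport ψ → tsupport ψ ⊆ U → ∀ i : Fin 3,
    ∫ x in U, u x * fderiv ℝ ψ x (EuclideanSpace.single i 1) = -∫ x in U, g x i * ψ x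

/-- `u ∈ H¹(U)` with weak gradient `g`. -/
structure MemH1 (U : Set E3) (u : E3 → ℝ) (g : E3 → E3) : Prop where
  memLp : MemLp u 2 (volume.restrict U)
  memLp_grad : MemLp g 2 (volume.restrict U)
  weakGrad : HasWeakGrad U u g

/-- `u ∈ H¹(U; ℝ³)`; `g x c` is the weak gradient of the component `c` of `u`. -/
def MemH1Vec (U : Set E3) (u : E3 → E3) (g : E3 → Fin 3 → E3) : Prop :=
  ∀ c : Fin 3, MemH1 U (fun x => u x c) (fun x => g x c)

/-- `u` belongs to the Beppo-Levi space `W_bp(U)`, with weak gradient `g`. -/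
structure MemBeppoLevi (U : Set E3) (u : E3 → ℝ) (g : E3 → E3) : Prop where
  memLp_weighted : MemLp (fun x => u x / Real.sqrt (1 + ‖x‖ ^ 2)) 2 (volume.restrict U)
  memLp_grad : MemLp g 2 (volume.restrict U)
  weakGrad : HasWeakGrad U u g

/-! ### Coefficients -/

/-- `M ξ · ζ`. -/
def form (M : Matrix (Fin 3) (Fin 3) ℝ) (ξ ζ : E3) : ℝ := ∑ i, ∑ j, M i j * ξ j * ζ i

/-- `M P · Q` for two gradients of vector fields: the sum of `M P_c · Q_c` over the components. -/
def gradForm (M : Matrix (Fin 3) (Fin 3) ℝ) (P Q : Fin 3 → E3) : ℝ := ∑ c, form M (P c) (Q c)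

/-- A symmetric and uniformly coercive matrix field in `L^∞(D; C_♯(Y))`. -/
structure IsCoefficient (D : Set E3) (M : E3 → E3 → Matrix (Fin 3) (Fin 3) ℝ) : Prop where
  measurable : ∀ y i j, AEStronglyMeasurable (fun x => M x y i j) (volume.restrict D)
  continuous : ∀ᵐ x ∂volume.restrict D, ∀ i j, Continuous fun y => M x y i j
  periodic : ∀ᵐ x ∂volume.restrict D, ∀ (k : Fin 3 → ℤ) (y : E3), M x (y + intVec k) = M x y
  bounded : ∃ B : ℝ, ∀ᵐ x ∂volume.restrict D, ∀ y i j, |M x y i j| ≤ B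
  symmetric : ∀ᵐ x ∂volume.restrict D, ∀ y, (M x y).IsSymm
  coercive : ∃ α : ℝ, 0 < α ∧
    ∀ᵐ x ∂volume.restrict D, ∀ y ξ, α * ‖ξ‖ ^ 2 ≤ form (M x y) ξ ξ

/-- The oscillating coefficient `x ↦ M (x, x / ε)`. -/
def osc (M : E3 → E3 → Matrix (Fin 3) (Fin 3) ℝ) (ε : ℝ) (x : E3) : Matrix (Fin 3) (Fin 3) ℝ :=
  M x (ε⁻¹ • x)

/-! ### The microscopic model -/

/-- The data of the microscopic model, apart from the initial values. -/
structure Model where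
  /-- the macroscopic domain -/
  Ω : Set E3
  /-- the reference hole -/
  H : Set E3
  A : E3 → E3 → Matrix (Fin 3) (Fin 3) ℝ
  K : E3 → E3 → Matrix (Fin 3) (Fin 3) ℝ
  μ : E3 → E3 → Matrix (Fin 3) (Fin 3) ℝ
  γ : ℝ
  θc : ℝ
  c₁ : ℝ
  c₂ : ℝ
  k₀ : ℝ
  k₁ : ℝ

/-- The standing assumptions on the data. -/
structure Model.Standing (P : Model) : Prop where
  isOpen_Ω : IsOpen P.Ω
  isConnected_Ω : IsConnected P.Ω
  isBounded_Ω : Bornology.IsBounded P.Ω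
  smooth_Ω : HasSmoothBoundary P.Ω
  isOpen_H : IsOpen P.H
  closure_H : closure P.H ⊆ unitCell
  smooth_H : HasSmoothBoundary P.H
  isConnected_cell : IsConnected (unitCell \ closure P.H)
  coeff_A : IsCoefficient P.Ω P.A
  coeff_K : IsCoefficient P.Ω P.K
  coeff_μ : IsCoefficient univ P.μ
  γ_pos : 0 < P.γ
  θc_pos : 0 < P.θc
  c₁_pos : 0 < P.c₁
  c₂_pos : 0 < P.c₂
  k₀_pos : 0 < P.k₀
  k₁_pos : 0 < P.k₁

/-- The perforated domain `Ω^ε`. -/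
def Model.dom (P : Model) (ε : ℝ) : Set E3 := perforated P.Ω P.H ε

/-- The complement of the closed holes in `ℝ³`, on which the magnetic potential lives. -/
def Model.ext (P : Model) (ε : ℝ) : Set E3 := (closedHoles P.Ω P.H ε)ᶜ

/-- `F(s) = c₁ ln s + c₂ s`. -/
def Model.F (P : Model) (s : ℝ) : ℝ := P.c₁ * Real.log s + P.c₂ * s

/-- Initial values, with the weak gradients of the magnetization and of the potential. -/
structure InitialData where
  m : E3 → E3
  Dm : E3 → Fin 3 → E3
  θ : E3 → ℝ
  φ : E3 → ℝ
  Dφ : E3 → E3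

/-- The unknowns, as functions of time and space, with their derivatives: `dtm` is the time derivative of
the magnetization `m`, while `Dm`, `Dθ`, `Dlogθ`, `Dφ` are the spatial gradients of `m`, `θ`, `ln θ`
and `φ`. -/
structure Fields where
  m : ℝ → E3 → E3
  dtm : ℝ → E3 → E3
  Dm : ℝ → E3 → Fin 3 → E3
  θ : ℝ → E3 → ℝ
  Dθ : ℝ → E3 → E3
  Dlogθ : ℝ → E3 → E3
  φ : ℝ → E3 → ℝ
  Dφ : ℝ → E3 → E3

/-- Weak form of the magnetostatic problem: `div (μ^ε ∇φ + χ_{Ω^ε} m) = 0` outside the closed holes, with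
zero normal flux on the boundary of the holes; `φ` is in the Beppo-Levi space, and so are the test
functions. -/
def Model.Magnetostatic (P : Model) (ε : ℝ) (m : E3 → E3) (φ : E3 → ℝ) (Dφ : E3 → E3) : Prop :=
  MemBeppoLevi (P.ext ε) φ Dφ ∧
    ∀ (ψ : E3 → ℝ) (Dψ : E3 → E3), MemBeppoLevi (P.ext ε) ψ Dψ →
      (∫ x in P.ext ε, form (osc P.μ ε x) (Dφ x) (Dψ x)) +
        ∫ x in P.dom ε, inner ℝ (m x) (Dψ x) = 0

/-- Admissible initial values. -/
structure Model.IsInitial (P : Model) (ε : ℝ) (I : InitialData) : Prop where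
  m_memH1 : MemH1Vec (P.dom ε) I.m I.Dm
  θ_memLp : MemLp I.θ 2 (volume.restrict (P.dom ε))
  θ_pos : ∀ᵐ x ∂volume.restrict (P.dom ε), 0 < I.θ x
  v_memLp : MemLp (fun x => P.F (I.θ x)) 2 (volume.restrict (P.dom ε))
  magnetostatic : P.Magnetostatic ε I.m I.φ I.Dφ

/-- The heat equation
`∂ₜ F(θ) - m · ∂ₜ m = div (K^ε ∇(k₀ ln θ + k₁ θ))` in `Ω^ε`, with zero flux on `∂Ω^ε` and with the
initial value `F(θ₀)` at time `0`, integrated over `(0, t)`, as an identity in the dual of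
`H¹(Ω^ε)`. -/
def Model.HeatAt (P : Model) (ε : ℝ) (I : InitialData) (S : Fields) (t : ℝ) : Prop :=
  ∀ (r : E3 → ℝ) (Dr : E3 → E3), MemH1 (P.dom ε) r Dr →
    ∫ x in P.dom ε, P.F (S.θ t x) * r x =
      (∫ x in P.dom ε, P.F (I.θ x) * r x) +
        ∫ s in (0 : ℝ)..t,
          ((∫ x in P.dom ε, inner ℝ (S.m s x) (S.dtm s x) * r x) -
            ∫ x in P.dom ε,
              form (osc P.K ε x) (P.k₀ • S.Dlogθ s x + P.k₁ • S.Dθ s x) (Dr x))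

/-- The equation
`γ ∂ₜ m = div (A^ε ∇m) - θ_c (|m|² - 1) m - θ m + ∇φ` in `Ω^ε`, with `(A^ε ∇m) · ν = 0` on `∂Ω^ε`, at
time `t`, in weak form. -/
def Model.MagnetizationAt (P : Model) (ε : ℝ) (S : Fields) (t : ℝ) : Prop :=
  ∀ (p : E3 → E3) (Dp : E3 → Fin 3 → E3), MemH1Vec (P.dom ε) p Dp →
    P.γ * ∫ x in P.dom ε, inner ℝ (S.dtm t x) (p x) =
      -(∫ x in P.dom ε, gradForm (osc P.A ε x) (S.Dm t x) (Dp x))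
        - P.θc * (∫ x in P.dom ε, (‖S.m t x‖ ^ 2 - 1) * inner ℝ (S.m t x) (p x))
        - (∫ x in P.dom ε, S.θ t x * inner ℝ (S.m t x) (p x))
        + ∫ x in P.dom ε, inner ℝ (S.Dφ t x) (p x)

/-- The fields take at time `t` the value of the time-continuous representative of the solution. For a
weak solution this is so at almost every `t`; for its continuous representative, at every `t`. -/
structure Model.RegularAt (P : Model) (ε : ℝ) (I : InitialData) (S : Fields) (t : ℝ) : Prop where
  m_memH1 : MemH1Vec (P.dom ε) (S.m t) (S.Dm t)
  m_memL4 : MemLp (S.m t) 4 (volume.restrict (P.dom ε))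
  m_eq : ∀ᵐ x ∂volume.restrict (P.dom ε), S.m t x = I.m x + ∫ s in (0 : ℝ)..t, S.dtm s x
  θ_memLp : MemLp (S.θ t) 2 (volume.restrict (P.dom ε))
  θ_pos : ∀ᵐ x ∂volume.restrict (P.dom ε), 0 < S.θ t x
  v_memLp : MemLp (fun x => P.F (S.θ t x)) 2 (volume.restrict (P.dom ε))
  heat : P.HeatAt ε I S t
  magnetostatic : P.Magnetostatic ε (S.m t) (S.φ t) (S.Dφ t)

/-- Lebesgue measure on `(0,T) × U`. -/
def cylMeasure (T : ℝ) (U : Set E3) : Measure (ℝ × E3) :=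
  (volume.restrict (Ioo 0 T)).prod (volume.restrict U)

/-- `S` is a weak solution of the microscopic problem on `(0,T)` with initial values `I`:
`m ∈ L²(0,T;H¹(Ω^ε)) ∩ L^∞(0,T;L⁴(Ω^ε)) ∩ H¹(0,T;L²(Ω^ε))`, `θ > 0`,
`θ, ln θ ∈ L²(0,T;H¹(Ω^ε))`, `∇φ ∈ L^∞(0,T;L²(ℝ³ ∖ closed holes))`, with the equations, the boundary
conditions and the initial conditions in weak form. (That `c₁ ln θ + c₂ θ` is in
`H¹(0,T;H¹(Ω^ε)')` is contained in the heat equation.) -/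
structure Model.IsWeakSolution (P : Model) (T ε : ℝ) (I : InitialData) (S : Fields) : Prop where
  initial : P.IsInitial ε I
  m_memLp : MemLp (fun q : ℝ × E3 => S.m q.1 q.2) 2 (cylMeasure T (P.dom ε))
  Dm_memLp : MemLp (fun q : ℝ × E3 => S.Dm q.1 q.2) 2 (cylMeasure T (P.dom ε))
  dtm_memLp : MemLp (fun q : ℝ × E3 => S.dtm q.1 q.2) 2 (cylMeasure T (P.dom ε))
  m_bounded_L4 : ∃ B : ℝ, ∀ᵐ t ∂volume.restrict (Ioo 0 T),
    eLpNorm (S.m t) 4 (volume.restrict (P.dom ε)) ≤ ENNReal.ofReal B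
  θ_memLp : MemLp (fun q : ℝ × E3 => S.θ q.1 q.2) 2 (cylMeasure T (P.dom ε))
  logθ_memLp : MemLp (fun q : ℝ × E3 => Real.log (S.θ q.1 q.2)) 2 (cylMeasure T (P.dom ε))
  Dθ_memLp : MemLp (fun q : ℝ × E3 => S.Dθ q.1 q.2) 2 (cylMeasure T (P.dom ε))
  Dlogθ_memLp : MemLp (fun q : ℝ × E3 => S.Dlogθ q.1 q.2) 2 (cylMeasure T (P.dom ε))
  θ_memH1 : ∀ᵐ t ∂volume.restrict (Ioo 0 T), MemH1 (P.dom ε) (S.θ t) (S.Dθ t)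
  logθ_memH1 : ∀ᵐ t ∂volume.restrict (Ioo 0 T),
    MemH1 (P.dom ε) (fun x => Real.log (S.θ t x)) (S.Dlogθ t)
  Dφ_measurable : AEStronglyMeasurable (fun q : ℝ × E3 => S.Dφ q.1 q.2) (cylMeasure T (P.ext ε))
  Dφ_bounded_L2 : ∃ B : ℝ, ∀ᵐ t ∂volume.restrict (Ioo 0 T),
    eLpNorm (S.Dφ t) 2 (volume.restrict (P.ext ε)) ≤ ENNReal.ofReal B
  magnetization : ∀ᵐ t ∂volume.restrict (Ioo 0 T), P.MagnetizationAt ε S t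
  regular : ∀ᵐ t ∂volume.restrict (Ioo 0 T), P.RegularAt ε I S t

/-! ### Energy -/

/-- The energy of a magnetization with gradient `Dm`, a temperature and a potential with gradient
`Dφ`. -/
def Model.energy (P : Model) (ε : ℝ) (m : E3 → E3) (Dm : E3 → Fin 3 → E3) (θ : E3 → ℝ)
    (Dφ : E3 → E3) : ℝ :=
  (1 / 2) * ((∫ x in P.dom ε, gradForm (osc P.A ε x) (Dm x) (Dm x))
    + P.θc / 2 * (∫ x in P.dom ε, ‖m x‖ ^ 4)
    + P.c₂ * (∫ x in P.dom ε, θ x ^ 2)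
    + (∫ x in P.ext ε, form (osc P.μ ε x) (Dφ x) (Dφ x))
    + 2 * P.c₁ * ∫ x in P.dom ε, θ x)

/-- `𝓔^ε(t)`. -/
def Model.energyAt (P : Model) (ε : ℝ) (S : Fields) (t : ℝ) : ℝ :=
  P.energy ε (S.m t) (S.Dm t) (S.θ t) (S.Dφ t)

/-- `𝓔^ε(0)`. -/
def Model.initialEnergy (P : Model) (ε : ℝ) (I : InitialData) : ℝ :=
  P.energy ε I.m I.Dm I.θ I.Dφ

/-- `(γ/2) ‖∂ₜ m‖² + ∫ K^ε ∇(k₀ ln θ + k₁ θ) · ∇θ` at time `s`. -/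
def Model.dissipation (P : Model) (ε : ℝ) (S : Fields) (s : ℝ) : ℝ :=
  P.γ / 2 * (∫ x in P.dom ε, ‖S.dtm s x‖ ^ 2) +
    ∫ x in P.dom ε, form (osc P.K ε x) (P.k₀ • S.Dlogθ s x + P.k₁ • S.Dθ s x) (S.Dθ s x)

/-- `‖m₀‖_{H¹(Ω^ε)} ≤ R` and `‖θ₀‖_{L²(Ω^ε)} ≤ R`. -/
def Model.InitialBound (P : Model) (ε : ℝ) (I : InitialData) (R : ℝ) : Prop :=
  (∫ x in P.dom ε, ‖I.m x‖ ^ 2) + (∑ c, ∫ x in P.dom ε, ‖I.Dm x c‖ ^ 2) ≤ R ^ 2 ∧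
    ∫ x in P.dom ε, I.θ x ^ 2 ≤ R ^ 2

end PhaseTransition

end

noncomputable section

namespace PhaseTransition

open scoped ENNReal Convolution ContDiff


/-! ### Translations and averages in `L²` -/

/-! Formally, test the magnetization equation with ∂ₜm, the heat equation with θ, and the time
derivative of the magnetostatic equation with φ. The coupling θ m·∂ₜm cancels, ∇φ·∂ₜm becomes the
derivative of the potential energy, and θ dF(θ) = d(c₁ θ + c₂ θ²/2). There remains d𝓔/dt + γ‖∂ₜm‖² +
∫ K∇(k₀ ln θ + k₁ θ)·∇θ = θ_c ∫ m·∂ₜm. The right side integrates to (θ_c/2)(‖m(t)‖² − ‖m(0)‖²), and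
s² ≤ s⁴/4 + 1 absorbs it into half of the energy. This gives η₁ = 2 and η₂ = θ_c |Ω| for every ε.
The flux term is nonnegative because ∇θ = θ ∇ln θ (`grad_eq_smul_grad_log`).

The regularity does not allow this directly: ∂ₜm is only square integrable in space, F(θ) has a time
derivative only in a dual space, and 𝓔 is not known to be continuous. Backward differences of length
η replace the derivatives. Each part of 𝓔 is convex in the right variable (∇m, m, F(θ), ∇φ), so its
increment is at most its derivative at the later time applied to the increment of that variable; the
coupling then keeps only a term of favourable sign, because θ > 0 (`Model.Evolution.energy_step`).
After integration over (0,τ) and division by η, the energy differences telescope to the mean of 𝓔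
over (τ − η, τ) minus 𝓔(0), the solution being continued by its initial values to negative times.
The backward averages of ∂ₜm and of the flux converge in L² as η → 0.

To pass from the mean of 𝓔 just before τ to 𝓔(τ), lower semicontinuity from the left is used
(`Model.Evolution.lsc_energy`). The equations make m and F(θ) weakly continuous in time, and the
energy is convex in them.

The L⁴ bound also needs 𝓔(0) to be bounded in terms of R alone. The potential is controlled by m₀,
and the quartic term needs the embedding of H¹(Ω^ε) in L⁴ with a constant free of ε
(`exists_uniform_sobolev`). Sobolev–Poincaré inequalities are proved on Ω and on the perforated
reference cell, from the cone property and connectedness. On each scaled cell u is close to a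
constant; a cut-off replaces u by that constant near the hole, which extends u to Ω. The gradient of
the cut-off costs a factor 1/ε, and the scaled Poincaré inequality returns a factor ε. -/

lemma sq_lintegral_le {α : Type*} [MeasurableSpace α] (ν : Measure α) {f : α → ℝ≥0∞}
    (hf : AEMeasurable f ν) : (∫⁻ a, f a ∂ν) ^ 2 ≤ ν univ * ∫⁻ a, f a ^ 2 ∂ν := by
  have h := ENNReal.lintegral_mul_le_Lp_mul_Lq ν (Real.HolderConjugate.two_two)
    hf (aemeasurable_const (b := (1 : ℝ≥0∞)))
  simp only [Pi.mul_apply, mul_one, ENNReal.one_rpow, lintegral_const, one_mul] at h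
  calc (∫⁻ a, f a ∂ν) ^ 2
      ≤ ((∫⁻ a, f a ^ (2 : ℝ) ∂ν) ^ (1 / 2 : ℝ) * ν univ ^ (1 / 2 : ℝ)) ^ 2 := by gcongr
    _ = ν univ * ∫⁻ a, f a ^ 2 ∂ν := by
        rw [mul_pow, ← ENNReal.rpow_natCast, ← ENNReal.rpow_natCast, ← ENNReal.rpow_mul,
          ← ENNReal.rpow_mul]
        norm_num
        rw [mul_comm]

/-- Composition is continuous on L² when measure-preserving maps tend to the identity in the
compact-open topology. The space is general because the lemma serves both translations of ℝ³ and
shifts in time on ℝ × ℝ³. -/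
lemma tendsto_lintegral_comp_sub_sq {X E α : Type*} [TopologicalSpace X] [R1Space X]
    [MeasurableSpace X] [BorelSpace X] [NormedAddCommGroup E] {μ : Measure X}
    [IsLocallyFiniteMeasure μ] [μ.InnerRegularCompactLTTop] {l : Filter α} {τ : α → C(X, X)}
    (hτ : Tendsto τ l (𝓝 (ContinuousMap.id X))) (hm : ∀ a, MeasurePreserving (τ a) μ μ)
    {f : X → E} (hf : MemLp f 2 μ) :
    Tendsto (fun a => ∫⁻ x, ‖f (τ a x) - f x‖ₑ ^ 2 ∂μ) l (𝓝 0) := by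
  have : Fact ((1 : ℝ≥0∞) ≤ 2) := ⟨by norm_num⟩
  have h := Filter.Tendsto.compMeasurePreservingLp (f := fun _ : α => hf.toLp f)
    (f₀ := hf.toLp f) tendsto_const_nhds hτ hm (MeasurePreserving.id μ) (by simp)
  rw [tendsto_iff_edist_tendsto_0] at h
  have h2 := (ENNReal.continuous_pow 2).tendsto 0 |>.comp h
  simp only [ne_eq, OfNat.ofNat_ne_zero, not_false_eq_true, zero_pow] at h2
  refine h2.congr fun a => ?_
  simp only [Function.comp_apply]
  rw [Lp.edist_def, eLpNorm_eq_lintegral_rpow_enorm_toReal (by simp) (by simp),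
    ← ENNReal.rpow_natCast, ← ENNReal.rpow_mul]
  have e1 : (1 / ENNReal.toReal 2 * ((2 : ℕ) : ℝ)) = 1 := by norm_num
  have e2 : ENNReal.toReal 2 = ((2 : ℕ) : ℝ) := by norm_num
  rw [e1, e2, ENNReal.rpow_one]
  simp_rw [ENNReal.rpow_natCast]
  refine lintegral_congr_ae ?_
  have h3 : (Lp.compMeasurePreserving (⇑(τ a)) (hm a) (hf.toLp f) : X → E)
      =ᵐ[μ] fun x => f (τ a x) :=
    (Lp.coeFn_compMeasurePreserving _ (hm a)).trans
      ((hm a).quasiMeasurePreserving.ae_eq_comp hf.coeFn_toLp)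
  have h4 : (Lp.compMeasurePreserving (⇑(ContinuousMap.id X)) (MeasurePreserving.id μ)
      (hf.toLp f) : X → E) =ᵐ[μ] f :=
    (Lp.coeFn_compMeasurePreserving _ (MeasurePreserving.id μ)).trans hf.coeFn_toLp
  filter_upwards [h3, h4] with x hx hx'
  simp only [Pi.sub_apply]
  exact congrArg (fun z => ‖z‖ₑ ^ 2) (congrArg₂ (· - ·) hx hx')

lemma tendsto_lintegral_translate_sub_sq {E : Type*} [NormedAddCommGroup E] {f : E3 → E}
    (hf : MemLp f 2 volume) :
    Tendsto (fun b : E3 => ∫⁻ x, ‖f (x - b) - f x‖ₑ ^ 2) (𝓝 0) (𝓝 0) := by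
  refine tendsto_lintegral_comp_sub_sq (τ := fun b : E3 => ⟨fun x => x - b, by fun_prop⟩) ?_
    (fun b => measurePreserving_sub_right volume b) hf
  -- Currying a jointly continuous map gives continuity in `b` for the compact-open topology.
  let c : C(E3, C(E3, E3)) := ContinuousMap.curry ⟨fun p : E3 × E3 => p.2 - p.1, by fun_prop⟩
  have h := c.continuous.tendsto 0
  have h0 : c 0 = ContinuousMap.id E3 := by ext x; simp [c]
  rw [h0] at h
  exact h

/-! ### Mollification -/

/-- The probability measure with density `φ`. -/
def bumpMeasure (φ : ContDiffBump (0 : E3)) : Measure E3 :=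
  volume.withDensity fun t => ENNReal.ofReal (φ.normed volume t)

/-- The mollification of `f`. -/
def moll {E : Type*} [NormedAddCommGroup E] [NormedSpace ℝ E] (φ : ContDiffBump (0 : E3))
    (f : E3 → E) : E3 → E :=
  φ.normed volume ⋆[ContinuousLinearMap.lsmul ℝ ℝ, volume] f

variable {E : Type*} [NormedAddCommGroup E] [NormedSpace ℝ E]

lemma measurable_bump (φ : ContDiffBump (0 : E3)) :
    Measurable fun t => ENNReal.ofReal (φ.normed volume t) :=
  (φ.continuous_normed.measurable).ennreal_ofReal

instance isProbabilityMeasure_bumpMeasure (φ : ContDiffBump (0 : E3)) :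
    IsProbabilityMeasure (bumpMeasure φ) := by
  constructor
  rw [bumpMeasure, withDensity_apply _ MeasurableSet.univ, Measure.restrict_univ,
    ← ofReal_integral_eq_lintegral_ofReal φ.integrable_normed
      (Eventually.of_forall φ.nonneg_normed), φ.integral_normed, ENNReal.ofReal_one]

lemma ae_bumpMeasure (φ : ContDiffBump (0 : E3)) :
    ∀ᵐ t ∂bumpMeasure φ, ‖t‖ < φ.rOut := by
  rw [bumpMeasure, ae_withDensity_iff (measurable_bump φ)]
  refine Eventually.of_forall fun t ht => ?_
  have : t ∈ Function.support (φ.normed volume) := by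
    intro h
    simp [h] at ht
  rw [φ.support_normed_eq] at this
  simpa using this

lemma bumpMeasure_ac (φ : ContDiffBump (0 : E3)) : bumpMeasure φ ≪ volume :=
  withDensity_absolutelyContinuous _ _

/-- A mollification is an average against a probability measure. Contraction and convergence in L²
thus reduce to Cauchy–Schwarz and Tonelli. -/
lemma enorm_moll_le (φ : ContDiffBump (0 : E3)) (f : E3 → E) (x : E3) :
    ‖moll φ f x‖ₑ ≤ ∫⁻ t, ‖f (x - t)‖ₑ ∂bumpMeasure φ := by
  rw [moll, convolution_def]
  refine (enorm_integral_le_lintegral_enorm _).trans ?_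
  rw [bumpMeasure, lintegral_withDensity_eq_lintegral_mul_non_measurable _ (measurable_bump φ)
    (Eventually.of_forall fun _ => ENNReal.ofReal_lt_top)]
  refine lintegral_mono fun t => ?_
  simp only [ContinuousLinearMap.lsmul_apply, Pi.mul_apply]
  rw [enorm_smul, Real.enorm_of_nonneg (φ.nonneg_normed t)]

lemma aemeasurable_comp_sub {β : Type*} [MeasurableSpace β] {f : E3 → β}
    (hf : AEMeasurable f volume) (φ : ContDiffBump (0 : E3)) :
    AEMeasurable (fun p : E3 × E3 => f (p.1 - p.2)) (volume.prod (bumpMeasure φ)) :=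
  (hf.comp_quasiMeasurePreserving (quasiMeasurePreserving_sub volume volume)).mono_ac
    (Measure.AbsolutelyContinuous.rfl.prod (bumpMeasure_ac φ))

lemma aemeasurable_comp_sub_left {β : Type*} [MeasurableSpace β] {f : E3 → β}
    (hf : AEMeasurable f volume) (φ : ContDiffBump (0 : E3)) (x : E3) :
    AEMeasurable (fun t : E3 => f (x - t)) (bumpMeasure φ) :=
  (hf.comp_quasiMeasurePreserving
    (Measure.measurePreserving_sub_left volume x).quasiMeasurePreserving).mono_ac (bumpMeasure_ac φ)

lemma lintegral_moll_sq_le {f : E3 → E} (hf : AEStronglyMeasurable f volume)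
    (φ : ContDiffBump (0 : E3)) :
    ∫⁻ x, ‖moll φ f x‖ₑ ^ 2 ≤ ∫⁻ x, ‖f x‖ₑ ^ 2 := by
  calc ∫⁻ x, ‖moll φ f x‖ₑ ^ 2
      ≤ ∫⁻ x, ∫⁻ t, ‖f (x - t)‖ₑ ^ 2 ∂bumpMeasure φ := by
        refine lintegral_mono fun x => ?_
        calc ‖moll φ f x‖ₑ ^ 2 ≤ (∫⁻ t, ‖f (x - t)‖ₑ ∂bumpMeasure φ) ^ 2 := by
              gcongr; exact enorm_moll_le φ f x
          _ ≤ _ := by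
              simpa using sq_lintegral_le (bumpMeasure φ)
                (aemeasurable_comp_sub_left hf.enorm φ x)
    _ = ∫⁻ t, (∫⁻ x, ‖f (x - t)‖ₑ ^ 2) ∂bumpMeasure φ :=
        lintegral_lintegral_swap (aemeasurable_comp_sub (hf.enorm.pow_const 2) φ)
    _ = ∫⁻ x, ‖f x‖ₑ ^ 2 := by
        simp_rw [lintegral_sub_right_eq_self (μ := (volume : Measure E3)) (fun x => ‖f x‖ₑ ^ 2)]
        simp

/-- The mollification on `A` sees `f` only within distance `rOut`. This bounds mollifications by
integrals of `f` over sets that stay inside the domain. -/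
lemma setLIntegral_moll_le {f : E3 → E} (hf : AEStronglyMeasurable f volume)
    (φ : ContDiffBump (0 : E3)) {A A' : Set E3} (hA : MeasurableSet A) (hA' : MeasurableSet A')
    (h : ∀ x ∈ A, ∀ t : E3, ‖t‖ < φ.rOut → x - t ∈ A') :
    ∫⁻ x in A, ‖moll φ f x‖ₑ ≤ ∫⁻ x in A', ‖f x‖ₑ := by
  calc ∫⁻ x in A, ‖moll φ f x‖ₑ
      ≤ ∫⁻ x in A, ∫⁻ t, A'.indicator (fun y => ‖f y‖ₑ) (x - t) ∂bumpMeasure φ := by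
        refine setLIntegral_mono' hA fun x hx => (enorm_moll_le φ f x).trans ?_
        refine lintegral_mono_ae ?_
        filter_upwards [ae_bumpMeasure φ] with t ht
        rw [indicator_of_mem (h x hx t ht)]
    _ ≤ ∫⁻ x, ∫⁻ t, A'.indicator (fun y => ‖f y‖ₑ) (x - t) ∂bumpMeasure φ :=
        setLIntegral_le_lintegral _ _
    _ = ∫⁻ t, (∫⁻ x, A'.indicator (fun y => ‖f y‖ₑ) (x - t)) ∂bumpMeasure φ :=
        lintegral_lintegral_swap (aemeasurable_comp_sub (hf.enorm.indicator hA') φ)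
    _ = ∫⁻ x in A', ‖f x‖ₑ := by
        simp_rw [lintegral_sub_right_eq_self (μ := (volume : Measure E3))
          (A'.indicator fun y => ‖f y‖ₑ)]
        simp [lintegral_indicator hA']

lemma locallyIntegrable_of_memLp_two {E : Type*} [NormedAddCommGroup E] {f : E3 → E} (hf : MemLp f 2 volume) :
    LocallyIntegrable f volume := hf.locallyIntegrable (by norm_num)

lemma contDiff_moll {f : E3 → E} (hf : LocallyIntegrable f volume) (φ : ContDiffBump (0 : E3)) :
    ContDiff ℝ ∞ (moll φ f) :=
  φ.hasCompactSupport_normed.contDiff_convolution_left _ φ.contDiff_normed hf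

lemma enorm_moll_sub_le [CompleteSpace E] {f : E3 → E} (hf : LocallyIntegrable f volume)
    (φ : ContDiffBump (0 : E3)) (x : E3) :
    ‖moll φ f x - f x‖ₑ ≤ ∫⁻ t, ‖f (x - t) - f x‖ₑ ∂bumpMeasure φ := by
  have h1 : moll φ f x - f x = ∫ t, φ.normed volume t • (f (x - t) - f x) := by
    simp_rw [smul_sub]
    rw [integral_sub, φ.integral_normed_smul volume (f x), moll, convolution_def]
    · rfl
    · exact (φ.hasCompactSupport_normed.convolutionExists_left (ContinuousLinearMap.lsmul ℝ ℝ)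
        φ.continuous_normed hf x)
    · exact φ.integrable_normed.smul_const _
  rw [h1]
  refine (enorm_integral_le_lintegral_enorm _).trans ?_
  rw [bumpMeasure, lintegral_withDensity_eq_lintegral_mul_non_measurable _ (measurable_bump φ)
    (Eventually.of_forall fun _ => ENNReal.ofReal_lt_top)]
  refine lintegral_mono fun t => ?_
  simp only [Pi.mul_apply]
  rw [enorm_smul, Real.enorm_of_nonneg (φ.nonneg_normed t)]

/-- Mollifications converge in `L²`. -/
lemma tendsto_lintegral_moll_sub_sq [CompleteSpace E] {f : E3 → E} (hf : MemLp f 2 volume)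
    {φ : ℕ → ContDiffBump (0 : E3)} (hφ : Tendsto (fun n => (φ n).rOut) atTop (𝓝 0)) :
    Tendsto (fun n => ∫⁻ x, ‖moll (φ n) f x - f x‖ₑ ^ 2) atTop (𝓝 0) := by
  have hT := tendsto_lintegral_translate_sub_sq hf
  rw [ENNReal.tendsto_nhds_zero] at hT ⊢
  intro ε hε
  obtain ⟨δ, hδ, hδ'⟩ := Metric.eventually_nhds_iff.1 (hT ε hε)
  filter_upwards [hφ.eventually (gt_mem_nhds hδ)] with n hn
  have hm := hf.aestronglyMeasurable
  calc ∫⁻ x, ‖moll (φ n) f x - f x‖ₑ ^ 2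
      ≤ ∫⁻ x, ∫⁻ t, ‖f (x - t) - f x‖ₑ ^ 2 ∂bumpMeasure (φ n) := by
        refine lintegral_mono fun x => ?_
        calc ‖moll (φ n) f x - f x‖ₑ ^ 2
            ≤ (∫⁻ t, ‖f (x - t) - f x‖ₑ ∂bumpMeasure (φ n)) ^ 2 := by
              gcongr; exact enorm_moll_sub_le (locallyIntegrable_of_memLp_two hf) (φ n) x
          _ ≤ _ := by
              have h1 : AEStronglyMeasurable (fun t : E3 => f (x - t)) (bumpMeasure (φ n)) :=
                (hm.comp_quasiMeasurePreserving
                  (Measure.measurePreserving_sub_left volume x).quasiMeasurePreserving).mono_ac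
                  (bumpMeasure_ac (φ n))
              simpa using sq_lintegral_le (bumpMeasure (φ n))
                (h1.sub aestronglyMeasurable_const).enorm
    _ = ∫⁻ t, (∫⁻ x, ‖f (x - t) - f x‖ₑ ^ 2) ∂bumpMeasure (φ n) := by
        refine lintegral_lintegral_swap ?_
        have h1 : AEStronglyMeasurable (fun p : E3 × E3 => f (p.1 - p.2))
            (volume.prod (bumpMeasure (φ n))) :=
          (hm.comp_quasiMeasurePreserving (quasiMeasurePreserving_sub volume volume)).mono_ac
            (Measure.AbsolutelyContinuous.rfl.prod (bumpMeasure_ac (φ n)))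
        exact (h1.sub hm.comp_fst).enorm.pow_const 2
    _ ≤ ∫⁻ _, ε ∂bumpMeasure (φ n) := by
        refine lintegral_mono_ae ?_
        filter_upwards [ae_bumpMeasure (φ n)] with t ht
        exact hδ' (by simpa using ht.trans hn)
    _ = ε := by simp


/-! ### Mollification of weakly differentiable functions -/

lemma fderiv_moll_apply {f : E3 → ℝ} (hf : LocallyIntegrable f volume)
    (φ : ContDiffBump (0 : E3)) (x v : E3) :
    fderiv ℝ (moll φ f) x v = ∫ t, fderiv ℝ (φ.normed volume) (x - t) v * f t := by
  have hc : HasCompactSupport (φ.normed (volume : Measure E3)) := φ.hasCompactSupport_normed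
  have hd : ContDiff ℝ 1 (φ.normed (volume : Measure E3)) := φ.contDiff_normed
  have h := hc.hasFDerivAt_convolution_left (ContinuousLinearMap.lsmul ℝ ℝ) hd hf x
  rw [moll, h.fderiv, convolution_eq_swap, ContinuousLinearMap.integral_apply]
  · rfl
  · have := (hc.fderiv ℝ).convolutionExists_left
      ((ContinuousLinearMap.lsmul ℝ ℝ : ℝ →L[ℝ] ℝ →L[ℝ] ℝ).precompL E3)
      (hd.continuous_fderiv one_ne_zero) hf x
    exact this.integrable_swap

lemma moll_apply_coord {g : E3 → E3} (hg : LocallyIntegrable g volume)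
    (φ : ContDiffBump (0 : E3)) (x : E3) (i : Fin 3) :
    moll φ g x i = ∫ t, φ.normed volume (x - t) * g t i := by
  rw [moll, convolution_eq_swap]
  have hex := ((φ.hasCompactSupport_normed (μ := (volume : Measure E3))).convolutionExists_left
      (ContinuousLinearMap.lsmul ℝ ℝ) φ.continuous_normed hg x).integrable_swap
  exact ((EuclideanSpace.proj i : E3 →L[ℝ] ℝ).integral_comp_comm hex).symm

lemma fderiv_apply_eq_sum (L : E3 →L[ℝ] ℝ) (w : E3) :
    L w = ∑ i, w i * L (EuclideanSpace.single i 1) := by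
  conv_lhs => rw [← (EuclideanSpace.basisFun (Fin 3) ℝ).sum_repr w]
  simp [map_sum]

/-- The gradient of the mollification is the mollification of the weak gradient. -/
lemma fderiv_moll_eq_inner {U : Set E3} (hU : IsOpen U) {u : E3 → ℝ} {g : E3 → E3}
    (hu : LocallyIntegrable (U.indicator u) volume) (hg : LocallyIntegrable (U.indicator g) volume)
    (h : HasWeakGrad U u g) (φ : ContDiffBump (0 : E3)) {x : E3}
    (hx : Metric.closedBall x φ.rOut ⊆ U) (w : E3) :
    fderiv ℝ (moll φ (U.indicator u)) x w = inner ℝ (moll φ (U.indicator g) x) w := by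
  have key : ∀ i : Fin 3, fderiv ℝ (moll φ (U.indicator u)) x (EuclideanSpace.single i 1)
      = moll φ (U.indicator g) x i := by
    intro i
    -- The reflected bump centred at `x` is supported in the closed ball about `x`, hence is an
    -- admissible test function on `U`.
    set ψ : E3 → ℝ := fun t => φ.normed volume (x - t) with hψ
    have hψd : ContDiff ℝ (⊤ : ℕ∞) ψ := by
      have : ContDiff ℝ (⊤ : ℕ∞) (φ.normed (volume : Measure E3)) := φ.contDiff_normed
      exact this.comp (contDiff_const.sub contDiff_id)
    have hsupp : tsupport ψ ⊆ Metric.closedBall x φ.rOut := by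
      refine closure_minimal ?_ Metric.isClosed_closedBall
      intro t ht
      have : x - t ∈ Function.support (φ.normed (volume : Measure E3)) := ht
      rw [φ.support_normed_eq] at this
      rw [Metric.mem_closedBall, dist_comm, dist_eq_norm]
      exact le_of_lt (by simpa using this)
    have hcs : HasCompactSupport ψ :=
      (isCompact_closedBall x φ.rOut).of_isClosed_subset (isClosed_tsupport _) hsupp
    have hw := h ψ hψd hcs (hsupp.trans hx) i
    have hder : ∀ t, fderiv ℝ ψ t (EuclideanSpace.single i 1)
        = -fderiv ℝ (φ.normed volume) (x - t) (EuclideanSpace.single i 1) := by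
      intro t
      have h1 : HasFDerivAt (φ.normed (volume : Measure E3))
          (fderiv ℝ (φ.normed volume) (x - t)) (x - t) :=
        ((φ.contDiff_normed (n := 1)).differentiable (by norm_num) _).hasFDerivAt
      have h2 : HasFDerivAt (fun t : E3 => x - t) (-ContinuousLinearMap.id ℝ E3) t :=
        (hasFDerivAt_id t).const_sub x
      have h3 : HasFDerivAt ψ _ t := h1.comp t h2
      rw [h3.fderiv]
      simp
    rw [fderiv_moll_apply hu, moll_apply_coord hg]
    have e1 : (∫ t, fderiv ℝ (φ.normed volume) (x - t) (EuclideanSpace.single i 1)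
        * U.indicator u t) = -∫ t in U, u t * fderiv ℝ ψ t (EuclideanSpace.single i 1) := by
      rw [← integral_indicator hU.measurableSet, ← integral_neg]
      refine integral_congr_ae (Eventually.of_forall fun t => ?_)
      by_cases ht : t ∈ U
      · simp [ht, hder, mul_comm]
      · simp [ht]
    have e2 : (∫ t, φ.normed volume (x - t) * (U.indicator g t) i) = ∫ t in U, g t i * ψ t := by
      rw [← integral_indicator hU.measurableSet]
      refine integral_congr_ae (Eventually.of_forall fun t => ?_)
      by_cases ht : t ∈ U
      · simp [ht, hψ, mul_comm]
      · simp [ht]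
    rw [e1, e2, hw, neg_neg]
  rw [fderiv_apply_eq_sum]
  simp_rw [key]
  rw [PiLp.inner_apply]
  simp

/-- A sequence of bump functions shrinking to the origin. -/
def bump (n : ℕ) : ContDiffBump (0 : E3) where
  rIn := 1 / (2 * (n + 1 : ℝ))
  rOut := 1 / (n + 1 : ℝ)
  rIn_pos := by positivity
  rIn_lt_rOut := by
    have : (0 : ℝ) < n + 1 := by positivity
    apply one_div_lt_one_div_of_lt this
    linarith

lemma tendsto_bump : Tendsto (fun n => (bump n).rOut) atTop (𝓝 0) :=
  tendsto_one_div_add_atTop_nhds_zero_nat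

lemma ae_tendsto_moll {E : Type*} [NormedAddCommGroup E] [NormedSpace ℝ E] [CompleteSpace E]
    {f : E3 → E} (hf : LocallyIntegrable f volume) :
    ∀ᵐ x, Tendsto (fun n => moll (bump n) f x) atTop (𝓝 (f x)) := by
  -- Convergence at Lebesgue points requires a bounded ratio of outer to inner radius; for `bump`
  -- the ratio is 2.
  refine ContDiffBump.ae_convolution_tendsto_right_of_locallyIntegrable (K := 2) tendsto_bump
    (Eventually.of_forall fun n => ?_) hf
  simp only [bump]
  have : (0 : ℝ) < n + 1 := by positivity
  field_simp
  norm_num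

lemma memLp_indicator {E : Type*} [NormedAddCommGroup E] {U : Set E3} (hU : IsOpen U)
    {f : E3 → E} {p : ℝ≥0∞} (hf : MemLp f p (volume.restrict U)) :
    MemLp (U.indicator f) p volume :=
  (memLp_indicator_iff_restrict hU.measurableSet).2 hf

/-! ### Chain rule -/

lemma integrable_mul_of_memLp_two {α : Type*} [MeasurableSpace α] {ν : Measure α} {f g : α → ℝ}
    (hf : MemLp f 2 ν) (hg : MemLp g 2 ν) : Integrable (fun x => f x * g x) ν :=
  MemLp.integrable_mul (p := 2) (q := 2) hf hg

lemma tendsto_lintegral_mul_of_sq {α : Type*} [MeasurableSpace α] {ν : Measure α}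
    {a : ℕ → α → ℝ≥0∞} {b : α → ℝ≥0∞} (ha : ∀ n, AEMeasurable (a n) ν) (hb : AEMeasurable b ν)
    (h : Tendsto (fun n => ∫⁻ x, a n x ^ 2 ∂ν) atTop (𝓝 0)) (hb2 : ∫⁻ x, b x ^ 2 ∂ν ≠ ⊤) :
    Tendsto (fun n => ∫⁻ x, a n x * b x ∂ν) atTop (𝓝 0) := by
  have h1 : ∀ n, ∫⁻ x, a n x * b x ∂ν
      ≤ (∫⁻ x, a n x ^ 2 ∂ν) ^ (1 / 2 : ℝ) * (∫⁻ x, b x ^ 2 ∂ν) ^ (1 / 2 : ℝ) := fun n => by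
    have := ENNReal.lintegral_mul_le_Lp_mul_Lq ν (Real.HolderConjugate.two_two) (ha n) hb
    simpa using this
  have h2 : Tendsto (fun n => (∫⁻ x, a n x ^ 2 ∂ν) ^ (1 / 2 : ℝ)
      * (∫⁻ x, b x ^ 2 ∂ν) ^ (1 / 2 : ℝ)) atTop (𝓝 0) := by
    have h3 := ((ENNReal.continuous_rpow_const (y := (1 / 2 : ℝ))).tendsto 0).comp h
    have h4 := ENNReal.Tendsto.mul_const (b := (∫⁻ x, b x ^ 2 ∂ν) ^ (1 / 2 : ℝ)) h3
      (Or.inr (ENNReal.rpow_ne_top_of_nonneg (by norm_num) hb2))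
    simpa using h4
  exact tendsto_of_tendsto_of_tendsto_of_le_of_le tendsto_const_nhds h2 (fun _ => zero_le) h1

lemma lintegral_enorm_sq_ne_top {α E : Type*} [MeasurableSpace α] [NormedAddCommGroup E]
    {ν : Measure α} {f : α → E} (hf : MemLp f 2 ν) : ∫⁻ x, ‖f x‖ₑ ^ 2 ∂ν ≠ ⊤ := by
  have h := hf.eLpNorm_lt_top
  rw [eLpNorm_lt_top_iff_lintegral_rpow_enorm_lt_top (by simp) (by simp)] at h
  simpa using h.ne

lemma exists_bump_closedBall_subset {U K : Set E3} (hU : IsOpen U) (hK : IsCompact K)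
    (hKU : K ⊆ U) : ∀ᶠ n in atTop, ∀ x ∈ K, Metric.closedBall x (bump n).rOut ⊆ U := by
  obtain ⟨δ, hδ, hδU⟩ := hK.exists_cthickening_subset_open hU hKU
  filter_upwards [tendsto_bump.eventually (gt_mem_nhds hδ)] with n hn x hx
  exact (Metric.closedBall_subset_cthickening hx _).trans
    ((Metric.cthickening_mono hn.le _).trans hδU)

/-- The classical chain rule holds for the mollified functions near the support of the test
function, and both sides pass to the limit: the left because f is Lipschitz, the right because f′ is
bounded and continuous. -/
lemma hasWeakGrad_comp {U : Set E3} (hU : IsOpen U) {u : E3 → ℝ} {g : E3 → E3}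
    (hu : MemLp u 2 (volume.restrict U)) (hg : MemLp g 2 (volume.restrict U))
    (h : HasWeakGrad U u g) {f : ℝ → ℝ} (hf : ContDiff ℝ 1 f) {C : ℝ}
    (hC : ∀ s, |deriv f s| ≤ C) :
    HasWeakGrad U (fun x => f (u x)) (fun x => deriv f (u x) • g x) := by
  intro ψ hψ hψc hψU i
  set e : E3 := EuclideanSpace.single i 1
  set uU := U.indicator u
  set gU := U.indicator g
  have huU : MemLp uU 2 volume := memLp_indicator hU hu
  have hgU : MemLp gU 2 volume := memLp_indicator hU hg
  have huUl := locallyIntegrable_of_memLp_two huU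
  have hgUl := locallyIntegrable_of_memLp_two hgU
  set un : ℕ → E3 → ℝ := fun n => moll (bump n) uU
  set gn : ℕ → E3 → E3 := fun n => moll (bump n) gU
  have hun : ∀ n, ContDiff ℝ ∞ (un n) := fun n => contDiff_moll huUl _
  have hgn : ∀ n, ContDiff ℝ ∞ (gn n) := fun n => contDiff_moll hgUl _
  have hC0 : 0 ≤ C := (abs_nonneg _).trans (hC 0)
  have hf' : Continuous (deriv f) := hf.continuous_deriv (by norm_num)
  have hlip : ∀ a b, |f a - f b| ≤ C * |a - b| := by
    intro a b
    have := Convex.norm_image_sub_le_of_norm_deriv_le (f := f) (s := univ) (x := b) (y := a)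
      (fun x _ => hf.differentiable (by norm_num) x) (fun x _ => hC x) convex_univ trivial trivial
    simpa using this
  have hψ' : Continuous fun x => fderiv ℝ ψ x e :=
    (hψ.continuous_fderiv (by simp)).clm_apply continuous_const
  have hψ'c : HasCompactSupport fun x => fderiv ℝ ψ x e := hψc.fderiv_apply ℝ e
  have hψ2 : MemLp ψ 2 volume := hψ.continuous.memLp_of_hasCompactSupport hψc
  have hψ'2 : MemLp (fun x => fderiv ℝ ψ x e) 2 volume := hψ'.memLp_of_hasCompactSupport hψ'c
  -- the identity for the mollified functions
  have hIBP : ∀ᶠ n in atTop, ∫ x, f (un n x) * fderiv ℝ ψ x e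
      = -∫ x, deriv f (un n x) * gn n x i * ψ x := by
    filter_upwards [exists_bump_closedBall_subset hU hψc hψU] with n hn
    have hfun : ContDiff ℝ 1 (fun x => f (un n x)) := hf.comp ((hun n).of_le (by simp))
    have hfd : ∀ x, fderiv ℝ (fun x => f (un n x)) x e
        = deriv f (un n x) * fderiv ℝ (un n) x e := by
      intro x
      have h1 : HasDerivAt f (deriv f (un n x)) (un n x) :=
        (hf.differentiable (by norm_num) _).hasDerivAt
      have h2 : HasFDerivAt (un n) (fderiv ℝ (un n) x) x :=
        ((hun n).differentiable (by simp) x).hasFDerivAt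
      have h3 : HasFDerivAt (fun x => f (un n x)) _ x := h1.comp_hasFDerivAt x h2
      rw [h3.fderiv]
      simp
    have hcd : Continuous fun x => fderiv ℝ (fun x => f (un n x)) x e :=
      (hfun.continuous_fderiv (by norm_num)).clm_apply continuous_const
    rw [integral_mul_fderiv_eq_neg_fderiv_mul_of_integrable
      ((hcd.mul hψ.continuous).integrable_of_hasCompactSupport hψc.mul_left)
      ((hfun.continuous.mul hψ').integrable_of_hasCompactSupport hψ'c.mul_left)
      ((hfun.continuous.mul hψ.continuous).integrable_of_hasCompactSupport hψc.mul_left)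
      (fun x _ => hfun.differentiable (by norm_num) x)
      (fun x _ => hψ.differentiable (by simp) x)]
    congr 1
    refine integral_congr_ae (Eventually.of_forall fun x => ?_)
    simp only
    by_cases hx : x ∈ tsupport ψ
    · rw [hfd, fderiv_moll_eq_inner hU huUl hgUl h (bump n) (hn x hx)]
      simp [e, EuclideanSpace.inner_single_right, gn, gU]
    · rw [image_eq_zero_of_notMem_tsupport hx]; simp
  have hsqu := tendsto_lintegral_moll_sub_sq huU tendsto_bump
  have hsqg := tendsto_lintegral_moll_sub_sq hgU tendsto_bump
  have humeas : AEStronglyMeasurable (fun x => f (uU x)) volume :=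
    hf.continuous.comp_aestronglyMeasurable huU.aestronglyMeasurable
  have hdmeas : AEStronglyMeasurable (fun x => deriv f (uU x)) volume :=
    hf'.comp_aestronglyMeasurable huU.aestronglyMeasurable
  have hgi : MemLp (fun x => gU x i) 2 volume := hgU.eval_piLp i
  have hint1 : Integrable (fun x => f (uU x) * fderiv ℝ ψ x e) := by
    -- Since `f 0` is arbitrary, f(u) itself need not be square integrable; f(u) − f(0) is, and the
    -- constant meets a compactly supported factor.
    have h1 : Integrable (fun x => (f (uU x) - f 0) * fderiv ℝ ψ x e) := by
      refine integrable_mul_of_memLp_two ?_ hψ'2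
      refine MemLp.of_le_mul (c := C) huU (humeas.sub aestronglyMeasurable_const)
        (Eventually.of_forall fun x => ?_)
      simpa using hlip (uU x) 0
    have h2 : Integrable (fun x => f 0 * fderiv ℝ ψ x e) :=
      (hψ'.integrable_of_hasCompactSupport hψ'c).const_mul _
    refine (h1.add h2).congr (Eventually.of_forall fun x => ?_)
    simp only [Pi.add_apply]; ring
  have hint2 : Integrable (fun x => deriv f (uU x) * gU x i * ψ x) := by
    refine integrable_mul_of_memLp_two ?_ hψ2
    refine MemLp.of_le_mul (c := C) hgi (hdmeas.mul hgi.aestronglyMeasurable)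
        (Eventually.of_forall fun x => ?_)
    rw [norm_mul]
    gcongr
    exact hC _
  have hlim1 : Tendsto (fun n => ∫ x, f (un n x) * fderiv ℝ ψ x e) atTop
      (𝓝 (∫ x, f (uU x) * fderiv ℝ ψ x e)) := by
    refine tendsto_integral_of_L1 _ hint1.aestronglyMeasurable (Eventually.of_forall fun n => ?_) ?_
    · exact ((hf.continuous.comp (hun n).continuous).mul hψ').integrable_of_hasCompactSupport
        hψ'c.mul_left
    · have h1 : Tendsto (fun n => ENNReal.ofReal C * ∫⁻ x, ‖un n x - uU x‖ₑ * ‖fderiv ℝ ψ x e‖ₑ)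
          atTop (𝓝 0) := by
        have := ENNReal.Tendsto.const_mul (a := ENNReal.ofReal C) (tendsto_lintegral_mul_of_sq
          (a := fun n x => ‖un n x - uU x‖ₑ) (b := fun x => ‖fderiv ℝ ψ x e‖ₑ)
          (fun n => ((hun n).continuous.aestronglyMeasurable.sub huU.aestronglyMeasurable).enorm)
          hψ'2.aestronglyMeasurable.enorm hsqu (lintegral_enorm_sq_ne_top hψ'2))
          (Or.inr ENNReal.ofReal_ne_top)
        simpa using this
      refine tendsto_of_tendsto_of_tendsto_of_le_of_le tendsto_const_nhds h1
        (fun _ => zero_le) fun n => ?_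
      simp only
      rw [← lintegral_const_mul' _ _ ENNReal.ofReal_ne_top]
      refine lintegral_mono fun x => ?_
      rw [← sub_mul, enorm_mul, ← mul_assoc]
      gcongr
      rw [← ofReal_norm, ← ofReal_norm, ← ENNReal.ofReal_mul hC0]
      exact ENNReal.ofReal_le_ofReal (hlip _ _)
  have hlim2 : Tendsto (fun n => ∫ x, deriv f (un n x) * gn n x i * ψ x) atTop
      (𝓝 (∫ x, deriv f (uU x) * gU x i * ψ x)) := by
    have hcgi : ∀ n, Continuous fun x => gn n x i := fun n =>
      (EuclideanSpace.proj i : E3 →L[ℝ] ℝ).continuous.comp (hgn n).continuous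
    -- Split f′(uₙ)gₙ as f′(uₙ)(gₙ − g) + f′(uₙ)g. The first part vanishes by L² convergence of the
    -- gradients, the second converges by domination and a.e. convergence of uₙ.
    have hA : Tendsto (fun n => ∫ x, deriv f (un n x) * ((gn n x i - gU x i) * ψ x)) atTop
        (𝓝 0) := by
      have h1 : Tendsto (fun n => ENNReal.ofReal C * ∫⁻ x, ‖gn n x - gU x‖ₑ * ‖ψ x‖ₑ)
          atTop (𝓝 0) := by
        have := ENNReal.Tendsto.const_mul (a := ENNReal.ofReal C) (tendsto_lintegral_mul_of_sq
          (a := fun n x => ‖gn n x - gU x‖ₑ) (b := fun x => ‖ψ x‖ₑ)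
          (fun n => ((hgn n).continuous.aestronglyMeasurable.sub hgU.aestronglyMeasurable).enorm)
          hψ2.aestronglyMeasurable.enorm hsqg (lintegral_enorm_sq_ne_top hψ2))
          (Or.inr ENNReal.ofReal_ne_top)
        simpa using this
      rw [tendsto_zero_iff_enorm_tendsto_zero]
      refine tendsto_of_tendsto_of_tendsto_of_le_of_le tendsto_const_nhds h1
        (fun _ => zero_le) fun n => ?_
      refine (enorm_integral_le_lintegral_enorm _).trans ?_
      rw [← lintegral_const_mul' _ _ ENNReal.ofReal_ne_top]
      refine lintegral_mono fun x => ?_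
      rw [enorm_mul, enorm_mul]
      gcongr
      · rw [← ofReal_norm]
        exact ENNReal.ofReal_le_ofReal (hC _)
      · rw [← ofReal_norm, ← ofReal_norm]
        exact ENNReal.ofReal_le_ofReal (PiLp.norm_apply_le (gn n x - gU x) i)
    have hB : Tendsto (fun n => ∫ x, deriv f (un n x) * (gU x i * ψ x)) atTop
        (𝓝 (∫ x, deriv f (uU x) * (gU x i * ψ x))) := by
      refine tendsto_integral_of_dominated_convergence (fun x => C * ‖gU x i * ψ x‖)
        (fun n => ?_) ?_ (fun n => Eventually.of_forall fun x => ?_) ?_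
      · exact (hf'.comp (hun n).continuous).aestronglyMeasurable.mul
          (hgi.aestronglyMeasurable.mul hψ2.aestronglyMeasurable)
      · exact (integrable_mul_of_memLp_two hgi hψ2).norm.const_mul C
      · rw [norm_mul]
        gcongr
        exact hC _
      · filter_upwards [ae_tendsto_moll huUl] with x hx
        exact ((hf'.tendsto _).comp hx).mul_const _
    have := hA.add hB
    rw [zero_add] at this
    refine (this.congr fun n => ?_).trans_eq ?_
    · rw [← integral_add]
      · refine integral_congr_ae (Eventually.of_forall fun x => ?_)
        simp only; ring
      · have : Integrable fun x => (gn n x i - gU x i) * ψ x := by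
          simp_rw [sub_mul]
          exact (((hcgi n).mul hψ.continuous).integrable_of_hasCompactSupport hψc.mul_left).sub
            (integrable_mul_of_memLp_two hgi hψ2)
        exact this.bdd_mul (c := C) (hf'.comp (hun n).continuous).aestronglyMeasurable
          (Eventually.of_forall fun x => hC _)
      · exact (integrable_mul_of_memLp_two hgi hψ2).bdd_mul (c := C)
          (hf'.comp (hun n).continuous).aestronglyMeasurable
          (Eventually.of_forall fun x => hC _)
    · simp_rw [mul_assoc]
  have hfin := tendsto_nhds_unique (hlim1.congr' hIBP) hlim2.neg
  have e1 : ∫ x in U, f (u x) * fderiv ℝ ψ x e = ∫ x, f (uU x) * fderiv ℝ ψ x e := by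
    rw [← integral_indicator hU.measurableSet]
    refine integral_congr_ae (Eventually.of_forall fun x => ?_)
    by_cases hx : x ∈ U
    · simp [uU, hx]
    · have h0 : fderiv ℝ ψ x e = 0 := image_eq_zero_of_notMem_tsupport
        (f := fun x => fderiv ℝ ψ x e) fun hx' => hx (hψU (tsupport_fderiv_apply_subset ℝ e hx'))
      simp [hx, h0]
  have e2 : ∫ x in U, (deriv f (u x) • g x) i * ψ x = ∫ x, deriv f (uU x) * gU x i * ψ x := by
    rw [← integral_indicator hU.measurableSet]
    refine integral_congr_ae (Eventually.of_forall fun x => ?_)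
    by_cases hx : x ∈ U
    · simp [uU, gU, hx]
    · simp [gU, hx]
  rw [e1, e2, hfin]

/-- Weak gradients are unique. -/
lemma hasWeakGrad_unique {U : Set E3} (hU : IsOpen U) {u : E3 → ℝ} {g g' : E3 → E3}
    (hg : MemLp g 2 (volume.restrict U)) (hg' : MemLp g' 2 (volume.restrict U))
    (h : HasWeakGrad U u g) (h' : HasWeakGrad U u g') :
    ∀ᵐ x ∂volume.restrict U, g x = g' x := by
  have key : ∀ i : Fin 3, ∀ᵐ x, x ∈ U → g x i - g' x i = 0 := by
    intro i
    have h1 : MemLp (fun x => g x i) 2 (volume.restrict U) := hg.eval_piLp i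
    have h2 : MemLp (fun x => g' x i) 2 (volume.restrict U) := hg'.eval_piLp i
    refine hU.ae_eq_zero_of_integral_contDiff_smul_eq_zero ?_ fun ψ hψ hψc hψU => ?_
    · have : LocallyIntegrable (fun x => g x i - g' x i) (volume.restrict U) :=
        (h1.sub h2).locallyIntegrable (by norm_num)
      exact (locallyIntegrableOn_of_locallyIntegrable_restrict this)
    · have hψ2 : MemLp ψ 2 (volume.restrict U) :=
        (hψ.continuous.memLp_of_hasCompactSupport (μ := volume) hψc).restrict U
      have e := (h ψ hψ hψc hψU i).symm.trans (h' ψ hψ hψc hψU i)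
      have e1 : ∫ x, ψ x • (g x i - g' x i) = ∫ x in U, (g x i * ψ x - g' x i * ψ x) := by
        rw [← integral_indicator hU.measurableSet]
        refine integral_congr_ae (Eventually.of_forall fun x => ?_)
        by_cases hx : x ∈ U
        · simp [hx]; ring
        · simp [hx, image_eq_zero_of_notMem_tsupport fun h => hx (hψU h)]
      rw [e1, integral_sub (integrable_mul_of_memLp_two h1 hψ2)
        (integrable_mul_of_memLp_two h2 hψ2)]
      linarith
  rw [ae_restrict_iff' hU.measurableSet]
  filter_upwards [key 0, key 1, key 2] with x h0 h1 h2 hx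
  ext i
  fin_cases i
  · exact sub_eq_zero.1 (h0 hx)
  · exact sub_eq_zero.1 (h1 hx)
  · exact sub_eq_zero.1 (h2 hx)

/-- `∇θ = θ ∇ln θ`. -/
lemma grad_eq_smul_grad_log {U : Set E3} (hU : IsOpen U) {θ : E3 → ℝ} {g gl : E3 → E3}
    (h : MemH1 U θ g) (hl : MemH1 U (fun x => Real.log (θ x)) gl)
    (hpos : ∀ᵐ x ∂volume.restrict U, 0 < θ x) :
    ∀ᵐ x ∂volume.restrict U, g x = θ x • gl x := by
  -- The exponential has unbounded derivative, so the chain rule cannot be applied to θ = exp(ln θ).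
  -- Instead the gradient of arctan θ is computed from θ and from ln θ, and the common factor 1/(1 +
  -- θ²) is cancelled.
  have d1 : ∀ s, HasDerivAt Real.arctan (1 / (1 + s ^ 2)) s := Real.hasDerivAt_arctan
  have d2 : ∀ s, HasDerivAt (fun s => Real.arctan (Real.exp s))
      (1 / (1 + Real.exp s ^ 2) * Real.exp s) s := fun s => (Real.hasDerivAt_exp s).arctan
  have b1 : ∀ s, |deriv Real.arctan s| ≤ 1 := fun s => by
    rw [(d1 s).deriv, abs_of_nonneg (by positivity), div_le_one (by positivity)]
    nlinarith [sq_nonneg s]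
  have b2 : ∀ s, |deriv (fun s => Real.arctan (Real.exp s)) s| ≤ 1 := fun s => by
    rw [(d2 s).deriv, abs_of_nonneg (by positivity), one_div, inv_mul_eq_div,
      div_le_one (by positivity)]
    nlinarith [sq_nonneg (Real.exp s - 1), Real.exp_pos s]
  have w1 := hasWeakGrad_comp hU h.memLp h.memLp_grad h.weakGrad Real.contDiff_arctan b1
  have w2 := hasWeakGrad_comp hU hl.memLp hl.memLp_grad hl.weakGrad
    (Real.contDiff_arctan.comp Real.contDiff_exp) b2
  have w2' : HasWeakGrad U (fun x => Real.arctan (θ x))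
      (fun x => deriv (fun s => Real.arctan (Real.exp s)) (Real.log (θ x)) • gl x) := by
    intro ψ hψ hψc hψU i
    refine Eq.trans ?_ (w2 ψ hψ hψc hψU i)
    refine integral_congr_ae ?_
    filter_upwards [hpos] with x hx
    simp [Real.exp_log hx]
  have m1 : MemLp (fun x => deriv Real.arctan (θ x) • g x) 2 (volume.restrict U) := by
    refine MemLp.of_le h.memLp_grad (AEStronglyMeasurable.smul
      ((Real.contDiff_arctan.continuous_deriv (n := 1) le_rfl).comp_aestronglyMeasurable
        h.memLp.aestronglyMeasurable) h.memLp_grad.aestronglyMeasurable)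
      (Eventually.of_forall fun x => ?_)
    rw [norm_smul]
    exact mul_le_of_le_one_left (norm_nonneg _) (b1 _)
  have m2 : MemLp (fun x => deriv (fun s => Real.arctan (Real.exp s)) (Real.log (θ x)) • gl x) 2
      (volume.restrict U) := by
    refine MemLp.of_le hl.memLp_grad (AEStronglyMeasurable.smul
      (((Real.contDiff_arctan.comp Real.contDiff_exp).continuous_deriv
        (n := 1) le_rfl).comp_aestronglyMeasurable
        hl.memLp.aestronglyMeasurable) hl.memLp_grad.aestronglyMeasurable)
      (Eventually.of_forall fun x => ?_)
    rw [norm_smul]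
    exact mul_le_of_le_one_left (norm_nonneg _) (b2 _)
  filter_upwards [hasWeakGrad_unique hU m1 m2 w1 w2', hpos] with x hx hp
  rw [(d1 _).deriv, (d2 _).deriv, Real.exp_log hp, mul_smul] at hx
  exact smul_right_injective E3 (by positivity : 1 / (1 + θ x ^ 2) ≠ 0) hx


/-! ### Sobolev inequality on domains with the cone property -/

lemma pow_four_lintegral_le {α : Type*} [MeasurableSpace α] (ν : Measure α) {f : α → ℝ≥0∞}
    (hf : AEMeasurable f ν) : (∫⁻ a, f a ∂ν) ^ 4 ≤ ν univ ^ 3 * ∫⁻ a, f a ^ 4 ∂ν := by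
  have h1 := sq_lintegral_le ν hf
  have h2 := sq_lintegral_le ν (hf.pow_const 2)
  calc (∫⁻ a, f a ∂ν) ^ 4 = ((∫⁻ a, f a ∂ν) ^ 2) ^ 2 := by ring
    _ ≤ (ν univ * ∫⁻ a, f a ^ 2 ∂ν) ^ 2 := by gcongr
    _ = ν univ ^ 2 * (∫⁻ a, f a ^ 2 ∂ν) ^ 2 := by ring
    _ ≤ ν univ ^ 2 * (ν univ * ∫⁻ a, (f a ^ 2) ^ 2 ∂ν) := by gcongr
    _ = ν univ ^ 3 * ∫⁻ a, f a ^ 4 ∂ν := by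
        simp_rw [← pow_mul]; ring

lemma lintegral_comp_add_smul (F : E3 → ℝ≥0∞) (hF : Measurable F) (x : E3) {s : ℝ} (hs : 0 < s) :
    ∫⁻ w, F (x + s • w) = ENNReal.ofReal (s⁻¹ ^ 3) * ∫⁻ w, F w := by
  have h := lintegral_map (μ := (volume : Measure E3)) (f := fun y => F (x + y))
    (g := fun w => s • w) (hF.comp (measurable_const_add x)) (measurable_const_smul s)
  rw [← h, Measure.map_addHaar_smul _ hs.ne', lintegral_smul_measure,
    lintegral_add_left_eq_self (μ := (volume : Measure E3)) F x]
  rw [smul_eq_mul, finrank_euclideanSpace, Fintype.card_fin, abs_of_nonneg (by positivity)]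
  congr 2
  rw [inv_pow]

/-- The measure `s ^ (-3/4) ds` on `(0,1]`. -/
def weightMeasure : Measure ℝ :=
  (volume.restrict (Ioc (0 : ℝ) 1)).withDensity fun s => ENNReal.ofReal (s ^ (-(3 / 4) : ℝ))

lemma weightMeasure_univ_ne_top : weightMeasure univ ≠ ⊤ := by
  rw [weightMeasure, withDensity_apply _ MeasurableSet.univ, Measure.restrict_univ]
  have h : IntervalIntegrable (fun s : ℝ => s ^ (-(3 / 4) : ℝ)) volume 0 1 :=
    intervalIntegral.intervalIntegrable_rpow' (by norm_num)
  rw [intervalIntegrable_iff_integrableOn_Ioc_of_le zero_le_one] at h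
  exact h.lintegral_lt_top.ne

instance : IsFiniteMeasure weightMeasure := ⟨weightMeasure_univ_ne_top.lt_top⟩

lemma lintegral_weight (F : ℝ → ℝ≥0∞) :
    ∫⁻ s, F s ∂weightMeasure
      = ∫⁻ s in Ioc (0 : ℝ) 1, ENNReal.ofReal (s ^ (-(3 / 4) : ℝ)) * F s := by
  rw [weightMeasure, lintegral_withDensity_eq_lintegral_mul_non_measurable _
    (by fun_prop) (Eventually.of_forall fun _ => ENNReal.ofReal_lt_top)]
  rfl

/-- Averages over cones map `L²` to `L⁴`. -/
lemma lintegral_cone_pow_four_le {G : E3 → ℝ≥0∞} (hG : Measurable G) (B : Set E3) :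
    ∫⁻ x, (∫⁻ s in Ioc (0 : ℝ) 1, ∫⁻ w in B, G (x + s • w)) ^ 4
      ≤ weightMeasure univ ^ 4 * volume B ^ 3 * (∫⁻ x, G x ^ 2) ^ 2 := by
  set N := ∫⁻ x, G x ^ 2
  set V := volume B
  let g : ℝ → E3 → ℝ≥0∞ := fun s x => ∫⁻ w in B, G (x + s • w)
  have hg : Measurable (Function.uncurry g) := by
    have : Measurable fun p : (ℝ × E3) × E3 => G (p.1.2 + p.1.1 • p.2) := by fun_prop
    exact this.lintegral_prod_right'
  have hgs : ∀ s, Measurable (g s) := fun s => hg.of_uncurry_left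
  have hgx : ∀ x, Measurable fun s => g s x := fun x => hg.of_uncurry_right
  -- For fixed s the mean over `B` is bounded pointwise by a multiple of s^(-3/2)‖G‖₂, and in L²
  -- uniformly in s. Interpolation gives an L⁴ norm of order s^(-3/4).
  have hsup : ∀ s, 0 < s → ∀ x, g s x ^ 2 ≤ V * (ENNReal.ofReal (s⁻¹ ^ 3) * N) := by
    intro s hs x
    have h1 := sq_lintegral_le (volume.restrict B) (f := fun w => G (x + s • w)) (by fun_prop)
    rw [Measure.restrict_apply_univ] at h1
    refine h1.trans ?_
    gcongr
    refine (setLIntegral_le_lintegral _ _).trans ?_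
    rw [lintegral_comp_add_smul (fun y => G y ^ 2) (by fun_prop) x hs]
  have hL2 : ∀ s, ∫⁻ x, g s x ^ 2 ≤ V ^ 2 * N := by
    intro s
    calc ∫⁻ x, g s x ^ 2 ≤ ∫⁻ x, V * ∫⁻ w in B, G (x + s • w) ^ 2 := by
          refine lintegral_mono fun x => ?_
          have h1 := sq_lintegral_le (volume.restrict B) (f := fun w => G (x + s • w)) (by fun_prop)
          rwa [Measure.restrict_apply_univ] at h1
      _ = V * ∫⁻ w in B, (∫⁻ x, G (x + s • w) ^ 2) := by
          rw [lintegral_const_mul]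
          · rw [lintegral_lintegral_swap (by fun_prop)]
          · have : Measurable fun p : E3 × E3 => G (p.1 + s • p.2) ^ 2 := by fun_prop
            exact this.lintegral_prod_right'
      _ = V ^ 2 * N := by
          simp_rw [lintegral_add_right_eq_self (μ := (volume : Measure E3)) (fun y => G y ^ 2)]
          simp only [lintegral_const, Measure.restrict_apply_univ]
          ring
  have hL4 : ∀ s, 0 < s → ∫⁻ x, g s x ^ 4 ≤ ENNReal.ofReal (s⁻¹ ^ 3) * (V ^ 3 * N ^ 2) := by
    intro s hs
    calc ∫⁻ x, g s x ^ 4 ≤ ∫⁻ x, (V * (ENNReal.ofReal (s⁻¹ ^ 3) * N)) * g s x ^ 2 := by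
          refine lintegral_mono fun x => ?_
          calc g s x ^ 4 = g s x ^ 2 * g s x ^ 2 := by ring
            _ ≤ _ := by gcongr; exact hsup s hs x
      _ = (V * (ENNReal.ofReal (s⁻¹ ^ 3) * N)) * ∫⁻ x, g s x ^ 2 :=
          lintegral_const_mul _ ((hgs s).pow_const 2)
      _ ≤ (V * (ENNReal.ofReal (s⁻¹ ^ 3) * N)) * (V ^ 2 * N) := by gcongr; exact hL2 s
      _ = _ := by ring
  -- The order s^(-3/4) is integrable at 0. Hölder is applied for the measure s^(-3/4) ds, and the
  -- resulting factor s³ cancels the s⁻³ of `hL4`.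
  have hJ : ∀ x, (∫⁻ s in Ioc (0 : ℝ) 1, g s x) ^ 4 ≤ weightMeasure univ ^ 3 *
      ∫⁻ s, (ENNReal.ofReal (s ^ 3) * g s x ^ 4) ∂weightMeasure := by
    intro x
    have h1 : ∫⁻ s in Ioc (0 : ℝ) 1, g s x
        = ∫⁻ s, ENNReal.ofReal (s ^ (3 / 4 : ℝ)) * g s x ∂weightMeasure := by
      rw [lintegral_weight]
      refine setLIntegral_congr_fun measurableSet_Ioc fun s hs => ?_
      rw [← mul_assoc, ← ENNReal.ofReal_mul (by have := hs.1; positivity),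
        ← Real.rpow_add hs.1]
      simp
    rw [h1]
    refine (pow_four_lintegral_le _ ?_).trans ?_
    · have := hgx x
      fun_prop
    · refine mul_le_mul_right ?_ _
      rw [lintegral_weight, lintegral_weight]
      refine setLIntegral_mono' measurableSet_Ioc fun s hs => ?_
      rw [mul_pow, ← ENNReal.ofReal_pow (by have := hs.1; positivity), ← Real.rpow_natCast,
        ← Real.rpow_natCast, ← Real.rpow_mul hs.1.le]
      norm_num
  calc ∫⁻ x, (∫⁻ s in Ioc (0 : ℝ) 1, g s x) ^ 4
      ≤ ∫⁻ x, weightMeasure univ ^ 3 *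
          ∫⁻ s, (ENNReal.ofReal (s ^ 3) * g s x ^ 4) ∂weightMeasure := lintegral_mono hJ
    _ = weightMeasure univ ^ 3 *
          ∫⁻ s, (∫⁻ x, ENNReal.ofReal (s ^ 3) * g s x ^ 4) ∂weightMeasure := by
        rw [lintegral_const_mul']
        · congr 1
          refine lintegral_lintegral_swap (f := fun x s => ENNReal.ofReal (s ^ 3) * g s x ^ 4) ?_
          have : Measurable fun p : E3 × ℝ => g p.2 p.1 := hg.comp measurable_swap
          exact Measurable.aemeasurable (by unfold Function.uncurry; fun_prop)
        · exact ENNReal.pow_ne_top weightMeasure_univ_ne_top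
    _ ≤ weightMeasure univ ^ 3 * ∫⁻ _, (V ^ 3 * N ^ 2) ∂weightMeasure := by
        refine mul_le_mul_right ?_ _
        rw [lintegral_weight, lintegral_weight]
        refine setLIntegral_mono' measurableSet_Ioc fun s hs => ?_
        refine mul_le_mul_right ?_ _
        rw [lintegral_const_mul _ ((hgs s).pow_const 4)]
        calc ENNReal.ofReal (s ^ 3) * ∫⁻ x, g s x ^ 4
            ≤ ENNReal.ofReal (s ^ 3) * (ENNReal.ofReal (s⁻¹ ^ 3) * (V ^ 3 * N ^ 2)) := by
              gcongr; exact hL4 s hs.1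
          _ = V ^ 3 * N ^ 2 := by
              rw [← mul_assoc, ← ENNReal.ofReal_mul (by have := hs.1; positivity), ← mul_pow,
                mul_inv_cancel₀ hs.1.ne']
              simp
    _ = _ := by
        rw [lintegral_const]; ring

/-- The points whose distance from the complement of `U` is at least `ρ`. -/
def core (U : Set E3) (ρ : ℝ) : Set E3 := {z | Metric.ball z ρ ⊆ U}

lemma isClosed_core (U : Set E3) (ρ : ℝ) : IsClosed (core U ρ) := by
  have : core U ρ = ⋂ y ∈ Uᶜ, {z | ρ ≤ dist y z} := by
    ext z
    simp only [core, mem_ofPred_eq, mem_iInter, mem_compl_iff]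
    constructor
    · intro h y hy
      by_contra hlt
      exact hy (h (by simpa [Metric.mem_ball] using hlt))
    · intro h y hy
      by_contra hyU
      exact absurd (h y hyU) (not_le.2 hy)
  rw [this]
  exact isClosed_biInter fun y _ => isClosed_le continuous_const (continuous_const.dist continuous_id)

lemma core_subset {U : Set E3} {ρ : ℝ} (hρ : 0 < ρ) : core U ρ ⊆ U :=
  fun _ hz => hz (Metric.mem_ball_self hρ)

lemma core_anti (U : Set E3) {ρ ρ' : ℝ} (h : ρ ≤ ρ') : core U ρ' ⊆ core U ρ :=
  fun _ hz => (Metric.ball_subset_ball h).trans hz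

lemma isCompact_core {U : Set E3} (hU : Bornology.IsBounded U) {ρ : ℝ} (hρ : 0 < ρ) :
    IsCompact (core U ρ) :=
  Metric.isCompact_of_isClosed_isBounded (isClosed_core U ρ) (hU.subset (core_subset hρ))

lemma sub_mem_core {U : Set E3} {ρ r : ℝ} {z t : E3} (hz : z ∈ core U ρ) (ht : ‖t‖ ≤ ρ - r) :
    z - t ∈ core U r := by
  intro y hy
  apply hz
  rw [Metric.mem_ball, dist_eq_norm] at hy ⊢
  calc ‖y - z‖ = ‖(y - (z - t)) - t‖ := by congr 1; abel
    _ ≤ ‖y - (z - t)‖ + ‖t‖ := norm_sub_le _ _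
    _ < ρ := by linarith

/-- The cone property of `U` near `x₀`. -/
def ConeAt (U : Set E3) (x₀ : E3) : Prop :=
  ∃ η > 0, ∃ e : E3, ∃ δ > 0, ∀ x ∈ U, x ∈ Metric.ball x₀ η → ∀ w ∈ Metric.ball e δ,
    ∀ s ∈ Ioc (0 : ℝ) 1, x + s • w ∈ U

lemma enorm_sub_le_lintegral_fderiv {u : E3 → ℝ} (hu : ContDiff ℝ 1 u) (x w : E3) :
    ‖u (x + w) - u x‖ₑ ≤ ∫⁻ s in Ioc (0 : ℝ) 1, ‖fderiv ℝ u (x + s • w) w‖ₑ := by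
  have hd : ∀ s : ℝ, HasDerivAt (fun s : ℝ => u (x + s • w)) (fderiv ℝ u (x + s • w) w) s := by
    intro s
    have h1 : HasFDerivAt u (fderiv ℝ u (x + s • w)) (x + s • w) :=
      (hu.differentiable (by norm_num) _).hasFDerivAt
    have h2 : HasDerivAt (fun s : ℝ => x + s • w) w s := by
      simpa using ((hasDerivAt_id s).smul_const w).const_add x
    exact h1.comp_hasDerivAt s h2
  have hc : Continuous fun s : ℝ => fderiv ℝ u (x + s • w) w :=
    ((hu.continuous_fderiv (by norm_num)).comp (by fun_prop)).clm_apply continuous_const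
  have h := intervalIntegral.integral_eq_sub_of_hasDerivAt (a := 0) (b := 1)
    (fun s _ => hd s) (hc.intervalIntegrable 0 1)
  simp only [one_smul, zero_smul, add_zero] at h
  rw [← h, intervalIntegral.integral_of_le zero_le_one]
  exact enorm_integral_le_lintegral_enorm _

lemma enorm_le_add_lintegral_fderiv {u : E3 → ℝ} (hu : ContDiff ℝ 1 u) (x w : E3) :
    ‖u x‖ₑ ≤ ‖u (x + w)‖ₑ + ∫⁻ s in Ioc (0 : ℝ) 1, ‖fderiv ℝ u (x + s • w) w‖ₑ := by
  have h2 : u x = u (x + w) - (u (x + w) - u x) := by ring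
  rw [h2]
  refine enorm_sub_le.trans (add_le_add ?_ ?_)
  · simp
  · simpa using enorm_sub_le_lintegral_fderiv hu x w

lemma add_pow_four_le (a b : ℝ≥0∞) : (a + b) ^ 4 ≤ 8 * (a ^ 4 + b ^ 4) := by
  have h := ENNReal.rpow_add_le_mul_rpow_add_rpow a b (p := 4) (by norm_num)
  have e : (2 : ℝ≥0∞) ^ ((4 : ℝ) - 1) = 8 := by
    rw [show ((4 : ℝ) - 1) = ((3 : ℕ) : ℝ) by norm_num, ENNReal.rpow_natCast]; norm_num
  rw [e] at h
  exact_mod_cast h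

lemma measurableSet_core (U : Set E3) (ρ : ℝ) : MeasurableSet (core U ρ) :=
  (isClosed_core U ρ).measurableSet

lemma closedBall_subset_of_mem_core {U : Set E3} {r : ℝ} (hr : 0 < r) {x : E3}
    (hx : x ∈ core U (2 * r)) : Metric.closedBall x r ⊆ U :=
  (Metric.closedBall_subset_ball (by linarith)).trans hx

/-- Sobolev inequality near a point at which the cone property holds. -/
lemma lintegral_pow_four_near_le {U : Set E3} (hU : IsOpen U) {x₀ e : E3} {η δ : ℝ} (hη : 0 < η)
    (hδ : 0 < δ) (hcone : ∀ x ∈ U, x ∈ Metric.ball x₀ η → ∀ w ∈ Metric.ball e δ,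
      ∀ s ∈ Ioc (0 : ℝ) 1, x + s • w ∈ U) :
    ∃ C : ℝ≥0∞, C ≠ ⊤ ∧ ∀ (u : E3 → ℝ) (g : E3 → E3), MemH1 U u g →
      ∫⁻ x in U ∩ Metric.ball x₀ (η / 2), ‖u x‖ₑ ^ 4
        ≤ C * ((∫⁻ x in core U (δ / 4), ‖u x‖ₑ) ^ 4 + (∫⁻ x in U, ‖g x‖ₑ ^ 2) ^ 2) := by
  set B := Metric.ball e (δ / 2)
  set W := Metric.ball x₀ (η / 2)
  set V := volume B
  set M : ℝ≥0∞ := ENNReal.ofReal (‖e‖ + δ)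
  have hV0 : V ≠ 0 := (Metric.measure_ball_pos volume e (by positivity)).ne'
  have hVt : V ≠ ⊤ := measure_ball_lt_top.ne
  set c := weightMeasure univ
  refine ⟨(V ^ 4)⁻¹ * (8 * (volume W + M ^ 4 * (c ^ 4 * V ^ 3))), ?_, fun u g hug => ?_⟩
  · have h1 : (V ^ 4)⁻¹ ≠ ⊤ := ENNReal.inv_ne_top.2 (pow_ne_zero _ hV0)
    have h2 : volume W ≠ ⊤ := measure_ball_lt_top.ne
    have h3 : M ≠ ⊤ := ENNReal.ofReal_ne_top
    have h4 : c ≠ ⊤ := weightMeasure_univ_ne_top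
    finiteness
  have huU : MemLp (U.indicator u) 2 volume := memLp_indicator hU hug.memLp
  have hgU : MemLp (U.indicator g) 2 volume := memLp_indicator hU hug.memLp_grad
  have hul := locallyIntegrable_of_memLp_two huU
  have hgl := locallyIntegrable_of_memLp_two hgU
  set un : ℕ → E3 → ℝ := fun n => moll (bump n) (U.indicator u)
  set gn : ℕ → E3 → E3 := fun n => moll (bump n) (U.indicator g)
  have hun : ∀ n, ContDiff ℝ ∞ (un n) := fun n => contDiff_moll hul _
  have hgn : ∀ n, ContDiff ℝ ∞ (gn n) := fun n => contDiff_moll hgl _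
  set J := ∫⁻ x in core U (δ / 4), ‖u x‖ₑ
  set N := ∫⁻ x in U, ‖g x‖ₑ ^ 2
  set r : ℕ → ℝ := fun n => (bump n).rOut
  have hr : ∀ n, 0 < r n := fun n => (bump n).rOut_pos
  have hcore : ∀ n, MeasurableSet (core U (2 * r n)) := fun n => measurableSet_core _ _
  have hN : ∀ n, ∫⁻ x, ‖gn n x‖ₑ ^ 2 ≤ N := by
    intro n
    refine (lintegral_moll_sq_le hgU.aestronglyMeasurable _).trans (le_of_eq ?_)
    simp only [N]
    rw [← lintegral_indicator hU.measurableSet]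
    congr 1; ext x
    by_cases hx : x ∈ U <;> simp [hx]
  -- estimate for the mollified functions
  have hest : ∀ᶠ n in atTop, ∫⁻ x in core U (2 * r n) ∩ W, ‖un n x‖ₑ ^ 4
      ≤ (V ^ 4)⁻¹ * (8 * (volume W + M ^ 4 * (c ^ 4 * V ^ 3))) * (J ^ 4 + N ^ 2) := by
    have hsm : ∀ᶠ n in atTop, r n < min (η / 4) (δ / 4) :=
      tendsto_bump.eventually (gt_mem_nhds (by positivity))
    filter_upwards [hsm] with n hn
    have hnη : r n < η / 4 := hn.trans_le (min_le_left _ _)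
    have hnδ : r n < δ / 4 := hn.trans_le (min_le_right _ _)
    set Un := core U (2 * r n)
    let G : E3 → ℝ≥0∞ := Un.indicator fun x => ‖gn n x‖ₑ
    have hG : Measurable G := ((hgn n).continuous.enorm.measurable).indicator (hcore n)
    -- The core inherits the cone property: the ball about x + s w is a translate of the ball about
    -- x, all of whose points lie in `U` and within η of x₀.
    have hcn : ∀ x ∈ Un ∩ W, ∀ w ∈ Metric.ball e δ, ∀ s ∈ Ioc (0 : ℝ) 1, x + s • w ∈ Un := by
      rintro x ⟨hx, hxW⟩ w hw s hs y hy
      have h1 : y - s • w ∈ Metric.ball x (2 * r n) := by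
        rw [Metric.mem_ball, dist_eq_norm] at hy ⊢
        rwa [show y - s • w - x = y - (x + s • w) by abel]
      have h2 : y - s • w ∈ Metric.ball x₀ η := by
        rw [Metric.mem_ball] at h1 hxW ⊢
        calc dist (y - s • w) x₀ ≤ dist (y - s • w) x + dist x x₀ := dist_triangle _ _ _
          _ < η := by linarith
      have := hcone _ (hx h1) h2 w hw s hs
      simpa using this
    -- `B` has half the admissible radius, so the far ends x + w keep distance δ/2 from the
    -- complement of `U`. The lower-order term therefore involves u only on a compact core.
    have hxw : ∀ x ∈ Un ∩ W, ∀ w ∈ B, x + w ∈ core U (δ / 2) := by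
      rintro x ⟨hx, hxW⟩ w hw y hy
      have h1 : y - x ∈ Metric.ball e δ := by
        rw [Metric.mem_ball, dist_eq_norm] at hy ⊢
        have hw' : ‖w - e‖ < δ / 2 := by rw [← dist_eq_norm]; exact hw
        calc ‖y - x - e‖ = ‖(y - (x + w)) + (w - e)‖ := by congr 1; abel
          _ ≤ ‖y - (x + w)‖ + ‖w - e‖ := norm_add_le _ _
          _ < δ := by linarith
      have h2 : x ∈ Metric.ball x₀ η := Metric.ball_subset_ball (by linarith) hxW
      have := hcone x (core_subset (by have := hr n; positivity) hx) h2 _ h1 1 (by simp)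
      simpa using this
    -- The fundamental theorem of calculus along the segment from x to x + w, averaged over w in
    -- `B`.
    have hpt : ∀ x ∈ Un ∩ W, V * ‖un n x‖ₑ
        ≤ J + M * ∫⁻ s in Ioc (0 : ℝ) 1, ∫⁻ w in B, G (x + s • w) := by
      intro x hx
      have hB : MeasurableSet B := Metric.isOpen_ball.measurableSet
      calc V * ‖un n x‖ₑ = ∫⁻ _ in B, ‖un n x‖ₑ := by
            rw [lintegral_const, Measure.restrict_apply_univ, mul_comm]
        _ ≤ ∫⁻ w in B, (‖un n (x + w)‖ₑ + ∫⁻ s in Ioc (0 : ℝ) 1, M * G (x + s • w)) := by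
            refine setLIntegral_mono' hB fun w hw => ?_
            refine (enorm_le_add_lintegral_fderiv ((hun n).of_le (by simp)) x w).trans ?_
            refine add_le_add le_rfl ?_
            refine setLIntegral_mono' measurableSet_Ioc fun s hs => ?_
            have hmem := hcn x hx w (Metric.ball_subset_ball (by linarith) hw) s hs
            rw [fderiv_moll_eq_inner hU hul hgl hug.weakGrad (bump n)
              (closedBall_subset_of_mem_core (hr n) hmem)]
            simp only [G, indicator_of_mem hmem]
            rw [← ofReal_norm, ← ofReal_norm, ← ENNReal.ofReal_mul (by positivity)]
            refine ENNReal.ofReal_le_ofReal ?_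
            refine (norm_inner_le_norm _ _).trans ?_
            rw [mul_comm]
            gcongr
            have hw' : ‖w - e‖ < δ / 2 := by rw [← dist_eq_norm]; exact hw
            calc ‖w‖ = ‖e + (w - e)‖ := by congr 1; abel
              _ ≤ ‖e‖ + ‖w - e‖ := norm_add_le _ _
              _ ≤ ‖e‖ + δ := by linarith
        _ = (∫⁻ w in B, ‖un n (x + w)‖ₑ)
              + M * ∫⁻ s in Ioc (0 : ℝ) 1, ∫⁻ w in B, G (x + s • w) := by
            have hmu : Measurable fun w => ‖un n (x + w)‖ₑ :=
              (hun n).continuous.enorm.measurable.comp (measurable_const_add x)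
            rw [lintegral_add_left hmu]
            congr 1
            rw [lintegral_lintegral_swap (by fun_prop)]
            simp_rw [lintegral_const_mul' M _ ENNReal.ofReal_ne_top]
        _ ≤ _ := by
            gcongr ?_ + _
            calc ∫⁻ w in B, ‖un n (x + w)‖ₑ
                ≤ ∫⁻ w in B, (core U (δ / 2)).indicator (fun z => ‖un n z‖ₑ) (x + w) := by
                  refine setLIntegral_mono' hB fun w hw => ?_
                  rw [indicator_of_mem (hxw x hx w hw)]
              _ ≤ ∫⁻ w, (core U (δ / 2)).indicator (fun z => ‖un n z‖ₑ) (x + w) :=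
                  setLIntegral_le_lintegral _ _
              _ = ∫⁻ z in core U (δ / 2), ‖un n z‖ₑ := by
                  rw [lintegral_add_left_eq_self (μ := (volume : Measure E3))
                    ((core U (δ / 2)).indicator (fun z => ‖un n z‖ₑ)),
                    lintegral_indicator (measurableSet_core _ _)]
              _ ≤ ∫⁻ z in core U (δ / 4), ‖U.indicator u z‖ₑ :=
                  setLIntegral_moll_le huU.aestronglyMeasurable _ (measurableSet_core _ _)
                    (measurableSet_core _ _) fun z hz t ht =>
                      sub_mem_core hz (by change ‖t‖ < r n at ht; linarith)
              _ = J := by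
                  refine setLIntegral_congr_fun (measurableSet_core _ _) fun z hz => ?_
                  rw [indicator_of_mem (core_subset (by positivity) hz)]
    have hVmul : V ^ 4 * ∫⁻ x in Un ∩ W, ‖un n x‖ₑ ^ 4
        ≤ 8 * (volume W * J ^ 4 + M ^ 4 * (c ^ 4 * V ^ 3 * N ^ 2)) := by
      have hmeasI : Measurable fun x => ∫⁻ s in Ioc (0 : ℝ) 1, ∫⁻ w in B, G (x + s • w) := by
        have h1 : Measurable fun p : (E3 × ℝ) × E3 => G (p.1.1 + p.1.2 • p.2) := by fun_prop
        exact (h1.lintegral_prod_right' (ν := volume.restrict B)).lintegral_prod_right'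
      calc V ^ 4 * ∫⁻ x in Un ∩ W, ‖un n x‖ₑ ^ 4
          = ∫⁻ x in Un ∩ W, (V * ‖un n x‖ₑ) ^ 4 := by
            rw [← lintegral_const_mul' _ _ (ENNReal.pow_ne_top hVt)]
            simp_rw [mul_pow]
        _ ≤ ∫⁻ x in Un ∩ W, 8 * (J ^ 4 +
              M ^ 4 * (∫⁻ s in Ioc (0 : ℝ) 1, ∫⁻ w in B, G (x + s • w)) ^ 4) := by
            refine setLIntegral_mono' ((hcore n).inter Metric.isOpen_ball.measurableSet)
              fun x hx => ?_
            calc (V * ‖un n x‖ₑ) ^ 4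
                ≤ (J + M * ∫⁻ s in Ioc (0 : ℝ) 1, ∫⁻ w in B, G (x + s • w)) ^ 4 := by
                  gcongr; exact hpt x hx
              _ ≤ _ := by
                  refine (add_pow_four_le _ _).trans ?_
                  rw [mul_pow]
        _ = 8 * ((∫⁻ _ in Un ∩ W, J ^ 4) + M ^ 4 * ∫⁻ x in Un ∩ W,
              (∫⁻ s in Ioc (0 : ℝ) 1, ∫⁻ w in B, G (x + s • w)) ^ 4) := by
            rw [lintegral_const_mul' _ _ (by norm_num), lintegral_add_left measurable_const,
              lintegral_const_mul' _ _ (ENNReal.pow_ne_top ENNReal.ofReal_ne_top)]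
        _ ≤ _ := by
            refine mul_le_mul_right (add_le_add ?_ (mul_le_mul_right ?_ _)) _
            · rw [lintegral_const, Measure.restrict_apply_univ, mul_comm]
              gcongr
              exact inter_subset_right
            · refine (setLIntegral_le_lintegral _ _).trans ((lintegral_cone_pow_four_le hG B).trans ?_)
              gcongr
              refine le_trans (lintegral_mono fun x => ?_) (hN n)
              gcongr
              exact indicator_le_self _ _ x
    calc ∫⁻ x in Un ∩ W, ‖un n x‖ₑ ^ 4
        = (V ^ 4)⁻¹ * (V ^ 4 * ∫⁻ x in Un ∩ W, ‖un n x‖ₑ ^ 4) := by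
          rw [← mul_assoc, ENNReal.inv_mul_cancel (pow_ne_zero _ hV0) (ENNReal.pow_ne_top hVt),
            one_mul]
      _ ≤ (V ^ 4)⁻¹ * (8 * (volume W * J ^ 4 + M ^ 4 * (c ^ 4 * V ^ 3 * N ^ 2))) := by gcongr
      _ ≤ (V ^ 4)⁻¹ * (8 * (volume W * (J ^ 4 + N ^ 2)
            + M ^ 4 * (c ^ 4 * V ^ 3 * (J ^ 4 + N ^ 2)))) := by
          gcongr
          · exact le_self_add
          · exact le_add_self
      _ = _ := by ring
  -- Fatou
  have hlim : ∀ᵐ x, (U ∩ W).indicator (fun x => ‖u x‖ₑ ^ 4) x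
      ≤ liminf (fun n => (core U (2 * r n) ∩ W).indicator (fun x => ‖un n x‖ₑ ^ 4) x) atTop := by
    filter_upwards [ae_tendsto_moll hul] with x hx
    by_cases hxU : x ∈ U ∩ W
    · rw [indicator_of_mem hxU]
      obtain ⟨ρ, hρ, hρU⟩ := Metric.isOpen_iff.1 hU x hxU.1
      have hev : ∀ᶠ n in atTop, x ∈ core U (2 * r n) ∩ W := by
        filter_upwards [tendsto_bump.eventually (gt_mem_nhds (half_pos hρ))] with n hn
        refine ⟨(Metric.ball_subset_ball ?_).trans hρU, hxU.2⟩
        change (bump n).rOut < ρ / 2 at hn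
        change 2 * (bump n).rOut ≤ ρ
        linarith
      have ht : Tendsto (fun n => (core U (2 * r n) ∩ W).indicator
          (fun x => ‖un n x‖ₑ ^ 4) x) atTop (𝓝 (‖u x‖ₑ ^ 4)) := by
        have h1 : Tendsto (fun n => ‖un n x‖ₑ ^ 4) atTop (𝓝 (‖U.indicator u x‖ₑ ^ 4)) :=
          ((ENNReal.continuous_pow 4).tendsto _).comp hx.enorm
        rw [indicator_of_mem hxU.1] at h1
        refine h1.congr' ?_
        filter_upwards [hev] with n hn
        rw [indicator_of_mem hn]
      exact ht.liminf_eq.ge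
    · rw [indicator_of_notMem hxU]
      exact zero_le
  have hW : MeasurableSet W := Metric.isOpen_ball.measurableSet
  calc ∫⁻ x in U ∩ W, ‖u x‖ₑ ^ 4
      = ∫⁻ x, (U ∩ W).indicator (fun x => ‖u x‖ₑ ^ 4) x :=
        (lintegral_indicator (hU.measurableSet.inter hW) _).symm
    _ ≤ ∫⁻ x, liminf (fun n => (core U (2 * r n) ∩ W).indicator
          (fun x => ‖un n x‖ₑ ^ 4) x) atTop := lintegral_mono_ae hlim
    _ ≤ liminf (fun n => ∫⁻ x, (core U (2 * r n) ∩ W).indicator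
          (fun x => ‖un n x‖ₑ ^ 4) x) atTop := by
        refine lintegral_liminf_le fun n => ?_
        exact ((hun n).continuous.enorm.measurable.pow_const 4).indicator ((hcore n).inter hW)
    _ ≤ _ := by
        refine liminf_le_of_frequently_le' (Eventually.frequently ?_)
        filter_upwards [hest] with n hn
        rwa [lintegral_indicator ((hcore n).inter hW)]

/-- Sobolev inequality on a bounded open set with the cone property. -/
lemma lintegral_pow_four_le_core {U : Set E3} (hU : IsOpen U) (hb : Bornology.IsBounded U)
    (hcone : ∀ x ∈ closure U, ConeAt U x) :
    ∃ ρ > 0, ∃ C : ℝ≥0∞, C ≠ ⊤ ∧ ∀ (u : E3 → ℝ) (g : E3 → E3), MemH1 U u g →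
      ∫⁻ x in U, ‖u x‖ₑ ^ 4
        ≤ C * ((∫⁻ x in core U ρ, ‖u x‖ₑ) ^ 4 + (∫⁻ x in U, ‖g x‖ₑ ^ 2) ^ 2) := by
  have hK : IsCompact (closure U) := hb.isCompact_closure
  -- The estimate is local: a union of two sets costs the sum of the constants and the smaller ρ,
  -- for which the core is larger.
  refine hK.induction_on (p := fun S => ∃ ρ > 0, ∃ C : ℝ≥0∞, C ≠ ⊤ ∧
    ∀ (u : E3 → ℝ) (g : E3 → E3), MemH1 U u g → ∫⁻ x in U ∩ S, ‖u x‖ₑ ^ 4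
      ≤ C * ((∫⁻ x in core U ρ, ‖u x‖ₑ) ^ 4 + (∫⁻ x in U, ‖g x‖ₑ ^ 2) ^ 2)) ?_ ?_ ?_ ?_
    |>.imp fun ρ => ?_
  · exact ⟨1, one_pos, 0, by simp, by simp⟩
  · rintro S S' hSS' ⟨ρ, hρ, C, hC, h⟩
    refine ⟨ρ, hρ, C, hC, fun u g hug => le_trans ?_ (h u g hug)⟩
    exact lintegral_mono_set (inter_subset_inter_right _ hSS')
  · rintro S S' ⟨ρ, hρ, C, hC, h⟩ ⟨ρ', hρ', C', hC', h'⟩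
    refine ⟨min ρ ρ', lt_min hρ hρ', C + C', by finiteness, fun u g hug => ?_⟩
    rw [inter_union_distrib_left]
    refine (lintegral_union_le _ _ _).trans ?_
    rw [add_mul]
    refine add_le_add ((h u g hug).trans ?_) ((h' u g hug).trans ?_)
    · gcongr
      exact core_anti _ (min_le_left _ _)
    · gcongr
      exact core_anti _ (min_le_right _ _)
  · intro x hx
    obtain ⟨η, hη, e, δ, hδ, h⟩ := hcone x hx
    obtain ⟨C, hC, hCu⟩ := lintegral_pow_four_near_le hU hη hδ h
    exact ⟨Metric.ball x (η / 2), mem_nhdsWithin_of_mem_nhds (Metric.ball_mem_nhds x (half_pos hη)),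
      δ / 4, by positivity, C, hC, hCu⟩
  · rw [inter_eq_self_of_subset_left subset_closure]
    exact id


/-! ### Poincaré inequality on connected domains -/

/-- The oscillation between `A` and `B` is controlled by the gradient. -/
def OscControl (U A B : Set E3) : Prop :=
  ∃ C : ℝ≥0∞, C ≠ ⊤ ∧ ∀ (u : E3 → ℝ) (g : E3 → E3), Measurable u → MemH1 U u g →
    ∫⁻ x in A, ∫⁻ y in B, ‖u x - u y‖ₑ ≤ C * ∫⁻ x in U, ‖g x‖ₑ

lemma OscControl.mono {U A B A' B' : Set E3} (h : OscControl U A B) (hA : A' ⊆ A) (hB : B' ⊆ B) :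
    OscControl U A' B' := by
  obtain ⟨C, hC, h⟩ := h
  refine ⟨C, hC, fun u g hu hug => le_trans ?_ (h u g hu hug)⟩
  exact (lintegral_mono_set hA).trans (lintegral_mono fun x => lintegral_mono_set hB)

lemma measurable_enorm_sub {u : E3 → ℝ} (hu : Measurable u) :
    Measurable fun p : E3 × E3 => ‖u p.1 - u p.2‖ₑ := by fun_prop

lemma OscControl.symm {U A B : Set E3} (h : OscControl U A B) : OscControl U B A := by
  obtain ⟨C, hC, h⟩ := h
  refine ⟨C, hC, fun u g hu hug => le_trans (le_of_eq ?_) (h u g hu hug)⟩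
  rw [lintegral_lintegral_swap (measurable_enorm_sub hu).aemeasurable]
  simp_rw [enorm_sub_rev]

lemma OscControl.union {U A A' B : Set E3} (h : OscControl U A B) (h' : OscControl U A' B) :
    OscControl U (A ∪ A') B := by
  obtain ⟨C, hC, h⟩ := h
  obtain ⟨C', hC', h'⟩ := h'
  refine ⟨C + C', by finiteness, fun u g hu hug => ?_⟩
  refine (lintegral_union_le _ _ _).trans ?_
  rw [add_mul]
  exact add_le_add (h u g hu hug) (h' u g hu hug)

/-- Insert u(y) between u(x) and u(z), integrate over y in `B` and divide by the volume of `B`,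
which must be positive and finite. -/
lemma OscControl.trans {U A B D : Set E3} (h : OscControl U A B) (h' : OscControl U B D)
    (hB0 : volume B ≠ 0) (hB : volume B ≠ ⊤) (hA : volume A ≠ ⊤) (hD : volume D ≠ ⊤) :
    OscControl U A D := by
  obtain ⟨C, hC, h⟩ := h
  obtain ⟨C', hC', h'⟩ := h'.symm
  refine ⟨(volume B)⁻¹ * (volume D * C + volume A * C'), ?_, fun u g hu hug => ?_⟩
  · have : (volume B)⁻¹ ≠ ⊤ := ENNReal.inv_ne_top.2 hB0
    finiteness
  have hm := measurable_enorm_sub hu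
  have hm1 : Measurable fun x => ∫⁻ y in B, ‖u x - u y‖ₑ :=
    hm.lintegral_prod_right' (ν := volume.restrict B)
  set N := ∫⁻ x in U, ‖g x‖ₑ
  have key : volume B * ∫⁻ x in A, ∫⁻ z in D, ‖u x - u z‖ₑ
      ≤ volume D * (C * N) + volume A * (C' * N) := by
    calc volume B * ∫⁻ x in A, ∫⁻ z in D, ‖u x - u z‖ₑ
        = ∫⁻ x in A, ∫⁻ z in D, volume B * ‖u x - u z‖ₑ := by
          rw [← lintegral_const_mul' _ _ hB]
          simp_rw [lintegral_const_mul' _ _ hB]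
      _ ≤ ∫⁻ x in A, ∫⁻ z in D, ((∫⁻ y in B, ‖u x - u y‖ₑ) + ∫⁻ y in B, ‖u z - u y‖ₑ) := by
          refine lintegral_mono fun x => lintegral_mono fun z => ?_
          rw [← lintegral_add_left (by fun_prop), mul_comm, ← Measure.restrict_apply_univ,
            ← lintegral_const]
          refine lintegral_mono fun y => ?_
          calc ‖u x - u z‖ₑ = ‖(u x - u y) - (u z - u y)‖ₑ := by congr 1; ring
            _ ≤ _ := enorm_sub_le
      _ = volume D * (∫⁻ x in A, ∫⁻ y in B, ‖u x - u y‖ₑ)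
            + volume A * ∫⁻ z in D, ∫⁻ y in B, ‖u z - u y‖ₑ := by
          have e1 : ∀ x, ∫⁻ z in D, ((∫⁻ y in B, ‖u x - u y‖ₑ) + ∫⁻ y in B, ‖u z - u y‖ₑ)
              = volume D * (∫⁻ y in B, ‖u x - u y‖ₑ) + ∫⁻ z in D, ∫⁻ y in B, ‖u z - u y‖ₑ := by
            intro x
            rw [lintegral_add_left measurable_const, lintegral_const, Measure.restrict_apply_univ,
              mul_comm]
          simp_rw [e1]
          rw [lintegral_add_right _ measurable_const, lintegral_const_mul _ hm1, lintegral_const,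
            Measure.restrict_apply_univ, mul_comm (volume A)]
      _ ≤ _ := by
          gcongr
          · exact h u g hu hug
          · exact h' u g hu hug
  calc ∫⁻ x in A, ∫⁻ z in D, ‖u x - u z‖ₑ
      = (volume B)⁻¹ * (volume B * ∫⁻ x in A, ∫⁻ z in D, ‖u x - u z‖ₑ) := by
        rw [← mul_assoc, ENNReal.inv_mul_cancel hB0 hB, one_mul]
    _ ≤ (volume B)⁻¹ * (volume D * (C * N) + volume A * (C' * N)) := by gcongr
    _ = _ := by ring

/-- Averages over segments between two points of `B`. -/
lemma lintegral_segment_le {G : E3 → ℝ≥0∞} (hG : Measurable G) (B : Set E3) {s : ℝ}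
    (hs : s ∈ Ioc (0 : ℝ) 1) :
    ∫⁻ x in B, ∫⁻ y in B, G (x + s • (y - x)) ≤ 8 * volume B * ∫⁻ z, G z := by
  have hbd : ∀ t : ℝ, 1 / 2 ≤ t → ENNReal.ofReal (t⁻¹ ^ 3) ≤ 8 := by
    intro t ht
    rw [show (8 : ℝ≥0∞) = ENNReal.ofReal (2 ^ 3) by norm_num]
    have h0 : 0 < t := by linarith
    have : t⁻¹ ≤ 2 := by rw [inv_le_comm₀ h0 two_pos]; linarith
    gcongr
  -- The change of variables is made in the endpoint whose weight, s or 1 − s, is at least 1/2; the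
  -- Jacobian then costs at most 2³ = 8.
  rcases le_total (1 / 2) s with h | h
  · have : ∀ x, ∫⁻ y in B, G (x + s • (y - x)) ≤ 8 * ∫⁻ z, G z := by
      intro x
      refine (setLIntegral_le_lintegral _ _).trans ?_
      have e : ∀ y, x + s • (y - x) = (x - s • x) + s • y := fun y => by rw [smul_sub]; abel
      simp_rw [e]
      rw [lintegral_comp_add_smul G hG _ hs.1]
      gcongr
      exact hbd s h
    refine (lintegral_mono this).trans ?_
    rw [lintegral_const, Measure.restrict_apply_univ]
    exact le_of_eq (by ring)
  · rcases eq_or_lt_of_le hs.2 with h1 | h1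
    · linarith
    have : ∀ y, ∫⁻ x in B, G (x + s • (y - x)) ≤ 8 * ∫⁻ z, G z := by
      intro y
      refine (setLIntegral_le_lintegral _ _).trans ?_
      have e : ∀ x, x + s • (y - x) = s • y + (1 - s) • x := fun x => by
        rw [smul_sub, sub_smul, one_smul]; abel
      simp_rw [e]
      rw [lintegral_comp_add_smul G hG _ (by linarith)]
      gcongr
      exact hbd _ (by linarith)
    rw [lintegral_lintegral_swap (by fun_prop)]
    refine (lintegral_mono this).trans ?_
    rw [lintegral_const, Measure.restrict_apply_univ]
    exact le_of_eq (by ring)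

/-- A ball is convex, so differences are integrals of the gradient along segments inside it. The
closed ball leaves room for mollification, and Fatou in each variable removes it. -/
lemma oscControl_ball {U : Set E3} (hU : IsOpen U) {z : E3} {R : ℝ}
    (hR : Metric.closedBall z R ⊆ U) :
    OscControl U (Metric.ball z R) (Metric.ball z R) := by
  set B := Metric.ball z R
  have hB : MeasurableSet B := Metric.isOpen_ball.measurableSet
  refine ⟨ENNReal.ofReal (2 * R) * (8 * volume B), ?_, fun u g hu hug => ?_⟩
  · have : volume B ≠ ⊤ := measure_ball_lt_top.ne
    finiteness
  have huU : MemLp (U.indicator u) 2 volume := memLp_indicator hU hug.memLp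
  have hgU : MemLp (U.indicator g) 2 volume := memLp_indicator hU hug.memLp_grad
  have hul := locallyIntegrable_of_memLp_two huU
  have hgl := locallyIntegrable_of_memLp_two hgU
  set un : ℕ → E3 → ℝ := fun n => moll (bump n) (U.indicator u)
  set gn : ℕ → E3 → E3 := fun n => moll (bump n) (U.indicator g)
  have hun : ∀ n, ContDiff ℝ ∞ (un n) := fun n => contDiff_moll hul _
  have hgn : ∀ n, ContDiff ℝ ∞ (gn n) := fun n => contDiff_moll hgl _
  have hunm : ∀ n, Measurable (un n) := fun n => (hun n).continuous.measurable
  set N := ∫⁻ x in U, ‖g x‖ₑ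
  have hest : ∀ᶠ n in atTop, ∫⁻ x in B, ∫⁻ y in B, ‖un n x - un n y‖ₑ
      ≤ ENNReal.ofReal (2 * R) * (8 * volume B) * N := by
    filter_upwards [exists_bump_closedBall_subset hU (isCompact_closedBall z R) hR] with n hn
    have hnB : ∀ x ∈ B, Metric.closedBall x (bump n).rOut ⊆ U := fun x hx =>
      hn x (Metric.ball_subset_closedBall hx)
    let G : E3 → ℝ≥0∞ := B.indicator fun x => ‖gn n x‖ₑ
    have hG : Measurable G := ((hgn n).continuous.enorm.measurable).indicator hB
    have hGN : ∫⁻ x, G x ≤ N := by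
      simp only [G]
      rw [lintegral_indicator hB]
      refine (setLIntegral_moll_le hgU.aestronglyMeasurable (bump n) hB hU.measurableSet
        fun x hx t ht => hnB x hx ?_).trans (le_of_eq ?_)
      · rw [Metric.mem_closedBall, dist_eq_norm]; simpa using ht.le
      · refine setLIntegral_congr_fun hU.measurableSet fun x hx => ?_
        rw [indicator_of_mem hx]
    calc ∫⁻ x in B, ∫⁻ y in B, ‖un n x - un n y‖ₑ
        ≤ ∫⁻ x in B, ∫⁻ y in B, ∫⁻ s in Ioc (0 : ℝ) 1,
            ENNReal.ofReal (2 * R) * G (x + s • (y - x)) := by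
          refine setLIntegral_mono' hB fun x hx => setLIntegral_mono' hB fun y hy => ?_
          have h1 := enorm_sub_le_lintegral_fderiv ((hun n).of_le (by simp)) x (y - x)
          rw [add_sub_cancel, enorm_sub_rev] at h1
          refine h1.trans (setLIntegral_mono' measurableSet_Ioc fun s hs => ?_)
          have hmem : x + s • (y - x) ∈ B :=
            (convex_ball z R).add_smul_sub_mem hx hy ⟨hs.1.le, hs.2⟩
          rw [fderiv_moll_eq_inner hU hul hgl hug.weakGrad (bump n) (hnB _ hmem)]
          simp only [G, indicator_of_mem hmem]
          have hR0 : 0 < R := (dist_nonneg (x := x) (y := z)).trans_lt hx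
          rw [← ofReal_norm, ← ofReal_norm, ← ENNReal.ofReal_mul (by positivity)]
          refine ENNReal.ofReal_le_ofReal ((norm_inner_le_norm _ _).trans ?_)
          rw [mul_comm]
          gcongr
          rw [← dist_eq_norm]
          have hx' : dist x z < R := hx
          have hy' : dist y z < R := hy
          calc dist y x ≤ dist y z + dist x z := dist_triangle_right _ _ _
            _ ≤ 2 * R := by linarith
      _ = ENNReal.ofReal (2 * R) * ∫⁻ s in Ioc (0 : ℝ) 1, ∫⁻ x in B, ∫⁻ y in B,
            G (x + s • (y - x)) := by
          simp_rw [lintegral_const_mul' _ _ ENNReal.ofReal_ne_top]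
          congr 1
          have e1 : ∀ x, ∫⁻ y in B, ∫⁻ s in Ioc (0 : ℝ) 1, G (x + s • (y - x))
              = ∫⁻ s in Ioc (0 : ℝ) 1, ∫⁻ y in B, G (x + s • (y - x)) := fun x =>
            lintegral_lintegral_swap (by fun_prop)
          simp_rw [e1]
          refine lintegral_lintegral_swap ?_
          have : Measurable fun p : (E3 × ℝ) × E3 => G (p.1.1 + p.1.2 • (p.2 - p.1.1)) := by
            fun_prop
          exact (this.lintegral_prod_right' (ν := volume.restrict B)).aemeasurable
      _ ≤ ENNReal.ofReal (2 * R) * ∫⁻ s in Ioc (0 : ℝ) 1, 8 * volume B * N := by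
          refine mul_le_mul_right (setLIntegral_mono' measurableSet_Ioc fun s hs => ?_) _
          exact (lintegral_segment_le hG B hs).trans (mul_le_mul_right hGN _)
      _ = _ := by
          rw [lintegral_const, Measure.restrict_apply_univ, Real.volume_Ioc]
          simp only [sub_zero, ENNReal.ofReal_one]
          ring
  have hae : ∀ᵐ x ∂volume.restrict B, Tendsto (fun n => un n x) atTop (𝓝 (u x)) := by
    rw [ae_restrict_iff' hB]
    filter_upwards [ae_tendsto_moll hul] with x hx hxB
    rwa [indicator_of_mem (hR (Metric.ball_subset_closedBall hxB))] at hx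
  calc ∫⁻ x in B, ∫⁻ y in B, ‖u x - u y‖ₑ
      ≤ ∫⁻ x in B, liminf (fun n => ∫⁻ y in B, ‖un n x - un n y‖ₑ) atTop := by
        refine lintegral_mono_ae ?_
        filter_upwards [hae] with x hx
        calc ∫⁻ y in B, ‖u x - u y‖ₑ
            ≤ ∫⁻ y in B, liminf (fun n => ‖un n x - un n y‖ₑ) atTop := by
              refine lintegral_mono_ae ?_
              filter_upwards [hae] with y hy
              exact (hx.sub hy).enorm.liminf_eq.ge
          _ ≤ _ := lintegral_liminf_le fun n => by
              have := hunm n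
              fun_prop
    _ ≤ liminf (fun n => ∫⁻ x in B, ∫⁻ y in B, ‖un n x - un n y‖ₑ) atTop :=
        lintegral_liminf_le fun n =>
          (measurable_enorm_sub (hunm n)).lintegral_prod_right' (ν := volume.restrict B)
    _ ≤ _ := liminf_le_of_frequently_le' hest.frequently

/-- Mutual control is symmetric, transitive and true for nearby centres, so it propagates through a
preconnected set. The claim is made for all radii so that intermediate balls may be shrunk freely.
-/
lemma oscControl_of_isPreconnected {U : Set E3} (hU : IsOpen U) (hc : IsPreconnected U)
    {x y : E3} (hx : x ∈ U) (hy : y ∈ U) :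
    ∀ r r' : ℝ, 0 < r → 0 < r' → Metric.closedBall x r ⊆ U → Metric.closedBall y r' ⊆ U →
      OscControl U (Metric.ball x r) (Metric.ball y r') := by
  have hpos : ∀ (z : E3) (r : ℝ), 0 < r → volume (Metric.ball z r) ≠ 0 := fun z r hr =>
    (Metric.measure_ball_pos volume z hr).ne'
  have hfin : ∀ (z : E3) (r : ℝ), volume (Metric.ball z r) ≠ ⊤ := fun z r =>
    measure_ball_lt_top.ne
  refine hc.induction₂' (fun x y => ∀ r r' : ℝ, 0 < r → 0 < r' → Metric.closedBall x r ⊆ U →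
    Metric.closedBall y r' ⊆ U → OscControl U (Metric.ball x r) (Metric.ball y r')) ?_ ?_ hx hy
  · intro x hx
    obtain ⟨R, hR, hRU⟩ := Metric.nhds_basis_closedBall.mem_iff.1 (hU.mem_nhds hx)
    have hb := oscControl_ball hU hRU
    filter_upwards [mem_nhdsWithin_of_mem_nhds (Metric.ball_mem_nhds x hR)] with y hy
    have key : ∀ r r' : ℝ, 0 < r → 0 < r' → Metric.closedBall x r ⊆ U →
        Metric.closedBall y r' ⊆ U → OscControl U (Metric.ball x r) (Metric.ball y r') := by
      intro r r' hr hr' hrU hrU'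
      have hd : 0 < R - dist y x := sub_pos.2 hy
      have h1 : OscControl U (Metric.ball x r) (Metric.ball x (min r R)) :=
        (oscControl_ball hU hrU).mono le_rfl (Metric.ball_subset_ball (min_le_left _ _))
      have h2 : OscControl U (Metric.ball x (min r R)) (Metric.ball y (min r' (R - dist y x))) :=
        hb.mono (Metric.ball_subset_ball (min_le_right _ _))
          ((Metric.ball_subset_ball (min_le_right _ _)).trans
            (Metric.ball_subset_ball' (by linarith)))
      have h3 : OscControl U (Metric.ball y (min r' (R - dist y x))) (Metric.ball y r') :=
        (oscControl_ball hU hrU').mono (Metric.ball_subset_ball (min_le_left _ _)) le_rfl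
      exact (h1.trans h2 (hpos _ _ (lt_min hr hR)) (hfin _ _) (hfin _ _) (hfin _ _)).trans h3
        (hpos _ _ (lt_min hr' hd)) (hfin _ _) (hfin _ _) (hfin _ _)
    exact ⟨key, fun r r' hr hr' h h' => (key r' r hr' hr h' h).symm⟩
  · intro x y z hx hy hz hxy hyz r r' hr hr' hrU hrU'
    obtain ⟨R, hR, hRU⟩ := Metric.nhds_basis_closedBall.mem_iff.1 (hU.mem_nhds hy)
    exact (hxy r R hr hR hrU hRU).trans (hyz R r' hR hr' hRU hrU') (hpos _ _ hR) (hfin _ _)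
      (hfin _ _) (hfin _ _)

/-- Finitely many balls cover `K`, each compared with one fixed ball in `U`; that ball then links
`K` to itself. -/
lemma oscControl_compact {U K : Set E3} (hU : IsOpen U) (hc : IsConnected U) (hK : IsCompact K)
    (hKU : K ⊆ U) : OscControl U K K := by
  obtain ⟨z, hz⟩ := hc.nonempty
  obtain ⟨R, hR, hRU⟩ := Metric.nhds_basis_closedBall.mem_iff.1 (hU.mem_nhds hz)
  have h : OscControl U K (Metric.ball z R) := by
    refine hK.induction_on (p := fun S => OscControl U S (Metric.ball z R)) ?_ ?_ ?_ ?_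
    · exact ⟨0, by simp, by simp⟩
    · exact fun S S' hSS' h => h.mono hSS' le_rfl
    · exact fun S S' h h' => h.union h'
    · intro x hx
      obtain ⟨r, hr, hrU⟩ := Metric.nhds_basis_closedBall.mem_iff.1 (hU.mem_nhds (hKU hx))
      exact ⟨_, mem_nhdsWithin_of_mem_nhds (Metric.ball_mem_nhds x hr),
        oscControl_of_isPreconnected hU hc.isPreconnected (hKU hx) hz r R hr hR hrU hRU⟩
  exact h.trans h.symm (Metric.measure_ball_pos volume z hR).ne' measure_ball_lt_top.ne
    hK.measure_lt_top.ne hK.measure_lt_top.ne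

/-! ### Classical gradients and elementary operations in H¹ -/

lemma gradient_apply (f : E3 → ℝ) (x : E3) (i : Fin 3) :
    gradient f x i = fderiv ℝ f x (EuclideanSpace.single i 1) := by
  have h : inner ℝ (gradient f x) (EuclideanSpace.single i (1 : ℝ))
      = fderiv ℝ f x (EuclideanSpace.single i 1) := by
    rw [gradient, InnerProductSpace.toDual_symm_apply]
  rw [← h, EuclideanSpace.inner_single_right]
  simp only [one_mul]
  rfl

lemma norm_gradient (f : E3 → ℝ) (x : E3) : ‖gradient f x‖ = ‖fderiv ℝ f x‖ := by
  rw [← toDual_gradient, LinearIsometryEquiv.norm_map]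

lemma continuous_gradient {f : E3 → ℝ} (hf : ContDiff ℝ 1 f) : Continuous (gradient f) :=
  (InnerProductSpace.toDual ℝ E3).symm.continuous.comp (hf.continuous_fderiv (by norm_num))

lemma setIntegral_eq_of_tsupport {U : Set E3} {ψ F : E3 → ℝ} (hU : tsupport ψ ⊆ U)
    (hF : ∀ x ∉ tsupport ψ, F x = 0) : ∫ x in U, F x = ∫ x, F x :=
  setIntegral_eq_integral_of_forall_compl_eq_zero fun x hx => hF x fun h => hx (hU h)

lemma fderiv_eq_zero_of_notMem_tsupport {ψ : E3 → ℝ} {x : E3} (hx : x ∉ tsupport ψ) :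
    fderiv ℝ ψ x = 0 :=
  image_eq_zero_of_notMem_tsupport (f := fderiv ℝ ψ) fun h => hx (tsupport_fderiv_subset ℝ h)

/-- The gradient of a continuously differentiable function is its weak gradient. -/
lemma hasWeakGrad_of_contDiff (U : Set E3) {f : E3 → ℝ} (hf : ContDiff ℝ 1 f) :
    HasWeakGrad U f (gradient f) := by
  intro ψ hψ hψc hψU i
  have hψ' : Continuous fun x => fderiv ℝ ψ x (EuclideanSpace.single i 1) :=
    (hψ.continuous_fderiv (by simp)).clm_apply continuous_const
  have hf' : Continuous fun x => fderiv ℝ f x (EuclideanSpace.single i 1) :=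
    (hf.continuous_fderiv (by norm_num)).clm_apply continuous_const
  rw [setIntegral_eq_of_tsupport hψU fun x hx => by
      rw [fderiv_eq_zero_of_notMem_tsupport hx]; simp,
    setIntegral_eq_of_tsupport hψU fun x hx => by
      rw [image_eq_zero_of_notMem_tsupport hx, mul_zero],
    integral_mul_fderiv_eq_neg_fderiv_mul_of_integrable
      ((hf'.mul hψ.continuous).integrable_of_hasCompactSupport hψc.mul_left)
      ((hf.continuous.mul hψ').integrable_of_hasCompactSupport (hψc.fderiv_apply ℝ _).mul_left)
      ((hf.continuous.mul hψ.continuous).integrable_of_hasCompactSupport hψc.mul_left)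
      (fun x _ => hf.differentiable (by norm_num) x) (fun x _ => hψ.differentiable (by simp) x)]
  simp_rw [gradient_apply]

lemma integrable_mul_fderiv {U : Set E3} {u ψ : E3 → ℝ} (hu : MemLp u 2 (volume.restrict U))
    (hψ : ContDiff ℝ (⊤ : ℕ∞) ψ) (hψc : HasCompactSupport ψ) (v : E3) :
    Integrable (fun x => u x * fderiv ℝ ψ x v) (volume.restrict U) :=
  integrable_mul_of_memLp_two hu ((((hψ.continuous_fderiv (by simp)).clm_apply
    continuous_const).memLp_of_hasCompactSupport (hψc.fderiv_apply ℝ v)).restrict U)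

lemma integrable_coord_mul {U : Set E3} {g : E3 → E3} {ψ : E3 → ℝ}
    (hg : MemLp g 2 (volume.restrict U)) (hψ : ContDiff ℝ (⊤ : ℕ∞) ψ)
    (hψc : HasCompactSupport ψ) (i : Fin 3) :
    Integrable (fun x => g x i * ψ x) (volume.restrict U) :=
  integrable_mul_of_memLp_two (hg.eval_piLp i)
    ((hψ.continuous.memLp_of_hasCompactSupport hψc).restrict U)

lemma MemH1.sub {U : Set E3} {u u' : E3 → ℝ} {g g' : E3 → E3}
    (h : MemH1 U u g) (h' : MemH1 U u' g') :
    MemH1 U (fun x => u x - u' x) (fun x => g x - g' x) := by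
  refine ⟨h.memLp.sub h'.memLp, h.memLp_grad.sub h'.memLp_grad, fun ψ hψ hψc hψU i => ?_⟩
  simp only [sub_mul, PiLp.sub_apply]
  rw [integral_sub (integrable_mul_fderiv h.memLp hψ hψc _)
    (integrable_mul_fderiv h'.memLp hψ hψc _), integral_sub
    (integrable_coord_mul h.memLp_grad hψ hψc i) (integrable_coord_mul h'.memLp_grad hψ hψc i),
    h.weakGrad ψ hψ hψc hψU i, h'.weakGrad ψ hψ hψc hψU i]
  ring

lemma MemH1.add {U : Set E3} {u u' : E3 → ℝ} {g g' : E3 → E3}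
    (h : MemH1 U u g) (h' : MemH1 U u' g') :
    MemH1 U (fun x => u x + u' x) (fun x => g x + g' x) := by
  refine ⟨h.memLp.add h'.memLp, h.memLp_grad.add h'.memLp_grad, fun ψ hψ hψc hψU i => ?_⟩
  simp only [add_mul, PiLp.add_apply]
  rw [integral_add (integrable_mul_fderiv h.memLp hψ hψc _)
    (integrable_mul_fderiv h'.memLp hψ hψc _), integral_add
    (integrable_coord_mul h.memLp_grad hψ hψc i) (integrable_coord_mul h'.memLp_grad hψ hψc i),
    h.weakGrad ψ hψ hψc hψU i, h'.weakGrad ψ hψ hψc hψU i]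
  ring

lemma memLp_two_of_continuous {E : Type*} [NormedAddCommGroup E] {U : Set E3}
    (hb : Bornology.IsBounded U) {f : E3 → E} (hf : Continuous f) :
    MemLp f 2 (volume.restrict U) := by
  have : IsFiniteMeasure (volume.restrict (closure U)) := ⟨by
    rw [Measure.restrict_apply_univ]; exact hb.isCompact_closure.measure_lt_top⟩
  obtain ⟨C, hC⟩ := hb.isCompact_closure.exists_bound_of_continuousOn hf.continuousOn
  refine MemLp.mono_measure (Measure.restrict_mono subset_closure le_rfl) ?_
  refine MemLp.of_bound hf.aestronglyMeasurable C ?_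
  rw [ae_restrict_iff' isClosed_closure.measurableSet]
  exact Eventually.of_forall hC

lemma memH1_of_contDiff {U : Set E3} (hb : Bornology.IsBounded U) {f : E3 → ℝ}
    (hf : ContDiff ℝ 1 f) : MemH1 U f (gradient f) :=
  ⟨memLp_two_of_continuous hb hf.continuous, memLp_two_of_continuous hb (continuous_gradient hf),
    hasWeakGrad_of_contDiff U hf⟩

lemma memH1_const {U : Set E3} (hb : Bornology.IsBounded U) (a : ℝ) :
    MemH1 U (fun _ => a) (fun _ => 0) := by
  have h := memH1_of_contDiff hb (contDiff_const (c := a) (n := 1))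
  have e : gradient (fun _ : E3 => a) = fun _ => 0 := by
    ext x i; rw [gradient_apply]; simp
  rwa [e] at h

lemma MemH1.congr {U : Set E3} {u u' : E3 → ℝ} {g : E3 → E3} (h : MemH1 U u g)
    (huu : u =ᵐ[volume.restrict U] u') : MemH1 U u' g := by
  refine ⟨h.memLp.ae_eq huu, h.memLp_grad, fun ψ hψ hψc hψU i => ?_⟩
  rw [← h.weakGrad ψ hψ hψc hψU i]
  refine integral_congr_ae ?_
  filter_upwards [huu] with x hx
  rw [hx]

/-- Sobolev–Poincaré inequality. -/
lemma exists_lintegral_sub_const_pow_four_le {U : Set E3} (hU : IsOpen U)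
    (hb : Bornology.IsBounded U) (hc : IsConnected U) (hcone : ∀ x ∈ closure U, ConeAt U x) :
    ∃ C : ℝ≥0∞, C ≠ ⊤ ∧ ∀ (u : E3 → ℝ) (g : E3 → E3), MemH1 U u g →
      ∃ a : ℝ, ∫⁻ x in U, ‖u x - a‖ₑ ^ 4 ≤ C * (∫⁻ x in U, ‖g x‖ₑ ^ 2) ^ 2 := by
  obtain ⟨ρ, hρ, C, hC, hS⟩ := lintegral_pow_four_le_core hU hb hcone
  set K := core U ρ
  have hK : IsCompact K := isCompact_core hb hρ
  obtain ⟨C', hC', hO⟩ := oscControl_compact hU hc hK (core_subset hρ)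
  have hUt : volume U ≠ ⊤ := hb.measure_lt_top.ne
  have hS' : ∀ (u : E3 → ℝ) (g : E3 → E3), MemH1 U u g → ∀ a : ℝ,
      ∫⁻ x in U, ‖u x - a‖ₑ ^ 4
        ≤ C * ((∫⁻ x in K, ‖u x - a‖ₑ) ^ 4 + (∫⁻ x in U, ‖g x‖ₑ ^ 2) ^ 2) := by
    intro u g hug a
    have := hS _ _ (hug.sub (memH1_const hb a))
    simpa using this
  -- reduction to measurable functions
  suffices h : ∃ C : ℝ≥0∞, C ≠ ⊤ ∧ ∀ (u : E3 → ℝ) (g : E3 → E3), Measurable u → MemH1 U u g →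
      ∃ a : ℝ, ∫⁻ x in U, ‖u x - a‖ₑ ^ 4 ≤ C * (∫⁻ x in U, ‖g x‖ₑ ^ 2) ^ 2 by
    obtain ⟨C, hC, h⟩ := h
    refine ⟨C, hC, fun u g hug => ?_⟩
    have hae := hug.memLp.aestronglyMeasurable.ae_eq_mk
    obtain ⟨a, ha⟩ := h _ g hug.memLp.aestronglyMeasurable.stronglyMeasurable_mk.measurable
      (hug.congr hae)
    refine ⟨a, le_trans (le_of_eq ?_) ha⟩
    refine lintegral_congr_ae ?_
    filter_upwards [hae] with x hx
    rw [hx]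
  -- If the core is null, the lower-order term of the Sobolev inequality vanishes and the constant 0
  -- serves.
  by_cases hK0 : volume K = 0
  · refine ⟨C, hC, fun u g hu hug => ⟨0, (hS' u g hug 0).trans ?_⟩⟩
    rw [Measure.restrict_eq_zero.2 hK0]
    simp
  refine ⟨C * (((volume K)⁻¹ * C') ^ 4 * volume U ^ 2 + 1), ?_, fun u g hu hug => ?_⟩
  · have : (volume K)⁻¹ ≠ ⊤ := ENNReal.inv_ne_top.2 hK0
    finiteness
  have hm := measurable_enorm_sub hu
  have hm1 : Measurable fun y => ∫⁻ x in K, ‖u x - u y‖ₑ :=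
    (hm.comp measurable_swap).lintegral_prod_right' (ν := volume.restrict K)
  -- The constant is the value of u at a point whose L¹ distance to u over the core does not exceed
  -- the mean of such distances.
  obtain ⟨y, hyK, hy⟩ := exists_le_setLAverage hK0 hK.measure_lt_top.ne hm1.aemeasurable
  refine ⟨u y, (hS' u g hug (u y)).trans ?_⟩
  set N1 := ∫⁻ x in U, ‖g x‖ₑ
  set N := ∫⁻ x in U, ‖g x‖ₑ ^ 2
  have h1 : ∫⁻ x in K, ‖u x - u y‖ₑ ≤ (volume K)⁻¹ * C' * N1 := by
    refine hy.trans ?_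
    rw [setLAverage_eq, ENNReal.div_eq_inv_mul, mul_assoc]
    refine mul_le_mul_right ?_ _
    rw [lintegral_lintegral_swap (f := fun y x => ‖u x - u y‖ₑ)
      (hm.comp measurable_swap).aemeasurable]
    exact hO u g hu hug
  have h2 : N1 ^ 4 ≤ volume U ^ 2 * N ^ 2 := by
    have h3 := sq_lintegral_le (volume.restrict U) hug.memLp_grad.aestronglyMeasurable.enorm
    rw [Measure.restrict_apply_univ] at h3
    calc N1 ^ 4 = (N1 ^ 2) ^ 2 := by ring
      _ ≤ (volume U * N) ^ 2 := by gcongr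
      _ = _ := by ring
  calc C * ((∫⁻ x in K, ‖u x - u y‖ₑ) ^ 4 + N ^ 2)
      ≤ C * (((volume K)⁻¹ * C' * N1) ^ 4 + N ^ 2) := by gcongr
    _ = C * (((volume K)⁻¹ * C') ^ 4 * N1 ^ 4 + N ^ 2) := by rw [mul_pow _ N1]
    _ ≤ C * (((volume K)⁻¹ * C') ^ 4 * (volume U ^ 2 * N ^ 2) + N ^ 2) := by gcongr
    _ = _ := by ring


/-! ### The cone property of the domain and of the perforated cell -/

lemma coneAt_of_mem {U : Set E3} (hU : IsOpen U) {x : E3} (hx : x ∈ U) : ConeAt U x := by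
  obtain ⟨R, hR, hRU⟩ := Metric.isOpen_iff.1 hU x hx
  refine ⟨R / 2, half_pos hR, 0, R / 2, half_pos hR, fun z _ hz w hw s hs => hRU ?_⟩
  rw [Metric.mem_ball, dist_eq_norm] at hz ⊢
  rw [mem_ball_zero_iff] at hw
  have h1 : ‖s • w‖ ≤ ‖w‖ := by
    rw [norm_smul, Real.norm_of_nonneg hs.1.le]
    exact mul_le_of_le_one_left (norm_nonneg _) hs.2
  calc ‖z + s • w - x‖ = ‖(z - x) + s • w‖ := by congr 1; abel
    _ ≤ ‖z - x‖ + ‖s • w‖ := norm_add_le _ _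
    _ < R := by linarith

/-- Directions of descent of a function with nonvanishing differential. -/
lemma exists_descent {ρ : E3 → ℝ} (hρ : ContDiff ℝ 1 ρ) {x : E3} (hx : fderiv ℝ ρ x ≠ 0)
    {V : Set E3} (hV : V ∈ 𝓝 x) :
    ∃ R > 0, Metric.ball x R ⊆ V ∧ ∃ e : E3, ∃ δ > 0, ∀ z ∈ Metric.ball x (R / 2),
      ∀ w ∈ Metric.ball e δ, ∀ s ∈ Ioc (0 : ℝ) 1, z + s • w ∈ Metric.ball x R ∧
        ρ (z + s • w) < ρ z := by
  obtain ⟨v, hv⟩ : ∃ v, fderiv ℝ ρ x v < 0 := by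
    obtain ⟨v, hv⟩ : ∃ v, fderiv ℝ ρ x v ≠ 0 := by
      by_contra h
      push Not at h
      exact hx (ContinuousLinearMap.ext h)
    rcases lt_or_gt_of_ne hv with h | h
    · exact ⟨v, h⟩
    · exact ⟨-v, by simpa using h⟩
  have hcont : Continuous fun p : E3 × E3 => fderiv ℝ ρ p.1 p.2 :=
    ((hρ.continuous_fderiv (by norm_num)).comp continuous_fst).clm_apply continuous_snd
  have hnh : ∀ᶠ p : E3 × E3 in 𝓝 (x, v), fderiv ℝ ρ p.1 p.2 < 0 :=
    hcont.continuousAt.eventually_lt continuousAt_const hv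
  obtain ⟨κ, hκ, hneg⟩ := Metric.eventually_nhds_iff.1 hnh
  obtain ⟨R₁, hR₁, hR₁V⟩ := Metric.mem_nhds_iff.1 hV
  set R := min κ R₁
  have hR : 0 < R := lt_min hκ hR₁
  -- With this scale every w in the ball about l v of radius l κ has norm at most R/4, so z + s w
  -- stays in the ball of radius R, where `ρ` decreases in the direction w.
  set l : ℝ := R / (4 * (‖v‖ + κ))
  have hden : 0 < ‖v‖ + κ := by positivity
  have hl : 0 < l := by positivity
  refine ⟨R, hR, (Metric.ball_subset_ball (min_le_right _ _)).trans hR₁V, l • v, l * κ,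
    by positivity, fun z hz w hw s hs => ?_⟩
  set w' := l⁻¹ • w
  have hww : w = l • w' := by rw [smul_smul, mul_inv_cancel₀ hl.ne', one_smul]
  have hw' : dist w' v < κ := by
    rw [Metric.mem_ball, hww, dist_smul₀, Real.norm_of_nonneg hl.le] at hw
    exact lt_of_mul_lt_mul_left hw hl.le
  have hwn : ‖w‖ ≤ R / 4 := by
    have h1 : ‖w'‖ ≤ ‖v‖ + κ := by
      have h2 : ‖w' - v‖ < κ := by rwa [← dist_eq_norm]
      calc ‖w'‖ = ‖v + (w' - v)‖ := by congr 1; abel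
        _ ≤ ‖v‖ + ‖w' - v‖ := norm_add_le _ _
        _ ≤ _ := by linarith
    rw [hww, norm_smul, Real.norm_of_nonneg hl.le]
    calc l * ‖w'‖ ≤ l * (‖v‖ + κ) := by gcongr
      _ = R / 4 := by simp only [l]; field_simp
  have hmem : ∀ t ∈ Icc (0 : ℝ) 1, z + t • w ∈ Metric.ball x R := by
    intro t ht
    rw [Metric.mem_ball, dist_eq_norm] at hz ⊢
    have h1 : ‖t • w‖ ≤ ‖w‖ := by
      rw [norm_smul, Real.norm_of_nonneg ht.1]
      exact mul_le_of_le_one_left (norm_nonneg _) ht.2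
    calc ‖z + t • w - x‖ = ‖(z - x) + t • w‖ := by congr 1; abel
      _ ≤ ‖z - x‖ + ‖t • w‖ := norm_add_le _ _
      _ < R := by linarith
  refine ⟨hmem s ⟨hs.1.le, hs.2⟩, ?_⟩
  have hd : ∀ t : ℝ, HasDerivAt (fun t : ℝ => ρ (z + t • w)) (fderiv ℝ ρ (z + t • w) w) t := by
    intro t
    have h1 : HasFDerivAt ρ (fderiv ℝ ρ (z + t • w)) (z + t • w) :=
      (hρ.differentiable (by norm_num) _).hasFDerivAt
    have h2 : HasDerivAt (fun t : ℝ => z + t • w) w t := by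
      simpa using ((hasDerivAt_id t).smul_const w).const_add z
    exact h1.comp_hasDerivAt t h2
  have hanti : StrictAntiOn (fun t : ℝ => ρ (z + t • w)) (Icc 0 1) := by
    refine strictAntiOn_of_deriv_neg (convex_Icc 0 1)
      (fun t _ => (hd t).continuousAt.continuousWithinAt) fun t ht => ?_
    rw [interior_Icc] at ht
    rw [(hd t).deriv, hww, map_smul, smul_eq_mul, ← hww]
    refine mul_neg_of_pos_of_neg hl (hneg (y := (z + t • w, w')) ?_)
    rw [Prod.dist_eq]
    exact max_lt ((hmem t ⟨ht.1.le, ht.2.le⟩).trans_le (min_le_left _ _)) hw'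
  have := hanti ⟨le_rfl, zero_le_one⟩ ⟨hs.1.le, hs.2⟩ hs.1
  simpa using this

/-- Moving in a descent direction lowers `ρ`, so it does not leave the sublevel set. -/
lemma coneAt_of_sublevel {U V : Set E3} {ρ : E3 → ℝ} {x : E3} (hV : V ∈ 𝓝 x)
    (hρ : ContDiff ℝ 1 ρ) (hx : fderiv ℝ ρ x ≠ 0) (h : ∀ z ∈ V, z ∈ U ↔ ρ z < 0) :
    ConeAt U x := by
  obtain ⟨R, hR, hRV, e, δ, hδ, hd⟩ := exists_descent hρ hx hV
  refine ⟨R / 2, half_pos hR, e, δ, hδ, fun z hzU hz w hw s hs => ?_⟩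
  obtain ⟨h1, h2⟩ := hd z hz w hw s hs
  have hzV : z ∈ V := hRV (Metric.ball_subset_ball (by linarith) hz)
  exact (h _ (hRV h1)).2 (h2.trans ((h z hzV).1 hzU))

lemma coneAt_of_hasSmoothBoundary {U : Set E3} (hU : IsOpen U) (h : HasSmoothBoundary U) {x : E3}
    (hx : x ∈ closure U) : ConeAt U x := by
  by_cases hxU : x ∈ U
  · exact coneAt_of_mem hU hxU
  obtain ⟨V, hV, ρ, hρ, hρx, hUV⟩ := h x ⟨hx, by rwa [hU.interior_eq]⟩
  refine coneAt_of_sublevel hV (hρ.of_le (by exact_mod_cast le_top)) hρx fun z hz => ?_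
  have := Set.ext_iff.1 hUV z
  simpa [hz] using this

lemma isOpen_unitCell : IsOpen unitCell := by
  have : unitCell = ⋂ i : Fin 3, {y : E3 | 0 < y i ∧ y i < 1} := by
    ext y; simp [unitCell]
  rw [this]
  refine isOpen_iInter_of_finite fun i => ?_
  have hc : Continuous fun y : E3 => y i := (EuclideanSpace.proj i : E3 →L[ℝ] ℝ).continuous
  exact (isOpen_lt continuous_const hc).inter (isOpen_lt hc continuous_const)

lemma convex_unitCell : Convex ℝ unitCell := by
  intro x hx y hy a b ha hb hab i
  have h1 := hx i
  have h2 := hy i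
  simp only [PiLp.add_apply, PiLp.smul_apply, smul_eq_mul]
  rcases eq_or_lt_of_le ha with h | h
  · have : b = 1 := by linarith
    subst this; simp [← h, h2]
  · constructor
    · have := mul_pos h h1.1
      have := mul_nonneg hb h2.1.le
      linarith
    · have := mul_lt_mul_of_pos_left h1.2 h
      have := mul_le_mul_of_nonneg_left h2.2.le hb
      linarith

/-- The centre of the reference cell. -/
def cellCenter : E3 := WithLp.toLp 2 fun _ => 1 / 2

lemma ball_cellCenter_subset : Metric.ball cellCenter (1 / 2) ⊆ unitCell := by
  intro y hy i
  rw [Metric.mem_ball, dist_eq_norm] at hy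
  have h1 : ‖(y - cellCenter) i‖ < 1 / 2 := (PiLp.norm_apply_le (y - cellCenter) i).trans_lt hy
  simp only [PiLp.sub_apply, cellCenter, Real.norm_eq_abs, abs_lt] at h1
  constructor <;> linarith [h1.1, h1.2]

lemma isBounded_unitCell : Bornology.IsBounded unitCell := by
  refine (Metric.isBounded_closedBall (x := (0 : E3)) (r := 2)).subset fun y hy => ?_
  rw [mem_closedBall_zero_iff, EuclideanSpace.norm_eq, Real.sqrt_le_left (by norm_num)]
  have h : ∀ i, ‖y i‖ ^ 2 ≤ 1 := fun i => by
    rw [Real.norm_eq_abs, sq_abs]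
    nlinarith [(hy i).1, (hy i).2]
  calc ∑ i, ‖y i‖ ^ 2 ≤ ∑ _i : Fin 3, (1 : ℝ) := Finset.sum_le_sum fun i _ => h i
    _ ≤ 2 ^ 2 := by norm_num

/-- The two boundaries are a positive distance apart and are treated separately. At the hole,
smoothness gives the cone. The cube has edges and corners, but it is convex, so at its boundary the
cone points to the centre. -/
lemma coneAt_perforated_cell {H : Set E3} (hH : IsOpen H) (hHY : closure H ⊆ unitCell)
    (hs : HasSmoothBoundary H) {x : E3} (hx : x ∈ closure (unitCell \ closure H)) :
    ConeAt (unitCell \ closure H) x := by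
  have hopen : IsOpen (unitCell \ closure H) := isOpen_unitCell.sdiff isClosed_closure
  by_cases hxH : x ∈ closure H
  · -- on the boundary of the hole
    have hxH' : x ∉ H := by
      intro hxH'
      obtain ⟨y, hy, hy'⟩ := mem_closure_iff.1 hx H hH hxH'
      exact hy'.2 (subset_closure hy)
    obtain ⟨V, hV, ρ, hρ, hρx, hUV⟩ := hs x ⟨hxH, by rwa [hH.interior_eq]⟩
    have hρ1 : ContDiff ℝ 1 ρ := hρ.of_le (by exact_mod_cast le_top)
    have hUV' : ∀ z ∈ V, z ∈ H ↔ ρ z < 0 := fun z hz => by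
      have := Set.ext_iff.1 hUV z
      simpa [hz] using this
    obtain ⟨R, hR, hRV, e, δ, hδ, hd⟩ := exists_descent hρ1 hρx
      (inter_mem hV (isOpen_unitCell.mem_nhds (hHY hxH)))
    refine coneAt_of_sublevel (V := Metric.ball x (R / 2)) (ρ := fun z => -ρ z)
      (Metric.ball_mem_nhds x (half_pos hR)) hρ1.neg ?_ fun z hz => ?_
    · rw [fderiv_fun_neg]; exact neg_ne_zero.2 hρx
    have hzb : z ∈ Metric.ball x R := Metric.ball_subset_ball (by linarith) hz
    have hzV := hRV hzb
    rw [neg_lt_zero]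
    constructor
    -- A point with ρ ≤ 0 is the limit of the points z + s e, at which ρ < 0, so it lies in the
    -- closed hole. Near x the complement of the closed hole is thus exactly {ρ > 0}.
    · rintro ⟨-, hzH⟩
      by_contra hle
      push Not at hle
      apply hzH
      have ht : Tendsto (fun s : ℝ => z + s • e) (𝓝[>] 0) (𝓝 z) := by
        have : Continuous fun s : ℝ => z + s • e := by fun_prop
        have h2 := this.tendsto 0
        simp only [zero_smul, add_zero] at h2
        exact h2.mono_left nhdsWithin_le_nhds
      refine mem_closure_of_tendsto ht ?_
      filter_upwards [Ioc_mem_nhdsGT (zero_lt_one (α := ℝ))] with s hs'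
      obtain ⟨h1, h2⟩ := hd z hz e (Metric.mem_ball_self hδ) s hs'
      exact (hUV' _ (hRV h1).1).2 (h2.trans_le hle)
    · intro hpos
      refine ⟨hzV.2, fun hzH => ?_⟩
      have hn : {y | 0 < ρ y} ∩ Metric.ball x R ∈ 𝓝 z :=
        inter_mem ((isOpen_lt continuous_const hρ1.continuous).mem_nhds hpos)
          (Metric.isOpen_ball.mem_nhds hzb)
      obtain ⟨y, hy, hyH⟩ := mem_closure_iff_nhds.1 hzH _ hn
      exact absurd ((hUV' y (hRV hy.2).1).1 hyH) (not_lt.2 (le_of_lt hy.1))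
  by_cases hxY : x ∈ unitCell
  · exact coneAt_of_mem hopen ⟨hxY, hxH⟩
  -- on the boundary of the cell
  obtain ⟨R, hR, hRH⟩ := Metric.isOpen_iff.1 (isClosed_closure (s := H)).isOpen_compl x hxH
  set v := cellCenter - x
  -- The bound 1 keeps s l a convex weight; the other bound keeps z + s w within R of x, hence away
  -- from the hole.
  set l : ℝ := min 1 (R / (4 * (‖v‖ + 1)))
  have hl : 0 < l := by positivity
  have hl1 : l ≤ 1 := min_le_left _ _
  refine ⟨min (R / 2) (1 / 4), by positivity, l • v, l * (1 / 4), by positivity,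
    fun z hz hzx w hw s hs => ?_⟩
  set w' := l⁻¹ • w
  have hww : w = l • w' := by rw [smul_smul, mul_inv_cancel₀ hl.ne', one_smul]
  have hw' : ‖w' - v‖ < 1 / 4 := by
    rw [Metric.mem_ball, hww, dist_smul₀, Real.norm_of_nonneg hl.le] at hw
    rw [← dist_eq_norm]
    exact lt_of_mul_lt_mul_left hw hl.le
  rw [Metric.mem_ball, dist_eq_norm] at hzx
  have hz1 : ‖z - x‖ < R / 2 := hzx.trans_le (min_le_left _ _)
  have hz2 : ‖z - x‖ < 1 / 4 := hzx.trans_le (min_le_right _ _)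
  refine ⟨?_, ?_⟩
  · have hzw : z + w' ∈ unitCell := by
      refine ball_cellCenter_subset ?_
      rw [Metric.mem_ball, dist_eq_norm]
      calc ‖z + w' - cellCenter‖ = ‖(z - x) + (w' - v)‖ := by
            congr 1; simp only [v]; abel
        _ ≤ ‖z - x‖ + ‖w' - v‖ := norm_add_le _ _
        _ < 1 / 2 := by linarith
    have hmem := convex_unitCell.add_smul_sub_mem hz.1 hzw (t := s * l)
      ⟨mul_nonneg hs.1.le hl.le, mul_le_one₀ hs.2 hl.le hl1⟩
    rwa [add_sub_cancel_left, mul_smul, ← hww] at hmem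
  · refine hRH ?_
    rw [Metric.mem_ball, dist_eq_norm]
    have h1 : ‖w'‖ ≤ ‖v‖ + 1 := by
      calc ‖w'‖ = ‖v + (w' - v)‖ := by congr 1; abel
        _ ≤ ‖v‖ + ‖w' - v‖ := norm_add_le _ _
        _ ≤ _ := by linarith
    have h2 : ‖s • w‖ ≤ R / 4 := by
      rw [norm_smul, Real.norm_of_nonneg hs.1.le, hww, norm_smul, Real.norm_of_nonneg hl.le]
      calc s * (l * ‖w'‖) ≤ 1 * (R / (4 * (‖v‖ + 1)) * (‖v‖ + 1)) := by
            gcongr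
            · exact hs.2
            · exact min_le_right _ _
        _ = R / 4 := by field_simp
    calc ‖z + s • w - x‖ = ‖(z - x) + s • w‖ := by congr 1; abel
      _ ≤ ‖z - x‖ + ‖s • w‖ := norm_add_le _ _
      _ < R := by linarith


/-! ### Geometry of the perforated domain -/

/-- The affine map `y ↦ ε (k + y)` as a homeomorphism. -/
def cellHomeo (ε : ℝ) (hε : 0 < ε) (k : Fin 3 → ℤ) : E3 ≃ₜ E3 :=
  (Homeomorph.addLeft (intVec k)).trans (Homeomorph.smulOfNeZero ε hε.ne')

lemma scaled_eq_image {ε : ℝ} (hε : 0 < ε) (k : Fin 3 → ℤ) (S : Set E3) :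
    scaled ε k S = cellHomeo ε hε k '' S := rfl

lemma map_cellHomeo {ε : ℝ} (hε : 0 < ε) (k : Fin 3 → ℤ) :
    (volume : Measure E3).map (cellHomeo ε hε k) = ENNReal.ofReal (ε⁻¹ ^ 3) • volume := by
  have h1 : (⇑(cellHomeo ε hε k) : E3 → E3) = (fun x => ε • x) ∘ fun y => intVec k + y := rfl
  rw [h1, ← Measure.map_map (measurable_const_smul ε) (measurable_const_add _),
    map_add_left_eq_self, Measure.map_addHaar_smul _ hε.ne', finrank_euclideanSpace,
    Fintype.card_fin, abs_of_nonneg (by positivity), inv_pow]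

lemma map_restrict_cellHomeo {ε : ℝ} (hε : 0 < ε) (k : Fin 3 → ℤ) (S : Set E3) :
    (volume.restrict S).map (cellHomeo ε hε k)
      = ENNReal.ofReal (ε⁻¹ ^ 3) • volume.restrict (scaled ε k S) := by
  have he := (cellHomeo ε hε k).toMeasurableEquiv.measurableEmbedding
  have h := he.restrict_map volume (scaled ε k S)
  change (volume.map (cellHomeo ε hε k)).restrict _
    = (volume.restrict (cellHomeo ε hε k ⁻¹' _)).map (cellHomeo ε hε k) at h
  rw [scaled_eq_image hε, preimage_image_eq _ (cellHomeo ε hε k).injective, map_cellHomeo,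
    Measure.restrict_smul] at h
  rw [scaled_eq_image hε]
  exact h.symm

lemma setLIntegral_comp_cellHomeo {ε : ℝ} (hε : 0 < ε) (k : Fin 3 → ℤ) (S : Set E3)
    (F : E3 → ℝ≥0∞) : ∫⁻ y in S, F (cellHomeo ε hε k y)
      = ENNReal.ofReal (ε⁻¹ ^ 3) * ∫⁻ x in scaled ε k S, F x := by
  have he := (cellHomeo ε hε k).toMeasurableEquiv.measurableEmbedding
  have h := he.lintegral_map (μ := volume.restrict S) F
  change ∫⁻ x, F x ∂(volume.restrict S).map (cellHomeo ε hε k) = _ at h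
  rw [map_restrict_cellHomeo, lintegral_smul_measure] at h
  exact h.symm

lemma setIntegral_comp_cellHomeo {ε : ℝ} (hε : 0 < ε) (k : Fin 3 → ℤ) (S : Set E3)
    (F : E3 → ℝ) : ∫ y in S, F (cellHomeo ε hε k y)
      = ε⁻¹ ^ 3 * ∫ x in scaled ε k S, F x := by
  have he := (cellHomeo ε hε k).toMeasurableEquiv.measurableEmbedding
  have h := he.integral_map (μ := volume.restrict S) F
  change ∫ x, F x ∂(volume.restrict S).map (cellHomeo ε hε k) = _ at h
  rw [map_restrict_cellHomeo, integral_smul_measure,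
    ENNReal.toReal_ofReal (by positivity)] at h
  exact h.symm

lemma memLp_comp_cellHomeo {E : Type*} [NormedAddCommGroup E] {ε : ℝ} (hε : 0 < ε)
    (k : Fin 3 → ℤ) (S : Set E3) {F : E3 → E}
    (hF : MemLp F 2 (volume.restrict (scaled ε k S))) :
    MemLp (fun y => F (cellHomeo ε hε k y)) 2 (volume.restrict S) := by
  have he := (cellHomeo ε hε k).toMeasurableEquiv.measurableEmbedding
  have h := he.memLp_map_measure_iff (μ := volume.restrict S) (g := F) (p := 2)
  refine h.1 ?_
  change MemLp F 2 ((volume.restrict S).map (cellHomeo ε hε k))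
  rw [map_restrict_cellHomeo]
  exact hF.smul_measure ENNReal.ofReal_ne_top

lemma disjoint_scaled_unitCell {ε : ℝ} (hε : 0 < ε) {k k' : Fin 3 → ℤ} (h : k ≠ k') :
    Disjoint (scaled ε k unitCell) (scaled ε k' unitCell) := by
  rw [Set.disjoint_left]
  rintro _ ⟨y, hy, rfl⟩ ⟨y', hy', heq⟩
  apply h
  have h1 : intVec k' + y' = intVec k + y := smul_right_injective E3 hε.ne' heq
  ext i
  have h2 : ((k' i : ℝ)) + y' i = k i + y i := by
    have := congrArg (fun z : E3 => z i) h1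
    simpa [intVec] using this
  have ha := hy i
  have hb := hy' i
  have h3 : (k i : ℝ) < k' i + 1 := by linarith [ha.1, hb.2]
  have h4 : (k' i : ℝ) < k i + 1 := by linarith [ha.2, hb.1]
  have h5 : k i < k' i + 1 := by exact_mod_cast h3
  have h6 : k' i < k i + 1 := by exact_mod_cast h4
  omega

/-- The indices of the cells contained in `Ω`. -/
def cellIndices (Ω : Set E3) (ε : ℝ) : Set (Fin 3 → ℤ) := {k | scaled ε k unitCell ⊆ Ω}

lemma cellCenter_mem : cellCenter ∈ unitCell :=
  ball_cellCenter_subset (Metric.mem_ball_self (by norm_num))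

lemma finite_cellIndices {Ω : Set E3} (hb : Bornology.IsBounded Ω) {ε : ℝ} (hε : 0 < ε) :
    (cellIndices Ω ε).Finite := by
  obtain ⟨R, hR⟩ := hb.subset_closedBall 0
  set N : ℤ := ⌈ε⁻¹ * R⌉ + 1
  refine (Set.finite_Icc (fun _ : Fin 3 => -N) (fun _ => N)).subset fun k hk => ?_
  have h1 : cellHomeo ε hε k cellCenter ∈ Ω := hk ⟨cellCenter, cellCenter_mem, rfl⟩
  have h2 : ‖ε • (intVec k + cellCenter)‖ ≤ R := by
    have := hR h1
    rwa [mem_closedBall_zero_iff] at this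
  rw [norm_smul, Real.norm_of_nonneg hε.le] at h2
  have h3 : ∀ i, |(k i : ℝ) + 1 / 2| ≤ ε⁻¹ * R := by
    intro i
    have h4 := PiLp.norm_apply_le (intVec k + cellCenter) i
    simp only [PiLp.add_apply, intVec, cellCenter, Real.norm_eq_abs] at h4
    rw [← div_eq_inv_mul, le_div_iff₀ hε, mul_comm]
    exact (mul_le_mul_of_nonneg_left h4 hε.le).trans h2
  have h5 : (ε⁻¹ * R : ℝ) ≤ ⌈ε⁻¹ * R⌉ := Int.le_ceil _
  constructor
  · intro i
    have h6 := (abs_le.1 (h3 i)).1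
    have : (-(N : ℝ)) ≤ k i := by simp only [N]; push_cast; linarith
    exact_mod_cast this
  · intro i
    have h6 := (abs_le.1 (h3 i)).2
    have : (k i : ℝ) ≤ N := by simp only [N]; push_cast; linarith
    exact_mod_cast this

lemma isClosed_closedHoles {Ω H : Set E3} (hb : Bornology.IsBounded Ω) {ε : ℝ} (hε : 0 < ε) :
    IsClosed (closedHoles Ω H ε) := by
  refine (finite_cellIndices hb hε).isClosed_biUnion fun k _ => ?_
  rw [scaled_eq_image hε]
  exact (cellHomeo ε hε k).isClosed_image.2 isClosed_closure

lemma isOpen_dom {P : Model} (hP : P.Standing) {ε : ℝ} (hε : 0 < ε) : IsOpen (P.dom ε) :=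
  hP.isOpen_Ω.sdiff (isClosed_closedHoles hP.isBounded_Ω hε)

lemma dom_subset_ext (P : Model) (ε : ℝ) : P.dom ε ⊆ P.ext ε := fun _ hx => hx.2

lemma scaled_mono {ε : ℝ} {k : Fin 3 → ℤ} {S S' : Set E3} (h : S ⊆ S') :
    scaled ε k S ⊆ scaled ε k S' := image_mono h

/-- The perforated reference cell. -/
def perfCell (P : Model) : Set E3 := unitCell \ closure P.H

lemma scaled_perfCell_subset_dom {P : Model} (hP : P.Standing) {ε : ℝ} (hε : 0 < ε)
    {k : Fin 3 → ℤ} (hk : k ∈ cellIndices P.Ω ε) : scaled ε k (perfCell P) ⊆ P.dom ε := by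
  intro x hx
  have hxY : x ∈ scaled ε k unitCell := scaled_mono sdiff_subset hx
  refine ⟨hk hxY, fun hxH => ?_⟩
  simp only [closedHoles, mem_iUnion] at hxH
  obtain ⟨k', hk', hx'⟩ := hxH
  by_cases hkk : k' = k
  · subst hkk
    obtain ⟨y, hy, rfl⟩ := hx
    obtain ⟨y', hy', heq⟩ := hx'
    have : y' = y := (cellHomeo ε hε k').injective heq
    exact hy.2 (this ▸ hy')
  · exact (Set.disjoint_left.1 (disjoint_scaled_unitCell hε hkk)
      (scaled_mono hP.closure_H hx')) hxY

lemma HasWeakGrad.mono {U U' : Set E3} {u : E3 → ℝ} {g : E3 → E3} (h : HasWeakGrad U u g)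
    (hU : U' ⊆ U) : HasWeakGrad U' u g := by
  intro ψ hψ hψc hψU i
  have z1 : ∀ x ∉ tsupport ψ, u x * fderiv ℝ ψ x (EuclideanSpace.single i 1) = 0 := by
    intro x hx
    rw [fderiv_eq_zero_of_notMem_tsupport hx]
    simp
  have z2 : ∀ x ∉ tsupport ψ, g x i * ψ x = 0 := by
    intro x hx
    rw [image_eq_zero_of_notMem_tsupport hx, mul_zero]
  have := h ψ hψ hψc (hψU.trans hU) i
  rw [setIntegral_eq_of_tsupport (hψU.trans hU) z1,
    setIntegral_eq_of_tsupport (hψU.trans hU) z2] at this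
  rw [setIntegral_eq_of_tsupport hψU z1, setIntegral_eq_of_tsupport hψU z2, this]

lemma MemH1.mono {U U' : Set E3} {u : E3 → ℝ} {g : E3 → E3} (h : MemH1 U u g)
    (hU : U' ⊆ U) : MemH1 U' u g :=
  ⟨h.memLp.mono_measure (Measure.restrict_mono hU le_rfl),
    h.memLp_grad.mono_measure (Measure.restrict_mono hU le_rfl), h.weakGrad.mono hU⟩

/-- Rescaling of functions on a cell. -/
lemma MemH1.comp_cellHomeo {ε : ℝ} (hε : 0 < ε) (k : Fin 3 → ℤ) {S : Set E3}
    {u : E3 → ℝ} {g : E3 → E3} (h : MemH1 (scaled ε k S) u g) :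
    MemH1 S (fun y => u (cellHomeo ε hε k y)) (fun y => ε • g (cellHomeo ε hε k y)) := by
  refine ⟨memLp_comp_cellHomeo hε k S h.memLp,
    (memLp_comp_cellHomeo hε k S h.memLp_grad).const_smul ε, fun ψ hψ hψc hψS i => ?_⟩
  set Φ := cellHomeo ε hε k
  set ψ' : E3 → ℝ := fun x => ψ (Φ.symm x)
  have hsm : ContDiff ℝ (⊤ : ℕ∞) fun x => Φ.symm x := by
    have : (fun x => Φ.symm x) = fun x => -intVec k + ε⁻¹ • x := rfl
    rw [this]
    exact contDiff_const.add (contDiff_id.const_smul ε⁻¹)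
  have hψ' : ContDiff ℝ (⊤ : ℕ∞) ψ' := hψ.comp hsm
  have hts : tsupport ψ' = Φ '' tsupport ψ := by
    have : Function.support ψ' = Φ '' Function.support ψ := by
      rw [Φ.image_eq_preimage_symm]; rfl
    rw [tsupport, this, ← Φ.image_closure]; rfl
  have hψ'c : HasCompactSupport ψ' := by
    rw [HasCompactSupport, hts]
    exact hψc.isCompact.image Φ.continuous
  have hfd : ∀ y v, fderiv ℝ ψ' (Φ y) v = ε⁻¹ * fderiv ℝ ψ y v := by
    intro y v
    have h1 : HasFDerivAt ψ (fderiv ℝ ψ y) (Φ.symm (Φ y)) := by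
      rw [Φ.symm_apply_apply]
      exact (hψ.differentiable (by simp) y).hasFDerivAt
    have h2 : HasFDerivAt (fun x => Φ.symm x) (ε⁻¹ • ContinuousLinearMap.id ℝ E3) (Φ y) :=
      ((hasFDerivAt_id (Φ y)).const_smul ε⁻¹).const_add (-intVec k)
    have h3 : HasFDerivAt ψ' _ (Φ y) := h1.comp (Φ y) h2
    rw [h3.fderiv]
    simp
  have hw := h.weakGrad ψ' hψ' hψ'c (by rw [hts]; exact image_mono hψS) i
  have e1 := setIntegral_comp_cellHomeo hε k S
    (fun x => u x * fderiv ℝ ψ' x (EuclideanSpace.single i 1))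
  have e2 := setIntegral_comp_cellHomeo hε k S (fun x => g x i * ψ' x)
  rw [hw] at e1
  have e3 : ∫ y in S, u (Φ y) * fderiv ℝ ψ y (EuclideanSpace.single i 1)
      = ε * ∫ y in S, u (Φ y) * fderiv ℝ ψ' (Φ y) (EuclideanSpace.single i 1) := by
    rw [← integral_const_mul]
    congr 1; ext y
    rw [hfd]
    field_simp
  have e4 : ∫ y in S, (ε • g (Φ y)) i * ψ y = ε * ∫ y in S, g (Φ y) i * ψ' (Φ y) := by
    rw [← integral_const_mul]
    congr 1; ext y
    simp only [ψ', Φ.symm_apply_apply, PiLp.smul_apply, smul_eq_mul]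
    ring
  rw [e3, e4, e1, e2]
  ring


/-! ### A uniform Sobolev inequality on perforated domains -/

lemma add_sq_le_two (a b : ℝ≥0∞) : (a + b) ^ 2 ≤ 2 * (a ^ 2 + b ^ 2) := by
  have h := ENNReal.rpow_add_le_mul_rpow_add_rpow a b (p := 2) (by norm_num)
  norm_num at h
  exact_mod_cast h

lemma enorm_sq_lintegral_sq_le {α : Type*} [MeasurableSpace α] (ν : Measure α) {f : α → ℝ}
    (hf : AEMeasurable f ν) :
    (∫⁻ x, ‖f x‖ₑ ^ 2 ∂ν) ^ 2 ≤ ν univ * ∫⁻ x, ‖f x‖ₑ ^ 4 ∂ν := by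
  have h := sq_lintegral_le ν (f := fun x => ‖f x‖ₑ ^ 2) (hf.enorm.pow_const 2)
  simpa only [← pow_mul] using h

/-- An `L⁴` bound for `u - b` and an `L²` bound for `u` give an `L⁴` bound for `u`. -/
lemma lintegral_pow_four_le_of_sub_const {α : Type*} [MeasurableSpace α] (ν : Measure α)
    [IsFiniteMeasure ν] {u : α → ℝ} (hu : AEMeasurable u ν) (b : ℝ) :
    ν univ * ∫⁻ x, ‖u x‖ₑ ^ 4 ∂ν
      ≤ 72 * (ν univ * ∫⁻ x, ‖u x - b‖ₑ ^ 4 ∂ν) + 64 * (∫⁻ x, ‖u x‖ₑ ^ 2 ∂ν) ^ 2 := by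
  set X := ∫⁻ x, ‖u x - b‖ₑ ^ 4 ∂ν
  set M := ∫⁻ x, ‖u x‖ₑ ^ 2 ∂ν
  set D := ν univ
  have hub : AEMeasurable (fun x => u x - b) ν := hu.sub_const b
  have h1 : ∫⁻ x, ‖u x‖ₑ ^ 4 ∂ν ≤ 8 * (X + ‖b‖ₑ ^ 4 * D) := by
    calc ∫⁻ x, ‖u x‖ₑ ^ 4 ∂ν ≤ ∫⁻ x, 8 * (‖u x - b‖ₑ ^ 4 + ‖b‖ₑ ^ 4) ∂ν := by
          refine lintegral_mono fun x => ?_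
          refine le_trans ?_ (add_pow_four_le _ _)
          refine pow_le_pow_left' ?_ 4
          simpa using enorm_add_le (u x - b) b
      _ = 8 * (X + ‖b‖ₑ ^ 4 * D) := by
          rw [lintegral_const_mul' _ _ (by norm_num), lintegral_add_left' (hub.enorm.pow_const 4),
            lintegral_const]
  -- The size of the constant is read off from u and u − b in L². The total mass stays as a factor,
  -- so nothing is divided by it.
  have h2 : ‖b‖ₑ ^ 2 * D ≤ 2 * (∫⁻ x, ‖u x - b‖ₑ ^ 2 ∂ν + M) := by
    calc ‖b‖ₑ ^ 2 * D = ∫⁻ _, ‖b‖ₑ ^ 2 ∂ν := by rw [lintegral_const]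
      _ ≤ ∫⁻ x, 2 * (‖u x - b‖ₑ ^ 2 + ‖u x‖ₑ ^ 2) ∂ν := by
          refine lintegral_mono fun x => ?_
          refine le_trans ?_ (add_sq_le_two _ _)
          refine pow_le_pow_left' ?_ 2
          have := enorm_add_le (b - u x) (u x)
          rw [sub_add_cancel] at this
          rwa [← enorm_neg (u x - b), neg_sub]
      _ = _ := by
          rw [lintegral_const_mul' _ _ (by norm_num), lintegral_add_left' (hub.enorm.pow_const 2)]
  have h3 : ‖b‖ₑ ^ 4 * D * D ≤ 8 * (D * X + M ^ 2) := by
    calc ‖b‖ₑ ^ 4 * D * D = (‖b‖ₑ ^ 2 * D) ^ 2 := by ring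
      _ ≤ (2 * (∫⁻ x, ‖u x - b‖ₑ ^ 2 ∂ν + M)) ^ 2 := pow_le_pow_left' h2 2
      _ = 4 * (∫⁻ x, ‖u x - b‖ₑ ^ 2 ∂ν + M) ^ 2 := by ring
      _ ≤ 4 * (2 * ((∫⁻ x, ‖u x - b‖ₑ ^ 2 ∂ν) ^ 2 + M ^ 2)) :=
          mul_le_mul_right (add_sq_le_two _ _) _
      _ ≤ 4 * (2 * (D * X + M ^ 2)) :=
          mul_le_mul_right (mul_le_mul_right
            (add_le_add (enorm_sq_lintegral_sq_le ν hub) le_rfl) _) _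
      _ = _ := by ring
  calc D * ∫⁻ x, ‖u x‖ₑ ^ 4 ∂ν ≤ D * (8 * (X + ‖b‖ₑ ^ 4 * D)) := mul_le_mul_right h1 _
    _ = 8 * (D * X) + 8 * (‖b‖ₑ ^ 4 * D * D) := by ring
    _ ≤ 8 * (D * X) + 8 * (8 * (D * X + M ^ 2)) := add_le_add le_rfl (mul_le_mul_right h3 _)
    _ = _ := by ring

lemma memLp_extend {E : Type*} [NormedAddCommGroup E] {U Ω : Set E3} (hU : IsOpen U)
    (hΩ : IsOpen Ω) (hUΩ : U ⊆ Ω) {f : E3 → E} (hf : MemLp f 2 (volume.restrict U))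
    (h0 : ∀ x ∈ Ω \ U, f x = 0) : MemLp f 2 (volume.restrict Ω) := by
  have h1 : MemLp (U.indicator f) 2 (volume.restrict Ω) := by
    rw [memLp_indicator_iff_restrict hU.measurableSet, Measure.restrict_restrict hU.measurableSet,
      inter_eq_self_of_subset_left hUΩ]
    exact hf
  refine h1.ae_eq ?_
  filter_upwards [ae_restrict_mem hΩ.measurableSet] with x hx
  by_cases hxU : x ∈ U
  · rw [indicator_of_mem hxU]
  · rw [indicator_of_notMem hxU, h0 x ⟨hx, hxU⟩]

lemma memLp_continuous_smul {E : Type*} [NormedAddCommGroup E] [NormedSpace ℝ E] {U : Set E3}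
    (hb : Bornology.IsBounded U) {f : E3 → E} {χ : E3 → ℝ} (hχ : Continuous χ)
    (hf : MemLp f 2 (volume.restrict U)) (hU : MeasurableSet U) :
    MemLp (fun x => χ x • f x) 2 (volume.restrict U) := by
  obtain ⟨C, hC⟩ := hb.isCompact_closure.exists_bound_of_continuousOn hχ.continuousOn
  refine hf.of_le_mul (c := C) (hχ.aestronglyMeasurable.smul hf.1) ?_
  rw [ae_restrict_iff' hU]
  refine Eventually.of_forall fun x hx => ?_
  rw [norm_smul]
  exact mul_le_mul_of_nonneg_right (hC x (subset_closure hx)) (norm_nonneg _)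

lemma memLp_smul_continuous {E : Type*} [NormedAddCommGroup E] [NormedSpace ℝ E] {U : Set E3}
    (hb : Bornology.IsBounded U) {f : E3 → ℝ} {v : E3 → E} (hv : Continuous v)
    (hf : MemLp f 2 (volume.restrict U)) (hU : MeasurableSet U) :
    MemLp (fun x => f x • v x) 2 (volume.restrict U) := by
  obtain ⟨C, hC⟩ := hb.isCompact_closure.exists_bound_of_continuousOn hv.continuousOn
  refine hf.of_le_mul (c := C) (hf.1.smul hv.aestronglyMeasurable) ?_
  rw [ae_restrict_iff' hU]
  refine Eventually.of_forall fun x hx => ?_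
  rw [norm_smul, mul_comm]
  exact mul_le_mul_of_nonneg_right (hC x (subset_closure hx)) (norm_nonneg _)

/-- Multiplication by a cut-off function that vanishes near `Ω \ U` turns functions in `H¹(U)` into
functions in `H¹(Ω)`. -/
lemma MemH1.cutoff {U Ω : Set E3} (hU : IsOpen U) (hΩ : IsOpen Ω) (hb : Bornology.IsBounded Ω)
    (hUΩ : U ⊆ Ω) {χ : E3 → ℝ} (hχ : ContDiff ℝ (⊤ : ℕ∞) χ) (hs : tsupport χ ∩ Ω ⊆ U)
    {u : E3 → ℝ} {g : E3 → E3} (h : MemH1 U u g) :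
    MemH1 Ω (fun x => χ x * u x) (fun x => χ x • g x + u x • gradient χ x) := by
  have hbU := hb.subset hUΩ
  have hχ1 : ContDiff ℝ 1 χ := hχ.of_le (by exact_mod_cast le_top)
  have z : ∀ x ∈ Ω \ U, x ∉ tsupport χ := fun x hx hx' => hx.2 (hs ⟨hx', hx.1⟩)
  have zg : ∀ x ∉ tsupport χ, gradient χ x = 0 := fun x hx => by
    rw [← norm_eq_zero, norm_gradient, fderiv_eq_zero_of_notMem_tsupport hx, norm_zero]
  have m1 := memLp_continuous_smul hbU hχ.continuous h.memLp hU.measurableSet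
  have m2 := memLp_continuous_smul hbU hχ.continuous h.memLp_grad hU.measurableSet
  have m3 := memLp_smul_continuous hbU (continuous_gradient hχ1) h.memLp hU.measurableSet
  refine ⟨memLp_extend hU hΩ hUΩ m1 fun x hx => ?_, memLp_extend hU hΩ hUΩ (m2.add m3) fun x hx => ?_,
    fun ψ hψ hψc hψΩ i => ?_⟩
  · rw [image_eq_zero_of_notMem_tsupport (z x hx), zero_mul]
  · rw [image_eq_zero_of_notMem_tsupport (z x hx), zg x (z x hx), zero_smul, smul_zero, add_zero]
  have hprod : ContDiff ℝ (⊤ : ℕ∞) fun x => χ x * ψ x := hχ.mul hψ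
  -- ψ is a test function on Ω only; multiplied by the cut-off it becomes one on `U`, and the weak
  -- gradient of u applies.
  have hts : tsupport (fun x => χ x * ψ x) ⊆ U := by
    intro x hx
    have h1 : x ∈ tsupport χ := tsupport_mul_subset_left hx
    have h2 : x ∈ tsupport ψ := tsupport_mul_subset_right hx
    exact hs ⟨h1, hψΩ h2⟩
  have hw := h.weakGrad _ hprod hψc.mul_left hts i
  have hfd : ∀ x, fderiv ℝ (fun x => χ x * ψ x) x (EuclideanSpace.single i 1)
      = χ x * fderiv ℝ ψ x (EuclideanSpace.single i 1) + gradient χ x i * ψ x := by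
    intro x
    have h1 := (hχ.differentiable (by simp) x).hasFDerivAt
    have h2 := (hψ.differentiable (by simp) x).hasFDerivAt
    have h3 : HasFDerivAt (fun x => χ x * ψ x) _ x := h1.mul h2
    rw [h3.fderiv, gradient_apply]
    simp only [_root_.add_apply, _root_.smul_apply, smul_eq_mul]
    ring
  have e1 : ∫ x in Ω, χ x * u x * fderiv ℝ ψ x (EuclideanSpace.single i 1)
      = ∫ x in U, χ x * u x * fderiv ℝ ψ x (EuclideanSpace.single i 1) :=
    setIntegral_eq_of_subset_of_forall_sdiff_eq_zero hΩ.measurableSet hUΩ fun x hx => by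
      rw [image_eq_zero_of_notMem_tsupport (z x hx), zero_mul, zero_mul]
  have e2 : ∫ x in Ω, (χ x • g x + u x • gradient χ x) i * ψ x
      = ∫ x in U, (χ x • g x + u x • gradient χ x) i * ψ x :=
    setIntegral_eq_of_subset_of_forall_sdiff_eq_zero hΩ.measurableSet hUΩ fun x hx => by
      rw [image_eq_zero_of_notMem_tsupport (z x hx), zg x (z x hx)]; simp
  rw [e1, e2]
  have i1 : Integrable (fun x => χ x * u x * fderiv ℝ ψ x (EuclideanSpace.single i 1))
      (volume.restrict U) := integrable_mul_fderiv m1 hψ hψc _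
  have i2 : Integrable (fun x => (u x • gradient χ x) i * ψ x) (volume.restrict U) :=
    integrable_coord_mul m3 hψ hψc i
  have i3 : Integrable (fun x => (χ x • g x) i * ψ x) (volume.restrict U) :=
    integrable_coord_mul m2 hψ hψc i
  have e3 : ∫ x in U, u x * fderiv ℝ (fun x => χ x * ψ x) x (EuclideanSpace.single i 1)
      = (∫ x in U, χ x * u x * fderiv ℝ ψ x (EuclideanSpace.single i 1))
        + ∫ x in U, (u x • gradient χ x) i * ψ x := by
    rw [← integral_add i1 i2]
    congr 1; ext x
    rw [hfd]
    simp only [PiLp.smul_apply, smul_eq_mul]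
    ring
  have e4 : ∫ x in U, (χ x • g x + u x • gradient χ x) i * ψ x
      = (∫ x in U, (χ x • g x) i * ψ x) + ∫ x in U, (u x • gradient χ x) i * ψ x := by
    rw [← integral_add i3 i2]
    congr 1; ext x
    rw [PiLp.add_apply, add_mul]
  have e5 : ∫ x in U, g x i * (χ x * ψ x) = ∫ x in U, (χ x • g x) i * ψ x := by
    congr 1; ext x
    simp only [PiLp.smul_apply, smul_eq_mul]
    ring
  rw [e3, e5] at hw
  rw [e4]
  linarith

lemma isOpen_perfCell (P : Model) : IsOpen (perfCell P) := isOpen_unitCell.sdiff isClosed_closure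

lemma isOpen_scaled {ε : ℝ} (hε : 0 < ε) (k : Fin 3 → ℤ) {S : Set E3} (hS : IsOpen S) :
    IsOpen (scaled ε k S) := by
  rw [scaled_eq_image hε]
  exact (cellHomeo ε hε k).isOpenMap _ hS

lemma volume_scaled {ε : ℝ} (hε : 0 < ε) (k : Fin 3 → ℤ) (S : Set E3) :
    volume (scaled ε k S) = ENNReal.ofReal (ε ^ 3) * volume S := by
  have h := setLIntegral_comp_cellHomeo hε k S (fun _ => 1)
  simp only [setLIntegral_one] at h
  rw [h, ← mul_assoc, ← ENNReal.ofReal_mul (by positivity), ← mul_pow, mul_inv_cancel₀ hε.ne',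
    one_pow, ENNReal.ofReal_one, one_mul]

/-- The scaled Sobolev–Poincaré inequality on the perforated cells. -/
lemma exists_cell_poincare {P : Model} (hP : P.Standing) : ∃ C : ℝ≥0∞, C ≠ ⊤ ∧
    ∀ (ε : ℝ), 0 < ε → ∀ (k : Fin 3 → ℤ) (u : E3 → ℝ) (g : E3 → E3),
      MemH1 (scaled ε k (perfCell P)) u g → ∃ a : ℝ,
        ∫⁻ x in scaled ε k (perfCell P), ‖u x - a‖ₑ ^ 4
          ≤ C * ENNReal.ofReal ε * (∫⁻ x in scaled ε k (perfCell P), ‖g x‖ₑ ^ 2) ^ 2 ∧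
        ∫⁻ x in scaled ε k (perfCell P), ‖u x - a‖ₑ ^ 2
          ≤ C * ENNReal.ofReal ε ^ 2 * ∫⁻ x in scaled ε k (perfCell P), ‖g x‖ₑ ^ 2 := by
  obtain ⟨C, hC, h⟩ := exists_lintegral_sub_const_pow_four_le (isOpen_perfCell P)
    (isBounded_unitCell.subset sdiff_subset) hP.isConnected_cell
    (fun x hx => coneAt_perforated_cell hP.isOpen_H hP.closure_H hP.smooth_H hx)
  set V := volume (perfCell P)
  have hV : V ≠ ⊤ := ((measure_mono sdiff_subset).trans_lt
    isBounded_unitCell.measure_lt_top).ne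
  -- The constant must dominate C for the L⁴ bound, and its square must dominate V C for the L²
  -- bound, which comes from the L⁴ bound by Cauchy–Schwarz and a square root.
  refine ⟨C + (1 + V * C), ?_, fun ε hε k u g hu => ?_⟩
  · finiteness
  obtain ⟨a, ha⟩ := h _ _ (hu.comp_cellHomeo hε k)
  set e := ENNReal.ofReal ε
  have he0 : e ≠ 0 := by simpa [e] using hε
  have het : e ≠ ⊤ := ENNReal.ofReal_ne_top
  have hinv : ENNReal.ofReal (ε⁻¹ ^ 3) = (e⁻¹) ^ 3 := by
    rw [ENNReal.ofReal_pow (by positivity), ENNReal.ofReal_inv_of_pos hε]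
  set N := ∫⁻ x in scaled ε k (perfCell P), ‖g x‖ₑ ^ 2
  have h4 : ∫⁻ x in scaled ε k (perfCell P), ‖u x - a‖ₑ ^ 4 ≤ C * e * N ^ 2 := by
    have e1 := setLIntegral_comp_cellHomeo hε k (perfCell P) (fun x => ‖u x - a‖ₑ ^ 4)
    have e2 := setLIntegral_comp_cellHomeo hε k (perfCell P) (fun x => ‖ε • g x‖ₑ ^ 2)
    rw [e1, e2, hinv] at ha
    have e3 : ∫⁻ x in scaled ε k (perfCell P), ‖ε • g x‖ₑ ^ 2 = e ^ 2 * N := by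
      rw [← lintegral_const_mul' _ _ (by finiteness)]
      congr 1; ext x
      rw [enorm_smul, mul_pow, Real.enorm_of_nonneg hε.le]
    rw [e3] at ha
    have e4 : e ^ 3 * e⁻¹ ^ 3 = 1 := by
      rw [← mul_pow, ENNReal.mul_inv_cancel he0 het, one_pow]
    have e5 : e * e⁻¹ = 1 := ENNReal.mul_inv_cancel he0 het
    -- Powers of ε: volume gives ε³ on the left, the squared gradient integral gives (ε⁻³ ε²)², and
    -- one factor ε is left.
    calc ∫⁻ x in scaled ε k (perfCell P), ‖u x - a‖ₑ ^ 4
        = e ^ 3 * (e⁻¹ ^ 3 * ∫⁻ x in scaled ε k (perfCell P), ‖u x - a‖ₑ ^ 4) := by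
          rw [← mul_assoc, e4, one_mul]
      _ ≤ e ^ 3 * (C * (e⁻¹ ^ 3 * (e ^ 2 * N)) ^ 2) := mul_le_mul_right ha _
      _ = (e * e⁻¹) ^ 6 * (C * e * N ^ 2) := by ring
      _ = _ := by rw [e5, one_pow, one_mul]
  refine ⟨a, h4.trans ?_, ?_⟩
  · exact mul_le_mul_left (mul_le_mul_left le_self_add _) _
  have hm : AEMeasurable (fun x => u x - a) (volume.restrict (scaled ε k (perfCell P))) :=
    hu.memLp.1.aemeasurable.sub_const a
  have h2 := enorm_sq_lintegral_sq_le _ hm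
  rw [Measure.restrict_apply_univ, volume_scaled hε, ENNReal.ofReal_pow hε.le] at h2
  refine (ENNReal.pow_le_pow_left_iff two_ne_zero).1 (h2.trans ?_)
  have h5 : V * C ≤ (C + (1 + V * C)) ^ 2 := by
    calc V * C ≤ 1 + V * C := le_add_self
      _ = (1 + V * C) * 1 := (mul_one _).symm
      _ ≤ (1 + V * C) * (1 + V * C) := mul_le_mul_right le_self_add _
      _ = (1 + V * C) ^ 2 := by ring
      _ ≤ _ := pow_le_pow_left' le_add_self 2
  calc e ^ 3 * V * ∫⁻ x in scaled ε k (perfCell P), ‖u x - a‖ₑ ^ 4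
      ≤ e ^ 3 * V * (C * e * N ^ 2) := mul_le_mul_right h4 _
    _ = V * C * (e ^ 4 * N ^ 2) := by ring
    _ ≤ (C + (1 + V * C)) ^ 2 * (e ^ 4 * N ^ 2) := mul_le_mul_left h5 _
    _ = _ := by ring


/-- A smooth cut-off function: `1` near the closed reference hole and compactly supported in the
reference cell. -/
lemma exists_cell_cutoff {H : Set E3} (hH : closure H ⊆ unitCell) :
    ∃ ζ : E3 → ℝ, ContDiff ℝ (⊤ : ℕ∞) ζ ∧ tsupport ζ ⊆ unitCell ∧
      (∀ x ∈ closure H, ∀ᶠ y in 𝓝 x, ζ y = 1) ∧ (∀ x, 0 ≤ ζ x ∧ ζ x ≤ 1) := by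
  obtain ⟨f, hf0, hf1, hf⟩ := exists_contMDiffMap_zero_one_nhds_of_isClosed (n := ⊤)
    (modelWithCornersSelf ℝ E3) (s := unitCellᶜ) (t := closure H) isOpen_unitCell.isClosed_compl
    isClosed_closure (disjoint_compl_left_iff_subset.2 hH)
  refine ⟨f, f.contMDiff.contDiff, fun x hx => ?_, fun x hx => ?_, fun x => hf x⟩
  · by_contra hxn
    have h1 : ∀ᶠ y in 𝓝 x, f y = 0 := hf0.filter_mono (nhds_le_nhdsSet hxn)
    exact (notMem_tsupport_iff_eventuallyEq.2 h1) hx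
  · exact hf1.filter_mono (nhds_le_nhdsSet hx)

/-- The transported cut-off function on the cell `ε (k + Y)`. -/
def cellCutoff (ζ : E3 → ℝ) (ε : ℝ) (k : Fin 3 → ℤ) (x : E3) : ℝ := ζ (-intVec k + ε⁻¹ • x)

lemma contDiff_cellCutoff {ζ : E3 → ℝ} (hζ : ContDiff ℝ (⊤ : ℕ∞) ζ) (ε : ℝ) (k : Fin 3 → ℤ) :
    ContDiff ℝ (⊤ : ℕ∞) (cellCutoff ζ ε k) :=
  hζ.comp (contDiff_const.add (contDiff_id.const_smul ε⁻¹))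

lemma tsupport_cellCutoff {ζ : E3 → ℝ} (hζ : tsupport ζ ⊆ unitCell) {ε : ℝ} (hε : 0 < ε)
    (k : Fin 3 → ℤ) : tsupport (cellCutoff ζ ε k) ⊆ scaled ε k unitCell := by
  set Φ := cellHomeo ε hε k
  have : Function.support (cellCutoff ζ ε k) = Φ '' Function.support ζ := by
    rw [Φ.image_eq_preimage_symm]; rfl
  rw [tsupport, this, ← Φ.image_closure]
  exact image_mono hζ

lemma exists_norm_gradient_cellCutoff_le {ζ : E3 → ℝ} (hζ : ContDiff ℝ (⊤ : ℕ∞) ζ)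
    (hs : tsupport ζ ⊆ unitCell) : ∃ L : ℝ, 0 ≤ L ∧ ∀ (ε : ℝ), 0 < ε → ∀ (k : Fin 3 → ℤ) (x : E3),
      ‖gradient (cellCutoff ζ ε k) x‖ ≤ L * ε⁻¹ := by
  have hc : HasCompactSupport ζ :=
    Metric.isCompact_of_isClosed_isBounded (isClosed_tsupport _) (isBounded_unitCell.subset hs)
  obtain ⟨L, hL⟩ := (hζ.continuous_fderiv (by simp)).bounded_above_of_compact_support (hc.fderiv ℝ)
  refine ⟨L, (norm_nonneg _).trans (hL 0), fun ε hε k x => ?_⟩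
  have h1 := (hζ.differentiable (by simp) (-intVec k + ε⁻¹ • x)).hasFDerivAt
  have h2 : HasFDerivAt (fun x : E3 => -intVec k + ε⁻¹ • x) (ε⁻¹ • ContinuousLinearMap.id ℝ E3) x :=
    ((hasFDerivAt_id x).const_smul ε⁻¹).const_add (-intVec k)
  have h3 : HasFDerivAt (cellCutoff ζ ε k) _ x := h1.comp x h2
  rw [norm_gradient, h3.fderiv]
  refine (ContinuousLinearMap.opNorm_comp_le _ _).trans ?_
  refine mul_le_mul (hL _) ?_ (norm_nonneg _) ((norm_nonneg _).trans (hL 0))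
  rw [norm_smul, Real.norm_of_nonneg (by positivity)]
  exact mul_le_of_le_one_right (by positivity) ContinuousLinearMap.norm_id_le

lemma mem_scaled_perfCell {P : Model} {ε : ℝ} {k : Fin 3 → ℤ} {x : E3} (hx : x ∈ P.dom ε)
    (hk : k ∈ cellIndices P.Ω ε) (hxk : x ∈ scaled ε k unitCell) : x ∈ scaled ε k (perfCell P) := by
  obtain ⟨y, hy, rfl⟩ := hxk
  refine ⟨y, ⟨hy, fun hyH => hx.2 ?_⟩, rfl⟩
  simp only [closedHoles, mem_iUnion]
  exact ⟨k, hk, y, hyH, rfl⟩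

lemma sum_setLIntegral_cells {P : Model} {ε : ℝ} (hε : 0 < ε) (I : Finset (Fin 3 → ℤ))
    (F : E3 → ℝ≥0∞) : ∑ k ∈ I, ∫⁻ x in scaled ε k (perfCell P), F x
      = ∫⁻ x in ⋃ k ∈ I, scaled ε k (perfCell P), F x := by
  symm
  refine lintegral_biUnion_finset (fun k _ k' _ hkk => ?_)
    (fun k _ => (isOpen_scaled hε k (isOpen_perfCell P)).measurableSet) F
  exact (disjoint_scaled_unitCell hε hkk).mono (scaled_mono sdiff_subset) (scaled_mono sdiff_subset)

/-- Functions that vanish in `Ω^ε` off the cells. -/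
lemma setLIntegral_dom_le_sum {P : Model} (hP : P.Standing) {ε : ℝ} (hε : 0 < ε)
    {I : Finset (Fin 3 → ℤ)} {F : E3 → ℝ≥0∞}
    (hF : ∀ x ∈ P.dom ε, (∀ k ∈ I, x ∉ scaled ε k (perfCell P)) → F x = 0) :
    ∫⁻ x in P.dom ε, F x ≤ ∑ k ∈ I, ∫⁻ x in scaled ε k (perfCell P), F x := by
  rw [sum_setLIntegral_cells hε,
    ← lintegral_indicator (isOpen_dom hP hε).measurableSet,
    ← lintegral_indicator (I.measurableSet_biUnion
      fun k _ => (isOpen_scaled hε k (isOpen_perfCell P)).measurableSet)]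
  refine lintegral_mono fun x => ?_
  by_cases hx : x ∈ P.dom ε
  · rw [indicator_of_mem hx]
    by_cases hxU : x ∈ ⋃ k ∈ I, scaled ε k (perfCell P)
    · rw [indicator_of_mem hxU]
    · rw [hF x hx fun k hk hxk => hxU (mem_biUnion hk hxk)]
      exact zero_le
  · rw [indicator_of_notMem hx]
    exact zero_le

lemma sum_setLIntegral_le_dom {P : Model} (hP : P.Standing) {ε : ℝ} (hε : 0 < ε)
    {I : Finset (Fin 3 → ℤ)} (hI : ∀ k, k ∈ I ↔ k ∈ cellIndices P.Ω ε) (F : E3 → ℝ≥0∞) :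
    ∑ k ∈ I, ∫⁻ x in scaled ε k (perfCell P), F x ≤ ∫⁻ x in P.dom ε, F x := by
  rw [sum_setLIntegral_cells hε]
  exact lintegral_mono_set
    (iUnion₂_subset fun k hk => scaled_perfCell_subset_dom hP hε ((hI k).1 hk))

lemma volume_perfCell_pos {P : Model} (hP : P.Standing) : volume (perfCell P) ≠ 0 :=
  ((isOpen_perfCell P).measure_pos volume hP.isConnected_cell.nonempty).ne'

lemma volume_perfCell_ne_top (P : Model) : volume (perfCell P) ≠ ⊤ :=
  ((measure_mono sdiff_subset).trans_lt isBounded_unitCell.measure_lt_top).ne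

/-- A cell inside Ω has volume at most that of Ω, which bounds ε. This is needed because ε ranges
over all positive numbers and the L⁴ bound on the cells carries a factor ε. -/
lemma ofReal_le_of_mem_cellIndices {P : Model} (hP : P.Standing) : ∃ C : ℝ≥0∞, C ≠ ⊤ ∧
    ∀ (ε : ℝ), 0 < ε → ∀ k ∈ cellIndices P.Ω ε, ENNReal.ofReal ε ≤ C := by
  refine ⟨1 + volume P.Ω / volume (perfCell P), ?_, fun ε hε k hk => ?_⟩
  · exact ENNReal.add_ne_top.2 ⟨ENNReal.one_ne_top,
      ENNReal.div_ne_top hP.isBounded_Ω.measure_lt_top.ne (volume_perfCell_pos hP)⟩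
  have h1 : ENNReal.ofReal (ε ^ 3) * volume (perfCell P) ≤ volume P.Ω := by
    rw [← volume_scaled hε k]
    exact measure_mono ((scaled_mono sdiff_subset).trans hk)
  have h2 : ENNReal.ofReal (ε ^ 3) ≤ volume P.Ω / volume (perfCell P) :=
    (ENNReal.le_div_iff_mul_le (Or.inl (volume_perfCell_pos hP))
      (Or.inl (volume_perfCell_ne_top P))).2 h1
  refine le_trans ?_ (add_le_add le_rfl h2)
  rw [← ENNReal.ofReal_one, ← ENNReal.ofReal_add zero_le_one (by positivity)]
  refine ENNReal.ofReal_le_ofReal ?_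
  rcases le_total ε 1 with h | h
  · nlinarith [pow_pos hε 3]
  · nlinarith [pow_le_pow_right₀ h (show 1 ≤ 3 by norm_num)]

/-- A cell is a fixed multiple of its perforated part in volume, so the holes remove at most a fixed
proportion of Ω. This keeps the bound on the constant subtracted from u uniform in ε. -/
lemma volume_le_volume_dom {P : Model} (hP : P.Standing) : ∃ C : ℝ≥0∞, C ≠ ⊤ ∧
    ∀ (ε : ℝ), 0 < ε → volume P.Ω ≤ C * volume (P.dom ε) := by
  set q := volume unitCell / volume (perfCell P)
  have hq : volume unitCell = q * volume (perfCell P) :=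
    (ENNReal.div_mul_cancel (volume_perfCell_pos hP) (volume_perfCell_ne_top P)).symm
  refine ⟨1 + q, ?_, fun ε hε => ?_⟩
  · exact ENNReal.add_ne_top.2 ⟨ENNReal.one_ne_top,
      ENNReal.div_ne_top isBounded_unitCell.measure_lt_top.ne (volume_perfCell_pos hP)⟩
  set I := (finite_cellIndices hP.isBounded_Ω hε).toFinset
  have hI : ∀ k, k ∈ I ↔ k ∈ cellIndices P.Ω ε := fun k => Set.Finite.mem_toFinset _
  have h1 : P.Ω ⊆ P.dom ε ∪ ⋃ k ∈ I, scaled ε k unitCell := by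
    intro x hx
    by_cases hxH : x ∈ closedHoles P.Ω P.H ε
    · simp only [closedHoles, mem_iUnion] at hxH
      obtain ⟨k, hk, hxk⟩ := hxH
      exact Or.inr (mem_biUnion ((hI k).2 hk) (scaled_mono hP.closure_H hxk))
    · exact Or.inl ⟨hx, hxH⟩
  calc volume P.Ω ≤ volume (P.dom ε) + ∑ k ∈ I, volume (scaled ε k unitCell) :=
        (measure_mono h1).trans ((measure_union_le _ _).trans
          (add_le_add le_rfl (measure_biUnion_finset_le _ _)))
    _ = volume (P.dom ε) + q * ∑ k ∈ I, ∫⁻ x in scaled ε k (perfCell P), 1 := by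
        rw [Finset.mul_sum]
        congr 1
        refine Finset.sum_congr rfl fun k _ => ?_
        rw [setLIntegral_one, volume_scaled hε, volume_scaled hε, hq]
        ring
    _ ≤ volume (P.dom ε) + q * ∫⁻ x in P.dom ε, 1 :=
        add_le_add le_rfl (mul_le_mul_right (sum_setLIntegral_le_dom hP hε hI _) _)
    _ = _ := by rw [setLIntegral_one]; ring


lemma gradient_congr {f f' : E3 → ℝ} {x : E3} (h : f =ᶠ[𝓝 x] f') :
    gradient f x = gradient f' x := by
  rw [gradient, gradient, h.fderiv_eq]

lemma gradient_const_sub {f : E3 → ℝ} {x : E3} (a : ℝ) :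
    gradient (fun y => a - f y) x = -gradient f x := by
  ext i
  rw [PiLp.neg_apply, gradient_apply, gradient_apply, fderiv_const_sub]
  rfl

lemma gradient_const_mul {f : E3 → ℝ} {x : E3} (hf : DifferentiableAt ℝ f x) (a : ℝ) :
    gradient (fun y => a * f y) x = a • gradient f x := by
  ext i
  rw [PiLp.smul_apply, gradient_apply, gradient_apply, fderiv_const_mul hf]
  rfl

lemma gradient_const_eq (a : ℝ) (x : E3) : gradient (fun _ : E3 => a) x = 0 := by
  ext i; rw [gradient_apply]; simp

/-- The Sobolev embedding `H¹ ⊆ L⁴` on the perforated domains, uniformly in `ε`. -/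
lemma exists_uniform_sobolev {P : Model} (hP : P.Standing) : ∃ C : ℝ≥0∞, C ≠ ⊤ ∧
    ∀ (ε : ℝ), 0 < ε → ∀ (u : E3 → ℝ) (g : E3 → E3), MemH1 (P.dom ε) u g →
      ∫⁻ x in P.dom ε, ‖u x‖ₑ ^ 4
        ≤ C * ((∫⁻ x in P.dom ε, ‖u x‖ₑ ^ 2) + ∫⁻ x in P.dom ε, ‖g x‖ₑ ^ 2) ^ 2 := by
  obtain ⟨C₀, hC₀, hcell⟩ := exists_cell_poincare hP
  obtain ⟨Ce, hCe, hee⟩ := ofReal_le_of_mem_cellIndices hP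
  obtain ⟨Cv, hCv, hvol⟩ := volume_le_volume_dom hP
  obtain ⟨CΩ, hCΩ, hΩ⟩ := exists_lintegral_sub_const_pow_four_le hP.isOpen_Ω hP.isBounded_Ω
    hP.isConnected_Ω fun x hx => coneAt_of_hasSmoothBoundary hP.isOpen_Ω hP.smooth_Ω hx
  obtain ⟨ζ, hζ, hζs, hζ1, hζb⟩ := exists_cell_cutoff hP.closure_H
  obtain ⟨L, hL0, hL⟩ := exists_norm_gradient_cellCutoff_le hζ hζs
  set ℓ := ENNReal.ofReal L
  have hΩ0 : volume P.Ω ≠ 0 := (hP.isOpen_Ω.measure_pos volume hP.isConnected_Ω.nonempty).ne'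
  have hΩt : volume P.Ω ≠ ⊤ := hP.isBounded_Ω.measure_lt_top.ne
  set C₁ := 8 * (CΩ * (2 * (1 + ℓ ^ 2 * C₀)) ^ 2 + C₀ * Ce) with hC₁
  refine ⟨(volume P.Ω)⁻¹ * (Cv * (72 * (volume P.Ω * C₁) + 64)), ?_, fun ε hε u g hu => ?_⟩
  · have : (volume P.Ω)⁻¹ ≠ ⊤ := ENNReal.inv_ne_top.2 hΩ0
    finiteness
  set I := (finite_cellIndices hP.isBounded_Ω hε).toFinset with hIdef
  have hI : ∀ k, k ∈ I ↔ k ∈ cellIndices P.Ω ε := fun k => Set.Finite.mem_toFinset _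
  have hdomΩ : P.dom ε ⊆ P.Ω := sdiff_subset
  have hdom := isOpen_dom hP hε
  set M := ∫⁻ x in P.dom ε, ‖u x‖ₑ ^ 2
  set N := ∫⁻ x in P.dom ε, ‖g x‖ₑ ^ 2
  set e := ENNReal.ofReal ε
  have he0 : e ≠ 0 := by simpa [e] using hε
  have het : e ≠ ⊤ := ENNReal.ofReal_ne_top
  have hex : ∀ k, ∃ a : ℝ, k ∈ I →
      ∫⁻ x in scaled ε k (perfCell P), ‖u x - a‖ₑ ^ 4
          ≤ C₀ * e * (∫⁻ x in scaled ε k (perfCell P), ‖g x‖ₑ ^ 2) ^ 2 ∧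
        ∫⁻ x in scaled ε k (perfCell P), ‖u x - a‖ₑ ^ 2
          ≤ C₀ * e ^ 2 * ∫⁻ x in scaled ε k (perfCell P), ‖g x‖ₑ ^ 2 := by
    intro k
    by_cases hk : k ∈ I
    · obtain ⟨a, ha⟩ := hcell ε hε k u g
        (hu.mono (scaled_perfCell_subset_dom hP hε ((hI k).1 hk)))
      exact ⟨a, fun _ => ha⟩
    · exact ⟨0, fun h => absurd h hk⟩
  choose a ha using hex
  -- `w` is the oscillation of u inside the cells: u − a k on the k-th perforated cell, and 0
  -- elsewhere.
  set w : E3 → ℝ := fun x => ∑ k ∈ I, (scaled ε k (perfCell P)).indicator (fun x => u x - a k) x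
    with hw
  have hw_on : ∀ k ∈ I, ∀ x ∈ scaled ε k (perfCell P), w x = u x - a k := by
    intro k hk x hx
    rw [hw]
    simp only
    rw [Finset.sum_eq_single_of_mem k hk, indicator_of_mem hx]
    intro j _ hjk
    refine indicator_of_notMem (fun hxj => ?_) _
    exact Set.disjoint_left.1 (disjoint_scaled_unitCell hε hjk) (scaled_mono sdiff_subset hxj)
      (scaled_mono sdiff_subset hx)
  have hw_off : ∀ x, (∀ k ∈ I, x ∉ scaled ε k (perfCell P)) → w x = 0 := fun x hx =>
    Finset.sum_eq_zero fun k hk => indicator_of_notMem (hx k hk) _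
  have hmeas : ∀ k, MeasurableSet (scaled ε k (perfCell P)) := fun k =>
    (isOpen_scaled hε k (isOpen_perfCell P)).measurableSet
  have hNk : ∑ k ∈ I, ∫⁻ x in scaled ε k (perfCell P), ‖g x‖ₑ ^ 2 ≤ N :=
    sum_setLIntegral_le_dom hP hε hI _
  have hW4 : ∫⁻ x in P.dom ε, ‖w x‖ₑ ^ 4 ≤ C₀ * Ce * N ^ 2 := by
    refine (setLIntegral_dom_le_sum hP hε fun x _ hx => by
      rw [hw_off x hx]; simp).trans ?_
    -- Each squared cell integral is bounded by the total `N` times the cell integral; the latter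
    -- are then summed.
    calc ∑ k ∈ I, ∫⁻ x in scaled ε k (perfCell P), ‖w x‖ₑ ^ 4
        ≤ ∑ k ∈ I, C₀ * Ce * N * ∫⁻ x in scaled ε k (perfCell P), ‖g x‖ₑ ^ 2 := by
          refine Finset.sum_le_sum fun k hk => ?_
          rw [setLIntegral_congr_fun (hmeas k) (g := fun x => ‖u x - a k‖ₑ ^ 4)
            fun x hx => by simp only; rw [hw_on k hk x hx]]
          refine (ha k hk).1.trans ?_
          rw [pow_two, mul_assoc, mul_assoc, mul_assoc]
          refine mul_le_mul_right (mul_le_mul' (hee ε hε k ((hI k).1 hk)) ?_) _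
          refine mul_le_mul_left ?_ _
          exact (Finset.single_le_sum (f := fun k =>
            ∫⁻ x in scaled ε k (perfCell P), ‖g x‖ₑ ^ 2) (fun _ _ => zero_le) hk).trans hNk
      _ = C₀ * Ce * N * ∑ k ∈ I, ∫⁻ x in scaled ε k (perfCell P), ‖g x‖ₑ ^ 2 :=
          (Finset.mul_sum _ _ _).symm
      _ ≤ C₀ * Ce * N * N := mul_le_mul_right hNk _
      _ = _ := by ring
  have hW2 : ∫⁻ x in P.dom ε, ‖w x‖ₑ ^ 2 ≤ C₀ * e ^ 2 * N := by
    refine (setLIntegral_dom_le_sum hP hε fun x _ hx => by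
      rw [hw_off x hx]; simp).trans ?_
    calc ∑ k ∈ I, ∫⁻ x in scaled ε k (perfCell P), ‖w x‖ₑ ^ 2
        ≤ ∑ k ∈ I, C₀ * e ^ 2 * ∫⁻ x in scaled ε k (perfCell P), ‖g x‖ₑ ^ 2 := by
          refine Finset.sum_le_sum fun k hk => ?_
          rw [setLIntegral_congr_fun (hmeas k) (g := fun x => ‖u x - a k‖ₑ ^ 2)
            fun x hx => by simp only; rw [hw_on k hk x hx]]
          exact (ha k hk).2
      _ = C₀ * e ^ 2 * ∑ k ∈ I, ∫⁻ x in scaled ε k (perfCell P), ‖g x‖ₑ ^ 2 :=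
          (Finset.mul_sum _ _ _).symm
      _ ≤ _ := mul_le_mul_right hNk _
  set Z : (Fin 3 → ℤ) → E3 → ℝ := cellCutoff ζ ε with hZ
  have hZs : ∀ k, tsupport (Z k) ⊆ scaled ε k unitCell := tsupport_cellCutoff hζs hε
  have hZd : ∀ k, ContDiff ℝ (⊤ : ℕ∞) (Z k) := contDiff_cellCutoff hζ ε
  have hsum : ∀ (c : (Fin 3 → ℤ) → ℝ), ∀ k ∈ I, ∀ x ∈ scaled ε k unitCell,
      ∑ j ∈ I, c j * Z j x = c k * Z k x := by
    intro c k hk x hx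
    refine Finset.sum_eq_single_of_mem k hk fun j _ hjk => ?_
    rw [image_eq_zero_of_notMem_tsupport fun h =>
      Set.disjoint_left.1 (disjoint_scaled_unitCell hε hjk) (hZs j h) hx, mul_zero]
  have hsum' : ∀ (c : (Fin 3 → ℤ) → ℝ), ∀ k ∈ I, ∀ x ∈ scaled ε k unitCell,
      ∀ᶠ y in 𝓝 x, ∑ j ∈ I, c j * Z j y = c k * Z k y := by
    intro c k hk x hx
    filter_upwards [(isOpen_scaled hε k isOpen_unitCell).mem_nhds hx] with y hy
    exact hsum c k hk y hy
  have hsum0 : ∀ (c : (Fin 3 → ℤ) → ℝ) (x : E3), (∀ k ∈ I, x ∉ scaled ε k unitCell) →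
      ∀ᶠ y in 𝓝 x, ∑ j ∈ I, c j * Z j y = 0 := by
    intro c x hx
    have : ∀ᶠ y in 𝓝 x, ∀ j ∈ I, Z j y = 0 := (Filter.eventually_all_finset I).2 fun j hj =>
      notMem_tsupport_iff_eventuallyEq.1 fun h => hx j hj (hZs j h)
    filter_upwards [this] with y hy
    exact Finset.sum_eq_zero fun j hj => by rw [hy j hj, mul_zero]
  -- The extension is χ u + q. In the k-th cell it equals u − Z k (u − a k), which is the constant a
  -- k near the hole; outside the cells it is u.
  set χ : E3 → ℝ := fun x => 1 - ∑ j ∈ I, 1 * Z j x with hχ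
  set q : E3 → ℝ := fun x => ∑ j ∈ I, a j * Z j x with hq
  have hχd : ContDiff ℝ (⊤ : ℕ∞) χ :=
    contDiff_const.sub (ContDiff.sum fun j _ => contDiff_const.mul (hZd j))
  have hqd : ContDiff ℝ (⊤ : ℕ∞) q := ContDiff.sum fun j _ => contDiff_const.mul (hZd j)
  have hhole : ∀ x ∈ P.Ω \ P.dom ε, ∃ k ∈ I, (∀ᶠ y in 𝓝 x, χ y = 0) ∧ ∀ᶠ y in 𝓝 x, q y = a k := by
    intro x hx
    have hxH : x ∈ closedHoles P.Ω P.H ε := by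
      by_contra h
      exact hx.2 ⟨hx.1, h⟩
    simp only [closedHoles, mem_iUnion] at hxH
    obtain ⟨k, hk, hxk⟩ := hxH
    have hkI := (hI k).2 hk
    have hxY := scaled_mono hP.closure_H hxk
    have hZ1 : ∀ᶠ y in 𝓝 x, Z k y = 1 := by
      obtain ⟨y, hy, rfl⟩ := hxk
      have h1 : Tendsto (fun x => (cellHomeo ε hε k).symm x) (𝓝 (cellHomeo ε hε k y)) (𝓝 y) := by
        have := (cellHomeo ε hε k).symm.continuous.tendsto (cellHomeo ε hε k y)
        rwa [Homeomorph.symm_apply_apply] at this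
      exact h1.eventually (hζ1 y hy)
    refine ⟨k, hkI, ?_, ?_⟩
    · filter_upwards [hsum' (fun _ => 1) k hkI x hxY, hZ1] with y hy hy1
      simp only [hχ]
      rw [hy, hy1]; norm_num
    · filter_upwards [hsum' a k hkI x hxY, hZ1] with y hy hy1
      simp only [hq]
      rw [hy, hy1, mul_one]
  have hχs : tsupport χ ∩ P.Ω ⊆ P.dom ε := by
    rintro x ⟨hx, hxΩ⟩
    by_contra hxd
    obtain ⟨k, _, h0, _⟩ := hhole x ⟨hxΩ, hxd⟩
    exact notMem_tsupport_iff_eventuallyEq.2 h0 hx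
  have hut := (hu.cutoff hdom hP.isOpen_Ω hP.isBounded_Ω hdomΩ hχd hχs).add
    (memH1_of_contDiff hP.isBounded_Ω (hqd.of_le (by exact_mod_cast le_top)))
  set ut : E3 → ℝ := fun x => χ x * u x + q x with hutdef
  set gt : E3 → E3 := fun x => χ x • g x + u x • gradient χ x + gradient q x with hgt
  have hgt_hole : ∀ x ∈ P.Ω \ P.dom ε, gt x = 0 := by
    intro x hx
    obtain ⟨k, _, h0, h1⟩ := hhole x hx
    simp only [hgt]
    rw [gradient_congr h0, gradient_congr h1, h0.self_of_nhds, gradient_const_eq, gradient_const_eq]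
    simp
  -- Both the change of u and the extra gradient are controlled by `w`; only the latter carries the
  -- factor 1/ε.
  have hcase : ∀ x ∈ P.dom ε, ‖u x - ut x‖ ≤ ‖w x‖ ∧ ‖gt x‖ ≤ ‖g x‖ + L * ε⁻¹ * ‖w x‖ := by
    intro x hx
    by_cases hxk : ∃ k ∈ I, x ∈ scaled ε k unitCell
    · obtain ⟨k, hk, hxk⟩ := hxk
      have hxS := mem_scaled_perfCell hx ((hI k).1 hk) hxk
      have h0 : 0 ≤ Z k x ∧ Z k x ≤ 1 := hζb _
      have g1 : gradient χ x = -gradient (Z k) x := by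
        rw [← gradient_const_sub 1]
        refine gradient_congr ?_
        filter_upwards [hsum' (fun _ => 1) k hk x hxk] with y hy
        simp only [hχ]
        rw [hy, one_mul]
      have g2 : gradient q x = a k • gradient (Z k) x := by
        rw [← gradient_const_mul ((hZd k).differentiable (by simp) x)]
        exact gradient_congr (hsum' a k hk x hxk)
      have v1 : χ x = 1 - Z k x := by
        simp only [hχ]; rw [hsum (fun _ => 1) k hk x hxk, one_mul]
      have v2 : q x = a k * Z k x := hsum a k hk x hxk
      rw [hw_on k hk x hxS]
      constructor
      · have : u x - ut x = Z k x * (u x - a k) := by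
          simp only [hutdef]; rw [v1, v2]; ring
        rw [this, norm_mul, Real.norm_of_nonneg h0.1]
        exact mul_le_of_le_one_left (norm_nonneg _) h0.2
      · have : gt x = (1 - Z k x) • g x - (u x - a k) • gradient (Z k) x := by
          simp only [hgt]; rw [g1, g2, v1]; module
        rw [this]
        refine (norm_sub_le _ _).trans (add_le_add ?_ ?_)
        · rw [norm_smul, Real.norm_of_nonneg (by linarith [h0.2])]
          exact mul_le_of_le_one_left (norm_nonneg _) (by linarith [h0.1])
        · rw [norm_smul, mul_comm]
          exact mul_le_mul_of_nonneg_right (hL ε hε k x) (norm_nonneg _)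
    · push Not at hxk
      have v1 : ∀ᶠ y in 𝓝 x, χ y = 1 := by
        filter_upwards [hsum0 (fun _ => 1) x hxk] with y hy
        simp only [hχ]; rw [hy, sub_zero]
      have v2 : ∀ᶠ y in 𝓝 x, q y = 0 := hsum0 a x hxk
      have g1 : gt x = g x := by
        simp only [hgt]
        rw [gradient_congr v1, gradient_congr v2, v1.self_of_nhds, gradient_const_eq,
          gradient_const_eq]
        simp
      constructor
      · simp only [hutdef]
        rw [v1.self_of_nhds, v2.self_of_nhds]
        simp
      · rw [g1]
        have : 0 ≤ L * ε⁻¹ * ‖w x‖ := by positivity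
        linarith
  -- The factor ε⁻² from the cut-off meets the ε² in `hW2`, so the extended gradient is bounded by
  -- the original one uniformly in ε.
  have hN' : ∫⁻ x in P.Ω, ‖gt x‖ₑ ^ 2 ≤ 2 * (1 + ℓ ^ 2 * C₀) * N := by
    have e1 : ∫⁻ x in P.Ω, ‖gt x‖ₑ ^ 2 = ∫⁻ x in P.dom ε, ‖gt x‖ₑ ^ 2 := by
      rw [← lintegral_indicator hP.isOpen_Ω.measurableSet, ← lintegral_indicator hdom.measurableSet]
      congr 1; ext x
      by_cases hx : x ∈ P.dom ε
      · rw [indicator_of_mem hx, indicator_of_mem (hdomΩ hx)]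
      · rw [indicator_of_notMem hx]
        by_cases hxΩ : x ∈ P.Ω
        · rw [indicator_of_mem hxΩ, hgt_hole x ⟨hxΩ, hx⟩]; simp
        · rw [indicator_of_notMem hxΩ]
    have hle : ENNReal.ofReal (L * ε⁻¹) = ℓ * e⁻¹ := by
      rw [ENNReal.ofReal_mul hL0, ENNReal.ofReal_inv_of_pos hε]
    rw [e1]
    calc ∫⁻ x in P.dom ε, ‖gt x‖ₑ ^ 2
        ≤ ∫⁻ x in P.dom ε, 2 * (‖g x‖ₑ ^ 2 + (ℓ * e⁻¹) ^ 2 * ‖w x‖ₑ ^ 2) := by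
          refine setLIntegral_mono' hdom.measurableSet fun x hx => ?_
          rw [← mul_pow]
          refine le_trans ?_ (add_sq_le_two _ _)
          refine pow_le_pow_left' ?_ 2
          rw [← hle, ← ofReal_norm, ← ofReal_norm, ← ofReal_norm,
            ← ENNReal.ofReal_mul (by positivity),
            ← ENNReal.ofReal_add (norm_nonneg _) (by positivity)]
          exact ENNReal.ofReal_le_ofReal (hcase x hx).2
      _ = 2 * (N + (ℓ * e⁻¹) ^ 2 * ∫⁻ x in P.dom ε, ‖w x‖ₑ ^ 2) := by
          have : (ℓ * e⁻¹) ^ 2 ≠ ⊤ := by rw [← hle]; finiteness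
          rw [lintegral_const_mul' _ _ (by norm_num),
            lintegral_add_left' (hu.memLp_grad.1.aemeasurable.enorm.pow_const 2),
            lintegral_const_mul' _ _ this]
      _ ≤ 2 * (N + (ℓ * e⁻¹) ^ 2 * (C₀ * e ^ 2 * N)) :=
          mul_le_mul_right (add_le_add le_rfl (mul_le_mul_right hW2 _)) _
      _ = 2 * (N + (e * e⁻¹) ^ 2 * (ℓ ^ 2 * C₀ * N)) := by ring
      _ = _ := by rw [ENNReal.mul_inv_cancel he0 het]; ring
  obtain ⟨b, hb⟩ := hΩ ut gt hut
  have hfin : IsFiniteMeasure (volume.restrict (P.dom ε)) := ⟨by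
    rw [Measure.restrict_apply_univ]; exact (measure_mono hdomΩ).trans_lt hΩt.lt_top⟩
  have hutm : AEMeasurable ut (volume.restrict (P.dom ε)) :=
    (hut.mono hdomΩ).memLp.1.aemeasurable
  have hX : ∫⁻ x in P.dom ε, ‖u x - b‖ₑ ^ 4 ≤ C₁ * N ^ 2 := by
    calc ∫⁻ x in P.dom ε, ‖u x - b‖ₑ ^ 4
        ≤ ∫⁻ x in P.dom ε, 8 * (‖ut x - b‖ₑ ^ 4 + ‖w x‖ₑ ^ 4) := by
          refine setLIntegral_mono' hdom.measurableSet fun x hx => ?_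
          refine le_trans ?_ (add_pow_four_le _ _)
          refine pow_le_pow_left' ?_ 4
          have h1 : ‖u x - b‖ₑ ≤ ‖ut x - b‖ₑ + ‖u x - ut x‖ₑ := by
            have := enorm_add_le (ut x - b) (u x - ut x)
            rwa [show ut x - b + (u x - ut x) = u x - b by ring] at this
          refine h1.trans (add_le_add le_rfl ?_)
          rw [enorm_le_iff_norm_le]
          exact (hcase x hx).1
      _ = 8 * ((∫⁻ x in P.dom ε, ‖ut x - b‖ₑ ^ 4) + ∫⁻ x in P.dom ε, ‖w x‖ₑ ^ 4) := by
          rw [lintegral_const_mul' _ _ (by norm_num),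
            lintegral_add_left' ((hutm.sub_const b).enorm.pow_const 4)]
      _ ≤ 8 * (CΩ * (2 * (1 + ℓ ^ 2 * C₀) * N) ^ 2 + C₀ * Ce * N ^ 2) := by
          refine mul_le_mul_right (add_le_add ((lintegral_mono_set hdomΩ).trans (hb.trans ?_)) hW4) _
          exact mul_le_mul_right (pow_le_pow_left' hN' 2) _
      _ = C₁ * N ^ 2 := by rw [hC₁]; ring
  have hmain := lintegral_pow_four_le_of_sub_const (volume.restrict (P.dom ε))
    hu.memLp.1.aemeasurable b
  rw [Measure.restrict_apply_univ] at hmain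
  set D := volume (P.dom ε)
  set Y := ∫⁻ x in P.dom ε, ‖u x‖ₑ ^ 4
  have hDΩ : D ≤ volume P.Ω := measure_mono hdomΩ
  have hfinal : volume P.Ω * Y ≤ Cv * (72 * (volume P.Ω * C₁) + 64) * (M + N) ^ 2 := by
    calc volume P.Ω * Y ≤ Cv * D * Y := mul_le_mul_left (hvol ε hε) _
      _ = Cv * (D * Y) := by ring
      _ ≤ Cv * (72 * (D * ∫⁻ x in P.dom ε, ‖u x - b‖ₑ ^ 4) + 64 * M ^ 2) :=
          mul_le_mul_right hmain _
      _ ≤ Cv * (72 * (volume P.Ω * (C₁ * (M + N) ^ 2)) + 64 * (M + N) ^ 2) := by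
          refine mul_le_mul_right (add_le_add (mul_le_mul_right (mul_le_mul' hDΩ ?_) _)
            (mul_le_mul_right (pow_le_pow_left' le_self_add 2) _)) _
          exact hX.trans (mul_le_mul_right (pow_le_pow_left' le_add_self 2) _)
      _ = _ := by ring
  calc Y = (volume P.Ω)⁻¹ * (volume P.Ω * Y) := by
        rw [← mul_assoc, ENNReal.inv_mul_cancel hΩ0 hΩt, one_mul]
    _ ≤ (volume P.Ω)⁻¹ * (Cv * (72 * (volume P.Ω * C₁) + 64) * (M + N) ^ 2) :=
        mul_le_mul_right hfinal _
    _ = _ := by ring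


/-! ### Quadratic forms and coefficients -/

/-- The vector `M ξ`. -/
def matVec (M : Matrix (Fin 3) (Fin 3) ℝ) (ξ : E3) : E3 :=
  WithLp.toLp 2 fun i => ∑ j, M i j * ξ j

lemma form_eq_inner (M : Matrix (Fin 3) (Fin 3) ℝ) (ξ ζ : E3) :
    form M ξ ζ = inner ℝ (matVec M ξ) ζ := by
  simp only [form, matVec, PiLp.inner_apply, RCLike.inner_apply, conj_trivial]
  refine Finset.sum_congr rfl fun i _ => ?_
  rw [Finset.mul_sum]
  exact Finset.sum_congr rfl fun j _ => mul_comm _ _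

lemma form_comm {M : Matrix (Fin 3) (Fin 3) ℝ} (hM : M.IsSymm) (ξ ζ : E3) :
    form M ξ ζ = form M ζ ξ := by
  simp only [form]
  rw [Finset.sum_comm]
  refine Finset.sum_congr rfl fun i _ => Finset.sum_congr rfl fun j _ => ?_
  rw [hM.apply j i]
  ring

lemma form_sub_left (M : Matrix (Fin 3) (Fin 3) ℝ) (ξ ξ' ζ : E3) :
    form M (ξ - ξ') ζ = form M ξ ζ - form M ξ' ζ := by
  simp only [form, ← Finset.sum_sub_distrib, PiLp.sub_apply]
  refine Finset.sum_congr rfl fun i _ => Finset.sum_congr rfl fun j _ => by ring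

lemma form_sub_right (M : Matrix (Fin 3) (Fin 3) ℝ) (ξ ζ ζ' : E3) :
    form M ξ (ζ - ζ') = form M ξ ζ - form M ξ ζ' := by
  rw [form_eq_inner, form_eq_inner, form_eq_inner, inner_sub_right]

lemma two_form_le {M : Matrix (Fin 3) (Fin 3) ℝ} (hM : M.IsSymm) (h0 : ∀ ξ, 0 ≤ form M ξ ξ)
    (ξ ζ : E3) : form M ξ ζ ≤ (form M ξ ξ + form M ζ ζ) / 2 := by
  have h := h0 (ξ - ζ)
  rw [form_sub_left, form_sub_right, form_sub_right, form_comm hM ζ ξ] at h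
  linarith

lemma norm_matVec_le {M : Matrix (Fin 3) (Fin 3) ℝ} {B : ℝ} (hM : ∀ i j, |M i j| ≤ B) (ξ : E3) :
    ‖matVec M ξ‖ ≤ 9 * B * ‖ξ‖ := by
  have h1 : ∀ i, |matVec M ξ i| ≤ 3 * B * ‖ξ‖ := fun i => by
    change |∑ j, M i j * ξ j| ≤ _
    calc |∑ j, M i j * ξ j| ≤ ∑ j, |M i j * ξ j| := Finset.abs_sum_le_sum_abs _ _
      _ ≤ ∑ _j : Fin 3, B * ‖ξ‖ := by
          refine Finset.sum_le_sum fun j _ => ?_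
          rw [abs_mul]
          exact mul_le_mul (hM i j) (PiLp.norm_apply_le ξ j) (abs_nonneg _)
            ((abs_nonneg _).trans (hM i j))
      _ = 3 * B * ‖ξ‖ := by simp; ring
  have hB : 0 ≤ 3 * B * ‖ξ‖ := (abs_nonneg _).trans (h1 0)
  rw [EuclideanSpace.norm_eq, Fin.sum_univ_three]
  refine (Real.sqrt_le_sqrt (y := (9 * B * ‖ξ‖) ^ 2) ?_).trans_eq (Real.sqrt_sq (by linarith))
  have h2 : ∀ i, ‖matVec M ξ i‖ ^ 2 ≤ (3 * B * ‖ξ‖) ^ 2 := fun i =>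
    pow_le_pow_left₀ (norm_nonneg _) (h1 i) 2
  nlinarith [h2 0, h2 1, h2 2, sq_nonneg (B * ‖ξ‖)]

/-- An essentially bounded, measurable field of matrices. -/
structure BddField {α : Type*} [MeasurableSpace α] (ν : Measure α)
    (N : α → Matrix (Fin 3) (Fin 3) ℝ) : Prop where
  measurable : ∀ i j, AEStronglyMeasurable (fun x => N x i j) ν
  bounded : ∃ B : ℝ, ∀ᵐ x ∂ν, ∀ i j, |N x i j| ≤ B

lemma integrable_inner_of_memLp_two {α : Type*} [MeasurableSpace α] {ν : Measure α} {f g : α → E3}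
    (hf : MemLp f 2 ν) (hg : MemLp g 2 ν) : Integrable (fun x => inner ℝ (f x) (g x)) ν := by
  refine (integrable_mul_of_memLp_two hf.norm hg.norm).mono' (hf.1.inner hg.1) ?_
  exact Eventually.of_forall fun x => norm_inner_le_norm _ _

section

variable {α : Type*} [MeasurableSpace α] {ν : Measure α} {N : α → Matrix (Fin 3) (Fin 3) ℝ}

lemma aestronglyMeasurable_E3 {f : α → E3} (hf : ∀ i, AEStronglyMeasurable (fun x => f x i) ν) :
    AEStronglyMeasurable f ν := by
  have h1 : AEMeasurable (fun x i => f x i) ν := aemeasurable_pi_lambda _ fun i => (hf i).aemeasurable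
  exact ((WithLp.measurable_toLp 2 (Fin 3 → ℝ)).comp_aemeasurable h1).aestronglyMeasurable

lemma BddField.memLp_matVec (hN : BddField ν N) {ξ : α → E3} (hξ : MemLp ξ 2 ν) :
    MemLp (fun x => matVec (N x) (ξ x)) 2 ν := by
  obtain ⟨B, hB⟩ := hN.bounded
  refine hξ.of_le_mul (c := 9 * B) (aestronglyMeasurable_E3 fun i => ?_) ?_
  · simp only [matVec]
    refine Finset.aestronglyMeasurable_fun_sum _ fun j _ => (hN.measurable i j).mul ?_
    exact (hξ.eval_piLp j).1
  · filter_upwards [hB] with x hx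
    exact norm_matVec_le hx _

lemma BddField.integrable_form (hN : BddField ν N) {ξ ζ : α → E3} (hξ : MemLp ξ 2 ν)
    (hζ : MemLp ζ 2 ν) : Integrable (fun x => form (N x) (ξ x) (ζ x)) ν := by
  simp_rw [form_eq_inner]
  exact integrable_inner_of_memLp_two (hN.memLp_matVec hξ) hζ

lemma BddField.integrable_gradForm (hN : BddField ν N) {ξ ζ : α → Fin 3 → E3}
    (hξ : ∀ c, MemLp (fun x => ξ x c) 2 ν) (hζ : ∀ c, MemLp (fun x => ζ x c) 2 ν) :
    Integrable (fun x => gradForm (N x) (ξ x) (ζ x)) ν :=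
  integrable_finsetSum _ fun c _ => hN.integrable_form (hξ c) (hζ c)

lemma BddField.comp_snd {β : Type*} [MeasurableSpace β] {κ : Measure β} [SFinite κ] [SFinite ν]
    (hN : BddField ν N) :
    BddField (κ.prod ν) fun q => N q.2 := by
  refine ⟨fun i j => (hN.measurable i j).comp_snd, ?_⟩
  obtain ⟨B, hB⟩ := hN.bounded
  exact ⟨B, Measure.quasiMeasurePreserving_snd.ae hB⟩

end

/-- Carathéodory's argument: for a simple function in place of x/ε the composition is measurable
piece by piece, and continuity in the fast variable gives the limit. -/
lemma IsCoefficient.aestronglyMeasurable_osc {D : Set E3} {M : E3 → E3 → Matrix (Fin 3) (Fin 3) ℝ}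
    (hM : IsCoefficient D M) (ε : ℝ) (i j : Fin 3) :
    AEStronglyMeasurable (fun x => osc M ε x i j) (volume.restrict D) := by
  have hmeas : Measurable fun x : E3 => ε⁻¹ • x := measurable_const_smul _
  set s : ℕ → SimpleFunc E3 E3 := fun n => SimpleFunc.approxOn (fun x : E3 => ε⁻¹ • x) hmeas univ 0
    (mem_univ _) n
  have hs : ∀ x, Tendsto (fun n => s n x) atTop (𝓝 (ε⁻¹ • x)) := fun x =>
    SimpleFunc.tendsto_approxOn hmeas (mem_univ _) (by simp)
  refine aestronglyMeasurable_of_tendsto_ae atTop (f := fun n x => M x (s n x) i j) (fun n => ?_) ?_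
  · refine ⟨fun x => (hM.measurable (s n x) i j).mk _ x,
      (SimpleFunc.measurable_bind (s n) (fun y x => (hM.measurable y i j).mk _ x)
        fun y => (hM.measurable y i j).stronglyMeasurable_mk.measurable).stronglyMeasurable, ?_⟩
    have : ∀ᵐ x ∂volume.restrict D, ∀ y ∈ (s n).range,
        M x y i j = (hM.measurable y i j).mk _ x := by
      rw [Filter.eventually_all_finset]
      exact fun y _ => (hM.measurable y i j).ae_eq_mk
    filter_upwards [this] with x hx
    exact hx _ (SimpleFunc.mem_range_self _ _)
  · filter_upwards [hM.continuous] with x hx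
    exact ((hx i j).tendsto _).comp (hs x)

lemma IsCoefficient.bddField {D U : Set E3} {M : E3 → E3 → Matrix (Fin 3) (Fin 3) ℝ}
    (hM : IsCoefficient D M) (ε : ℝ) (hU : U ⊆ D) : BddField (volume.restrict U) (osc M ε) := by
  have hle : volume.restrict U ≤ volume.restrict D := Measure.restrict_mono hU le_rfl
  refine ⟨fun i j => (hM.aestronglyMeasurable_osc ε i j).mono_measure hle, ?_⟩
  obtain ⟨B, hB⟩ := hM.bounded
  refine ⟨B, ae_mono hle ?_⟩
  filter_upwards [hB] with x hx
  exact hx _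

lemma IsCoefficient.ae_isSymm {D U : Set E3} {M : E3 → E3 → Matrix (Fin 3) (Fin 3) ℝ}
    (hM : IsCoefficient D M) (ε : ℝ) (hU : U ⊆ D) :
    ∀ᵐ x ∂volume.restrict U, (osc M ε x).IsSymm := by
  refine ae_mono (Measure.restrict_mono hU le_rfl) ?_
  filter_upwards [hM.symmetric] with x hx
  exact hx _

lemma IsCoefficient.exists_coercive {D : Set E3} {M : E3 → E3 → Matrix (Fin 3) (Fin 3) ℝ}
    (hM : IsCoefficient D M) : ∃ α : ℝ, 0 < α ∧ ∀ (ε : ℝ) (U : Set E3), U ⊆ D →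
      ∀ᵐ x ∂volume.restrict U, ∀ ξ, α * ‖ξ‖ ^ 2 ≤ form (osc M ε x) ξ ξ := by
  obtain ⟨α, hα, h⟩ := hM.coercive
  refine ⟨α, hα, fun ε U hU => ae_mono (Measure.restrict_mono hU le_rfl) ?_⟩
  filter_upwards [h] with x hx
  exact hx _

lemma IsCoefficient.ae_form_nonneg {D U : Set E3} {M : E3 → E3 → Matrix (Fin 3) (Fin 3) ℝ}
    (hM : IsCoefficient D M) (ε : ℝ) (hU : U ⊆ D) :
    ∀ᵐ x ∂volume.restrict U, ∀ ξ, 0 ≤ form (osc M ε x) ξ ξ := by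
  obtain ⟨α, hα, h⟩ := hM.exists_coercive
  filter_upwards [h ε U hU] with x hx ξ
  exact le_trans (by positivity) (hx ξ)

/-! ### Backward averages in time -/

section

variable {ν : Measure E3} [IsFiniteMeasure ν]

/-- The uniform probability measure on `(0, h]`. -/
def unifMeasure (h : ℝ) : Measure ℝ := ENNReal.ofReal h⁻¹ • volume.restrict (Ioc 0 h)

lemma isProbabilityMeasure_unifMeasure {h : ℝ} (hh : 0 < h) :
    IsProbabilityMeasure (unifMeasure h) := ⟨by
  rw [unifMeasure, Measure.smul_apply, Measure.restrict_apply_univ, Real.volume_Ioc, sub_zero,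
    smul_eq_mul, ← ENNReal.ofReal_mul (by positivity), inv_mul_cancel₀ hh.ne', ENNReal.ofReal_one]⟩

/-- The average of `G` over the time interval of length `h` that ends at the present time. -/
def timeAvg (h : ℝ) (G : ℝ × E3 → E3) (q : ℝ × E3) : E3 := ∫ r, G (q.1 - r, q.2) ∂unifMeasure h

lemma timeAvg_eq {h : ℝ} (hh : 0 < h) (G : ℝ × E3 → E3) (q : ℝ × E3) :
    timeAvg h G q = h⁻¹ • ∫ s in (q.1 - h)..q.1, G (s, q.2) := by
  rw [timeAvg, unifMeasure, integral_smul_measure, ENNReal.toReal_ofReal (by positivity)]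
  congr 1
  have h1 := intervalIntegral.integral_comp_sub_left (a := 0) (b := h)
    (fun s => G (s, q.2)) q.1
  rw [sub_zero] at h1
  rw [← h1, intervalIntegral.integral_of_le hh.le]

lemma measurePreserving_timeShift (r : ℝ) :
    MeasurePreserving (fun q : ℝ × E3 => (q.1 - r, q.2)) ((volume : Measure ℝ).prod ν)
      ((volume : Measure ℝ).prod ν) :=
  (measurePreserving_sub_right volume r).prod (MeasurePreserving.id ν)

lemma tendsto_lintegral_timeShift {G : ℝ × E3 → E3} (hG : MemLp G 2 ((volume : Measure ℝ).prod ν)) :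
    Tendsto (fun r : ℝ => ∫⁻ q, ‖G (q.1 - r, q.2) - G q‖ₑ ^ 2 ∂(volume : Measure ℝ).prod ν)
      (𝓝 0) (𝓝 0) := by
  refine tendsto_lintegral_comp_sub_sq
    (τ := fun r : ℝ => ⟨fun q : ℝ × E3 => (q.1 - r, q.2), by fun_prop⟩) ?_
    (fun r => measurePreserving_timeShift r) hG
  let c : C(ℝ, C(ℝ × E3, ℝ × E3)) :=
    ContinuousMap.curry ⟨fun p : ℝ × (ℝ × E3) => (p.2.1 - p.1, p.2.2), by fun_prop⟩
  have h := c.continuous.tendsto 0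
  have h0 : c 0 = ContinuousMap.id (ℝ × E3) := by ext x <;> simp [c]
  rw [h0] at h
  exact h

/-- The shear (r, q) ↦ (r, q shifted by r) preserves the product measure, since each shift does;
projecting to the second factor then preserves null sets. This makes the shifted function jointly
measurable when G is only a.e. measurable. -/
lemma quasiMeasurePreserving_timeShift (lam : Measure ℝ) [IsProbabilityMeasure lam] :
    Measure.QuasiMeasurePreserving (fun p : (ℝ × E3) × ℝ => (p.1.1 - p.2, p.1.2))
      (((volume : Measure ℝ).prod ν).prod lam) ((volume : Measure ℝ).prod ν) := by
  have h1 : MeasurePreserving (fun p : ℝ × (ℝ × E3) => (p.1, (p.2.1 - p.1, p.2.2)))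
      (lam.prod ((volume : Measure ℝ).prod ν)) (lam.prod ((volume : Measure ℝ).prod ν)) := by
    refine (MeasurePreserving.id lam).skew_product (g := fun (r : ℝ) (q : ℝ × E3) => (q.1 - r, q.2))
      (by fun_prop) ?_
    exact Eventually.of_forall fun r => (measurePreserving_timeShift r).map_eq
  have h2 := (Measure.quasiMeasurePreserving_snd (μ := lam)
    (ν := (volume : Measure ℝ).prod ν)).comp h1.quasiMeasurePreserving
  exact h2.comp (Measure.measurePreserving_swap (μ := (volume : Measure ℝ).prod ν)
    (ν := lam)).quasiMeasurePreserving

lemma enorm_integral_sub_sq_le {α : Type*} [MeasurableSpace α] (lam : Measure α)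
    [IsProbabilityMeasure lam] {f : α → E3} (hf : Integrable f lam) (c : E3) :
    ‖(∫ r, f r ∂lam) - c‖ₑ ^ 2 ≤ ∫⁻ r, ‖f r - c‖ₑ ^ 2 ∂lam := by
  have h1 : (∫ r, f r ∂lam) - c = ∫ r, (f r - c) ∂lam := by
    rw [integral_sub hf (integrable_const _)]; simp
  rw [h1]
  refine (pow_le_pow_left' (enorm_integral_le_lintegral_enorm _) 2).trans ?_
  simpa using sq_lintegral_le lam (hf.1.sub aestronglyMeasurable_const).enorm

variable {G : ℝ × E3 → E3}

lemma lintegral_timeShift_swap (hG : MemLp G 2 ((volume : Measure ℝ).prod ν)) {h : ℝ} (hh : 0 < h)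
    {G' : ℝ × E3 → E3} (hG' : AEStronglyMeasurable G' ((volume : Measure ℝ).prod ν)) :
    ∫⁻ q, (∫⁻ r, ‖G (q.1 - r, q.2) - G' q‖ₑ ^ 2 ∂unifMeasure h) ∂(volume : Measure ℝ).prod ν
      = ∫⁻ r, (∫⁻ q, ‖G (q.1 - r, q.2) - G' q‖ₑ ^ 2 ∂(volume : Measure ℝ).prod ν)
        ∂unifMeasure h := by
  have := isProbabilityMeasure_unifMeasure hh
  refine lintegral_lintegral_swap ?_
  have h1 := hG.1.comp_quasiMeasurePreserving (quasiMeasurePreserving_timeShift (unifMeasure h))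
  exact (h1.sub hG'.comp_fst).enorm.pow_const 2

/-- A Bochner average is meaningful only where the shifts are integrable; Tonelli and invariance
under shifts give square integrability in r for a.e. q. -/
lemma ae_integrable_timeShift (hG : MemLp G 2 ((volume : Measure ℝ).prod ν)) {h : ℝ} (hh : 0 < h) :
    ∀ᵐ q ∂(volume : Measure ℝ).prod ν,
      Integrable (fun r => G (q.1 - r, q.2)) (unifMeasure h) := by
  have := isProbabilityMeasure_unifMeasure hh
  have h1 := hG.1.comp_quasiMeasurePreserving (quasiMeasurePreserving_timeShift (unifMeasure h))
  have h2 := lintegral_timeShift_swap hG hh (G' := 0) aestronglyMeasurable_const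
  simp only [Pi.zero_apply, sub_zero] at h2
  have h3 : ∀ r, ∫⁻ q, ‖G (q.1 - r, q.2)‖ₑ ^ 2 ∂(volume : Measure ℝ).prod ν
      = ∫⁻ q, ‖G q‖ₑ ^ 2 ∂(volume : Measure ℝ).prod ν := fun r =>
    (measurePreserving_timeShift r).lintegral_comp_emb
      ((Homeomorph.subRight r).prodCongr (Homeomorph.refl E3)).measurableEmbedding
      (fun q => ‖G q‖ₑ ^ 2)
  simp_rw [h3] at h2
  rw [lintegral_const, measure_univ, mul_one] at h2
  have h4 : ∀ᵐ q ∂(volume : Measure ℝ).prod ν,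
      ∫⁻ r, ‖G (q.1 - r, q.2)‖ₑ ^ 2 ∂unifMeasure h < ⊤ := by
    refine ae_lt_top' ?_ ?_
    · exact (h1.enorm.pow_const 2).lintegral_prod_right'
    · rw [h2]; exact lintegral_enorm_sq_ne_top hG
  filter_upwards [h4, h1.prodMk_left] with q hq hqm
  have : MemLp (fun r => G (q.1 - r, q.2)) 2 (unifMeasure h) := by
    refine ⟨hqm, ?_⟩
    rw [eLpNorm_lt_top_iff_lintegral_rpow_enorm_lt_top (by simp) (by simp)]
    simpa using hq
  exact this.integrable (by norm_num)

lemma aestronglyMeasurable_timeAvg (hG : MemLp G 2 ((volume : Measure ℝ).prod ν)) {h : ℝ}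
    (hh : 0 < h) : AEStronglyMeasurable (timeAvg h G) ((volume : Measure ℝ).prod ν) := by
  have := isProbabilityMeasure_unifMeasure hh
  exact (hG.1.comp_quasiMeasurePreserving
    (quasiMeasurePreserving_timeShift (unifMeasure h))).integral_prod_right'

lemma lintegral_timeAvg_sub_le (hG : MemLp G 2 ((volume : Measure ℝ).prod ν)) {h : ℝ} (hh : 0 < h)
    {G' : ℝ × E3 → E3} (hG' : AEStronglyMeasurable G' ((volume : Measure ℝ).prod ν)) :
    ∫⁻ q, ‖timeAvg h G q - G' q‖ₑ ^ 2 ∂(volume : Measure ℝ).prod ν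
      ≤ ∫⁻ r, (∫⁻ q, ‖G (q.1 - r, q.2) - G' q‖ₑ ^ 2 ∂(volume : Measure ℝ).prod ν)
        ∂unifMeasure h := by
  have := isProbabilityMeasure_unifMeasure hh
  rw [← lintegral_timeShift_swap hG hh hG']
  refine lintegral_mono_ae ?_
  filter_upwards [ae_integrable_timeShift hG hh] with q hq
  exact enorm_integral_sub_sq_le _ hq _

lemma memLp_timeAvg (hG : MemLp G 2 ((volume : Measure ℝ).prod ν)) {h : ℝ} (hh : 0 < h) :
    MemLp (timeAvg h G) 2 ((volume : Measure ℝ).prod ν) := by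
  have := isProbabilityMeasure_unifMeasure hh
  refine ⟨aestronglyMeasurable_timeAvg hG hh, ?_⟩
  rw [eLpNorm_lt_top_iff_lintegral_rpow_enorm_lt_top (by simp) (by simp)]
  have h1 := lintegral_timeAvg_sub_le hG hh (G' := 0) aestronglyMeasurable_const
  have h3 : ∀ r, ∫⁻ q, ‖G (q.1 - r, q.2)‖ₑ ^ 2 ∂(volume : Measure ℝ).prod ν
      = ∫⁻ q, ‖G q‖ₑ ^ 2 ∂(volume : Measure ℝ).prod ν := fun r =>
    (measurePreserving_timeShift r).lintegral_comp_emb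
      ((Homeomorph.subRight r).prodCongr (Homeomorph.refl E3)).measurableEmbedding
      (fun q => ‖G q‖ₑ ^ 2)
  simp only [Pi.zero_apply, sub_zero, h3, lintegral_const, measure_univ, mul_one] at h1
  simpa using h1.trans_lt (lintegral_enorm_sq_ne_top hG).lt_top

/-- The squared error is at most the mean over r in (0, h] of the squared L² distance between G and
its shift by r. -/
lemma tendsto_timeAvg (hG : MemLp G 2 ((volume : Measure ℝ).prod ν)) {h : ℕ → ℝ}
    (hpos : ∀ n, 0 < h n) (hh : Tendsto h atTop (𝓝 0)) :
    Tendsto (fun n => ∫⁻ q, ‖timeAvg (h n) G q - G q‖ₑ ^ 2 ∂(volume : Measure ℝ).prod ν)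
      atTop (𝓝 0) := by
  have hT := tendsto_lintegral_timeShift hG
  rw [ENNReal.tendsto_nhds_zero] at hT ⊢
  intro ε hε
  obtain ⟨δ, hδ, hδ'⟩ := Metric.eventually_nhds_iff.1 (hT ε hε)
  filter_upwards [hh.eventually (gt_mem_nhds hδ)] with n hn
  have := isProbabilityMeasure_unifMeasure (hpos n)
  refine (lintegral_timeAvg_sub_le hG (hpos n) hG.1).trans ?_
  calc _ ≤ ∫⁻ _, ε ∂unifMeasure (h n) := by
        refine lintegral_mono_ae ?_
        refine Measure.ae_smul_measure ?_ _
        filter_upwards [ae_restrict_mem measurableSet_Ioc] with r hr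
        refine hδ' ?_
        rw [Real.dist_eq, sub_zero, abs_of_pos hr.1]
        exact hr.2.trans_lt hn
    _ = ε := by simp

lemma tendsto_integral_inner_timeAvg (hG : MemLp G 2 ((volume : Measure ℝ).prod ν))
    {f : ℝ × E3 → E3} (hf : MemLp f 2 ((volume : Measure ℝ).prod ν)) {h : ℕ → ℝ}
    (hpos : ∀ n, 0 < h n) (hh : Tendsto h atTop (𝓝 0)) :
    Tendsto (fun n => ∫ q, inner ℝ (f q) (timeAvg (h n) G q) ∂(volume : Measure ℝ).prod ν)
      atTop (𝓝 (∫ q, inner ℝ (f q) (G q) ∂(volume : Measure ℝ).prod ν)) := by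
  have hA := fun n => memLp_timeAvg hG (hpos n)
  refine tendsto_integral_of_L1 _ (integrable_inner_of_memLp_two hf hG).1
    (Eventually.of_forall fun n => integrable_inner_of_memLp_two hf (hA n)) ?_
  have h1 := tendsto_lintegral_mul_of_sq (a := fun n q => ‖timeAvg (h n) G q - G q‖ₑ)
    (b := fun q => ‖f q‖ₑ) (fun n => ((hA n).1.sub hG.1).enorm) hf.1.enorm
    (tendsto_timeAvg hG hpos hh) (lintegral_enorm_sq_ne_top hf)
  refine tendsto_of_tendsto_of_tendsto_of_le_of_le tendsto_const_nhds h1 (fun _ => zero_le) ?_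
  intro n
  refine lintegral_mono fun q => ?_
  simp only
  rw [← inner_sub_right, mul_comm, ← ofReal_norm, ← ofReal_norm, ← ofReal_norm,
    ← ENNReal.ofReal_mul (norm_nonneg _)]
  exact ENNReal.ofReal_le_ofReal (norm_inner_le_norm _ _)

end


/-! ### Functions of time and space -/

/-- Iterated almost-everywhere equality gives equality a.e. on the product only if the exceptional
set is measurable; measurable representatives provide this. -/
lemma ae_prod_eq_of_ae_ae {α β E : Type*} [MeasurableSpace α] [MeasurableSpace β]
    [NormedAddCommGroup E] {μ : Measure α} {ν : Measure β} [SFinite μ] [SFinite ν]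
    {f g : α × β → E} (hf : AEStronglyMeasurable f (μ.prod ν))
    (hg : AEStronglyMeasurable g (μ.prod ν)) (h : ∀ᵐ s ∂μ, ∀ᵐ x ∂ν, f (s, x) = g (s, x)) :
    f =ᵐ[μ.prod ν] g := by
  have h1 : ∀ᵐ q ∂μ.prod ν, hf.mk f q = hg.mk g q := by
    have hm : MeasurableSet {q | hf.mk f q = hg.mk g q} :=
      hf.stronglyMeasurable_mk.measurableSet_eq_fun hg.stronglyMeasurable_mk
    rw [Measure.ae_prod_iff_ae_ae hm]
    filter_upwards [h, Measure.ae_ae_of_ae_prod hf.ae_eq_mk,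
      Measure.ae_ae_of_ae_prod hg.ae_eq_mk] with s h1 h2 h3
    filter_upwards [h1, h2, h3] with x h1 h2 h3
    rw [← h2, ← h3, h1]
  filter_upwards [h1, hf.ae_eq_mk, hg.ae_eq_mk] with q h1 h2 h3
  rw [h2, h3, h1]

lemma ae_ae_swap_of_ae_prod {α β : Type*} [MeasurableSpace α] [MeasurableSpace β]
    {μ : Measure α} {ν : Measure β} [SFinite μ] [SFinite ν] {p : α × β → Prop}
    (h : ∀ᵐ q ∂μ.prod ν, p q) : ∀ᵐ x ∂ν, ∀ᵐ s ∂μ, p (s, x) := by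
  have h1 : ∀ᵐ q ∂ν.prod μ, p q.swap :=
    (Measure.measurePreserving_swap (μ := ν) (ν := μ)).quasiMeasurePreserving.ae h
  exact Measure.ae_ae_of_ae_prod h1

/-- The chain rule for the square of an absolutely continuous function. -/
lemma integral_mul_primitive {f : ℝ → ℝ} (hf : Integrable f volume) (c a b : ℝ) :
    ∫ s in a..b, (c + ∫ r in (0 : ℝ)..s, f r) * f s
      = ((c + ∫ r in (0 : ℝ)..b, f r) ^ 2 - (c + ∫ r in (0 : ℝ)..a, f r) ^ 2) / 2 := by
  have hi : ∀ a b, IntervalIntegrable f volume a b := fun a b => hf.intervalIntegrable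
  set G : ℝ → ℝ := fun s => c + ∫ r in (0 : ℝ)..s, f r
  have hG : ∀ s, G s = (c + ∫ r in (0 : ℝ)..a, f r) + ∫ r in a..s, f r := fun s => by
    simp only [G]
    rw [add_assoc, intervalIntegral.integral_add_adjacent_intervals (hi _ _) (hi _ _)]
  have hac : AbsolutelyContinuousOnInterval G a b := by
    have h1 := (hi a b).absolutelyContinuousOnInterval_intervalIntegral (c := a) left_mem_uIcc
    have h2 : G = fun s => (c + ∫ r in (0 : ℝ)..a, f r) + ∫ r in a..s, f r := funext hG
    rw [h2]
    have h3 : AbsolutelyContinuousOnInterval (fun _ : ℝ => c + ∫ r in (0 : ℝ)..a, f r) a b :=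
      (LipschitzWith.const _).lipschitzOnWith.absolutelyContinuousOnInterval
    exact h3.add h1
  have h1 := hac.integral_deriv_mul_eq_sub hac
  have hd : ∀ᵐ s, s ∈ uIoc a b → deriv G s * G s + G s * deriv G s = 2 * (G s * f s) := by
    filter_upwards [(hi a b).ae_hasDerivAt_integral] with s hs hsab
    have h2 := hs (uIoc_subset_uIcc hsab) a left_mem_uIcc
    have h3 : HasDerivAt G (f s) s := by
      have h2' := h2.const_add (c + ∫ r in (0 : ℝ)..a, f r)
      exact h2'.congr_of_eventuallyEq (Eventually.of_forall hG)
    rw [h3.deriv]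
    ring
  rw [intervalIntegral.integral_congr_ae hd, intervalIntegral.integral_const_mul] at h1
  rw [← sub_eq_zero] at h1 ⊢
  linarith

/-- The primitive is an integral over an extra variable r of f times the indicator of 0 < r ≤ s, and
that integrand is jointly measurable. -/
lemma aestronglyMeasurable_primitive {ν : Measure E3} [SFinite ν] {μ : Measure ℝ} [SFinite μ]
    {f : ℝ × E3 → E3} (hf : AEStronglyMeasurable f ((volume : Measure ℝ).prod ν)) :
    AEStronglyMeasurable (fun q : ℝ × E3 => ∫ r in Ioc 0 q.1, f (r, q.2)) (μ.prod ν) := by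
  have h1 : Measure.QuasiMeasurePreserving (fun p : (ℝ × E3) × ℝ => (p.2, p.1.2))
      ((μ.prod ν).prod (volume : Measure ℝ)) ((volume : Measure ℝ).prod ν) := by
    have hq : Measure.QuasiMeasurePreserving (fun p : (ℝ × E3) × ℝ => (p.1.2, p.2))
        ((μ.prod ν).prod (volume : Measure ℝ)) (ν.prod volume) := by
      have h2 : Measure.QuasiMeasurePreserving (Prod.map Prod.snd id : (ℝ × E3) × ℝ → E3 × ℝ)
          ((μ.prod ν).prod (volume : Measure ℝ)) (ν.prod volume) := by
        refine ⟨by fun_prop, ?_⟩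
        rw [← Measure.map_prod_map _ _ measurable_snd measurable_id, Measure.map_id]
        exact Measure.AbsolutelyContinuous.prod
          Measure.quasiMeasurePreserving_snd.absolutelyContinuous Measure.AbsolutelyContinuous.rfl
      exact h2
    exact (Measure.measurePreserving_swap).quasiMeasurePreserving.comp hq
  have h2 : AEStronglyMeasurable
      ({p : (ℝ × E3) × ℝ | p.2 ∈ Ioc 0 p.1.1}.indicator fun p => f (p.2, p.1.2))
      ((μ.prod ν).prod (volume : Measure ℝ)) := by
    refine (hf.comp_quasiMeasurePreserving h1).indicator ?_
    refine MeasurableSet.inter ?_ ?_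
    · exact measurableSet_lt measurable_const measurable_snd
    · exact measurableSet_le measurable_snd (measurable_fst.comp measurable_fst)
  refine h2.integral_prod_right'.congr (Eventually.of_forall fun q => ?_)
  simp only
  rw [← integral_indicator measurableSet_Ioc]
  rfl


lemma cylMeasure_eq (T : ℝ) (U : Set E3) : cylMeasure T U
    = ((volume : Measure ℝ).prod (volume.restrict U)).restrict (Ioo 0 T ×ˢ univ) := by
  rw [← Measure.prod_restrict, Measure.restrict_univ, cylMeasure]

lemma memLp_of_cyl {E : Type*} [NormedAddCommGroup E] {T : ℝ} {U : Set E3} {p : ℝ≥0∞}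
    {f : ℝ × E3 → E} (hf : MemLp f p (cylMeasure T U)) (h0 : ∀ q, q.1 ∉ Ioo 0 T → f q = 0) :
    MemLp f p ((volume : Measure ℝ).prod (volume.restrict U)) := by
  rw [cylMeasure_eq, ← memLp_indicator_iff_restrict (measurableSet_Ioo.prod MeasurableSet.univ)]
    at hf
  refine hf.ae_eq (Eventually.of_forall fun q => ?_)
  by_cases hq : q.1 ∈ Ioo 0 T
  · rw [indicator_of_mem (show q ∈ Ioo 0 T ×ˢ univ from ⟨hq, mem_univ _⟩)]
  · rw [indicator_of_notMem fun h => hq h.1, h0 q hq]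

lemma isFiniteMeasure_dom {P : Model} (hP : P.Standing) (ε : ℝ) :
    IsFiniteMeasure (volume.restrict (P.dom ε)) := ⟨by
  rw [Measure.restrict_apply_univ]
  exact (measure_mono sdiff_subset).trans_lt hP.isBounded_Ω.measure_lt_top⟩

/-- Fubini on (σ − h, σ] × ℝ³. It holds for every σ, not just almost every one, and is later applied
at a prescribed regular time. -/
lemma integral_inner_swap_timeAvg {ν : Measure E3} [IsFiniteMeasure ν] {G : ℝ × E3 → E3}
    (hG : MemLp G 2 ((volume : Measure ℝ).prod ν)) {ψ : E3 → E3} (hψ : MemLp ψ 2 ν) {h : ℝ}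
    (hh : 0 < h) (σ : ℝ) :
    ∫ s in (σ - h)..σ, ∫ x, inner ℝ (ψ x) (G (s, x)) ∂ν
      = h * ∫ x, inner ℝ (ψ x) (timeAvg h G (σ, x)) ∂ν := by
  set J := Ioc (σ - h) σ
  have hG' : MemLp G 2 ((volume.restrict J).prod ν) := by
    have e : (volume.restrict J).prod ν = ((volume : Measure ℝ).prod ν).restrict (J ×ˢ univ) := by
      rw [← Measure.prod_restrict, Measure.restrict_univ]
    rw [e]
    exact hG.restrict _
  have hψ' : MemLp (fun q : ℝ × E3 => ψ q.2) 2 ((volume.restrict J).prod ν) := hψ.comp_snd _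
  have hint := integrable_inner_of_memLp_two hψ' hG'
  have hG1 : Integrable G ((volume.restrict J).prod ν) := hG'.integrable (by norm_num)
  rw [intervalIntegral.integral_of_le (by linarith), integral_integral_swap hint,
    ← integral_const_mul]
  refine integral_congr_ae ?_
  filter_upwards [hG1.prod_left_ae] with x hx
  rw [integral_inner hx, timeAvg_eq hh, intervalIntegral.integral_of_le (by linarith),
    inner_smul_right]
  field_simp
  rfl

/-- The solution, extended by its initial values to negative times. The derivatives in the equations
are extended by zero. -/
def Fields.pad (S : Fields) (I : InitialData) (T : ℝ) : Fields where
  m s := if s ≤ 0 then I.m else S.m s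
  dtm s := if s ∈ Ioo 0 T then S.dtm s else 0
  Dm s := if s ≤ 0 then I.Dm else S.Dm s
  θ s := if s ≤ 0 then I.θ else S.θ s
  Dθ s := if s ∈ Ioo 0 T then S.Dθ s else 0
  Dlogθ s := if s ∈ Ioo 0 T then S.Dlogθ s else 0
  φ s := if s ≤ 0 then I.φ else S.φ s
  Dφ s := if s ≤ 0 then I.Dφ else S.Dφ s

/-- The flux of the heat equation. -/
def Model.flux (P : Model) (ε : ℝ) (S : Fields) (q : ℝ × E3) : E3 :=
  matVec (osc P.K ε q.2) (P.k₀ • S.Dlogθ q.1 q.2 + P.k₁ • S.Dθ q.1 q.2)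

/-- The properties of padded solutions that the energy estimate uses. -/
structure Model.Evolution (P : Model) (T ε : ℝ) (I : InitialData) (S : Fields) : Prop where
  regular_nonpos : ∀ s ≤ 0, P.RegularAt ε I S s
  regular : ∀ᵐ s ∂volume.restrict (Ioo 0 T), P.RegularAt ε I S s
  magnetization : ∀ᵐ s ∂volume.restrict (Ioo 0 T), P.MagnetizationAt ε S s
  θ_memH1 : ∀ᵐ s ∂volume.restrict (Ioo 0 T), MemH1 (P.dom ε) (S.θ s) (S.Dθ s)
  logθ_memH1 : ∀ᵐ s ∂volume.restrict (Ioo 0 T),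
    MemH1 (P.dom ε) (fun x => Real.log (S.θ s x)) (S.Dlogθ s)
  dtm_memLp : MemLp (fun q : ℝ × E3 => S.dtm q.1 q.2) 2
    ((volume : Measure ℝ).prod (volume.restrict (P.dom ε)))
  Dθ_memLp : MemLp (fun q : ℝ × E3 => S.Dθ q.1 q.2) 2
    ((volume : Measure ℝ).prod (volume.restrict (P.dom ε)))
  flux_memLp : MemLp (P.flux ε S) 2 ((volume : Measure ℝ).prod (volume.restrict (P.dom ε)))
  dtm_zero : ∀ s ∉ Ioo 0 T, S.dtm s = 0
  flux_zero : ∀ s ∉ Ioo 0 T, ∀ x, P.flux ε S (s, x) = 0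
  m_memLp : MemLp (fun q : ℝ × E3 => S.m q.1 q.2) 2 (cylMeasure T (P.dom ε))
  m_memL4 : MemLp (fun q : ℝ × E3 => S.m q.1 q.2) 4 (cylMeasure T (P.dom ε))

section

variable {P : Model} {T ε : ℝ} {I : InitialData} {S : Fields}

lemma isFiniteMeasure_cyl (hP : P.Standing) (T ε : ℝ) :
    IsFiniteMeasure (cylMeasure T (P.dom ε)) := by
  have := isFiniteMeasure_dom hP ε
  have : IsFiniteMeasure (volume.restrict (Ioo 0 T)) := ⟨by simp⟩
  rw [cylMeasure]
  infer_instance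

lemma Model.Evolution.dtm_integrable (h : P.Evolution T ε I S) (hP : P.Standing) :
    Integrable (fun q : ℝ × E3 => S.dtm q.1 q.2)
      ((volume : Measure ℝ).prod (volume.restrict (P.dom ε))) := by
  have := isFiniteMeasure_cyl hP T ε
  rw [← memLp_one_iff_integrable]
  refine memLp_of_cyl (T := T) ?_ fun q hq => by rw [h.dtm_zero q.1 hq]; rfl
  rw [memLp_one_iff_integrable]
  refine MemLp.integrable (q := 2) (by norm_num) ?_
  rw [cylMeasure_eq]
  exact h.dtm_memLp.restrict _

/-- The power of the magnetization against a function in `L⁴`. -/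
lemma Model.Evolution.power_integrable (h : P.Evolution T ε I S) (hP : P.Standing) {r : E3 → ℝ}
    (hr : MemLp r 4 (volume.restrict (P.dom ε))) :
    Integrable (fun q : ℝ × E3 => inner ℝ (S.m q.1 q.2) (S.dtm q.1 q.2) * r q.2)
      ((volume : Measure ℝ).prod (volume.restrict (P.dom ε))) := by
  have := isFiniteMeasure_dom hP ε
  have : IsFiniteMeasure (volume.restrict (Ioo 0 T)) := ⟨by simp⟩
  rw [← memLp_one_iff_integrable]
  refine memLp_of_cyl (T := T) ?_ fun q hq => by rw [h.dtm_zero q.1 hq]; simp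
  rw [memLp_one_iff_integrable]
  have h1 : MemLp (fun q : ℝ × E3 => S.dtm q.1 q.2) 2 (cylMeasure T (P.dom ε)) := by
    rw [cylMeasure_eq]; exact h.dtm_memLp.restrict _
  have h2 : MemLp (fun q : ℝ × E3 => r q.2) 4 (cylMeasure T (P.dom ε)) := hr.comp_snd _
  have i1 := h1.integrable_norm_pow (p := 2) (by norm_num)
  have i2 := h2.integrable_norm_pow (p := 4) (by norm_num)
  have i3 := h.m_memL4.integrable_norm_pow (p := 4) (by norm_num)
  refine ((i1.add i2).add i3).mono' ((h.m_memL4.1.inner h1.1).mul h2.1) ?_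
  refine Eventually.of_forall fun q => ?_
  simp only [Pi.add_apply]
  rw [norm_mul]
  have e1 := norm_inner_le_norm (𝕜 := ℝ) (S.m q.1 q.2) (S.dtm q.1 q.2)
  set a := ‖S.m q.1 q.2‖
  set b := ‖S.dtm q.1 q.2‖
  set c := ‖r q.2‖
  have ha : 0 ≤ a := norm_nonneg _
  have hb : 0 ≤ b := norm_nonneg _
  have hc : 0 ≤ c := norm_nonneg _
  refine (mul_le_mul_of_nonneg_right e1 hc).trans ?_
  -- Young's inequality twice: a b c ≤ b² + a⁴ + c⁴.
  nlinarith [sq_nonneg (b - a * c), sq_nonneg (a ^ 2 - c ^ 2), sq_nonneg b, sq_nonneg (a * c),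
    sq_nonneg (a^2), sq_nonneg (c^2)]

/-- For a.e. x the path m(·, x) agrees at a.e. time with the primitive of ∂ₜm, and each component
squared obeys the chain rule. The right side is written with the primitive so that one null set of x
serves for all a and b. -/
lemma Model.Evolution.ae_integral_power (h : P.Evolution T ε I S) (hP : P.Standing) :
    ∀ᵐ x ∂volume.restrict (P.dom ε), ∀ a b : ℝ,
      ∫ s in a..b, inner ℝ (S.m s x) (S.dtm s x)
        = (‖I.m x + ∫ s in (0 : ℝ)..b, S.dtm s x‖ ^ 2
          - ‖I.m x + ∫ s in (0 : ℝ)..a, S.dtm s x‖ ^ 2) / 2 := by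
  have hint := h.dtm_integrable hP
  have hprim : AEStronglyMeasurable (fun q : ℝ × E3 => I.m q.2 + ∫ r in Ioc 0 q.1, S.dtm r q.2)
      (cylMeasure T (P.dom ε)) := by
    have h0 : AEStronglyMeasurable I.m (volume.restrict (P.dom ε)) := by
      have h1 := (h.regular_nonpos 0 le_rfl)
      have h2 : AEStronglyMeasurable (S.m 0) (volume.restrict (P.dom ε)) := h1.m_memL4.1
      refine h2.congr ?_
      filter_upwards [h1.m_eq] with x hx
      rw [hx]; simp
    exact (AEStronglyMeasurable.comp_snd h0).add
      (aestronglyMeasurable_primitive (f := fun q => S.dtm q.1 q.2) h.dtm_memLp.1)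
  have heq := ae_prod_eq_of_ae_ae h.m_memLp.1 hprim (by
    filter_upwards [h.regular, ae_restrict_mem measurableSet_Ioo] with s hs hsT
    filter_upwards [hs.m_eq] with x hx
    rw [hx, intervalIntegral.integral_of_le hsT.1.le])
  filter_upwards [hint.prod_left_ae, ae_ae_swap_of_ae_prod heq] with x hx hxe a b
  have hx' : ∀ c, Integrable (fun s => S.dtm s x c) volume := fun c =>
    (EuclideanSpace.proj (𝕜 := ℝ) c).integrable_comp hx
  have hcoord : ∀ (t : ℝ) c, (I.m x + ∫ s in (0 : ℝ)..t, S.dtm s x) c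
      = I.m x c + ∫ s in (0 : ℝ)..t, S.dtm s x c := by
    intro t c
    have := (EuclideanSpace.proj (𝕜 := ℝ) c).intervalIntegral_comp_comm
      (hx.intervalIntegrable (a := 0) (b := t))
    rw [PiLp.add_apply]
    congr 1
    exact this.symm
  have e1 : ∫ s in a..b, inner ℝ (S.m s x) (S.dtm s x)
      = ∫ s in a..b, ∑ c, (I.m x c + ∫ r in (0 : ℝ)..s, S.dtm r x c) * S.dtm s x c := by
    refine intervalIntegral.integral_congr_ae ?_
    have hxe' := (ae_restrict_iff' measurableSet_Ioo).1 hxe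
    filter_upwards [hxe'] with s hs _
    by_cases hsT : s ∈ Ioo 0 T
    · have := hs hsT
      rw [this, ← intervalIntegral.integral_of_le hsT.1.le, PiLp.inner_apply]
      refine Finset.sum_congr rfl fun c _ => ?_
      rw [hcoord, RCLike.inner_apply, conj_trivial, mul_comm]
    · rw [h.dtm_zero s hsT]; simp
  have hcont : ∀ c, Continuous fun s => I.m x c + ∫ r in (0 : ℝ)..s, S.dtm r x c := fun c =>
    continuous_const.add (intervalIntegral.continuous_primitive
      (fun _ _ => (hx' c).intervalIntegrable) 0)
  rw [e1, intervalIntegral.integral_finsetSum fun c _ =>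
    ((hx' c).intervalIntegrable).continuousOn_mul (hcont c).continuousOn]
  simp_rw [integral_mul_primitive (hx' _)]
  rw [EuclideanSpace.norm_sq_eq, EuclideanSpace.norm_sq_eq, ← Finset.sum_sub_distrib,
    Finset.sum_div]
  refine Finset.sum_congr rfl fun c _ => ?_
  rw [hcoord, hcoord, Real.norm_eq_abs, Real.norm_eq_abs, sq_abs, sq_abs]

end


/-! ### The discrete energy inequality -/

lemma memLp_four_of_lintegral {α E : Type*} [MeasurableSpace α] [NormedAddCommGroup E]
    {ν : Measure α} {f : α → E} (hf : AEStronglyMeasurable f ν) (h : ∫⁻ x, ‖f x‖ₑ ^ 4 ∂ν ≠ ⊤) :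
    MemLp f 4 ν := by
  refine ⟨hf, ?_⟩
  rw [eLpNorm_lt_top_iff_lintegral_rpow_enorm_lt_top (by simp) (by simp)]
  simpa using h.lt_top

lemma MemH1.memLp_four {P : Model} (hP : P.Standing) {ε : ℝ} (hε : 0 < ε) {u : E3 → ℝ}
    {g : E3 → E3} (h : MemH1 (P.dom ε) u g) : MemLp u 4 (volume.restrict (P.dom ε)) := by
  obtain ⟨C, hC, hS⟩ := exists_uniform_sobolev hP
  refine memLp_four_of_lintegral h.memLp.1 ((hS ε hε u g h).trans_lt ?_).ne
  have h1 := lintegral_enorm_sq_ne_top h.memLp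
  have h2 := lintegral_enorm_sq_ne_top h.memLp_grad
  finiteness

lemma MemH1Vec.sub {U : Set E3} {u u' : E3 → E3} {g g' : E3 → Fin 3 → E3} (h : MemH1Vec U u g)
    (h' : MemH1Vec U u' g') : MemH1Vec U (fun x => u x - u' x) (fun x => g x - g' x) :=
  fun c => (h c).sub (h' c)

lemma MemH1Vec.memLp {U : Set E3} {u : E3 → E3} {g : E3 → Fin 3 → E3} (h : MemH1Vec U u g) :
    MemLp u 2 (volume.restrict U) := MemLp.of_eval_piLp fun c => (h c).memLp

section

variable {α : Type*} [MeasurableSpace α] {ν : Measure α}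

lemma integrable_pow_four {E : Type*} [NormedAddCommGroup E] {f : α → E} (hf : MemLp f 4 ν) :
    Integrable (fun x => ‖f x‖ ^ 4) ν := hf.integrable_norm_pow (p := 4) (by norm_num)

lemma integrable_norm_sq {E : Type*} [NormedAddCommGroup E] {f : α → E} (hf : MemLp f 2 ν) :
    Integrable (fun x => ‖f x‖ ^ 2) ν := hf.integrable_norm_pow (p := 2) (by norm_num)

lemma integrable_norm_sq_mul_inner {f g : α → E3} (hf : MemLp f 4 ν) (hg : MemLp g 4 ν) :
    Integrable (fun x => ‖f x‖ ^ 2 * inner ℝ (f x) (g x)) ν := by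
  refine ((integrable_pow_four hf).add (integrable_pow_four hg)).mono'
    ((hf.1.norm.pow 2).mul (hf.1.inner hg.1)) (Eventually.of_forall fun x => ?_)
  simp only [Pi.add_apply]
  rw [norm_mul, Real.norm_of_nonneg (by positivity)]
  have e1 := norm_inner_le_norm (𝕜 := ℝ) (f x) (g x)
  have ha := norm_nonneg (f x)
  have hb := norm_nonneg (g x)
  refine (mul_le_mul_of_nonneg_left e1 (by positivity)).trans ?_
  nlinarith [sq_nonneg (‖f x‖ ^ 2 - ‖f x‖ * ‖g x‖), sq_nonneg (‖f x‖ ^ 2 - ‖g x‖ ^ 2),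
    sq_nonneg (‖f x‖ ^ 2), sq_nonneg (‖g x‖ ^ 2)]

lemma integrable_mul_inner {r : α → ℝ} {f g : α → E3} (hr : MemLp r 2 ν) (hf : MemLp f 4 ν)
    (hg : MemLp g 4 ν) : Integrable (fun x => r x * inner ℝ (f x) (g x)) ν := by
  refine (((integrable_norm_sq hr).add (integrable_pow_four hf)).add
    (integrable_pow_four hg)).mono' (hr.1.mul (hf.1.inner hg.1)) (Eventually.of_forall fun x => ?_)
  simp only [Pi.add_apply]
  rw [norm_mul]
  have e1 := norm_inner_le_norm (𝕜 := ℝ) (f x) (g x)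
  have ha := norm_nonneg (f x)
  have hb := norm_nonneg (g x)
  have hc := norm_nonneg (r x)
  refine (mul_le_mul_of_nonneg_left e1 hc).trans ?_
  nlinarith [sq_nonneg (‖r x‖ - ‖f x‖ * ‖g x‖), sq_nonneg (‖f x‖ ^ 2 - ‖g x‖ ^ 2),
    sq_nonneg (‖f x‖ ^ 2), sq_nonneg (‖g x‖ ^ 2), sq_nonneg (‖r x‖), sq_nonneg (‖f x‖ * ‖g x‖)]

lemma integrable_mul_norm_sq {r : α → ℝ} {f : α → E3} (hr : MemLp r 2 ν) (hf : MemLp f 4 ν) :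
    Integrable (fun x => r x * ‖f x‖ ^ 2) ν := by
  have h := integrable_mul_inner hr hf hf
  simpa only [real_inner_self_eq_norm_sq] using h

/-- Convexity of the quadratic energy, with the derivative taken at the new state ξ, which is the
form a backward difference requires. -/
lemma integral_form_sub_le {N : α → Matrix (Fin 3) (Fin 3) ℝ} (hN : BddField ν N)
    (hs : ∀ᵐ x ∂ν, (N x).IsSymm) (h0 : ∀ᵐ x ∂ν, ∀ ξ, 0 ≤ form (N x) ξ ξ) {ξ ζ : α → E3}
    (hξ : MemLp ξ 2 ν) (hζ : MemLp ζ 2 ν) :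
    (∫ x, form (N x) (ξ x) (ξ x) ∂ν) / 2 - (∫ x, form (N x) (ζ x) (ζ x) ∂ν) / 2
      ≤ ∫ x, form (N x) (ξ x) (ξ x - ζ x) ∂ν := by
  simp_rw [form_sub_right]
  have i1 := hN.integrable_form hξ hξ
  have i2 := hN.integrable_form hζ hζ
  have i3 := hN.integrable_form hξ hζ
  rw [integral_sub i1 i3]
  have h1 : ∫ x, form (N x) (ξ x) (ζ x) ∂ν
      ≤ ∫ x, (form (N x) (ξ x) (ξ x) + form (N x) (ζ x) (ζ x)) / 2 ∂ν := by
    refine integral_mono_ae i3 ((i1.add i2).div_const 2) ?_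
    filter_upwards [hs, h0] with x hx hx0
    exact two_form_le hx hx0 _ _
  rw [integral_div, integral_add i1 i2] at h1
  linarith

lemma integral_gradForm_sub_le {N : α → Matrix (Fin 3) (Fin 3) ℝ} (hN : BddField ν N)
    (hs : ∀ᵐ x ∂ν, (N x).IsSymm) (h0 : ∀ᵐ x ∂ν, ∀ ξ, 0 ≤ form (N x) ξ ξ) {ξ ζ : α → Fin 3 → E3}
    (hξ : ∀ c, MemLp (fun x => ξ x c) 2 ν) (hζ : ∀ c, MemLp (fun x => ζ x c) 2 ν) :
    (∫ x, gradForm (N x) (ξ x) (ξ x) ∂ν) / 2 - (∫ x, gradForm (N x) (ζ x) (ζ x) ∂ν) / 2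
      ≤ ∫ x, gradForm (N x) (ξ x) (ξ x - ζ x) ∂ν := by
  have hd : ∀ c, MemLp (fun x => ξ x c - ζ x c) 2 ν := fun c => (hξ c).sub (hζ c)
  simp only [gradForm, Pi.sub_apply]
  rw [integral_finsetSum _ fun c _ => hN.integrable_form (hξ c) (hξ c),
    integral_finsetSum _ fun c _ => hN.integrable_form (hζ c) (hζ c),
    integral_finsetSum _ fun c _ => hN.integrable_form (hξ c) (hd c),
    Finset.sum_div, Finset.sum_div, ← Finset.sum_sub_distrib]
  exact Finset.sum_le_sum fun c _ => integral_form_sub_le hN hs h0 (hξ c) (hζ c)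

lemma pow_four_sub_le (a b : E3) :
    ‖a‖ ^ 4 / 4 - ‖b‖ ^ 4 / 4 ≤ ‖a‖ ^ 2 * inner ℝ a (a - b) := by
  rw [inner_sub_right, real_inner_self_eq_norm_sq]
  have e1 := real_inner_le_norm a b
  have ha := norm_nonneg a
  have hb := norm_nonneg b
  have e2 : ‖a‖ ^ 2 * inner ℝ a b ≤ ‖a‖ ^ 2 * (‖a‖ * ‖b‖) :=
    mul_le_mul_of_nonneg_left e1 (by positivity)
  nlinarith [sq_nonneg (‖a‖ ^ 2 - ‖a‖ * ‖b‖), sq_nonneg (‖a‖ ^ 2 - ‖b‖ ^ 2)]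

lemma integral_pow_four_sub_le {f g : α → E3} (hf : MemLp f 4 ν) (hg : MemLp g 4 ν) :
    (∫ x, ‖f x‖ ^ 4 ∂ν) / 4 - (∫ x, ‖g x‖ ^ 4 ∂ν) / 4
      ≤ ∫ x, ‖f x‖ ^ 2 * inner ℝ (f x) (f x - g x) ∂ν := by
  rw [← integral_div, ← integral_div, ← integral_sub ((integrable_pow_four hf).div_const 4)
    ((integrable_pow_four hg).div_const 4)]
  exact integral_mono (((integrable_pow_four hf).div_const 4).sub
    ((integrable_pow_four hg).div_const 4)) (integrable_norm_sq_mul_inner hf (hf.sub hg))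
    fun x => pow_four_sub_le _ _

end

/-- Convexity of the caloric energy as a function of the enthalpy. -/
lemma caloric_sub_le {P : Model} (hP : P.Standing) {a b : ℝ} (ha : 0 < a) (hb : 0 < b) :
    (P.c₁ * a + P.c₂ / 2 * a ^ 2) - (P.c₁ * b + P.c₂ / 2 * b ^ 2) ≤ (P.F a - P.F b) * a := by
  -- As d(c₁ θ + c₂ θ²/2) = θ dF(θ), this is a subgradient inequality with slope a. The logarithmic
  -- part is ln(b/a) ≤ b/a − 1 multiplied by a; the quadratic part has surplus c₂ (a − b)²/2.
  have h1 := Real.log_le_sub_one_of_pos (div_pos hb ha)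
  rw [Real.log_div hb.ne' ha.ne'] at h1
  have h2 : (Real.log b - Real.log a) * a ≤ b - a := by
    have := mul_le_mul_of_nonneg_right h1 ha.le
    rwa [sub_mul (b / a), div_mul_cancel₀ _ ha.ne', one_mul] at this
  simp only [Model.F]
  nlinarith [mul_le_mul_of_nonneg_left h2 hP.c₁_pos.le, mul_nonneg hP.c₂_pos.le (sq_nonneg (a - b))]

lemma integral_caloric_sub_le {P : Model} (hP : P.Standing) {ν : Measure E3} [IsFiniteMeasure ν]
    {f g : E3 → ℝ}
    (hf : MemLp f 2 ν) (hg : MemLp g 2 ν) (hf0 : ∀ᵐ x ∂ν, 0 < f x) (hg0 : ∀ᵐ x ∂ν, 0 < g x)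
    (hFf : MemLp (fun x => P.F (f x)) 2 ν) (hFg : MemLp (fun x => P.F (g x)) 2 ν) :
    (P.c₁ * (∫ x, f x ∂ν) + P.c₂ / 2 * ∫ x, f x ^ 2 ∂ν)
        - (P.c₁ * (∫ x, g x ∂ν) + P.c₂ / 2 * ∫ x, g x ^ 2 ∂ν)
      ≤ (∫ x, P.F (f x) * f x ∂ν) - ∫ x, P.F (g x) * f x ∂ν := by
  have f1 := (hf.integrable (by norm_num)).const_mul P.c₁
  have f2 := hf.integrable_sq.const_mul (P.c₂ / 2)
  have g1 := (hg.integrable (by norm_num)).const_mul P.c₁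
  have g2 := hg.integrable_sq.const_mul (P.c₂ / 2)
  have i1 := integrable_mul_of_memLp_two hFf hf
  have i2 := integrable_mul_of_memLp_two hFg hf
  have h := integral_mono_ae ((f1.add f2).sub (g1.add g2)) (i1.sub i2) (by
    filter_upwards [hf0, hg0] with x hx hx'
    have := caloric_sub_le hP hx hx'
    simp only [Pi.sub_apply, Pi.add_apply]
    linarith)
  rw [integral_sub' (f1.add f2) (g1.add g2), integral_sub' i1 i2, integral_add' f1 f2,
    integral_add' g1 g2, integral_const_mul, integral_const_mul, integral_const_mul,
    integral_const_mul] at h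
  exact h

lemma Model.energy_eq (P : Model) (ε : ℝ) (m : E3 → E3) (Dm : E3 → Fin 3 → E3) (θ : E3 → ℝ)
    (Dφ : E3 → E3) : P.energy ε m Dm θ Dφ =
      (∫ x in P.dom ε, gradForm (osc P.A ε x) (Dm x) (Dm x)) / 2
      + P.θc * ((∫ x in P.dom ε, ‖m x‖ ^ 4) / 4)
      + (P.c₁ * (∫ x in P.dom ε, θ x) + P.c₂ / 2 * ∫ x in P.dom ε, θ x ^ 2)
      + (∫ x in P.ext ε, form (osc P.μ ε x) (Dφ x) (Dφ x)) / 2 := by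
  rw [Model.energy]; ring

section

variable {P : Model} {T ε : ℝ} {I : InitialData} {S : Fields}

/-- Both magnetostatic problems are tested with the same potential φ. Their difference is the
derivative of the potential energy at φ along the increment, and convexity does the rest. -/
lemma Model.Magnetostatic.sub_le (hP : P.Standing) {m m' : E3 → E3} {φ φ' : E3 → ℝ}
    {Dφ Dφ' : E3 → E3} (h : P.Magnetostatic ε m φ Dφ) (h' : P.Magnetostatic ε m' φ' Dφ')
    (hm : MemLp m 2 (volume.restrict (P.dom ε))) (hm' : MemLp m' 2 (volume.restrict (P.dom ε))) :
    (∫ x in P.ext ε, form (osc P.μ ε x) (Dφ x) (Dφ x)) / 2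
        - (∫ x in P.ext ε, form (osc P.μ ε x) (Dφ' x) (Dφ' x)) / 2
      ≤ -∫ x in P.dom ε, inner ℝ (Dφ x) (m x - m' x) := by
  have hN := hP.coeff_μ.bddField ε (subset_univ (P.ext ε))
  have hs := hP.coeff_μ.ae_isSymm ε (subset_univ (P.ext ε))
  have h0 := hP.coeff_μ.ae_form_nonneg ε (subset_univ (P.ext ε))
  have hD := h.1.memLp_grad
  have hD' := h'.1.memLp_grad
  have hDd : MemLp Dφ 2 (volume.restrict (P.dom ε)) :=
    hD.mono_measure (Measure.restrict_mono (dom_subset_ext P ε) le_rfl)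
  have e1 := h.2 φ Dφ h.1
  have e2 := h'.2 φ Dφ h.1
  have e3 := integral_form_sub_le hN hs h0 hD hD'
  simp_rw [form_sub_right] at e3
  rw [integral_sub (hN.integrable_form hD hD) (hN.integrable_form hD hD')] at e3
  have e4 : ∫ x in P.ext ε, form (osc P.μ ε x) (Dφ x) (Dφ' x)
      = ∫ x in P.ext ε, form (osc P.μ ε x) (Dφ' x) (Dφ x) := by
    refine integral_congr_ae ?_
    filter_upwards [hs] with x hx
    exact form_comm hx _ _
  simp_rw [inner_sub_right]
  rw [integral_sub (integrable_inner_of_memLp_two hDd hm)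
    (integrable_inner_of_memLp_two hDd hm')]
  simp_rw [real_inner_comm (Dφ _)] at e1 e2
  linarith

lemma Model.Evolution.integrable_flux_inner (h : P.Evolution T ε I S) (hP : P.Standing)
    {Dr : E3 → E3} (hDr : MemLp Dr 2 (volume.restrict (P.dom ε))) :
    Integrable (fun q : ℝ × E3 => inner ℝ (P.flux ε S q) (Dr q.2))
      ((volume : Measure ℝ).prod (volume.restrict (P.dom ε))) := by
  have := isFiniteMeasure_dom hP ε
  have : IsFiniteMeasure (volume.restrict (Ioo 0 T)) := ⟨by simp⟩
  rw [← memLp_one_iff_integrable]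
  refine memLp_of_cyl (T := T) ?_ fun q hq => by rw [← Prod.mk.eta (p := q), h.flux_zero q.1 hq]; simp
  rw [memLp_one_iff_integrable]
  refine integrable_inner_of_memLp_two ?_ (hDr.comp_snd _)
  rw [cylMeasure_eq]
  exact h.flux_memLp.restrict _

/-- The heat equation between two regular times. -/
lemma Model.Evolution.heat_sub (h : P.Evolution T ε I S) (hP : P.Standing) (hε : 0 < ε) {a b : ℝ}
    (ha : P.RegularAt ε I S a) (hb : P.RegularAt ε I S b) {r : E3 → ℝ} {Dr : E3 → E3}
    (hr : MemH1 (P.dom ε) r Dr) :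
    (∫ x in P.dom ε, P.F (S.θ b x) * r x) - ∫ x in P.dom ε, P.F (S.θ a x) * r x
      = (∫ s in a..b, ∫ x in P.dom ε, inner ℝ (S.m s x) (S.dtm s x) * r x)
        - ∫ s in a..b, ∫ x in P.dom ε, inner ℝ (P.flux ε S (s, x)) (Dr x) := by
  -- Both heat identities start at time 0; subtracting them requires integrability in time. For the
  -- power term this rests on r ∈ H¹ ⊂ L⁴.
  have h1 := (h.power_integrable hP (hr.memLp_four hP hε)).integral_prod_left
  have h2 := (h.integrable_flux_inner hP hr.memLp_grad).integral_prod_left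
  have e1 := ha.heat r Dr hr
  have e2 := hb.heat r Dr hr
  simp_rw [form_eq_inner] at e1 e2
  have e3 := intervalIntegral.integral_interval_sub_left
    ((h1.sub h2).intervalIntegrable (a := 0) (b := b))
    ((h1.sub h2).intervalIntegrable (a := 0) (b := a))
  have e4 := intervalIntegral.integral_sub (h1.intervalIntegrable (a := a) (b := b))
    (h2.intervalIntegrable (a := a) (b := b))
  simp only [Pi.sub_apply] at e3
  simp only [Model.flux] at e3 e4 ⊢
  rw [e1, e2]
  linarith

/-- The power term between two regular times. -/
lemma Model.Evolution.integral_power (h : P.Evolution T ε I S) (hP : P.Standing) {a b : ℝ}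
    (hab : a ≤ b) (ha : P.RegularAt ε I S a) (hb : P.RegularAt ε I S b) {r : E3 → ℝ}
    (hr : MemLp r 4 (volume.restrict (P.dom ε))) :
    ∫ s in a..b, ∫ x in P.dom ε, inner ℝ (S.m s x) (S.dtm s x) * r x
      = ∫ x in P.dom ε, r x * ((‖S.m b x‖ ^ 2 - ‖S.m a x‖ ^ 2) / 2) := by
  have h1 := h.power_integrable hP hr
  have h2 : Integrable (fun q : ℝ × E3 => inner ℝ (S.m q.1 q.2) (S.dtm q.1 q.2) * r q.2)
      ((volume.restrict (Ioc a b)).prod (volume.restrict (P.dom ε))) := by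
    have e : (volume.restrict (Ioc a b)).prod (volume.restrict (P.dom ε))
        = ((volume : Measure ℝ).prod (volume.restrict (P.dom ε))).restrict (Ioc a b ×ˢ univ) := by
      rw [← Measure.prod_restrict, Measure.restrict_univ]
    rw [e]
    exact h1.restrict
  rw [intervalIntegral.integral_of_le hab, integral_integral_swap h2]
  refine integral_congr_ae ?_
  filter_upwards [h.ae_integral_power hP, ha.m_eq, hb.m_eq] with x hx hxa hxb
  rw [integral_mul_const, ← intervalIntegral.integral_of_le hab, hx a b, ← hxa, ← hxb, mul_comm]

/-- The increment of the magnetization. -/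
lemma Model.Evolution.ae_sub_eq (h : P.Evolution T ε I S) (hP : P.Standing) {a b : ℝ}
    (ha : P.RegularAt ε I S a) (hb : P.RegularAt ε I S b) :
    ∀ᵐ x ∂volume.restrict (P.dom ε), S.m b x - S.m a x = ∫ s in a..b, S.dtm s x := by
  filter_upwards [(h.dtm_integrable hP).prod_left_ae, ha.m_eq, hb.m_eq] with x hx hxa hxb
  rw [hxa, hxb, add_sub_add_left_eq_sub]
  exact intervalIntegral.integral_interval_sub_left hx.intervalIntegrable hx.intervalIntegrable

/-- The energy inequality for one backward step in time. -/
lemma Model.Evolution.energy_step (h : P.Evolution T ε I S) (hP : P.Standing) (hε : 0 < ε) {σ η : ℝ}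
    (hη : 0 < η) (hρ : P.RegularAt ε I S (σ - η)) (hσ : P.RegularAt ε I S σ)
    (hm : P.MagnetizationAt ε S σ) (hθ : MemH1 (P.dom ε) (S.θ σ) (S.Dθ σ)) :
    P.energyAt ε S σ - P.energyAt ε S (σ - η)
      + η * (P.γ * ∫ x in P.dom ε,
          inner ℝ (S.dtm σ x) (timeAvg η (fun q => S.dtm q.1 q.2) (σ, x)))
      + η * (∫ x in P.dom ε, inner ℝ (S.Dθ σ x) (timeAvg η (P.flux ε S) (σ, x)))
      ≤ η * (P.θc * ∫ x in P.dom ε,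
          inner ℝ (S.m σ x) (timeAvg η (fun q => S.dtm q.1 q.2) (σ, x))) := by
  have := isFiniteMeasure_dom hP ε
  set ρ := σ - η with hρdef
  have hAf := hP.coeff_A.bddField ε (U := P.dom ε) sdiff_subset
  have hAs := hP.coeff_A.ae_isSymm ε (U := P.dom ε) sdiff_subset
  have hA0 := hP.coeff_A.ae_form_nonneg ε (U := P.dom ε) sdiff_subset
  have hinc : ∀ᵐ x ∂volume.restrict (P.dom ε), S.m σ x - S.m ρ x
      = η • timeAvg η (fun q => S.dtm q.1 q.2) (σ, x) := by
    filter_upwards [h.ae_sub_eq hP hρ hσ] with x hx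
    rw [hx, timeAvg_eq hη, smul_inv_smul₀ hη.ne']
  have hinc' : ∀ v : E3 → E3, ∫ x in P.dom ε, inner ℝ (v x) (S.m σ x - S.m ρ x)
      = η * ∫ x in P.dom ε, inner ℝ (v x) (timeAvg η (fun q => S.dtm q.1 q.2) (σ, x)) := by
    intro v
    rw [← integral_const_mul]
    refine integral_congr_ae ?_
    filter_upwards [hinc] with x hx
    rw [hx, inner_smul_right]
  have hm2 := hσ.m_memH1.memLp
  have hm2' := hρ.m_memH1.memLp
  have hm4 := hσ.m_memL4
  have hm4' := hρ.m_memL4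
  -- The increment of m lies in H¹ and is admissible, whereas ∂ₜm is not.
  have e1 := hm _ _ (hσ.m_memH1.sub hρ.m_memH1)
  have e2 := integral_gradForm_sub_le hAf hAs hA0 (fun c => (hσ.m_memH1 c).memLp_grad)
    (fun c => (hρ.m_memH1 c).memLp_grad)
  have e3 := integral_pow_four_sub_le hm4 hm4'
  have e4 := integral_caloric_sub_le hP hσ.θ_memLp hρ.θ_memLp hσ.θ_pos hρ.θ_pos hσ.v_memLp
    hρ.v_memLp
  have e5 := hσ.magnetostatic.sub_le hP hρ.magnetostatic hm2 hm2'
  -- The enthalpy increment is tested with the temperature at the later time, the slope in the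
  -- convexity inequality `e4`.
  have e6 := h.heat_sub hP hε hρ hσ hθ
  rw [h.integral_power hP (by linarith) hρ hσ (hθ.memLp_four hP hε)] at e6
  have e7 : ∫ s in ρ..σ, ∫ x in P.dom ε, inner ℝ (P.flux ε S (s, x)) (S.Dθ σ x)
      = η * ∫ x in P.dom ε, inner ℝ (S.Dθ σ x) (timeAvg η (P.flux ε S) (σ, x)) := by
    rw [← integral_inner_swap_timeAvg h.flux_memLp hθ.memLp_grad hη σ]
    simp_rw [real_inner_comm (S.Dθ σ _)]
    rfl
  -- The coupling terms of the two equations differ by θ|m(σ) − m(ρ)|²/2, because |a|² − |b|² =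
  -- 2a·(a − b) − |a − b|²; positivity of θ gives the sign.
  have e8 : ∫ x in P.dom ε, S.θ σ x * ((‖S.m σ x‖ ^ 2 - ‖S.m ρ x‖ ^ 2) / 2)
      ≤ ∫ x in P.dom ε, S.θ σ x * inner ℝ (S.m σ x) (S.m σ x - S.m ρ x) := by
    refine integral_mono_ae ?_ (integrable_mul_inner hσ.θ_memLp hm4 (hm4.sub hm4')) ?_
    · have := ((integrable_mul_norm_sq hσ.θ_memLp hm4).sub
        (integrable_mul_norm_sq hσ.θ_memLp hm4')).div_const 2
      refine this.congr (Eventually.of_forall fun x => ?_)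
      simp only [Pi.sub_apply]
      ring
    · filter_upwards [hσ.θ_pos] with x hx
      refine mul_le_mul_of_nonneg_left ?_ hx.le
      have := norm_sub_sq_real (S.m σ x) (S.m ρ x)
      rw [inner_sub_right, real_inner_self_eq_norm_sq]
      nlinarith [sq_nonneg ‖S.m σ x - S.m ρ x‖]
  have e9 : ∫ x in P.dom ε, (‖S.m σ x‖ ^ 2 - 1) * inner ℝ (S.m σ x) (S.m σ x - S.m ρ x)
      = (∫ x in P.dom ε, ‖S.m σ x‖ ^ 2 * inner ℝ (S.m σ x) (S.m σ x - S.m ρ x))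
        - ∫ x in P.dom ε, inner ℝ (S.m σ x) (S.m σ x - S.m ρ x) := by
    have hd4 : MemLp (fun x => S.m σ x - S.m ρ x) 4 (volume.restrict (P.dom ε)) := hm4.sub hm4'
    have hd2 : MemLp (fun x => S.m σ x - S.m ρ x) 2 (volume.restrict (P.dom ε)) := hm2.sub hm2'
    rw [← integral_sub (integrable_norm_sq_mul_inner hm4 hd4)
      (integrable_inner_of_memLp_two hm2 hd2)]
    congr 1; ext x; ring
  rw [e9] at e1
  rw [hinc'] at e1
  rw [e7] at e6
  have e10 := hinc' (S.m σ)
  have e11 := mul_le_mul_of_nonneg_left e3 hP.θc_pos.le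
  simp only [Model.energyAt, Model.energy_eq]
  rw [hinc' (S.m σ)] at e1
  linarith

end


/-! ### The energy inequality in the limit of small steps -/

lemma integrable_integral_inner_cyl {τ : ℝ} {U : Set E3} [SFinite (volume.restrict U)]
    {f g : ℝ × E3 → E3} (hf : MemLp f 2 (cylMeasure τ U)) (hg : MemLp g 2 (cylMeasure τ U)) :
    IntegrableOn (fun s => ∫ x in U, inner ℝ (f (s, x)) (g (s, x))) (Ioo 0 τ) volume :=
  (integrable_inner_of_memLp_two hf hg).integral_prod_left

lemma integral_integral_inner_cyl {τ : ℝ} {U : Set E3} [SFinite (volume.restrict U)]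
    {f g : ℝ × E3 → E3} (hf : MemLp f 2 (cylMeasure τ U)) (hg : MemLp g 2 (cylMeasure τ U)) :
    ∫ s in Ioo 0 τ, ∫ x in U, inner ℝ (f (s, x)) (g (s, x))
      = ∫ q, inner ℝ ((Ioo 0 τ ×ˢ univ).indicator f q) (g q)
        ∂(volume : Measure ℝ).prod (volume.restrict U) := by
  have h := integral_prod _ (integrable_inner_of_memLp_two hf hg)
  have hs : MeasurableSet (Ioo 0 τ ×ˢ (univ : Set E3)) := measurableSet_Ioo.prod MeasurableSet.univ
  change ∫ z, _ ∂cylMeasure τ U = _ at h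
  rw [cylMeasure_eq, ← integral_indicator hs] at h
  refine h.symm.trans (integral_congr_ae (Eventually.of_forall fun q => ?_))
  by_cases hq : q ∈ Ioo 0 τ ×ˢ (univ : Set E3)
  · simp only [indicator_of_mem hq]
  · simp only [indicator_of_notMem hq, inner_zero_left]

lemma MemLp.cyl {E : Type*} [NormedAddCommGroup E] {τ : ℝ} {U : Set E3} {p : ℝ≥0∞} {f : ℝ × E3 → E}
    (hf : MemLp f p ((volume : Measure ℝ).prod (volume.restrict U))) :
    MemLp f p (cylMeasure τ U) := by
  rw [cylMeasure_eq]
  exact hf.restrict _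

lemma cylMeasure_mono {τ T : ℝ} (h : τ ≤ T) (U : Set E3) : cylMeasure τ U ≤ cylMeasure T U := by
  rw [cylMeasure_eq, cylMeasure_eq]
  exact Measure.restrict_mono (prod_mono (Ioo_subset_Ioo_right h) Subset.rfl) le_rfl

lemma tendsto_integral_cyl_timeAvg {τ : ℝ} {U : Set E3} [IsFiniteMeasure (volume.restrict U)]
    {f G : ℝ × E3 → E3} (hf : MemLp f 2 (cylMeasure τ U))
    (hG : MemLp G 2 ((volume : Measure ℝ).prod (volume.restrict U))) {h : ℕ → ℝ}
    (hpos : ∀ n, 0 < h n) (hh : Tendsto h atTop (𝓝 0)) :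
    Tendsto (fun n => ∫ s in Ioo 0 τ, ∫ x in U, inner ℝ (f (s, x)) (timeAvg (h n) G (s, x))) atTop
      (𝓝 (∫ s in Ioo 0 τ, ∫ x in U, inner ℝ (f (s, x)) (G (s, x)))) := by
  have hs : MeasurableSet (Ioo 0 τ ×ˢ (univ : Set E3)) := measurableSet_Ioo.prod MeasurableSet.univ
  rw [integral_integral_inner_cyl hf (MemLp.cyl hG)]
  simp_rw [fun n => integral_integral_inner_cyl hf (MemLp.cyl (memLp_timeAvg hG (hpos n)))]
  refine tendsto_integral_inner_timeAvg hG ?_ hpos hh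
  rw [cylMeasure_eq] at hf
  exact (memLp_indicator_iff_restrict hs).2 hf

/-- Overlapping parts of the two integrals cancel. Since E is constant at negative times, the
boundary term at 0 is exactly η E₀. -/
lemma integral_sub_shift {E : ℝ → ℝ} {τ η E₀ : ℝ} (hη : 0 < η) (hτ : 0 < τ)
    (hE : IntegrableOn E (Ioo 0 τ) volume) (hE0 : ∀ s ≤ 0, E s = E₀) :
    IntegrableOn (fun σ => E (σ - η)) (Ioo 0 τ) volume ∧
      ∫ σ in Ioo 0 τ, (E σ - E (σ - η)) = (∫ σ in (τ - η)..τ, E σ) - η * E₀ := by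
  have h1 : IntervalIntegrable E volume 0 τ := by
    rw [intervalIntegrable_iff_integrableOn_Ioo_of_le hτ.le]
    exact hE
  have h0 : ∀ a ≤ 0, IntervalIntegrable E volume a 0 := fun a ha => by
    refine (intervalIntegrable_const (c := E₀)).congr ?_
    rw [uIoc_of_le ha]
    exact fun s hs => (hE0 s hs.2).symm
  have h2 : IntervalIntegrable E volume (-η) τ := (h0 (-η) (by linarith)).trans h1
  have hmem : ∀ a ∈ Icc (-η) τ, ∀ b ∈ Icc (-η) τ, IntervalIntegrable E volume a b := by
    intro a ha b hb
    refine h2.mono_set ?_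
    rw [uIcc_of_le (by linarith : -η ≤ τ)]
    exact uIcc_subset_Icc ha hb
  have m1 : -η ∈ Icc (-η) τ := ⟨le_rfl, by linarith⟩
  have m2 : (0 : ℝ) ∈ Icc (-η) τ := ⟨by linarith, hτ.le⟩
  have m3 : τ - η ∈ Icc (-η) τ := ⟨by linarith, by linarith⟩
  have m4 : τ ∈ Icc (-η) τ := ⟨by linarith, le_rfl⟩
  have h3 : IntervalIntegrable (fun σ => E (σ - η)) volume 0 τ := by
    have := (hmem _ m1 _ m3).comp_sub_right η
    simpa using this
  refine ⟨(intervalIntegrable_iff_integrableOn_Ioo_of_le hτ.le).1 h3, ?_⟩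
  rw [← integral_Ioc_eq_integral_Ioo, ← intervalIntegral.integral_of_le hτ.le,
    intervalIntegral.integral_sub h1 h3, intervalIntegral.integral_comp_sub_right (fun s => E s) η,
    zero_sub]
  have e1 := intervalIntegral.integral_add_adjacent_intervals (hmem _ m1 _ m2) (hmem _ m2 _ m4)
  have e2 := intervalIntegral.integral_add_adjacent_intervals (hmem _ m1 _ m3) (hmem _ m3 _ m4)
  have e3 : ∫ s in (-η)..0, E s = η * E₀ := by
    rw [intervalIntegral.integral_congr (g := fun _ => E₀) fun s hs => ?_]
    · simp
    · rw [uIcc_of_le (by linarith)] at hs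
      exact hE0 s hs.2
  linarith

section

variable {P : Model} {T ε : ℝ} {I : InitialData} {S : Fields}

lemma Model.Evolution.ae_regular (h : P.Evolution T ε I S) :
    ∀ᵐ s : ℝ, s < T → P.RegularAt ε I S s := by
  filter_upwards [(ae_restrict_iff' measurableSet_Ioo).1 h.regular] with s hs hsT
  rcases le_or_gt s 0 with h0 | h0
  · exact h.regular_nonpos s h0
  · exact hs ⟨h0, hsT⟩

/-- Integrate `Model.Evolution.energy_step` over (0, τ) and divide by η. The energy differences
leave the mean over (τ − η, τ), which is at least c, minus E₀. -/
lemma Model.Evolution.averaged_step (h : P.Evolution T ε I S) (hP : P.Standing) (hε : 0 < ε)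
    {τ η E₀ c : ℝ} (hη : 0 < η) (hτ : τ ∈ Ioo 0 T)
    (hE : IntegrableOn (P.energyAt ε S) (Ioo 0 T) volume)
    (hE0 : ∀ s ≤ 0, P.energyAt ε S s = E₀)
    (hc : ∀ σ ∈ Ioo (τ - η) τ, P.RegularAt ε I S σ → c ≤ P.energyAt ε S σ) :
    c - E₀ + P.γ * (∫ s in Ioo 0 τ, ∫ x in P.dom ε,
          inner ℝ (S.dtm s x) (timeAvg η (fun q => S.dtm q.1 q.2) (s, x)))
      + (∫ s in Ioo 0 τ, ∫ x in P.dom ε, inner ℝ (S.Dθ s x) (timeAvg η (P.flux ε S) (s, x)))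
      ≤ P.θc * ∫ s in Ioo 0 τ, ∫ x in P.dom ε,
          inner ℝ (S.m s x) (timeAvg η (fun q => S.dtm q.1 q.2) (s, x)) := by
  have := isFiniteMeasure_dom hP ε
  have hsub : Ioo 0 τ ⊆ Ioo 0 T := Ioo_subset_Ioo_right hτ.2.le
  have a1 := memLp_timeAvg h.dtm_memLp hη
  have a2 := memLp_timeAvg h.flux_memLp hη
  have hm : MemLp (fun q : ℝ × E3 => S.m q.1 q.2) 2 (cylMeasure τ (P.dom ε)) :=
    h.m_memLp.mono_measure (cylMeasure_mono hτ.2.le _)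
  have i1 := integrable_integral_inner_cyl (τ := τ) (MemLp.cyl h.dtm_memLp) (MemLp.cyl a1)
  have i2 := integrable_integral_inner_cyl (τ := τ) (MemLp.cyl h.Dθ_memLp) (MemLp.cyl a2)
  have i3 := integrable_integral_inner_cyl (τ := τ) hm (MemLp.cyl a1)
  have hEτ := hE.mono_set hsub
  obtain ⟨i4, e4⟩ := integral_sub_shift hη hτ.1 hEτ hE0
  have hreg := h.ae_regular
  -- Shifts preserve null sets, and every nonpositive time is regular, so σ − η is regular for
  -- almost every σ.
  have hreg' : ∀ᵐ s : ℝ, s - η < T → P.RegularAt ε I S (s - η) :=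
    (measurePreserving_sub_right volume η).quasiMeasurePreserving.ae hreg
  have hstep : ∀ᵐ σ ∂volume.restrict (Ioo 0 τ),
      (P.energyAt ε S σ - P.energyAt ε S (σ - η))
      + η * (P.γ * ∫ x in P.dom ε,
          inner ℝ (S.dtm σ x) (timeAvg η (fun q => S.dtm q.1 q.2) (σ, x)))
      + η * (∫ x in P.dom ε, inner ℝ (S.Dθ σ x) (timeAvg η (P.flux ε S) (σ, x)))
      ≤ η * (P.θc * ∫ x in P.dom ε,
          inner ℝ (S.m σ x) (timeAvg η (fun q => S.dtm q.1 q.2) (σ, x))) := by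
    have hle : volume.restrict (Ioo 0 τ) ≤ volume.restrict (Ioo 0 T) :=
      Measure.restrict_mono hsub le_rfl
    filter_upwards [ae_mono hle h.magnetization, ae_mono hle h.θ_memH1, ae_mono hle h.regular,
      ae_restrict_of_ae hreg', ae_restrict_mem measurableSet_Ioo] with σ h1 h2 h3 h4 h5
    exact h.energy_step hP hε hη (h4 (by linarith [h5.2, hτ.2])) h3 h1 h2
  have hint := integral_mono_ae (((hEτ.sub i4).add ((i1.const_mul P.γ).const_mul η)).add
    (i2.const_mul η)) ((i3.const_mul P.θc).const_mul η) hstep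
  rw [integral_add' ((hEτ.sub i4).add ((i1.const_mul P.γ).const_mul η)) (i2.const_mul η),
    integral_add' (hEτ.sub i4) ((i1.const_mul P.γ).const_mul η), integral_const_mul,
    integral_const_mul, integral_const_mul, integral_const_mul, integral_const_mul] at hint
  have e4' : ∫ σ in Ioo 0 τ, (P.energyAt ε S - fun σ => P.energyAt ε S (σ - η)) σ
      = (∫ σ in (τ - η)..τ, P.energyAt ε S σ) - η * E₀ := e4
  rw [e4'] at hint
  have hIE : IntervalIntegrable (P.energyAt ε S) volume (τ - η) τ := by
    rw [intervalIntegrable_iff_integrableOn_Ioo_of_le (by linarith)]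
    refine (((integrableOn_const (C := E₀) (s := Ioc (τ - η) 0) (μ := volume)
      (by simp)).congr_fun (fun s hs => (hE0 s hs.2).symm) measurableSet_Ioc).union
      hEτ).mono_set ?_
    intro s hs
    rcases le_or_gt s 0 with h0 | h0
    · exact Or.inl ⟨hs.1, h0⟩
    · exact Or.inr ⟨h0, hs.2⟩
  have hlow : η * c ≤ ∫ σ in (τ - η)..τ, P.energyAt ε S σ := by
    have h1 : ∫ _σ in (τ - η)..τ, c = η * c := by simp
    rw [← h1]
    refine intervalIntegral.integral_mono_ae_restrict (by linarith) intervalIntegrable_const hIE ?_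
    have hne : ∀ᵐ s : ℝ, s ≠ τ - η ∧ s ≠ τ := by
      filter_upwards [measure_eq_zero_iff_ae_notMem.1 (measure_singleton (μ := volume) (τ - η)),
        measure_eq_zero_iff_ae_notMem.1 (measure_singleton (μ := volume) τ)] with s h1 h2
      exact ⟨h1, h2⟩
    rw [EventuallyLE, ae_restrict_iff' measurableSet_Icc]
    filter_upwards [hreg, hne] with s hs hn hsI
    have hlt : s < τ := lt_of_le_of_ne hsI.2 hn.2
    exact hc s ⟨lt_of_le_of_ne hsI.1 (Ne.symm hn.1), hlt⟩ (hs (hlt.trans hτ.2))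
  refine le_of_mul_le_mul_left ?_ hη
  rw [mul_add, mul_add, mul_sub]
  linarith

/-- The energy inequality, given a lower bound of the energy at the times before `τ`. -/
lemma Model.Evolution.energy_le_of_lower_bound (h : P.Evolution T ε I S) (hP : P.Standing)
    (hε : 0 < ε) {τ E₀ c : ℝ} (hτ : τ ∈ Ioo 0 T) (hτr : P.RegularAt ε I S τ)
    (hE : IntegrableOn (P.energyAt ε S) (Ioo 0 T) volume)
    (hE0 : ∀ s ≤ 0, P.energyAt ε S s = E₀)
    (hc : ∀ᶠ σ in 𝓝[<] τ, P.RegularAt ε I S σ → c ≤ P.energyAt ε S σ) :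
    c + P.γ * (∫ s in Ioo 0 τ, ∫ x in P.dom ε, ‖S.dtm s x‖ ^ 2)
      + (∫ s in Ioo 0 τ, ∫ x in P.dom ε, inner ℝ (S.Dθ s x) (P.flux ε S (s, x)))
      ≤ E₀ + P.θc / 2 * ((∫ x in P.dom ε, ‖S.m τ x‖ ^ 2) - ∫ x in P.dom ε, ‖S.m 0 x‖ ^ 2) := by
  have := isFiniteMeasure_dom hP ε
  have hm : MemLp (fun q : ℝ × E3 => S.m q.1 q.2) 2 (cylMeasure τ (P.dom ε)) :=
    h.m_memLp.mono_measure (cylMeasure_mono hτ.2.le _)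
  set η : ℕ → ℝ := fun n => 1 / ((n : ℝ) + 1)
  have hη : ∀ n, 0 < η n := fun n => Nat.one_div_pos_of_nat
  have hη0 : Tendsto η atTop (𝓝 0) := tendsto_one_div_add_atTop_nhds_zero_nat
  have t1 := tendsto_integral_cyl_timeAvg (MemLp.cyl (τ := τ) h.dtm_memLp) h.dtm_memLp hη hη0
  have t2 := tendsto_integral_cyl_timeAvg (MemLp.cyl (τ := τ) h.Dθ_memLp) h.flux_memLp hη hη0
  have t3 := tendsto_integral_cyl_timeAvg hm h.dtm_memLp hη hη0
  obtain ⟨δ, hδ, hδc⟩ : ∃ δ > 0, ∀ σ ∈ Ioo (τ - δ) τ, P.RegularAt ε I S σ →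
      c ≤ P.energyAt ε S σ := by
    obtain ⟨l, hl, hlc⟩ := (mem_nhdsLT_iff_exists_Ioo_subset).1 hc
    exact ⟨τ - l, sub_pos.2 hl, fun σ hσ => hlc (by rwa [sub_sub_cancel] at hσ)⟩
  have hlim := le_of_tendsto_of_tendsto ((t1.const_mul P.γ).const_add (c - E₀) |>.add t2)
    (t3.const_mul P.θc) (by
      filter_upwards [hη0.eventually (gt_mem_nhds hδ)] with n hn
      exact h.averaged_step hP hε (hη n) hτ hE hE0 fun σ hσ =>
        hδc σ ⟨by linarith [hσ.1], hσ.2⟩)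
  -- With weight 1 the power identity evaluates the limit of the right-hand side.
  have e1 := h.integral_power hP hτ.1.le (h.regular_nonpos 0 le_rfl) hτr
    (r := fun _ => 1) (memLp_const 1)
  have hm2 := integrable_norm_sq hτr.m_memH1.memLp
  have hm20 := integrable_norm_sq (h.regular_nonpos 0 le_rfl).m_memH1.memLp
  simp only [mul_one, one_mul] at e1
  rw [intervalIntegral.integral_of_le hτ.1.le, integral_Ioc_eq_integral_Ioo, integral_div,
    integral_sub hm2 hm20] at e1
  simp only [real_inner_self_eq_norm_sq] at hlim
  rw [e1] at hlim
  linarith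

end


/-! ### Approximation by smooth functions -/

lemma integral_norm_sq_le_of_lintegral {α E : Type*} [MeasurableSpace α] [NormedAddCommGroup E]
    {ν : Measure α} {f : α → E} (hf : AEStronglyMeasurable f ν) {d : ℝ} (hd : 0 ≤ d)
    (h : ∫⁻ x, ‖f x‖ₑ ^ 2 ∂ν ≤ ENNReal.ofReal d) : ∫ x, ‖f x‖ ^ 2 ∂ν ≤ d := by
  rw [integral_eq_lintegral_of_nonneg_ae (Eventually.of_forall fun x => by positivity)
    (show AEStronglyMeasurable (fun x => ‖f x‖ ^ 2) ν from hf.norm.pow 2)]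
  refine ENNReal.toReal_le_of_le_ofReal hd (le_trans (le_of_eq ?_) h)
  refine lintegral_congr fun x => ?_
  rw [ENNReal.ofReal_pow (norm_nonneg _), ofReal_norm]

lemma exists_mem_core {U : Set E3} (hU : IsOpen U) {x : E3} (hx : x ∈ U) :
    ∀ᶠ n : ℕ in atTop, x ∈ core U (1 / ((n : ℝ) + 1)) := by
  obtain ⟨r, hr, hrU⟩ := Metric.isOpen_iff.1 hU x hx
  filter_upwards [tendsto_one_div_add_atTop_nhds_zero_nat.eventually (gt_mem_nhds hr)] with n hn
  exact (Metric.ball_subset_ball hn.le).trans hrU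

/-- Test functions are dense in `L²(U)`. -/
lemma exists_contDiff_integral_sub_le {E : Type*} [NormedAddCommGroup E] [NormedSpace ℝ E]
    [CompleteSpace E] {U : Set E3} (hU : IsOpen U) (hb : Bornology.IsBounded U) {w : E3 → E}
    (hw : MemLp w 2 (volume.restrict U)) {d : ℝ} (hd : 0 < d) :
    ∃ χ : E3 → E, ContDiff ℝ (⊤ : ℕ∞) χ ∧ HasCompactSupport χ ∧ tsupport χ ⊆ U ∧
      MemLp χ 2 (volume.restrict U) ∧ ∫ x in U, ‖w x - χ x‖ ^ 2 ≤ d := by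
  set K : ℕ → Set E3 := fun n => core U (1 / ((n : ℝ) + 1))
  have hpos : ∀ n : ℕ, (0 : ℝ) < 1 / ((n : ℝ) + 1) := fun n => Nat.one_div_pos_of_nat
  have hKU : ∀ n, K n ⊆ U := fun n => core_subset (hpos n)
  have hKm : ∀ n, MeasurableSet (K n) := fun n => measurableSet_core U _
  -- Restriction to a compact core costs little in L² and leaves room to mollify without leaving
  -- `U`. Each of the two errors is made at most d/4, and the square of their sum costs a factor 2.
  have htrunc : Tendsto (fun n => ∫⁻ x in U, ‖w x - (K n).indicator w x‖ₑ ^ 2) atTop (𝓝 0) := by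
    have hlim := tendsto_lintegral_of_dominated_convergence' (μ := volume.restrict U)
      (F := fun n x => ‖w x - (K n).indicator w x‖ₑ ^ 2) (f := fun _ => 0)
      (fun x => ‖w x‖ₑ ^ 2) (fun n => ((hw.1.sub (hw.1.indicator (hKm n))).enorm.pow_const 2))
      (fun n => Eventually.of_forall fun x => ?_) (lintegral_enorm_sq_ne_top hw) ?_
    · simpa using hlim
    · simp only
      by_cases hx : x ∈ K n
      · rw [indicator_of_mem hx]; simp
      · rw [indicator_of_notMem hx, sub_zero]
    · filter_upwards [ae_restrict_mem hU.measurableSet] with x hx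
      refine tendsto_const_nhds.congr' ?_
      filter_upwards [exists_mem_core hU hx] with n hn
      rw [indicator_of_mem hn]; simp
  have hd4 : (0 : ℝ≥0∞) < ENNReal.ofReal (d / 4) := ENNReal.ofReal_pos.2 (by linarith)
  obtain ⟨N, hN⟩ := ((ENNReal.tendsto_nhds_zero.1 htrunc) _ hd4).exists
  set w₁ := (K N).indicator w
  have hw₁ : MemLp w₁ 2 volume := by
    rw [memLp_indicator_iff_restrict (hKm N)]
    exact hw.mono_measure (Measure.restrict_mono (hKU N) le_rfl)
  have hKc : IsCompact (K N) := isCompact_core hb (hpos N)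
  obtain ⟨δ, hδ, hδU⟩ := hKc.exists_cthickening_subset_open hU (hKU N)
  obtain ⟨n, hn1, hn2⟩ := (((ENNReal.tendsto_nhds_zero.1
    (tendsto_lintegral_moll_sub_sq hw₁ tendsto_bump)) _ hd4).and
    (tendsto_bump.eventually (gt_mem_nhds hδ))).exists
  set χ := moll (bump n) w₁ with hχ
  have hχd : ContDiff ℝ (⊤ : ℕ∞) χ := contDiff_moll (locallyIntegrable_of_memLp_two hw₁) (bump n)
  have hsupp : tsupport χ ⊆ Metric.cthickening δ (K N) := by
    refine closure_minimal (fun x hx => ?_) Metric.isClosed_cthickening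
    by_contra hxn
    refine hx ?_
    have h1 := enorm_moll_le (bump n) w₁ x
    have h2 : ∫⁻ t, ‖w₁ (x - t)‖ₑ ∂bumpMeasure (bump n) = 0 := by
      refine (lintegral_congr_ae ?_).trans lintegral_zero
      filter_upwards [ae_bumpMeasure (bump n)] with t ht
      have : x - t ∉ K N := fun h => hxn <| Metric.mem_cthickening_of_dist_le x (x - t) δ (K N) h
        (by rw [dist_eq_norm, sub_sub_cancel]; linarith)
      simp only [w₁, indicator_of_notMem this, enorm_zero]
    rw [h2] at h1
    exact enorm_eq_zero.1 (le_antisymm h1 zero_le)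
  have hχc : HasCompactSupport χ := hKc.cthickening.of_isClosed_subset (isClosed_tsupport _) hsupp
  have hχL : MemLp χ 2 (volume.restrict U) :=
    (hχd.continuous.memLp_of_hasCompactSupport hχc).restrict U
  refine ⟨χ, hχd, hχc, hsupp.trans hδU, hχL, ?_⟩
  refine integral_norm_sq_le_of_lintegral (hw.1.sub hχL.1) hd.le ?_
  calc ∫⁻ x in U, ‖w x - χ x‖ₑ ^ 2
      ≤ ∫⁻ x in U, 2 * (‖w x - w₁ x‖ₑ ^ 2 + ‖χ x - w₁ x‖ₑ ^ 2) := by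
        refine lintegral_mono fun x => ?_
        refine le_trans ?_ (add_sq_le_two _ _)
        refine pow_le_pow_left' ?_ 2
        have h1 := enorm_add_le (w x - w₁ x) (w₁ x - χ x)
        rwa [sub_add_sub_cancel, ← enorm_neg (w₁ x - χ x), neg_sub] at h1
    _ = 2 * ((∫⁻ x in U, ‖w x - w₁ x‖ₑ ^ 2) + ∫⁻ x in U, ‖χ x - w₁ x‖ₑ ^ 2) := by
        have hm : AEMeasurable (fun x => ‖w x - w₁ x‖ₑ ^ 2) (volume.restrict U) :=
          (hw.1.sub (hw.1.indicator (hKm N))).enorm.pow_const 2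
        rw [lintegral_const_mul' _ _ (by norm_num), lintegral_add_left' hm]
    _ ≤ 2 * (ENNReal.ofReal (d / 4) + ENNReal.ofReal (d / 4)) :=
        mul_le_mul_right (add_le_add hN ((setLIntegral_le_lintegral _ _).trans hn1)) _
    _ = ENNReal.ofReal d := by
        rw [← ENNReal.ofReal_add (by linarith) (by linarith),
          show (2 : ℝ≥0∞) = ENNReal.ofReal 2 by simp, ← ENNReal.ofReal_mul (by norm_num)]
        congr 1; ring

/-- Above the floor β² one has ln r ≥ 2 ln β ≥ −2/β. So F(r)² grows only like β⁻² as the floor is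
lowered, slowly enough for the weight β³ used in `enthalpy_gap_le`. -/
lemma F_sq_le {P : Model} (hP : P.Standing) {r β : ℝ} (hβ : 0 < β) (hr : β ^ 2 ≤ r) :
    P.F r ^ 2 ≤ 2 * (P.c₁ + P.c₂) ^ 2 * r ^ 2 + 8 * P.c₁ ^ 2 / β ^ 2 := by
  have hr0 : 0 < r := lt_of_lt_of_le (by positivity) hr
  have h1 : Real.log r ≤ r := (Real.log_le_sub_one_of_pos hr0).trans (by linarith)
  have h2 : -(2 / β) ≤ Real.log r := by
    have h3 := Real.one_sub_inv_le_log_of_pos hβ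
    have h4 := Real.log_le_log (by positivity) hr
    rw [Real.log_pow] at h4
    push_cast at h4
    have : 2 / β = 2 * β⁻¹ := rfl
    linarith
  have hc1 := hP.c₁_pos
  have hc2 := hP.c₂_pos
  have hw : 0 < 2 / β := by positivity
  have h3 : |P.F r| ≤ (P.c₁ + P.c₂) * r + P.c₁ * (2 / β) := by
    rw [abs_le, Model.F]
    constructor <;> nlinarith [mul_pos hc1 hw, mul_pos hc1 hr0, mul_pos hc2 hr0]
  rw [← sq_abs]
  refine (pow_le_pow_left₀ (abs_nonneg _) h3 2).trans ?_
  have : 8 * P.c₁ ^ 2 / β ^ 2 = 2 * (P.c₁ * (2 / β)) ^ 2 := by field_simp; ring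
  rw [this]
  nlinarith [sq_nonneg ((P.c₁ + P.c₂) * r - P.c₁ * (2 / β))]

/-- Young's inequality with weight β³. The first part contains β³ F(r)², of order β; the second
contains β⁻³(t − r)², of order β once (t − y)² has integral at most β⁴ and r is within β² of |y|. -/
lemma enthalpy_gap_le {P : Model} (hP : P.Standing) {t β : ℝ} (ht : 0 < t) (hβ : 0 < β) {y r : ℝ}
    (hrsq : r ^ 2 = y ^ 2 + (β ^ 2) ^ 2) (hrβ : β ^ 2 ≤ r) (hrχ : |y| ≤ r ∧ r ≤ |y| + β ^ 2) {c : ℝ}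
    (hc : c = P.c₁ + P.c₂) :
    (P.F t - P.F r) * (t - r) ≤ β ^ 3 * P.F t ^ 2 + (4 * c ^ 2 * β ^ 3) * t ^ 2
        + (4 * c ^ 2 * β ^ 3 + 1 / β ^ 3) * (t - y) ^ 2
        + (2 * c ^ 2 * β ^ 7 + 8 * P.c₁ ^ 2 * β + β) := by
  rw [hc]
  have a1 := F_sq_le hP hβ hrβ
  rw [hrsq] at a1
  have a2 : (t - r) ^ 2 ≤ 2 * (t - y) ^ 2 + 2 * (β ^ 2) ^ 2 := by
    have b1 : |t - r| ≤ |t - y| + β ^ 2 := by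
      have b2 : abs (t - abs y) ≤ |t - y| := by
        have := abs_abs_sub_abs_le (t) (y)
        rwa [abs_of_pos ht] at this
      have b3 : |t - r| ≤ abs (t - abs y) + abs (abs y - r) := abs_sub_le _ _ _
      have b4 : abs (abs y - r) ≤ β ^ 2 := by
        rw [abs_le]; constructor <;> linarith [hrχ.1, hrχ.2, sq_nonneg β]
      linarith
    have b5 := pow_le_pow_left₀ (abs_nonneg _) b1 2
    rw [sq_abs] at b5
    nlinarith [sq_nonneg (|t - y| - β ^ 2), sq_abs (t - y)]
  have a3 : y ^ 2 ≤ 2 * t ^ 2 + 2 * (t - y) ^ 2 := by nlinarith [sq_nonneg (y - 2 * t)]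
  have a4 : (P.F (t) - P.F (r)) ^ 2 ≤ 2 * P.F (t) ^ 2 + 2 * P.F (r) ^ 2 := by
    nlinarith [sq_nonneg (P.F (t) + P.F (r))]
  have a5 : (P.F (t) - P.F (r)) * (t - r)
      ≤ β ^ 3 / 2 * (P.F (t) - P.F (r)) ^ 2 + 1 / (2 * β ^ 3) * (t - r) ^ 2 := by
    have h0 : 0 ≤ 1 / (2 * β ^ 3) * (β ^ 3 * (P.F (t) - P.F (r)) - (t - r)) ^ 2 := by
      positivity
    have h1 : 1 / (2 * β ^ 3) * (β ^ 3 * (P.F (t) - P.F (r)) - (t - r)) ^ 2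
        = β ^ 3 / 2 * (P.F (t) - P.F (r)) ^ 2 + 1 / (2 * β ^ 3) * (t - r) ^ 2
          - (P.F (t) - P.F (r)) * (t - r) := by field_simp; ring
    linarith
  have a6 : P.F (r) ^ 2 ≤ 2 * (P.c₁ + P.c₂) ^ 2 * (2 * t ^ 2 + 2 * (t - y) ^ 2 + (β ^ 2) ^ 2)
      + 8 * P.c₁ ^ 2 / β ^ 2 := by
    refine a1.trans ?_
    have := mul_le_mul_of_nonneg_left a3 (by positivity : (0 : ℝ) ≤ 2 * (P.c₁ + P.c₂) ^ 2)
    linarith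
  have a7 := mul_le_mul_of_nonneg_left (a4.trans (add_le_add le_rfl
    (mul_le_mul_of_nonneg_left a6 (by norm_num : (0 : ℝ) ≤ 2))))
    (by positivity : 0 ≤ β ^ 3 / 2)
  have a8 := mul_le_mul_of_nonneg_left a2 (by positivity : 0 ≤ 1 / (2 * β ^ 3))
  have e1 : β ^ 3 / 2 * (2 * P.F (t) ^ 2 + 2 * (2 * (P.c₁ + P.c₂) ^ 2 * (2 * t ^ 2 + 2 * (t - y) ^ 2
      + (β ^ 2) ^ 2) + 8 * P.c₁ ^ 2 / β ^ 2))
      = β ^ 3 * P.F (t) ^ 2 + (4 * (P.c₁ + P.c₂) ^ 2 * β ^ 3) * t ^ 2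
        + (4 * (P.c₁ + P.c₂) ^ 2 * β ^ 3) * (t - y) ^ 2 + (2 * (P.c₁ + P.c₂) ^ 2 * β ^ 7 + 8 * P.c₁ ^ 2 * β) := by
    field_simp; ring
  have e2 : 1 / (2 * β ^ 3) * (2 * (t - y) ^ 2 + 2 * (β ^ 2) ^ 2)
      = 1 / β ^ 3 * (t - y) ^ 2 + β := by field_simp
  linarith

/-- The temperature at a regular time is approximated by smooth functions. -/
lemma exists_smooth_temperature {P : Model} (hP : P.Standing) {ε : ℝ} (hε : 0 < ε) {θ : E3 → ℝ}
    (hθ : MemLp θ 2 (volume.restrict (P.dom ε)))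
    (hθ0 : ∀ᵐ x ∂volume.restrict (P.dom ε), 0 < θ x)
    (hF : MemLp (fun x => P.F (θ x)) 2 (volume.restrict (P.dom ε))) {κ : ℝ} (hκ : 0 < κ) :
    ∃ r : E3 → ℝ, ContDiff ℝ 1 r ∧ (∀ x, 0 < r x) ∧
      MemLp (fun x => P.F (r x)) 2 (volume.restrict (P.dom ε)) ∧
      ∫ x in P.dom ε, (P.F (θ x) - P.F (r x)) * (θ x - r x) ≤ κ := by
  have := isFiniteMeasure_dom hP ε
  have hb : Bornology.IsBounded (P.dom ε) := hP.isBounded_Ω.subset sdiff_subset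
  set V := (volume.restrict (P.dom ε)).real univ
  set Θ := ∫ x in P.dom ε, θ x ^ 2
  set Φ := ∫ x in P.dom ε, P.F (θ x) ^ 2
  set c := P.c₁ + P.c₂
  set K := 2 * Φ + 4 * c ^ 2 * (2 * Θ + 2 + V) + 16 * P.c₁ ^ 2 * V with hK
  have hV : 0 ≤ V := measureReal_nonneg
  have hΘ : 0 ≤ Θ := integral_nonneg fun x => by positivity
  have hΦ : 0 ≤ Φ := integral_nonneg fun x => by positivity
  have hK0 : 0 ≤ K := by positivity
  -- For β ≤ 1 all powers of β in the integrated gap are at most β, and the total is at most β (K +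
  -- 1 + V).
  set β := min 1 (κ / (K + 1 + V))
  have hβ : 0 < β := lt_min one_pos (by positivity)
  have hβ1 : β ≤ 1 := min_le_left _ _
  have hβκ : β * (K + 1 + V) ≤ κ := by
    have := min_le_right 1 (κ / (K + 1 + V))
    rwa [le_div_iff₀ (by positivity)] at this
  obtain ⟨χ, hχd, hχc, _, hχL, hχ⟩ := exists_contDiff_integral_sub_le (isOpen_dom hP hε) hb hθ
    (d := β ^ 4) (by positivity)
  -- A smooth positive substitute for |χ|: at least β² and within β² of |χ|. Since θ > 0, replacing
  -- χ by |χ| does not increase the distance to θ.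
  set r : E3 → ℝ := fun x => Real.sqrt (χ x ^ 2 + (β ^ 2) ^ 2)
  have hpos : ∀ x, 0 < χ x ^ 2 + (β ^ 2) ^ 2 := fun x => by positivity
  have hr0 : ∀ x, 0 < r x := fun x => Real.sqrt_pos.2 (hpos x)
  have hrsq : ∀ x, r x ^ 2 = χ x ^ 2 + (β ^ 2) ^ 2 := fun x => Real.sq_sqrt (hpos x).le
  have hrβ : ∀ x, β ^ 2 ≤ r x := fun x => Real.le_sqrt_of_sq_le (by nlinarith [sq_nonneg (χ x)])
  have hrχ : ∀ x, |χ x| ≤ r x ∧ r x ≤ |χ x| + β ^ 2 := fun x => by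
    constructor
    · exact Real.le_sqrt_of_sq_le (by rw [sq_abs]; nlinarith [sq_nonneg (β ^ 2)])
    · refine Real.sqrt_le_iff.2 ⟨by positivity, ?_⟩
      nlinarith [sq_abs (χ x), abs_nonneg (χ x), sq_nonneg β]
  have hrd : ContDiff ℝ 1 r :=
    (((hχd.of_le (by exact_mod_cast le_top)).pow 2).add contDiff_const).sqrt fun x => (hpos x).ne'
  have hrL : MemLp r 2 (volume.restrict (P.dom ε)) := memLp_two_of_continuous hb hrd.continuous
  have hFr : MemLp (fun x => P.F (r x)) 2 (volume.restrict (P.dom ε)) := by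
    refine memLp_two_of_continuous hb ?_
    exact (continuous_const.mul (hrd.continuous.log fun x => (hr0 x).ne')).add
      (continuous_const.mul hrd.continuous)
  refine ⟨r, hrd, hr0, hFr, ?_⟩
  have hd1 : MemLp (fun x => θ x - χ x) 2 (volume.restrict (P.dom ε)) := hθ.sub hχL
  have hχ' : ∫ x in P.dom ε, (θ x - χ x) ^ 2 ≤ β ^ 4 := by
    refine le_trans (le_of_eq (integral_congr_ae (Eventually.of_forall fun x => ?_))) hχ
    simp only [Real.norm_eq_abs, sq_abs]
  have iF := hF.integrable_sq
  have iθ := hθ.integrable_sq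
  have id := hd1.integrable_sq
  have hpt : ∀ᵐ x ∂volume.restrict (P.dom ε), (P.F (θ x) - P.F (r x)) * (θ x - r x)
      ≤ β ^ 3 * P.F (θ x) ^ 2 + (4 * c ^ 2 * β ^ 3) * θ x ^ 2
        + (4 * c ^ 2 * β ^ 3 + 1 / β ^ 3) * (θ x - χ x) ^ 2
        + (2 * c ^ 2 * β ^ 7 + 8 * P.c₁ ^ 2 * β + β) := by
    filter_upwards [hθ0] with x hx
    exact enthalpy_gap_le hP hx hβ (hrsq x) (hrβ x) (hrχ x) rfl
  have hgap : Integrable (fun x => (P.F (θ x) - P.F (r x)) * (θ x - r x))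
      (volume.restrict (P.dom ε)) := integrable_mul_of_memLp_two (hF.sub hFr) (hθ.sub hrL)
  have hmono := integral_mono_ae hgap ((((iF.const_mul (β ^ 3)).add
    (iθ.const_mul (4 * c ^ 2 * β ^ 3))).add (id.const_mul (4 * c ^ 2 * β ^ 3 + 1 / β ^ 3))).add
    (integrable_const (2 * c ^ 2 * β ^ 7 + 8 * P.c₁ ^ 2 * β + β))) hpt
  rw [integral_add' (((iF.const_mul (β ^ 3)).add (iθ.const_mul (4 * c ^ 2 * β ^ 3))).add
      (id.const_mul (4 * c ^ 2 * β ^ 3 + 1 / β ^ 3))) (integrable_const _),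
    integral_add' ((iF.const_mul (β ^ 3)).add (iθ.const_mul (4 * c ^ 2 * β ^ 3)))
      (id.const_mul (4 * c ^ 2 * β ^ 3 + 1 / β ^ 3)),
    integral_add' (iF.const_mul (β ^ 3)) (iθ.const_mul (4 * c ^ 2 * β ^ 3)),
    integral_const_mul, integral_const_mul, integral_const_mul, integral_const, smul_eq_mul] at hmono
  refine hmono.trans ?_
  have hw3 : β ^ 3 ≤ β := by
    calc β ^ 3 ≤ β ^ 1 := pow_le_pow_of_le_one hβ.le hβ1 (by norm_num)
      _ = β := pow_one _
  have hw7 : β ^ 7 ≤ β := by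
    calc β ^ 7 ≤ β ^ 1 := pow_le_pow_of_le_one hβ.le hβ1 (by norm_num)
      _ = β := pow_one _
  have q1 : β ^ 3 * Φ ≤ β * Φ := mul_le_mul_of_nonneg_right hw3 hΦ
  have q2 : 4 * c ^ 2 * β ^ 3 * Θ ≤ 4 * c ^ 2 * β * Θ := by gcongr
  have q3 : (4 * c ^ 2 * β ^ 3 + 1 / β ^ 3) * ∫ x in P.dom ε, (θ x - χ x) ^ 2
      ≤ 4 * c ^ 2 * β + β := by
    refine (mul_le_mul_of_nonneg_left hχ' (by positivity)).trans ?_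
    have : (4 * c ^ 2 * β ^ 3 + 1 / β ^ 3) * β ^ 4 = 4 * c ^ 2 * β ^ 7 + β := by field_simp
    rw [this]
    gcongr
  have q4 : V * (2 * c ^ 2 * β ^ 7 + 8 * P.c₁ ^ 2 * β + β)
      ≤ V * (2 * c ^ 2 * β + 8 * P.c₁ ^ 2 * β + β) := by gcongr
  have q5 : 0 ≤ β * (Φ + 4 * c ^ 2 * Θ + 4 * c ^ 2 + 2 * c ^ 2 * V + 8 * P.c₁ ^ 2 * V) := by
    positivity
  rw [hK] at hβκ
  linarith


/-! ### Lower semicontinuity of the energy -/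

lemma eventually_abs_integral_lt {f : ℝ → ℝ} (hf : Integrable f volume) (τ : ℝ) {κ : ℝ}
    (hκ : 0 < κ) : ∀ᶠ σ in 𝓝[<] τ, |∫ s in σ..τ, f s| < κ := by
  have h1 : Continuous fun σ => ∫ s in τ..σ, f s :=
    intervalIntegral.continuous_primitive (fun _ _ => hf.intervalIntegrable) τ
  have h2 := (h1.abs.tendsto τ).mono_left (nhdsWithin_le_nhds (s := Iio τ))
  simp only [intervalIntegral.integral_same, abs_zero] at h2
  filter_upwards [h2.eventually (gt_mem_nhds hκ)] with σ hσ
  rwa [intervalIntegral.integral_symm, abs_neg]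

section

variable {P : Model} {T ε : ℝ} {I : InitialData} {S : Fields}

/-- Weak continuity in time of the magnetization. -/
lemma Model.Evolution.weak_continuous_m (h : P.Evolution T ε I S) (hP : P.Standing) {τ : ℝ}
    (hτ : P.RegularAt ε I S τ) {g : E3 → E3} (hg : MemLp g 2 (volume.restrict (P.dom ε))) {κ : ℝ}
    (hκ : 0 < κ) : ∀ᶠ σ in 𝓝[<] τ, P.RegularAt ε I S σ →
      |∫ x in P.dom ε, inner ℝ (g x) (S.m τ x - S.m σ x)| < κ := by
  have := isFiniteMeasure_dom hP ε
  have hint : Integrable (fun s => ∫ x in P.dom ε, inner ℝ (g x) (S.dtm s x)) volume := by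
    have : IsFiniteMeasure (volume.restrict (Ioo 0 T)) := ⟨by simp⟩
    have h1 : Integrable (fun q : ℝ × E3 => inner ℝ (g q.2) (S.dtm q.1 q.2))
        ((volume : Measure ℝ).prod (volume.restrict (P.dom ε))) := by
      rw [← memLp_one_iff_integrable]
      refine memLp_of_cyl (T := T) ?_ fun q hq => by rw [h.dtm_zero q.1 hq]; simp
      rw [memLp_one_iff_integrable]
      exact integrable_inner_of_memLp_two (hg.comp_snd _) (MemLp.cyl h.dtm_memLp)
    exact h1.integral_prod_left
  filter_upwards [eventually_abs_integral_lt hint τ hκ, self_mem_nhdsWithin] with σ h1 h2 hσ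
  have hη : 0 < τ - σ := sub_pos.2 h2
  have h3 := integral_inner_swap_timeAvg h.dtm_memLp hg hη τ
  rw [sub_sub_cancel] at h3
  rw [show (∫ x in P.dom ε, inner ℝ (g x) (S.m τ x - S.m σ x))
    = ∫ s in σ..τ, ∫ x in P.dom ε, inner ℝ (g x) (S.dtm s x) from ?_]
  · exact h1
  · rw [h3, ← integral_const_mul]
    refine integral_congr_ae ?_
    filter_upwards [h.ae_sub_eq hP hσ hτ] with x hx
    rw [hx, timeAvg_eq hη, sub_sub_cancel, inner_smul_right, ← mul_assoc,
      mul_inv_cancel₀ hη.ne', one_mul]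

/-- Weak continuity in time of the enthalpy. -/
lemma Model.Evolution.weak_continuous_F (h : P.Evolution T ε I S) (hP : P.Standing) (hε : 0 < ε)
    {τ : ℝ} (hτ : P.RegularAt ε I S τ) {r : E3 → ℝ} {Dr : E3 → E3} (hr : MemH1 (P.dom ε) r Dr)
    {κ : ℝ} (hκ : 0 < κ) : ∀ᶠ σ in 𝓝[<] τ, P.RegularAt ε I S σ →
      |(∫ x in P.dom ε, P.F (S.θ τ x) * r x) - ∫ x in P.dom ε, P.F (S.θ σ x) * r x| < κ := by
  have h1 := (h.power_integrable hP (hr.memLp_four hP hε)).integral_prod_left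
  have h2 := (h.integrable_flux_inner hP hr.memLp_grad).integral_prod_left
  filter_upwards [eventually_abs_integral_lt h1 τ (half_pos hκ),
    eventually_abs_integral_lt h2 τ (half_pos hκ)] with σ e1 e2 hσ
  rw [h.heat_sub hP hε hσ hτ hr]
  refine (abs_sub _ _).trans_lt ?_
  linarith

/-- The potential is determined by m: `Model.Magnetostatic.sub_le` bounds the loss of energy by a
fixed L² functional of the increment of m. -/
lemma Model.Evolution.lsc_potential (h : P.Evolution T ε I S) (hP : P.Standing) {τ : ℝ}
    (hτ : P.RegularAt ε I S τ) {κ : ℝ} (hκ : 0 < κ) :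
    ∀ᶠ σ in 𝓝[<] τ, P.RegularAt ε I S σ →
      (∫ x in P.ext ε, form (osc P.μ ε x) (S.Dφ τ x) (S.Dφ τ x)) / 2 - κ
        ≤ (∫ x in P.ext ε, form (osc P.μ ε x) (S.Dφ σ x) (S.Dφ σ x)) / 2 := by
  have hD : MemLp (S.Dφ τ) 2 (volume.restrict (P.dom ε)) :=
    hτ.magnetostatic.1.memLp_grad.mono_measure (Measure.restrict_mono (dom_subset_ext P ε) le_rfl)
  filter_upwards [h.weak_continuous_m hP hτ hD hκ] with σ h1 hσ
  have h2 := hτ.magnetostatic.sub_le hP hσ.magnetostatic hτ.m_memH1.memLp hσ.m_memH1.memLp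
  linarith [(abs_lt.1 (h1 hσ)).1]

/-- The natural slope θ(τ) is only known to be in L², while F(θ) is weakly continuous against H¹
functions. Two convexity inequalities through a smooth r leave ∫(F(θ(τ)) − F(θ(σ))) r plus the gap
∫(F(θ(τ)) − F(r))(θ(τ) − r), both small. -/
lemma Model.Evolution.lsc_caloric (h : P.Evolution T ε I S) (hP : P.Standing) (hε : 0 < ε) {τ : ℝ}
    (hτ : P.RegularAt ε I S τ) {κ : ℝ} (hκ : 0 < κ) :
    ∀ᶠ σ in 𝓝[<] τ, P.RegularAt ε I S σ →
      (P.c₁ * (∫ x in P.dom ε, S.θ τ x) + P.c₂ / 2 * ∫ x in P.dom ε, S.θ τ x ^ 2) - κ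
        ≤ P.c₁ * (∫ x in P.dom ε, S.θ σ x) + P.c₂ / 2 * ∫ x in P.dom ε, S.θ σ x ^ 2 := by
  have := isFiniteMeasure_dom hP ε
  have hb : Bornology.IsBounded (P.dom ε) := hP.isBounded_Ω.subset sdiff_subset
  obtain ⟨r, hrd, hr0, hFr, hgap⟩ := exists_smooth_temperature hP hε hτ.θ_memLp hτ.θ_pos hτ.v_memLp
    (half_pos hκ)
  have hr1 := memH1_of_contDiff hb hrd
  filter_upwards [h.weak_continuous_F hP hε hτ hr1 (half_pos hκ)] with σ h1 hσ
  have e1 := integral_caloric_sub_le hP hr1.memLp hσ.θ_memLp (Eventually.of_forall hr0) hσ.θ_pos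
    hFr hσ.v_memLp
  have e2 := integral_caloric_sub_le hP hτ.θ_memLp hr1.memLp hτ.θ_pos (Eventually.of_forall hr0)
    hτ.v_memLp hFr
  have i1 := integrable_mul_of_memLp_two hτ.v_memLp hτ.θ_memLp
  have i2 := integrable_mul_of_memLp_two hτ.v_memLp hr1.memLp
  have i3 := integrable_mul_of_memLp_two hFr hτ.θ_memLp
  have i4 := integrable_mul_of_memLp_two hFr hr1.memLp
  have e3 : ∫ x in P.dom ε, (P.F (S.θ τ x) - P.F (r x)) * (S.θ τ x - r x)
      = (∫ x in P.dom ε, P.F (S.θ τ x) * S.θ τ x) - (∫ x in P.dom ε, P.F (S.θ τ x) * r x)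
        - ((∫ x in P.dom ε, P.F (r x) * S.θ τ x) - ∫ x in P.dom ε, P.F (r x) * r x) := by
    have i12 : Integrable (fun x => P.F (S.θ τ x) * S.θ τ x - P.F (S.θ τ x) * r x)
        (volume.restrict (P.dom ε)) := i1.sub i2
    have i34 : Integrable (fun x => P.F (r x) * S.θ τ x - P.F (r x) * r x)
        (volume.restrict (P.dom ε)) := i3.sub i4
    rw [← integral_sub i1 i2, ← integral_sub i3 i4, ← integral_sub i12 i34]
    congr 1; ext x; ring
  rw [e3] at hgap
  linarith [(abs_lt.1 (h1 hσ)).2]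

/-- Truncation of vectors of norm larger than `n`. -/
def truncate (n : ℕ) (v : E3) : E3 := if ‖v‖ ≤ n then v else 0

lemma measurable_truncate (n : ℕ) : Measurable (truncate n) :=
  Measurable.ite (measurableSet_le measurable_norm measurable_const) measurable_id measurable_const

lemma norm_truncate_le (n : ℕ) (v : E3) : ‖truncate n v‖ ≤ n := by
  rw [truncate]; split_ifs with h
  · exact h
  · simp

lemma norm_truncate_le' (n : ℕ) (v : E3) : ‖truncate n v‖ ≤ ‖v‖ := by
  rw [truncate]; split_ifs with h
  · exact le_rfl
  · simp

/-- This is why large vectors are sent to 0 and not rescaled: the truncation is exactly orthogonal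
to the error it makes. -/
lemma inner_truncate (n : ℕ) (v : E3) : inner ℝ (truncate n v) (truncate n v - v) = 0 := by
  rw [truncate]; split_ifs with h <;> simp

lemma exists_truncate {ν : Measure E3} {f : E3 → E3} (hf : MemLp f 4 ν) {κ : ℝ} (hκ : 0 < κ) :
    ∃ n, (∫ x, ‖f x‖ ^ 4 ∂ν) - κ ≤ ∫ x, ‖truncate n (f x)‖ ^ 4 ∂ν := by
  have hm : ∀ n, AEStronglyMeasurable (fun x => truncate n (f x)) ν := fun n =>
    ((measurable_truncate n).comp_aemeasurable hf.1.aemeasurable).aestronglyMeasurable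
  have hlim : Tendsto (fun n => ∫ x, ‖truncate n (f x)‖ ^ 4 ∂ν) atTop (𝓝 (∫ x, ‖f x‖ ^ 4 ∂ν)) := by
    refine tendsto_integral_of_dominated_convergence (fun x => ‖f x‖ ^ 4)
      (fun n => (hm n).norm.pow 4) (integrable_pow_four hf) (fun n => ?_) ?_
    · refine Eventually.of_forall fun x => ?_
      rw [Real.norm_of_nonneg (by positivity)]
      exact pow_le_pow_left₀ (norm_nonneg _) (norm_truncate_le' n _) 4
    · refine Eventually.of_forall fun x => tendsto_const_nhds.congr' ?_
      obtain ⟨N, hN⟩ := exists_nat_ge ‖f x‖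
      filter_upwards [eventually_ge_atTop N] with n hn
      rw [truncate, if_pos (hN.trans (by exact_mod_cast hn))]
  obtain ⟨n, hn⟩ := (hlim.eventually (lt_mem_nhds (sub_lt_self _ hκ))).exists
  exact ⟨n, hn.le⟩

/-- The slope |m|²m need not be square integrable, but weak continuity is in L². Convexity is used
at a truncation of m(τ); by `inner_truncate` the truncation may then be replaced by m(τ) in the
increment. -/
lemma Model.Evolution.lsc_pow_four (h : P.Evolution T ε I S) (hP : P.Standing) {τ : ℝ}
    (hτ : P.RegularAt ε I S τ) {κ : ℝ} (hκ : 0 < κ) :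
    ∀ᶠ σ in 𝓝[<] τ, P.RegularAt ε I S σ →
      (∫ x in P.dom ε, ‖S.m τ x‖ ^ 4) / 4 - κ ≤ (∫ x in P.dom ε, ‖S.m σ x‖ ^ 4) / 4 := by
  have := isFiniteMeasure_dom hP ε
  obtain ⟨n, hn⟩ := exists_truncate hτ.m_memL4 (by linarith : 0 < 2 * κ)
  set b : E3 → E3 := fun x => truncate n (S.m τ x)
  have hbm : AEStronglyMeasurable b (volume.restrict (P.dom ε)) :=
    ((measurable_truncate n).comp_aemeasurable hτ.m_memL4.1.aemeasurable).aestronglyMeasurable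
  have hb4 : MemLp b 4 (volume.restrict (P.dom ε)) :=
    MemLp.of_bound hbm n (Eventually.of_forall fun x => norm_truncate_le n _)
  have hg : MemLp (fun x => ‖b x‖ ^ 2 • b x) 2 (volume.restrict (P.dom ε)) := by
    refine MemLp.of_bound ((hbm.norm.pow 2).smul hbm) ((n : ℝ) ^ 2 * n)
      (Eventually.of_forall fun x => ?_)
    rw [norm_smul, Real.norm_of_nonneg (by positivity)]
    have := norm_truncate_le n (S.m τ x)
    exact mul_le_mul (pow_le_pow_left₀ (norm_nonneg _) this 2) this (norm_nonneg _) (by positivity)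
  filter_upwards [h.weak_continuous_m hP hτ hg (half_pos hκ)] with σ h1 hσ
  have e1 := integral_pow_four_sub_le hb4 hσ.m_memL4
  have e2 : ∫ x in P.dom ε, ‖b x‖ ^ 2 * inner ℝ (b x) (b x - S.m σ x)
      = ∫ x in P.dom ε, inner ℝ (‖b x‖ ^ 2 • b x) (S.m τ x - S.m σ x) := by
    congr 1; ext x
    rw [real_inner_smul_left, ← sub_add_sub_cancel (b x) (S.m τ x) (S.m σ x), inner_add_right,
      inner_truncate, zero_add]
  rw [e2] at e1
  linarith [(abs_lt.1 (h1 hσ)).2]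

/-- Moving the derivatives onto a smooth field transfers the weak continuity of m to its gradient
without any bound on that gradient. -/
lemma integral_inner_test {U : Set E3} {u : E3 → ℝ} {g : E3 → E3} (hu : MemH1 U u g)
    {χ : E3 → E3} (hχ : ContDiff ℝ (⊤ : ℕ∞) χ) (hc : HasCompactSupport χ) (hs : tsupport χ ⊆ U) :
    ∫ x in U, inner ℝ (χ x) (g x)
      = -∫ x in U, u x * ∑ i, fderiv ℝ (fun y => χ y i) x (EuclideanSpace.single i 1) := by
  have hd : ∀ i : Fin 3, ContDiff ℝ (⊤ : ℕ∞) fun y => χ y i := fun i =>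
    (EuclideanSpace.proj (𝕜 := ℝ) i).contDiff.comp hχ
  have hcs : ∀ i : Fin 3, HasCompactSupport fun y => χ y i := fun i =>
    hc.comp_left (g := fun v : E3 => v i) rfl
  have hts : ∀ i : Fin 3, tsupport (fun y => χ y i) ⊆ U := fun i =>
    (closure_mono fun x (hx : χ x i ≠ 0) (h0 : χ x = 0) => hx (by simp [h0])).trans hs
  have e1 : ∀ x, inner ℝ (χ x) (g x) = ∑ i, g x i * χ x i := fun x => by
    rw [PiLp.inner_apply]
    exact Finset.sum_congr rfl fun i _ => by rw [RCLike.inner_apply, conj_trivial]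
  simp_rw [e1, Finset.mul_sum]
  rw [integral_finsetSum _ fun i _ => integrable_coord_mul hu.memLp_grad (hd i) (hcs i) i,
    integral_finsetSum _ fun i _ => integrable_mul_fderiv hu.memLp (hd i) (hcs i) _,
    ← Finset.sum_neg_distrib]
  refine Finset.sum_congr rfl fun i _ => ?_
  rw [hu.weakGrad _ (hd i) (hcs i) (hts i) i, neg_neg]

lemma integral_inner_ge {α : Type*} [MeasurableSpace α] {ν : Measure α} {f g : α → E3}
    (hf : MemLp f 2 ν) (hg : MemLp g 2 ν) {lam : ℝ} (hl : 0 < lam) :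
    -(1 / (2 * lam) * (∫ x, ‖f x‖ ^ 2 ∂ν)) - lam / 2 * (∫ x, ‖g x‖ ^ 2 ∂ν)
      ≤ ∫ x, inner ℝ (f x) (g x) ∂ν := by
  have i1 := (integrable_norm_sq hf).const_mul (1 / (2 * lam))
  have i1' : Integrable (fun x => -(1 / (2 * lam) * ‖f x‖ ^ 2)) ν := i1.neg
  have i2 := (integrable_norm_sq hg).const_mul (lam / 2)
  rw [← integral_const_mul, ← integral_const_mul, ← integral_neg, ← integral_sub i1' i2]
  refine integral_mono (i1'.sub i2) (integrable_inner_of_memLp_two hf hg) fun x => ?_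
  have h1 := neg_le_of_abs_le (abs_real_inner_le_norm (f x) (g x))
  have h2 : ‖f x‖ * ‖g x‖ ≤ 1 / (2 * lam) * ‖f x‖ ^ 2 + lam / 2 * ‖g x‖ ^ 2 := by
    have h0 : 0 ≤ 1 / (2 * lam) * (‖f x‖ - lam * ‖g x‖) ^ 2 := by positivity
    have h3 : 1 / (2 * lam) * (‖f x‖ - lam * ‖g x‖) ^ 2
        = 1 / (2 * lam) * ‖f x‖ ^ 2 + lam / 2 * ‖g x‖ ^ 2 - ‖f x‖ * ‖g x‖ := by field_simp; ring
    linarith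
  simp only
  linarith

/-- The slope A∇m(τ) is approximated in L² by a test field χ, for which weak continuity is
available. No bound on ∇m(σ) is used; the approximation error is absorbed by coercivity into the
energy at σ, hence the factor 1 + κ. -/
lemma Model.Evolution.lsc_grad_component (h : P.Evolution T ε I S) (hP : P.Standing) (hε : 0 < ε)
    {τ : ℝ} (hτ : P.RegularAt ε I S τ) {κ : ℝ} (hκ : 0 < κ) (c : Fin 3) :
    ∀ᶠ σ in 𝓝[<] τ, P.RegularAt ε I S σ →
      (∫ x in P.dom ε, form (osc P.A ε x) (S.Dm τ x c) (S.Dm τ x c)) - κ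
        ≤ (1 + κ) * ∫ x in P.dom ε, form (osc P.A ε x) (S.Dm σ x c) (S.Dm σ x c) := by
  have hb : Bornology.IsBounded (P.dom ε) := hP.isBounded_Ω.subset sdiff_subset
  have hAf := hP.coeff_A.bddField ε (U := P.dom ε) sdiff_subset
  have hAs := hP.coeff_A.ae_isSymm ε (U := P.dom ε) sdiff_subset
  have hA0 := hP.coeff_A.ae_form_nonneg ε (U := P.dom ε) sdiff_subset
  obtain ⟨α, hα, hcoer⟩ := hP.coeff_A.exists_coercive
  have hco := hcoer ε (P.dom ε) sdiff_subset
  have hD := (hτ.m_memH1 c).memLp_grad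
  set G := ∫ x in P.dom ε, ‖S.Dm τ x c‖ ^ 2
  have hG : 0 ≤ G := integral_nonneg fun x => by positivity
  have hwL := hAf.memLp_matVec hD
  set w : E3 → E3 := fun x => matVec (osc P.A ε x) (S.Dm τ x c)
  set Qτ := ∫ x in P.dom ε, form (osc P.A ε x) (S.Dm τ x c) (S.Dm τ x c) with hQτ
  -- `lam` is the weight in Young's inequality: lam/α ≤ κ absorbs the error at σ, and lam G ≤ κ/3
  -- bounds the error at τ. The tolerance lam κ/6 for χ then contributes κ/12 each time.
  set lam := min (α * κ) (κ / (3 * (G + 1)))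
  have hl : 0 < lam := lt_min (by positivity) (by positivity)
  have hl1 : lam / α ≤ κ := by
    rw [div_le_iff₀ hα, mul_comm]; exact min_le_left _ _
  have hl2 : lam * G ≤ κ / 3 := by
    have h1 : lam ≤ κ / (3 * (G + 1)) := min_le_right _ _
    rw [le_div_iff₀ (by positivity)] at h1
    nlinarith
  obtain ⟨χ, hχd, hχc, hχs, hχL, hχ⟩ := exists_contDiff_integral_sub_le (isOpen_dom hP hε) hb hwL
    (d := lam * κ / 6) (by positivity)
  set dv : E3 → ℝ := fun x => ∑ i, fderiv ℝ (fun y => χ y i) x (EuclideanSpace.single i 1)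
  have hdv : MemLp (fun x => EuclideanSpace.single c (dv x)) 2 (volume.restrict (P.dom ε)) := by
    refine memLp_two_of_continuous hb ?_
    have hc1 : Continuous dv := continuous_finsetSum _ fun i _ =>
      ((((EuclideanSpace.proj (𝕜 := ℝ) i).contDiff.comp hχd).continuous_fderiv
        (by simp)).clm_apply continuous_const)
    exact (PiLp.continuous_toLp 2 _).comp (continuous_pi fun j => by
      by_cases hj : j = c
      · subst hj; simpa using hc1
      · simpa [Pi.single_apply, hj] using continuous_const)
  have hd1 : MemLp (fun x => w x - χ x) 2 (volume.restrict (P.dom ε)) := hwL.sub hχL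
  have hd2 : MemLp (fun x => χ x - w x) 2 (volume.restrict (P.dom ε)) := hχL.sub hwL
  filter_upwards [h.weak_continuous_m hP hτ hdv (by positivity : 0 < κ / 6)] with σ h1 hσ
  have h1 := h1 hσ
  have hDσ := (hσ.m_memH1 c).memLp_grad
  set Qσ := ∫ x in P.dom ε, form (osc P.A ε x) (S.Dm σ x c) (S.Dm σ x c) with hQσ
  have hQσ0 : 0 ≤ Qσ := integral_nonneg_of_ae (by filter_upwards [hA0] with x hx; exact hx _)
  have e1 : ∫ x in P.dom ε, inner ℝ (w x) (S.Dm σ x c) ≤ (Qτ + Qσ) / 2 := by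
    have i1 := hAf.integrable_form hD hD
    have i2 := hAf.integrable_form hDσ hDσ
    rw [hQτ, hQσ, ← integral_add i1 i2, ← integral_div]
    refine integral_mono_ae (integrable_inner_of_memLp_two hwL hDσ) ((i1.add i2).div_const 2) ?_
    filter_upwards [hAs, hA0] with x hx hx0
    have := two_form_le hx hx0 (S.Dm τ x c) (S.Dm σ x c)
    rwa [form_eq_inner] at this
  have e2 := integral_inner_ge hd1 hDσ hl
  have e3 := integral_inner_ge hd2 hD hl
  simp_rw [norm_sub_rev (χ _)] at e3
  have hGσ : α * ∫ x in P.dom ε, ‖S.Dm σ x c‖ ^ 2 ≤ Qσ := by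
    rw [← integral_const_mul]
    refine integral_mono_ae ((integrable_norm_sq hDσ).const_mul α) (hAf.integrable_form hDσ hDσ) ?_
    filter_upwards [hco] with x hx
    exact hx _
  have e4 : ∫ x in P.dom ε, inner ℝ (w x - χ x) (S.Dm σ x c)
      = (∫ x in P.dom ε, inner ℝ (w x) (S.Dm σ x c)) - ∫ x in P.dom ε, inner ℝ (χ x) (S.Dm σ x c) := by
    simp_rw [inner_sub_left]
    exact integral_sub (integrable_inner_of_memLp_two hwL hDσ) (integrable_inner_of_memLp_two hχL hDσ)
  have e5 : ∫ x in P.dom ε, inner ℝ (χ x - w x) (S.Dm τ x c)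
      = (∫ x in P.dom ε, inner ℝ (χ x) (S.Dm τ x c)) - Qτ := by
    simp_rw [inner_sub_left]
    rw [integral_sub (integrable_inner_of_memLp_two hχL hD) (integrable_inner_of_memLp_two hwL hD),
      hQτ]
    simp_rw [form_eq_inner]
    rfl
  have e6 : (∫ x in P.dom ε, inner ℝ (χ x) (S.Dm τ x c)) - ∫ x in P.dom ε, inner ℝ (χ x) (S.Dm σ x c)
      = -∫ x in P.dom ε, inner ℝ (EuclideanSpace.single c (dv x)) (S.m τ x - S.m σ x) := by
    rw [integral_inner_test (hτ.m_memH1 c) hχd hχc hχs,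
      integral_inner_test (hσ.m_memH1 c) hχd hχc hχs, ← neg_sub', neg_inj]
    have hdv' : MemLp dv 2 (volume.restrict (P.dom ε)) := by
      have := hdv.eval_piLp c
      simpa using this
    rw [← integral_sub (integrable_mul_of_memLp_two (hτ.m_memH1 c).memLp hdv')
      (integrable_mul_of_memLp_two (hσ.m_memH1 c).memLp hdv')]
    congr 1; ext x
    rw [EuclideanSpace.inner_single_left, conj_trivial, PiLp.sub_apply]
    ring
  have hW : 1 / (2 * lam) * (∫ x in P.dom ε, ‖w x - χ x‖ ^ 2) ≤ κ / 12 := by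
    refine (mul_le_mul_of_nonneg_left hχ (by positivity)).trans (le_of_eq ?_)
    field_simp; norm_num
  have hlσ : lam / 2 * (∫ x in P.dom ε, ‖S.Dm σ x c‖ ^ 2) ≤ κ / 2 * Qσ := by
    have : lam / 2 * (∫ x in P.dom ε, ‖S.Dm σ x c‖ ^ 2)
        = lam / α / 2 * (α * ∫ x in P.dom ε, ‖S.Dm σ x c‖ ^ 2) := by field_simp
    rw [this]
    refine mul_le_mul (by linarith) hGσ ?_ (by positivity)
    exact mul_nonneg hα.le (integral_nonneg fun x => by positivity)
  have h1' := abs_lt.1 h1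
  rw [e4] at e2
  rw [e5] at e3
  have hG' : lam / 2 * (∫ x in P.dom ε, ‖S.Dm τ x c‖ ^ 2) ≤ κ / 6 := by
    have : lam / 2 * G ≤ κ / 6 := by linarith
    exact this
  linarith

/-- Lower semicontinuity of the energy at a regular time. -/
lemma Model.Evolution.lsc_energy (h : P.Evolution T ε I S) (hP : P.Standing) (hε : 0 < ε) {τ : ℝ}
    (hτ : P.RegularAt ε I S τ) {κ : ℝ} (hκ : 0 < κ) :
    ∀ᶠ σ in 𝓝[<] τ, P.RegularAt ε I S σ →
      P.energyAt ε S τ - κ ≤ (1 + κ) * P.energyAt ε S σ := by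
  have hθc := hP.θc_pos
  have hAf := hP.coeff_A.bddField ε (U := P.dom ε) sdiff_subset
  have hμ0 := hP.coeff_μ.ae_form_nonneg ε (subset_univ (P.ext ε))
  filter_upwards [h.lsc_potential hP hτ (by linarith : 0 < κ / 8),
    h.lsc_caloric hP hε hτ (by linarith : 0 < κ / 8),
    h.lsc_pow_four hP hτ (by positivity : 0 < κ / (8 * P.θc)),
    h.lsc_grad_component hP hε hτ (by linarith : 0 < κ / 8) 0,
    h.lsc_grad_component hP hε hτ (by linarith : 0 < κ / 8) 1,
    h.lsc_grad_component hP hε hτ (by linarith : 0 < κ / 8) 2] with σ h1 h2 h3 h4 h5 h6 hσ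
  have h1 := h1 hσ
  have h2 := h2 hσ
  have h3 := mul_le_mul_of_nonneg_left (h3 hσ) hθc.le
  have h4 := h4 hσ
  have h5 := h5 hσ
  have h6 := h6 hσ
  have hg : ∀ s, P.RegularAt ε I S s →
      ∫ x in P.dom ε, gradForm (osc P.A ε x) (S.Dm s x) (S.Dm s x)
        = (∫ x in P.dom ε, form (osc P.A ε x) (S.Dm s x 0) (S.Dm s x 0))
          + (∫ x in P.dom ε, form (osc P.A ε x) (S.Dm s x 1) (S.Dm s x 1))
          + ∫ x in P.dom ε, form (osc P.A ε x) (S.Dm s x 2) (S.Dm s x 2) := by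
    intro s hs
    simp only [gradForm]
    rw [integral_finsetSum _ fun c _ => hAf.integrable_form (hs.m_memH1 c).memLp_grad
      (hs.m_memH1 c).memLp_grad, Fin.sum_univ_three]
  have hA0 := hP.coeff_A.ae_form_nonneg ε (U := P.dom ε) sdiff_subset
  have p1 : ∀ c, 0 ≤ ∫ x in P.dom ε, form (osc P.A ε x) (S.Dm σ x c) (S.Dm σ x c) := fun c =>
    integral_nonneg_of_ae (by filter_upwards [hA0] with x hx; exact hx _)
  have p2 : 0 ≤ ∫ x in P.ext ε, form (osc P.μ ε x) (S.Dφ σ x) (S.Dφ σ x) :=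
    integral_nonneg_of_ae (by filter_upwards [hμ0] with x hx; exact hx _)
  have p3 : 0 ≤ ∫ x in P.dom ε, ‖S.m σ x‖ ^ 4 := integral_nonneg fun x => by positivity
  have p4 : 0 ≤ ∫ x in P.dom ε, S.θ σ x :=
    integral_nonneg_of_ae (by filter_upwards [hσ.θ_pos] with x hx; exact hx.le)
  have p5 : 0 ≤ ∫ x in P.dom ε, S.θ σ x ^ 2 := integral_nonneg fun x => by positivity
  have e3 : P.θc * ((∫ x in P.dom ε, ‖S.m τ x‖ ^ 4) / 4 - κ / (8 * P.θc))
      = P.θc * ((∫ x in P.dom ε, ‖S.m τ x‖ ^ 4) / 4) - κ / 8 := by field_simp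
  rw [e3] at h3
  simp only [Model.energyAt, Model.energy_eq]
  rw [hg τ hτ, hg σ hσ]
  -- Only the gradient part needs the factor 1 + κ; the other parts are nonnegative and may carry it
  -- too.
  have n1 := mul_nonneg hκ.le (p1 0)
  have n2 := mul_nonneg hκ.le (p1 1)
  have n3 := mul_nonneg hκ.le (p1 2)
  have n4 := mul_nonneg hκ.le p2
  have n5 := mul_nonneg hκ.le (mul_nonneg hθc.le p3)
  have n6 := mul_nonneg hκ.le (mul_nonneg hP.c₁_pos.le p4)
  have n7 := mul_nonneg hκ.le (mul_nonneg hP.c₂_pos.le p5)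
  linarith

end


/-! ### The solution continued to negative times -/

lemma memLp_cyl_of_bound {E : Type*} [NormedAddCommGroup E] {T : ℝ} {U : Set E3} {p : ℝ≥0∞}
    (hp0 : p ≠ 0) (hp : p ≠ ⊤) {f : ℝ × E3 → E} (hf : AEStronglyMeasurable f (cylMeasure T U))
    (hB : ∃ B : ℝ, ∀ᵐ t ∂volume.restrict (Ioo 0 T),
      eLpNorm (fun x => f (t, x)) p (volume.restrict U) ≤ ENNReal.ofReal B) :
    MemLp f p (cylMeasure T U) := by
  obtain ⟨B, hB⟩ := hB
  refine ⟨hf, ?_⟩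
  rw [eLpNorm_lt_top_iff_lintegral_rpow_enorm_lt_top hp0 hp, cylMeasure,
    lintegral_prod _ (hf.enorm.pow_const _)]
  have h1 : ∫⁻ t in Ioo 0 T, ∫⁻ x in U, ‖f (t, x)‖ₑ ^ p.toReal
      ≤ ∫⁻ _ in Ioo 0 T, ENNReal.ofReal B ^ p.toReal := by
    refine lintegral_mono_ae ?_
    filter_upwards [hB] with t ht
    rw [lintegral_rpow_enorm_eq_rpow_eLpNorm' (ENNReal.toReal_pos hp0 hp),
      ← eLpNorm_eq_eLpNorm' hp0 hp]
    exact ENNReal.rpow_le_rpow ht ENNReal.toReal_nonneg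
  refine h1.trans_lt ?_
  rw [setLIntegral_const]
  exact ENNReal.mul_lt_top (ENNReal.rpow_lt_top_of_nonneg ENNReal.toReal_nonneg
    ENNReal.ofReal_ne_top) (by simp)

section

variable {P : Model} {T ε : ℝ} {I : InitialData} {S : Fields}

lemma Fields.pad_dtm_of_mem {s : ℝ} (hs : s ∈ Ioo 0 T) : (S.pad I T).dtm s = S.dtm s := if_pos hs

lemma Fields.pad_Dθ_of_mem {s : ℝ} (hs : s ∈ Ioo 0 T) : (S.pad I T).Dθ s = S.Dθ s := if_pos hs

lemma Fields.pad_Dlogθ_of_mem {s : ℝ} (hs : s ∈ Ioo 0 T) : (S.pad I T).Dlogθ s = S.Dlogθ s :=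
  if_pos hs

lemma Fields.pad_dtm_of_notMem {s : ℝ} (hs : s ∉ Ioo 0 T) : (S.pad I T).dtm s = 0 := if_neg hs

lemma Fields.pad_Dθ_of_notMem {s : ℝ} (hs : s ∉ Ioo 0 T) : (S.pad I T).Dθ s = 0 := if_neg hs

lemma Fields.pad_Dlogθ_of_notMem {s : ℝ} (hs : s ∉ Ioo 0 T) : (S.pad I T).Dlogθ s = 0 := if_neg hs

lemma Fields.pad_m_of_nonpos {s : ℝ} (hs : s ≤ 0) : (S.pad I T).m s = I.m := if_pos hs

lemma Fields.pad_m_of_pos {s : ℝ} (hs : 0 < s) : (S.pad I T).m s = S.m s := if_neg hs.not_ge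

lemma Fields.pad_Dm_of_nonpos {s : ℝ} (hs : s ≤ 0) : (S.pad I T).Dm s = I.Dm := if_pos hs

lemma Fields.pad_Dm_of_pos {s : ℝ} (hs : 0 < s) : (S.pad I T).Dm s = S.Dm s := if_neg hs.not_ge

lemma Fields.pad_θ_of_nonpos {s : ℝ} (hs : s ≤ 0) : (S.pad I T).θ s = I.θ := if_pos hs

lemma Fields.pad_θ_of_pos {s : ℝ} (hs : 0 < s) : (S.pad I T).θ s = S.θ s := if_neg hs.not_ge

lemma Fields.pad_φ_of_nonpos {s : ℝ} (hs : s ≤ 0) : (S.pad I T).φ s = I.φ := if_pos hs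

lemma Fields.pad_φ_of_pos {s : ℝ} (hs : 0 < s) : (S.pad I T).φ s = S.φ s := if_neg hs.not_ge

lemma Fields.pad_Dφ_of_nonpos {s : ℝ} (hs : s ≤ 0) : (S.pad I T).Dφ s = I.Dφ := if_pos hs

lemma Fields.pad_Dφ_of_pos {s : ℝ} (hs : 0 < s) : (S.pad I T).Dφ s = S.Dφ s := if_neg hs.not_ge

lemma Model.energyAt_pad_of_nonpos {s : ℝ} (hs : s ≤ 0) :
    P.energyAt ε (S.pad I T) s = P.initialEnergy ε I := by
  rw [Model.energyAt, Fields.pad_m_of_nonpos hs, Fields.pad_Dm_of_nonpos hs,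
    Fields.pad_θ_of_nonpos hs, Fields.pad_Dφ_of_nonpos hs, Model.initialEnergy]

lemma Model.energyAt_pad_of_pos {s : ℝ} (hs : 0 < s) :
    P.energyAt ε (S.pad I T) s = P.energyAt ε S s := by
  rw [Model.energyAt, Fields.pad_m_of_pos hs, Fields.pad_Dm_of_pos hs,
    Fields.pad_θ_of_pos hs, Fields.pad_Dφ_of_pos hs, Model.energyAt]

lemma MemH1Vec.memLp_four (hP : P.Standing) (hε : 0 < ε) {u : E3 → E3} {g : E3 → Fin 3 → E3}
    (h : MemH1Vec (P.dom ε) u g) : MemLp u 4 (volume.restrict (P.dom ε)) :=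
  MemLp.of_eval_piLp fun c => (h c).memLp_four hP hε

/-- At nonpositive times all time integrals vanish, since the derivatives are extended by zero. What
remains is the admissibility of the initial data, with L⁴ from the Sobolev embedding. -/
lemma Model.IsInitial.regularAt_pad (h : P.IsInitial ε I) (hP : P.Standing) (hε : 0 < ε) {s : ℝ}
    (hs : s ≤ 0) : P.RegularAt ε I (S.pad I T) s := by
  have hn : ∀ r ∈ uIcc 0 s, r ∉ Ioo 0 T := fun r hr hr' => by
    rw [uIcc_of_ge hs] at hr
    exact absurd hr'.1 hr.2.not_gt
  constructor
  · rw [Fields.pad_m_of_nonpos hs, Fields.pad_Dm_of_nonpos hs]; exact h.m_memH1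
  · rw [Fields.pad_m_of_nonpos hs]; exact h.m_memH1.memLp_four hP hε
  · refine Eventually.of_forall fun x => ?_
    rw [Fields.pad_m_of_nonpos hs, intervalIntegral.integral_congr (g := fun _ => (0 : E3))
      fun r hr => by simp only [Fields.pad_dtm_of_notMem (hn r hr)]; rfl]
    simp
  · rw [Fields.pad_θ_of_nonpos hs]; exact h.θ_memLp
  · rw [Fields.pad_θ_of_nonpos hs]; exact h.θ_pos
  · rw [Fields.pad_θ_of_nonpos hs]; exact h.v_memLp
  · intro r Dr _
    rw [Fields.pad_θ_of_nonpos hs, intervalIntegral.integral_congr (g := fun _ => (0 : ℝ))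
      fun r hr => by
        simp [Fields.pad_dtm_of_notMem (hn r hr), Fields.pad_Dθ_of_notMem (hn r hr),
          Fields.pad_Dlogθ_of_notMem (hn r hr), form]]
    simp
  · rw [Fields.pad_m_of_nonpos hs, Fields.pad_φ_of_nonpos hs, Fields.pad_Dφ_of_nonpos hs]
    exact h.magnetostatic

lemma Model.RegularAt.pad {s : ℝ} (h : P.RegularAt ε I S s) (hs : s ∈ Ioo 0 T) :
    P.RegularAt ε I (S.pad I T) s := by
  have hm : ∀ r ∈ Ioc 0 s, r ∈ Ioo 0 T := fun r hr => ⟨hr.1, hr.2.trans_lt hs.2⟩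
  constructor
  · rw [Fields.pad_m_of_pos hs.1, Fields.pad_Dm_of_pos hs.1]; exact h.m_memH1
  · rw [Fields.pad_m_of_pos hs.1]; exact h.m_memL4
  · filter_upwards [h.m_eq] with x hx
    rw [Fields.pad_m_of_pos hs.1, hx, intervalIntegral.integral_of_le hs.1.le,
      intervalIntegral.integral_of_le hs.1.le]
    congr 1
    refine setIntegral_congr_fun measurableSet_Ioc fun r hr => ?_
    simp only [Fields.pad_dtm_of_mem (hm r hr)]
  · rw [Fields.pad_θ_of_pos hs.1]; exact h.θ_memLp
  · rw [Fields.pad_θ_of_pos hs.1]; exact h.θ_pos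
  · rw [Fields.pad_θ_of_pos hs.1]; exact h.v_memLp
  · intro r Dr hr
    rw [Fields.pad_θ_of_pos hs.1, h.heat r Dr hr, intervalIntegral.integral_of_le hs.1.le,
      intervalIntegral.integral_of_le hs.1.le]
    congr 1
    refine setIntegral_congr_fun measurableSet_Ioc fun r hr => ?_
    simp only [Fields.pad_dtm_of_mem (hm r hr), Fields.pad_Dθ_of_mem (hm r hr),
      Fields.pad_Dlogθ_of_mem (hm r hr), Fields.pad_m_of_pos hr.1]
  · rw [Fields.pad_m_of_pos hs.1, Fields.pad_φ_of_pos hs.1, Fields.pad_Dφ_of_pos hs.1]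
    exact h.magnetostatic

lemma MemLp.congr_cyl {E : Type*} [NormedAddCommGroup E] {U : Set E3} {p : ℝ≥0∞}
    {f g : ℝ × E3 → E} (hf : MemLp f p (cylMeasure T U)) (h : ∀ q, q.1 ∈ Ioo 0 T → g q = f q) :
    MemLp g p (cylMeasure T U) := by
  refine hf.ae_eq ?_
  rw [cylMeasure_eq]
  filter_upwards [ae_restrict_mem (measurableSet_Ioo.prod MeasurableSet.univ)] with q hq
  exact (h q hq.1).symm

lemma Model.IsWeakSolution.evolution (h : P.IsWeakSolution T ε I S) (hP : P.Standing)
    (hε : 0 < ε) : P.Evolution T ε I (S.pad I T) := by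
  have hz : ∀ s ∉ Ioo 0 T, ∀ x, P.flux ε (S.pad I T) (s, x) = 0 := fun s hs x => by
    simp only [Model.flux, Fields.pad_Dθ_of_notMem hs, Fields.pad_Dlogθ_of_notMem hs]
    ext i
    simp [matVec]
  have hDθ : MemLp (fun q : ℝ × E3 => (S.pad I T).Dθ q.1 q.2) 2 (cylMeasure T (P.dom ε)) :=
    MemLp.congr_cyl h.Dθ_memLp fun q hq => by rw [Fields.pad_Dθ_of_mem hq]
  have hDl : MemLp (fun q : ℝ × E3 => (S.pad I T).Dlogθ q.1 q.2) 2 (cylMeasure T (P.dom ε)) :=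
    MemLp.congr_cyl h.Dlogθ_memLp fun q hq => by rw [Fields.pad_Dlogθ_of_mem hq]
  have hK : BddField (cylMeasure T (P.dom ε)) fun q => osc P.K ε q.2 :=
    (hP.coeff_K.bddField ε (U := P.dom ε) sdiff_subset).comp_snd
  constructor
  · exact fun s hs => h.initial.regularAt_pad hP hε hs
  · filter_upwards [h.regular, ae_restrict_mem measurableSet_Ioo] with s hs hsT
    exact hs.pad hsT
  · filter_upwards [h.magnetization, ae_restrict_mem measurableSet_Ioo] with s hs hsT
    intro p Dp hp
    rw [Fields.pad_dtm_of_mem hsT, Fields.pad_m_of_pos hsT.1, Fields.pad_Dm_of_pos hsT.1,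
      Fields.pad_θ_of_pos hsT.1, Fields.pad_Dφ_of_pos hsT.1]
    exact hs p Dp hp
  · filter_upwards [h.θ_memH1, ae_restrict_mem measurableSet_Ioo] with s hs hsT
    rwa [Fields.pad_θ_of_pos hsT.1, Fields.pad_Dθ_of_mem hsT]
  · filter_upwards [h.logθ_memH1, ae_restrict_mem measurableSet_Ioo] with s hs hsT
    rwa [Fields.pad_θ_of_pos hsT.1, Fields.pad_Dlogθ_of_mem hsT]
  · refine memLp_of_cyl (T := T) (MemLp.congr_cyl h.dtm_memLp fun q hq => ?_) fun q hq => ?_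
    · rw [Fields.pad_dtm_of_mem hq]
    · rw [Fields.pad_dtm_of_notMem hq]; rfl
  · refine memLp_of_cyl hDθ fun q hq => ?_
    rw [Fields.pad_Dθ_of_notMem hq]; rfl
  · exact memLp_of_cyl (hK.memLp_matVec ((hDl.const_smul P.k₀).add (hDθ.const_smul P.k₁)))
      fun q hq => hz q.1 hq q.2
  · exact fun s hs => Fields.pad_dtm_of_notMem hs
  · exact hz
  · exact MemLp.congr_cyl h.m_memLp fun q hq => by rw [Fields.pad_m_of_pos hq.1]
  · refine MemLp.congr_cyl (memLp_cyl_of_bound (by simp) (by simp) h.m_memLp.1 h.m_bounded_L4)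
      fun q hq => by rw [Fields.pad_m_of_pos hq.1]

lemma Model.IsWeakSolution.integrableOn_energyAt (h : P.IsWeakSolution T ε I S) (hP : P.Standing) :
    IntegrableOn (P.energyAt ε S) (Ioo 0 T) volume := by
  have := isFiniteMeasure_cyl hP T ε
  have hA : BddField (cylMeasure T (P.dom ε)) fun q => osc P.A ε q.2 :=
    (hP.coeff_A.bddField ε (U := P.dom ε) sdiff_subset).comp_snd
  have hμ : BddField (cylMeasure T (P.ext ε)) fun q => osc P.μ ε q.2 :=
    (hP.coeff_μ.bddField ε (subset_univ (P.ext ε))).comp_snd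
  have hDm : ∀ c, MemLp (fun q : ℝ × E3 => S.Dm q.1 q.2 c) 2 (cylMeasure T (P.dom ε)) := fun c =>
    h.Dm_memLp.of_le ((continuous_apply c).comp_aestronglyMeasurable h.Dm_memLp.1)
      (Eventually.of_forall fun q => norm_le_pi_norm _ c)
  have hDφ : MemLp (fun q : ℝ × E3 => S.Dφ q.1 q.2) 2 (cylMeasure T (P.ext ε)) :=
    memLp_cyl_of_bound (by simp) (by simp) h.Dφ_measurable h.Dφ_bounded_L2
  have hm : MemLp (fun q : ℝ × E3 => S.m q.1 q.2) 4 (cylMeasure T (P.dom ε)) :=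
    memLp_cyl_of_bound (by simp) (by simp) h.m_memLp.1 h.m_bounded_L4
  have i1 := (hA.integrable_gradForm hDm hDm).integral_prod_left
  have i2 := (integrable_pow_four hm).integral_prod_left
  have i3 := h.θ_memLp.integrable_sq.integral_prod_left
  have i4 := (h.θ_memLp.integrable (by norm_num)).integral_prod_left
  have i5 := (hμ.integrable_form hDφ hDφ).integral_prod_left
  exact ((((i1.add (i2.const_mul (P.θc / 2))).add (i3.const_mul P.c₂)).add i5).add
    (i4.const_mul (2 * P.c₁))).const_mul (1 / 2)

end


/-! ### Proof of the energy estimate -/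

section

variable {P : Model} {T ε : ℝ} {I : InitialData} {S : Fields}

lemma Model.pow_four_le_energy (hP : P.Standing) (ε : ℝ) (m : E3 → E3) (Dm : E3 → Fin 3 → E3)
    {θ : E3 → ℝ} (hθ : ∀ᵐ x ∂volume.restrict (P.dom ε), 0 < θ x) (Dφ : E3 → E3) :
    P.θc / 4 * (∫ x in P.dom ε, ‖m x‖ ^ 4) ≤ P.energy ε m Dm θ Dφ := by
  have hA0 := hP.coeff_A.ae_form_nonneg ε (U := P.dom ε) sdiff_subset
  have hμ0 := hP.coeff_μ.ae_form_nonneg ε (subset_univ (P.ext ε))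
  have h1 : 0 ≤ ∫ x in P.dom ε, gradForm (osc P.A ε x) (Dm x) (Dm x) :=
    integral_nonneg_of_ae (by
      filter_upwards [hA0] with x hx
      exact Finset.sum_nonneg fun c _ => hx _)
  have h2 : 0 ≤ ∫ x in P.ext ε, form (osc P.μ ε x) (Dφ x) (Dφ x) :=
    integral_nonneg_of_ae (by filter_upwards [hμ0] with x hx; exact hx _)
  have h3 : 0 ≤ ∫ x in P.dom ε, θ x :=
    integral_nonneg_of_ae (by filter_upwards [hθ] with x hx; exact hx.le)
  have h4 : 0 ≤ ∫ x in P.dom ε, θ x ^ 2 := integral_nonneg fun x => sq_nonneg _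
  rw [P.energy_eq]
  have h5 := mul_nonneg hP.c₁_pos.le h3
  have h6 := mul_nonneg (half_pos hP.c₂_pos).le h4
  linarith

/-- Lower semicontinuity allows c = (𝓔(τ) − κ)/(1 + κ) as lower bound just before τ; then κ → 0. -/
lemma Model.Evolution.energy_le (h : P.Evolution T ε I S) (hP : P.Standing)
    (hε : 0 < ε) {τ E₀ : ℝ} (hτ : τ ∈ Ioo 0 T) (hτr : P.RegularAt ε I S τ)
    (hE : IntegrableOn (P.energyAt ε S) (Ioo 0 T) volume)
    (hE0 : ∀ s ≤ 0, P.energyAt ε S s = E₀) :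
    P.energyAt ε S τ + P.γ * (∫ s in Ioo 0 τ, ∫ x in P.dom ε, ‖S.dtm s x‖ ^ 2)
      + (∫ s in Ioo 0 τ, ∫ x in P.dom ε, inner ℝ (S.Dθ s x) (P.flux ε S (s, x)))
      ≤ E₀ + P.θc / 2 * ((∫ x in P.dom ε, ‖S.m τ x‖ ^ 2) - ∫ x in P.dom ε, ‖S.m 0 x‖ ^ 2) := by
  set X := P.γ * (∫ s in Ioo 0 τ, ∫ x in P.dom ε, ‖S.dtm s x‖ ^ 2)
  set Y := ∫ s in Ioo 0 τ, ∫ x in P.dom ε, inner ℝ (S.Dθ s x) (P.flux ε S (s, x))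
  have hlim : Tendsto (fun κ : ℝ => (P.energyAt ε S τ - κ) / (1 + κ) + X + Y) (𝓝[>] 0)
      (𝓝 ((P.energyAt ε S τ - 0) / (1 + 0) + X + Y)) := by
    refine Tendsto.mono_left ?_ nhdsWithin_le_nhds
    exact ContinuousAt.tendsto (f := fun κ : ℝ => (P.energyAt ε S τ - κ) / (1 + κ) + X + Y)
      (by fun_prop (disch := simp))
  rw [sub_zero, add_zero, div_one] at hlim
  refine le_of_tendsto hlim ?_
  filter_upwards [self_mem_nhdsWithin] with κ hκ
  have hκ : 0 < κ := hκ
  refine h.energy_le_of_lower_bound hP hε hτ hτr hE hE0 ?_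
  filter_upwards [h.lsc_energy hP hε hτr hκ] with σ h1 hσ
  rw [div_le_iff₀ (by linarith), mul_comm]
  exact h1 hσ

/-- With ∇θ = θ∇ln θ the flux equals (k₀ + k₁θ) K∇ln θ, so its product with ∇θ is (k₀ + k₁θ) θ K∇ln
θ·∇ln θ. -/
lemma Model.Evolution.integral_inner_flux_nonneg (h : P.Evolution T ε I S) (hP : P.Standing)
    (hε : 0 < ε) {τ : ℝ} (hτ : τ ≤ T) :
    0 ≤ ∫ s in Ioo 0 τ, ∫ x in P.dom ε, inner ℝ (S.Dθ s x) (P.flux ε S (s, x)) := by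
  have hk₀ := hP.k₀_pos
  have hk₁ := hP.k₁_pos
  refine integral_nonneg_of_ae (ae_mono (Measure.restrict_mono (Ioo_subset_Ioo_right hτ) le_rfl) ?_)
  filter_upwards [h.regular, h.θ_memH1, h.logθ_memH1] with s hs h1 h2
  refine integral_nonneg_of_ae ?_
  filter_upwards [grad_eq_smul_grad_log (isOpen_dom hP hε) h1 h2 hs.θ_pos, hs.θ_pos,
    hP.coeff_K.ae_form_nonneg ε (U := P.dom ε) sdiff_subset] with x hx hpos hK
  have e : P.k₀ • S.Dlogθ s x + P.k₁ • S.Dθ s x = (P.k₀ + P.k₁ * S.θ s x) • S.Dlogθ s x := by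
    rw [hx, smul_smul, ← add_smul]
  have e2 : form (osc P.K ε x) ((P.k₀ + P.k₁ * S.θ s x) • S.Dlogθ s x) (S.θ s x • S.Dlogθ s x)
      = (P.k₀ + P.k₁ * S.θ s x) * S.θ s x * form (osc P.K ε x) (S.Dlogθ s x) (S.Dlogθ s x) := by
    simp only [form, PiLp.smul_apply, smul_eq_mul, Finset.mul_sum]
    exact Finset.sum_congr rfl fun i _ => Finset.sum_congr rfl fun j _ => by ring
  rw [Pi.zero_apply, real_inner_comm, Model.flux, ← form_eq_inner, e]
  rw [hx, e2]
  exact mul_nonneg (by positivity) (hK _)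

lemma Model.Evolution.integral_dissipation (h : P.Evolution T ε I S) (hP : P.Standing) (τ : ℝ) :
    ∫ s in Ioo 0 τ, P.dissipation ε S s
      = P.γ / 2 * (∫ s in Ioo 0 τ, ∫ x in P.dom ε, ‖S.dtm s x‖ ^ 2)
        + ∫ s in Ioo 0 τ, ∫ x in P.dom ε, inner ℝ (S.Dθ s x) (P.flux ε S (s, x)) := by
  have := isFiniteMeasure_dom hP ε
  have i1 := ((integrable_norm_sq (MemLp.cyl (τ := τ) h.dtm_memLp)).integral_prod_left).const_mul
    (P.γ / 2)
  have i2 := integrable_integral_inner_cyl (τ := τ) (MemLp.cyl h.Dθ_memLp) (MemLp.cyl h.flux_memLp)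
  rw [← integral_const_mul, ← integral_add i1 i2]
  refine integral_congr_ae (Eventually.of_forall fun s => ?_)
  simp only [Model.dissipation, Model.flux, form_eq_inner, real_inner_comm]

/-- From s² ≤ s⁴/4 + 1. The factor 1/4 is what makes θ_c/2 times the quartic part equal to half of
the quartic term of the energy. -/
lemma integral_norm_sq_le_pow_four (hP : P.Standing) {m : E3 → E3}
    (hm : MemLp m 4 (volume.restrict (P.dom ε))) :
    ∫ x in P.dom ε, ‖m x‖ ^ 2 ≤ (∫ x in P.dom ε, ‖m x‖ ^ 4) / 4 + volume.real P.Ω := by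
  have := isFiniteMeasure_dom hP ε
  have i4 := (integrable_pow_four hm).div_const 4
  have i2 := integrable_norm_sq (hm.mono_exponent (p := 2) (by norm_num))
  have h1 : ∫ x in P.dom ε, ‖m x‖ ^ 2 ≤ ∫ x in P.dom ε, (‖m x‖ ^ 4 / 4 + 1) := by
    refine integral_mono i2 (i4.add (integrable_const _)) fun x => ?_
    simp only
    nlinarith [sq_nonneg (‖m x‖ ^ 2 / 2 - 1)]
  rw [integral_add i4 (integrable_const _), integral_div, integral_const, smul_eq_mul, mul_one,
    measureReal_restrict_apply_univ] at h1
  exact h1.trans (add_le_add_right (measureReal_mono sdiff_subset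
    hP.isBounded_Ω.measure_lt_top.ne) _)

/-- The energy estimate. -/
lemma Model.IsWeakSolution.energyAt_add_dissipation_le (h : P.IsWeakSolution T ε I S)
    (hP : P.Standing) (hε : 0 < ε) {t : ℝ} (ht : t ∈ Ioo 0 T) (hr : P.RegularAt ε I S t) :
    0 ≤ (∫ s in (0 : ℝ)..t, P.dissipation ε S s) ∧
      P.energyAt ε S t + (∫ s in (0 : ℝ)..t, P.dissipation ε S s)
        ≤ 2 * P.initialEnergy ε I + P.θc * volume.real P.Ω := by
  have hev := h.evolution hP hε
  have hθc := hP.θc_pos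
  have hE : IntegrableOn (P.energyAt ε (S.pad I T)) (Ioo 0 T) volume :=
    (h.integrableOn_energyAt hP).congr_fun
      (fun s hs => (Model.energyAt_pad_of_pos hs.1).symm) measurableSet_Ioo
  have h1 := hev.energy_le hP hε ht (hr.pad ht) hE fun s hs => Model.energyAt_pad_of_nonpos hs
  have hY := hev.integral_inner_flux_nonneg hP hε ht.2.le
  have hX : 0 ≤ P.γ * ∫ s in Ioo 0 t, ∫ x in P.dom ε, ‖(S.pad I T).dtm s x‖ ^ 2 :=
    mul_nonneg hP.γ_pos.le (integral_nonneg fun s => integral_nonneg fun x => by positivity)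
  have h2 := hev.integral_dissipation hP t
  have h3 : ∫ s in (0 : ℝ)..t, P.dissipation ε S s
      = ∫ s in Ioo 0 t, P.dissipation ε (S.pad I T) s := by
    rw [intervalIntegral.integral_of_le ht.1.le, integral_Ioc_eq_integral_Ioo]
    refine setIntegral_congr_fun measurableSet_Ioo fun s hs => ?_
    have hs' : s ∈ Ioo 0 T := ⟨hs.1, hs.2.trans ht.2⟩
    simp only [Model.dissipation, Fields.pad_dtm_of_mem hs', Fields.pad_Dθ_of_mem hs',
      Fields.pad_Dlogθ_of_mem hs']
  rw [h3, h2]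
  rw [Model.energyAt_pad_of_pos ht.1, Fields.pad_m_of_pos ht.1] at h1
  -- `h4` and `h5` give (θ_c/2)‖m(t)‖² ≤ 𝓔/2 + θ_c|Ω|/2. Absorbing half of the energy and doubling
  -- yields the constants 2 and θ_c|Ω|; the dissipation is doubled as well, which is harmless since
  -- it is nonnegative.
  have h4 := mul_le_mul_of_nonneg_left (integral_norm_sq_le_pow_four hP hr.m_memL4) hθc.le
  have h5 : P.θc / 4 * (∫ x in P.dom ε, ‖S.m t x‖ ^ 4) ≤ P.energyAt ε S t :=
    Model.pow_four_le_energy hP ε _ _ hr.θ_pos _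
  have h6 : 0 ≤ P.θc * ∫ x in P.dom ε, ‖(S.pad I T).m 0 x‖ ^ 2 :=
    mul_nonneg hθc.le (integral_nonneg fun x => by positivity)
  constructor
  · linarith
  · linarith

/-! ### Bounds by the initial data -/

lemma lintegral_enorm_pow_eq {α E : Type*} [MeasurableSpace α] [NormedAddCommGroup E]
    {ν : Measure α} {f : α → E} {n : ℕ} (hf : Integrable (fun x => ‖f x‖ ^ n) ν) :
    ∫⁻ x, ‖f x‖ₑ ^ n ∂ν = ENNReal.ofReal (∫ x, ‖f x‖ ^ n ∂ν) := by
  rw [ofReal_integral_eq_lintegral_ofReal hf (Eventually.of_forall fun x => by positivity)]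
  simp_rw [ENNReal.ofReal_pow (norm_nonneg _), ofReal_norm]

lemma exists_real_sobolev (hP : P.Standing) : ∃ C : ℝ, 0 ≤ C ∧
    ∀ ε : ℝ, 0 < ε → ∀ (u : E3 → ℝ) (g : E3 → E3), MemH1 (P.dom ε) u g →
      ∫ x in P.dom ε, ‖u x‖ ^ 4
        ≤ C * ((∫ x in P.dom ε, ‖u x‖ ^ 2) + ∫ x in P.dom ε, ‖g x‖ ^ 2) ^ 2 := by
  obtain ⟨C, hC, hS⟩ := exists_uniform_sobolev hP
  refine ⟨C.toReal, ENNReal.toReal_nonneg, fun ε hε u g hu => ?_⟩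
  have h1 := hS ε hε u g hu
  have n1 : 0 ≤ ∫ x in P.dom ε, ‖u x‖ ^ 2 := integral_nonneg fun x => by positivity
  have n2 : 0 ≤ ∫ x in P.dom ε, ‖g x‖ ^ 2 := integral_nonneg fun x => by positivity
  rw [lintegral_enorm_pow_eq (integrable_pow_four (hu.memLp_four hP hε)),
    lintegral_enorm_pow_eq (integrable_norm_sq hu.memLp),
    lintegral_enorm_pow_eq (integrable_norm_sq hu.memLp_grad), ← ENNReal.ofReal_add n1 n2,
    ← ENNReal.ofReal_pow (add_nonneg n1 n2)] at h1
  rw [← ENNReal.ofReal_toReal hC, ← ENNReal.ofReal_mul ENNReal.toReal_nonneg] at h1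
  exact (ENNReal.ofReal_le_ofReal_iff (mul_nonneg ENNReal.toReal_nonneg (sq_nonneg _))).1 h1

lemma norm_pow_four_le (v : E3) : ‖v‖ ^ 4 ≤ 3 * ∑ c, ‖v c‖ ^ 4 := by
  have h1 : ‖v‖ ^ 4 = (‖v‖ ^ 2) ^ 2 := by ring
  rw [h1, EuclideanSpace.norm_sq_eq, Fin.sum_univ_three, Fin.sum_univ_three]
  nlinarith [sq_nonneg (‖v 0‖ ^ 2 - ‖v 1‖ ^ 2), sq_nonneg (‖v 1‖ ^ 2 - ‖v 2‖ ^ 2),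
    sq_nonneg (‖v 0‖ ^ 2 - ‖v 2‖ ^ 2)]

lemma exists_pow_four_le (hP : P.Standing) : ∃ C : ℝ, 0 ≤ C ∧
    ∀ ε : ℝ, 0 < ε → ∀ (u : E3 → E3) (g : E3 → Fin 3 → E3), MemH1Vec (P.dom ε) u g →
      ∫ x in P.dom ε, ‖u x‖ ^ 4
        ≤ C * ((∫ x in P.dom ε, ‖u x‖ ^ 2) + ∑ c, ∫ x in P.dom ε, ‖g x c‖ ^ 2) ^ 2 := by
  obtain ⟨C, hC, hS⟩ := exists_real_sobolev hP
  refine ⟨9 * C, by positivity, fun ε hε u g hu => ?_⟩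
  set Q := (∫ x in P.dom ε, ‖u x‖ ^ 2) + ∑ c, ∫ x in P.dom ε, ‖g x c‖ ^ 2
  have hn : ∀ c, 0 ≤ ∫ x in P.dom ε, ‖g x c‖ ^ 2 := fun c =>
    integral_nonneg fun x => by positivity
  have i4 : ∀ c, Integrable (fun x => ‖u x c‖ ^ 4) (volume.restrict (P.dom ε)) := fun c =>
    integrable_pow_four ((hu c).memLp_four hP hε)
  have h1 : ∀ c, ∫ x in P.dom ε, ‖u x c‖ ^ 4 ≤ C * Q ^ 2 := fun c => by
    refine (hS ε hε _ _ (hu c)).trans ?_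
    refine mul_le_mul_of_nonneg_left (pow_le_pow_left₀ ?_ ?_ 2) hC
    · exact add_nonneg (integral_nonneg fun x => by positivity) (hn c)
    · refine add_le_add ?_ (Finset.single_le_sum (f := fun c => ∫ x in P.dom ε, ‖g x c‖ ^ 2)
        (fun c _ => hn c) (Finset.mem_univ c))
      exact integral_mono (integrable_norm_sq (hu c).memLp) (integrable_norm_sq hu.memLp)
        fun x => pow_le_pow_left₀ (norm_nonneg _) (PiLp.norm_apply_le _ c) 2
  have h2 : ∫ x in P.dom ε, ‖u x‖ ^ 4 ≤ ∫ x in P.dom ε, 3 * ∑ c, ‖u x c‖ ^ 4 :=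
    integral_mono (integrable_pow_four (hu.memLp_four hP hε))
      ((integrable_finsetSum _ fun c _ => i4 c).const_mul 3) fun x => norm_pow_four_le _
  rw [integral_const_mul, integral_finsetSum _ fun c _ => i4 c, Fin.sum_univ_three] at h2
  linarith [h1 0, h1 1, h1 2]

lemma IsCoefficient.exists_integral_gradForm_le {D : Set E3}
    {M : E3 → E3 → Matrix (Fin 3) (Fin 3) ℝ} (hM : IsCoefficient D M) : ∃ C : ℝ, 0 ≤ C ∧
      ∀ (ε : ℝ) (U : Set E3), U ⊆ D → ∀ ξ : E3 → Fin 3 → E3,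
        (∀ c, MemLp (fun x => ξ x c) 2 (volume.restrict U)) →
        ∫ x in U, gradForm (osc M ε x) (ξ x) (ξ x) ≤ C * ∑ c, ∫ x in U, ‖ξ x c‖ ^ 2 := by
  obtain ⟨B, hB⟩ := hM.bounded
  refine ⟨9 * |B|, by positivity, fun ε U hU ξ hξ => ?_⟩
  have hN := hM.bddField ε hU
  simp only [gradForm]
  rw [integral_finsetSum _ fun c _ => hN.integrable_form (hξ c) (hξ c), Finset.mul_sum]
  refine Finset.sum_le_sum fun c _ => ?_
  rw [← integral_const_mul]
  refine integral_mono_ae (hN.integrable_form (hξ c) (hξ c))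
    ((integrable_norm_sq (hξ c)).const_mul _) ?_
  filter_upwards [ae_mono (Measure.restrict_mono hU le_rfl) hB] with x hx
  rw [form_eq_inner]
  refine (real_inner_le_norm _ _).trans ?_
  have := norm_matVec_le (M := osc M ε x) (B := |B|)
    (fun i j => (hx _ i j).trans (le_abs_self B)) (ξ x c)
  calc _ ≤ 9 * |B| * ‖ξ x c‖ * ‖ξ x c‖ := mul_le_mul_of_nonneg_right this (norm_nonneg _)
    _ = _ := by ring

/-- Test the magnetostatic problem with φ itself and absorb half of the energy by coercivity. Hence
no bound on the initial potential has to be assumed. -/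
lemma exists_integral_potential_le (hP : P.Standing) : ∃ C : ℝ, 0 ≤ C ∧
    ∀ (ε : ℝ) (m : E3 → E3) (φ : E3 → ℝ) (Dφ : E3 → E3),
      MemLp m 2 (volume.restrict (P.dom ε)) → P.Magnetostatic ε m φ Dφ →
      ∫ x in P.ext ε, form (osc P.μ ε x) (Dφ x) (Dφ x) ≤ C * ∫ x in P.dom ε, ‖m x‖ ^ 2 := by
  obtain ⟨α, hα, hco⟩ := hP.coeff_μ.exists_coercive
  refine ⟨1 / α, by positivity, fun ε m φ Dφ hm h => ?_⟩
  have hD := h.1.memLp_grad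
  have hle := Measure.restrict_mono (dom_subset_ext P ε) (le_refl (volume : Measure E3))
  have h1 := h.2 φ Dφ h.1
  have h2 := integral_inner_ge hm (hD.mono_measure hle) hα
  have h3 : α * ∫ x in P.ext ε, ‖Dφ x‖ ^ 2
      ≤ ∫ x in P.ext ε, form (osc P.μ ε x) (Dφ x) (Dφ x) := by
    rw [← integral_const_mul]
    refine integral_mono_ae ((integrable_norm_sq hD).const_mul α)
      ((hP.coeff_μ.bddField ε (subset_univ _)).integrable_form hD hD) ?_
    filter_upwards [hco ε _ (subset_univ _)] with x hx
    exact hx _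
  have h4 : ∫ x in P.dom ε, ‖Dφ x‖ ^ 2 ≤ ∫ x in P.ext ε, ‖Dφ x‖ ^ 2 :=
    integral_mono_measure hle (Eventually.of_forall fun x => by positivity) (integrable_norm_sq hD)
  have h5 := mul_le_mul_of_nonneg_left h4 hα.le
  have h6 : 1 / (2 * α) * (∫ x in P.dom ε, ‖m x‖ ^ 2)
      = (1 / α * ∫ x in P.dom ε, ‖m x‖ ^ 2) / 2 := by field_simp
  linarith

/-- The quartic term is the one place where the constant of the Sobolev embedding must not depend on
ε. -/
lemma exists_initialEnergy_le (hP : P.Standing) (R : ℝ) : ∃ C : ℝ, ∀ ε : ℝ, 0 < ε →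
    ∀ I : InitialData, P.IsInitial ε I → P.InitialBound ε I R → P.initialEnergy ε I ≤ C := by
  obtain ⟨C₁, h1, hA⟩ := hP.coeff_A.exists_integral_gradForm_le
  obtain ⟨C₂, h2, hm⟩ := exists_pow_four_le hP
  obtain ⟨C₃, h3, hφ⟩ := exists_integral_potential_le hP
  have hθc := hP.θc_pos
  have hc₁ := hP.c₁_pos
  have hc₂ := hP.c₂_pos
  refine ⟨C₁ * R ^ 2 / 2 + P.θc * (C₂ * (R ^ 2) ^ 2 / 4)
    + (P.c₁ * ((R ^ 2 + volume.real P.Ω) / 2) + P.c₂ / 2 * R ^ 2) + C₃ * R ^ 2 / 2,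
    fun ε hε I hI hR => ?_⟩
  have := isFiniteMeasure_dom hP ε
  obtain ⟨hR1, hR2⟩ := hR
  have n1 : 0 ≤ ∫ x in P.dom ε, ‖I.m x‖ ^ 2 := integral_nonneg fun x => by positivity
  have n2 : 0 ≤ ∑ c, ∫ x in P.dom ε, ‖I.Dm x c‖ ^ 2 :=
    Finset.sum_nonneg fun c _ => integral_nonneg fun x => by positivity
  have e1 : ∫ x in P.dom ε, gradForm (osc P.A ε x) (I.Dm x) (I.Dm x) ≤ C₁ * R ^ 2 :=
    (hA ε (P.dom ε) sdiff_subset _ fun c => (hI.m_memH1 c).memLp_grad).trans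
      (mul_le_mul_of_nonneg_left (by linarith) h1)
  have e2 : ∫ x in P.dom ε, ‖I.m x‖ ^ 4 ≤ C₂ * (R ^ 2) ^ 2 :=
    (hm ε hε _ _ hI.m_memH1).trans
      (mul_le_mul_of_nonneg_left (pow_le_pow_left₀ (add_nonneg n1 n2) hR1 2) h2)
  have e3 : ∫ x in P.ext ε, form (osc P.μ ε x) (I.Dφ x) (I.Dφ x) ≤ C₃ * R ^ 2 :=
    (hφ ε _ _ _ hI.m_memH1.memLp hI.magnetostatic).trans
      (mul_le_mul_of_nonneg_left (by linarith) h3)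
  have e4 : ∫ x in P.dom ε, I.θ x ≤ (R ^ 2 + volume.real P.Ω) / 2 := by
    have i2 := hI.θ_memLp.integrable_sq
    have i3 : Integrable (fun x => (I.θ x ^ 2 + 1) / 2) (volume.restrict (P.dom ε)) :=
      (i2.add (integrable_const 1)).div_const 2
    have : ∫ x in P.dom ε, I.θ x ≤ ∫ x in P.dom ε, (I.θ x ^ 2 + 1) / 2 :=
      integral_mono (hI.θ_memLp.integrable (by norm_num)) i3 fun x => by
        simp only
        nlinarith [sq_nonneg (I.θ x - 1)]
    rw [integral_div, integral_add i2 (integrable_const _), integral_const, smul_eq_mul, mul_one,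
      measureReal_restrict_apply_univ] at this
    have hv : volume.real (P.dom ε) ≤ volume.real P.Ω :=
      measureReal_mono sdiff_subset hP.isBounded_Ω.measure_lt_top.ne
    linarith
  rw [Model.initialEnergy, P.energy_eq]
  have f2 := mul_le_mul_of_nonneg_left e2 hθc.le
  have f4 := mul_le_mul_of_nonneg_left e4 hc₁.le
  have f5 := mul_le_mul_of_nonneg_left hR2 (half_pos hc₂).le
  linarith

/-- A fourth root is avoided: D ≤ (D + 1)⁴. -/
lemma eLpNorm_four_le {ν : Measure E3} {f : E3 → E3} (hf : MemLp f 4 ν) {D : ℝ} (hD : 0 ≤ D)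
    (h : ∫ x, ‖f x‖ ^ 4 ∂ν ≤ D) : eLpNorm f 4 ν ≤ ENNReal.ofReal (D + 1) := by
  rw [eLpNorm_eq_lintegral_rpow_enorm_toReal (by simp) (by simp), one_div,
    ENNReal.rpow_inv_le_iff (by simp)]
  have e : ∀ a : ℝ≥0∞, a ^ (4 : ℝ≥0∞).toReal = a ^ 4 := fun a => by
    rw [ENNReal.toReal_ofNat]; exact ENNReal.rpow_ofNat a 4
  simp_rw [e]
  rw [lintegral_enorm_pow_eq (integrable_pow_four hf), ← ENNReal.ofReal_pow (by linarith)]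
  refine ENNReal.ofReal_le_ofReal (h.trans ?_)
  have : D + 1 ≤ (D + 1) ^ 4 := le_self_pow₀ (by linarith) (by norm_num)
  linarith

end

end PhaseTransition

end

open PhaseTransition in
theorem lemma4p1 (P : Model) (hP : P.Standing) (T : ℝ) (hT : 0 < T) :
    ∃ η₁ η₂ : ℝ, 0 ≤ η₁ ∧ 0 ≤ η₂ ∧
      (∀ ε : ℝ, 0 < ε → ∀ (I : InitialData) (S : Fields), P.IsWeakSolution T ε I S →
        ∀ t ∈ Ioo 0 T, P.RegularAt ε I S t →
          P.energyAt ε S t + ∫ s in (0 : ℝ)..t, P.dissipation ε S s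
            ≤ η₁ * P.initialEnergy ε I + η₂) ∧
      (∀ R : ℝ, ∃ C : ℝ, ∀ ε : ℝ, 0 < ε → ∀ (I : InitialData) (S : Fields),
        P.IsWeakSolution T ε I S → P.InitialBound ε I R →
          ∀ᵐ t ∂volume.restrict (Ioo 0 T),
            eLpNorm (S.m t) 4 (volume.restrict (P.dom ε)) ≤ ENNReal.ofReal C) := by
  have hθc := hP.θc_pos
  refine ⟨2, P.θc * volume.real P.Ω, by norm_num, mul_nonneg hθc.le measureReal_nonneg,
    fun ε hε I S h t ht hr => (h.energyAt_add_dissipation_le hP hε ht hr).2, fun R => ?_⟩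
  obtain ⟨C, hC⟩ := exists_initialEnergy_le hP R
  -- The bound on the initial energy comes without a sign, hence the maximum with 0; the summand 1
  -- comes from `eLpNorm_four_le`.
  refine ⟨max 0 (4 / P.θc * (2 * C + P.θc * volume.real P.Ω)) + 1, fun ε hε I S h hR => ?_⟩
  filter_upwards [h.regular, ae_restrict_mem measurableSet_Ioo] with t hr ht
  refine eLpNorm_four_le hr.m_memL4 (le_max_left _ _) (le_max_of_le_right ?_)
  obtain ⟨h1, h2⟩ := h.energyAt_add_dissipation_le hP hε ht hr
  have h3 : P.θc / 4 * (∫ x in P.dom ε, ‖S.m t x‖ ^ 4) ≤ P.energyAt ε S t :=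
    Model.pow_four_le_energy hP ε _ _ hr.θ_pos _
  have h4 := hC ε hε I h.initial hR
  calc ∫ x in P.dom ε, ‖S.m t x‖ ^ 4
      = 4 / P.θc * (P.θc / 4 * ∫ x in P.dom ε, ‖S.m t x‖ ^ 4) := by field_simp
    _ ≤ 4 / P.θc * (2 * C + P.θc * volume.real P.Ω) :=
      mul_le_mul_of_nonneg_left (by linarith) (by positivity)
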